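/- Let $S$ be a connected, second countable complex manifold (for instance the analytification of an irreducible smooth quasi-projective complex variety), and let $\mathbb V=(\mathbb V_{\mathbb Z},W_\bullet,F^\bullet)$ be a graded-polarizable variation of mixed $\mathbb Z$-Hodge structures on $S$. Let $\pi:\tilde S\to S$ be a universal covering, fix a flat trivialization of $\pi^*\mathbb V_{\mathbb Q}$ with fibre $V$, and for $\tilde s\in\tilde S$ let $\mathbf P_{\tilde s}\subset \mathbf{GL}(V)$ be the Mumford–Tate group of $(V,W_\bullet,F^\bullet_{\tilde s})$, i.e. the $\mathbb Q$-Zariski closure of the image of $\varphi_{\mathbb C,\tilde s}:\mathbb S_{\mathbb C}\to \mathbf{GL}(V_{\mathbb C})$. A point $\tilde s$ (or its image in $S$) is Hodge generic if $\mathbf P_{\tilde s}$ contains $\mathbf P_{\tilde s'}$ for all $\tilde s'\in\tilde S$. Then Hodge generic points exist. Fix one, $\tilde s_0$. Let $\mathbf P_S=\mathbf P_{\tilde s_0}$, with unipotent radical $\mathbf W_S$ and Lie algebra $\mathfrak p_S$; let $\mathcal D_S$ be the $\mathbf P_S(\mathbb R)\mathbf W_S(\mathbb C)$-orbit of $F_{\tilde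 s_0}^\bullet$ (the mixed Mumford–Tate domain), $\mathcal D_S^+$ its connected component containing $F^\bullet_{\tilde s_0}$, $\Gamma=\mathbf P_S(\mathbb Q)\cap \mathbf{GL}(V_{\mathbb Z})$ (an element of $\Gamma$ is regarded as acting on $\mathcal D_S^+$ when it stabilizes $\mathcal D_S^+$), and $\mathrm{Hod}^0(S,\mathbb V)=\Gamma\backslash\mathcal D_S^+$. The horizontal tangent bundle $T_h$ has fibre $F^{-1}\mathfrak p_{S,\mathbb C}/F^0\mathfrak p_{S,\mathbb C}$ at $F\in\mathcal D_S^+$. The Hodge codimension is $$\text{H-cd}(S,\mathbb V)=\dim_{\mathbb C}\mathrm{Gr}_F^{-1}(\mathfrak p_S\otimes\mathbb C)-\mathrm{rk}\,\mathrm{Im}\,\overline\nabla,$$ where $\overline\nabla:TS\to \mathrm{Gr}_F^{-1}(W_0\,\mathrm{End}\,\mathbb V\otimes\mathcal O_S)$ is the Kodaira–Spencer map and $\mathrm{rk}$ is the generic (maximal) rank. The map $\tilde\Phi:\tilde s\mapsto F^\bullet_{\tilde s}$ takes values in $\mathcal D_S^+$. If the monodromy of $\mathbb V$ is contained in $\mathbf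 P_S(\mathbb Q)$, then $\tilde\Phi$ descends to a period map $\Phi_S:S\to\mathrm{Hod}^0(S,\mathbb V)$. Whenever $\tilde\Phi$ descends to such a map $\Phi_S$, $$\text{H-cd}(S,\mathbb V)=\mathrm{rk}\,T_h\mathrm{Hod}^0(S,\mathbb V)-\dim_{\mathbb C}\Phi_S(S),$$ where $\dim_{\mathbb C}$ of a subset of $\mathrm{Hod}^0(S,\mathbb V)$ is the largest dimension of an immersed complex submanifold of $\mathcal D_S^+$ contained in its preimage; and at every Hodge generic point of $\Phi_S(S)$ at which $\Phi_S(S)$ is smooth (its preimage in $\mathcal D_S^+$ is a complex submanifold near the point of $\tilde\Phi(\tilde S)$ considered), the tangent space of $\Phi_S(S)$ is contained in the horizontal tangent space, with codimension $\text{H-cd}(S,\mathbb V)$. Moreover there are Hodge generic points $\tilde s$ at which the rank of $d\tilde\Phi$ is maximal, and for each of them $d\tilde\Phi(T_{\tilde s}\tilde S)$ is contained in $T_h$ at $\tilde\Phi(\tilde s)$, with codimension $\text{H-cd}(S,\mathbb V)$. -/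

import Mathlib

open scoped Manifold ContDiff Topology Matrix

noncomputable section

/- ### Filtrations, mixed Hodge structures and the Deligne splitting on `V_ℚ = ℚⁿ` -/

/-- Families `F^p` (`p ∈ ℤ`) of subspaces of `V_ℂ = ℂⁿ`; the points of the flag varieties. -/
abbrev Fil (n : ℕ) : Type := ℤ → Submodule ℂ (Fin n → ℂ)

/-- The translate `g F^•` of a filtration. -/
def Fil.act {n : ℕ} (g : Matrix (Fin n) (Fin n) ℂ) (F : Fil n) : Fil n :=
  fun p => (F p).map (Matrix.mulVecLin g)

/-- The complex conjugate of a subspace of `ℂⁿ`, for the real structure `ℝⁿ`. -/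
def conjSub {n : ℕ} (U : Submodule ℂ (Fin n → ℂ)) : Submodule ℂ (Fin n → ℂ) where
  carrier := {v | star v ∈ U}
  add_mem' := by
    intro a b ha hb
    simpa using U.add_mem ha hb
  zero_mem' := by simp
  smul_mem' := by
    intro c v hv
    simpa using U.smul_mem (star c) hv

/-- The complexification `U ⊗ ℂ ⊆ ℂⁿ` of a subspace `U ⊆ ℚⁿ`. -/
def complexify {n : ℕ} (U : Submodule ℚ (Fin n → ℚ)) : Submodule ℂ (Fin n → ℂ) :=
  Submodule.span ℂ ((fun (v : Fin n → ℚ) (i : Fin n) => (v i : ℂ)) '' (U : Set (Fin n → ℚ)))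

/-- `(ℚⁿ, W_•, F^•)` is a mixed `ℚ`-Hodge structure: `W` and `F` are finite filtrations, and
for each `k` the filtration induced by `F` on `Gr_k^W` is a pure Hodge structure of weight `k`,
that is `F^p Gr_k ⊕ conj (F^{k+1-p} Gr_k) = Gr_k` for all `p`. -/
structure IsMHS {n : ℕ} (W : ℤ → Submodule ℚ (Fin n → ℚ)) (F : Fil n) : Prop where
  W_mono : Monotone W
  W_bot : ∃ k, W k = ⊥
  W_top : ∃ k, W k = ⊤
  F_anti : Antitone F
  F_bot : ∃ p, F p = ⊥
  F_top : ∃ p, F p = ⊤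
  pure_sup : ∀ k p,
    ((F p ⊓ complexify (W k)) ⊔ complexify (W (k - 1))) ⊔
      ((conjSub (F (k + 1 - p)) ⊓ complexify (W k)) ⊔ complexify (W (k - 1))) =
    complexify (W k)
  pure_inf : ∀ k p,
    ((F p ⊓ complexify (W k)) ⊔ complexify (W (k - 1))) ⊓
      ((conjSub (F (k + 1 - p)) ⊓ complexify (W k)) ⊔ complexify (W (k - 1))) =
    complexify (W (k - 1))

/-- Deligne's splitting `V_ℂ = ⨁ V^{p,q}` of a mixed Hodge structure, by Deligne's formula
`V^{p,q} = F^p ∩ W_{p+q} ∩ (conj F^q ∩ W_{p+q} + ∑_{j ≥ 1} conj F^{q-j} ∩ W_{p+q-j-1})`. -/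
def deligneSplitting {n : ℕ} (W : ℤ → Submodule ℚ (Fin n → ℚ)) (F : Fil n) (p q : ℤ) :
    Submodule ℂ (Fin n → ℂ) :=
  F p ⊓ complexify (W (p + q)) ⊓
    ((conjSub (F q) ⊓ complexify (W (p + q))) ⊔
      ⨆ j : ℕ, conjSub (F (q - (j + 1))) ⊓ complexify (W (p + q - (j + 1) - 1)))

/-- `g = φ_ℂ(z, w)`, for the morphism `φ_ℂ : 𝕊_ℂ = 𝔾_m × 𝔾_m → GL(V_ℂ)` attached to a mixed Hodge
structure: `g` acts on `V^{p,q}` through `z^{-p} w^{-q}`. -/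
def IsTorusElement {n : ℕ} (W : ℤ → Submodule ℚ (Fin n → ℚ)) (F : Fil n) (z w : ℂˣ)
    (g : GL (Fin n) ℂ) : Prop :=
  ∀ p q : ℤ, ∀ v ∈ deligneSplitting W F p q,
    g.1 *ᵥ v = ((z : ℂ) ^ (-p) * (w : ℂ) ^ (-q)) • v

/- ### Algebraic `ℚ`-subgroups of `GL_n`, represented by their groups of complex points -/

/-- A subgroup of `GL_n(ℂ)` is (the group of complex points of) an algebraic subgroup of `GL_n`
over `ℚ` if it is the zero locus in `GL_n(ℂ)` of polynomials with rational coefficients. -/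
def IsRatAlgebraic {n : ℕ} (H : Subgroup (GL (Fin n) ℂ)) : Prop :=
  ∃ I : Set (MvPolynomial (Fin n × Fin n) ℚ), ∀ g : GL (Fin n) ℂ,
    g ∈ H ↔ ∀ f ∈ I, MvPolynomial.aeval (fun ij => g.1 ij.1 ij.2) f = 0

/-- The Mumford-Tate group of a mixed Hodge structure (its complex points): the `ℚ`-Zariski closure
of the image of `φ_ℂ`, i.e. the smallest algebraic `ℚ`-subgroup of `GL_n` containing it. -/
def mumfordTate {n : ℕ} (W : ℤ → Submodule ℚ (Fin n → ℚ)) (F : Fil n) :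
    Subgroup (GL (Fin n) ℂ) :=
  sInf {H | IsRatAlgebraic H ∧ ∀ z w g, IsTorusElement W F z w g → g ∈ H}

/-- The Lie algebra (over `ℚ`) of an algebraic subgroup `P` of `GL_n` over `ℚ`: the tangent space
at `1` defined by the ideal of all rational polynomials vanishing on `P`. -/
def lieAlg {n : ℕ} (P : Subgroup (GL (Fin n) ℂ)) : Submodule ℚ (Matrix (Fin n) (Fin n) ℚ) where
  carrier := {A | ∀ f : MvPolynomial (Fin n × Fin n) ℚ,
    (∀ g ∈ P, MvPolynomial.aeval (fun ij => g.1 ij.1 ij.2) f = 0) →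
    ∑ ij : Fin n × Fin n, A ij.1 ij.2 *
      MvPolynomial.eval (fun kl => (1 : Matrix (Fin n) (Fin n) ℚ) kl.1 kl.2)
        (MvPolynomial.pderiv ij f) = 0}
  add_mem' := by
    intro A B hA hB f hf
    simp only [Matrix.add_apply, add_mul, Finset.sum_add_distrib]
    rw [hA f hf, hB f hf, add_zero]
  zero_mem' := by
    intro f _
    simp
  smul_mem' := by
    intro c A hA f hf
    simp only [Matrix.smul_apply, smul_eq_mul, mul_assoc]
    rw [← Finset.mul_sum, hA f hf, mul_zero]

/-- The complexified Lie algebra `𝔭 ⊗ ℂ ⊆ 𝔤𝔩_n(ℂ)`. -/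
def lieAlgC {n : ℕ} (P : Subgroup (GL (Fin n) ℂ)) : Submodule ℂ (Matrix (Fin n) (Fin n) ℂ) :=
  Submodule.span ℂ ((fun A : Matrix (Fin n) (Fin n) ℚ => A.map (algebraMap ℚ ℂ)) '' (lieAlg P))

/-- The real points `P(ℝ)`. -/
def realPoints {n : ℕ} (P : Subgroup (GL (Fin n) ℂ)) : Subgroup (GL (Fin n) ℂ) :=
  P ⊓ (MonoidHom.id (GL (Fin n) ℂ)).eqLocus (Matrix.GeneralLinearGroup.map (starRingEnd ℂ))

/-- The unipotent radical of `P`: the largest normal unipotent algebraic `ℚ`-subgroup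
(unipotent groups are connected in characteristic zero). -/
def unipotentRadical {n : ℕ} (P : Subgroup (GL (Fin n) ℂ)) : Subgroup (GL (Fin n) ℂ) :=
  sSup {N | N ≤ P ∧ IsRatAlgebraic N ∧ (∀ g ∈ P, ∀ h ∈ N, g * h * g⁻¹ ∈ N) ∧
    ∀ h ∈ N, IsNilpotent (h.1 - 1)}

/-- The group `P(ℝ) 𝐖(ℂ)`, where `𝐖` is the unipotent radical of `P`. -/
def realUnipotent {n : ℕ} (P : Subgroup (GL (Fin n) ℂ)) : Subgroup (GL (Fin n) ℂ) :=
  realPoints P ⊔ unipotentRadical P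

/- ### Filtrations on endomorphisms -/

/-- `F^k End(V_ℂ)`: the endomorphisms mapping `F^p` into `F^{p+k}` for all `p`. -/
def endF {n : ℕ} (F : Fil n) (k : ℤ) : Submodule ℂ (Matrix (Fin n) (Fin n) ℂ) where
  carrier := {A | ∀ p, ∀ v ∈ F p, A *ᵥ v ∈ F (p + k)}
  add_mem' := by
    intro A B hA hB p v hv
    rw [Matrix.add_mulVec]
    exact (F (p + k)).add_mem (hA p v hv) (hB p v hv)
  zero_mem' := by
    intro p v _
    simp
  smul_mem' := by
    intro c A hA p v hv
    rw [Matrix.smul_mulVec]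
    exact (F (p + k)).smul_mem c (hA p v hv)

/-- `W_0 End(V_ℂ)`: the endomorphisms preserving the weight filtration. -/
def endW {n : ℕ} (W : ℤ → Submodule ℚ (Fin n → ℚ)) :
    Submodule ℂ (Matrix (Fin n) (Fin n) ℂ) where
  carrier := {A | ∀ k, ∀ v ∈ complexify (W k), A *ᵥ v ∈ complexify (W k)}
  add_mem' := by
    intro A B hA hB k v hv
    rw [Matrix.add_mulVec]
    exact Submodule.add_mem _ (hA k v hv) (hB k v hv)
  zero_mem' := by
    intro k v _
    simp
  smul_mem' := by
    intro c A hA k v hv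
    rw [Matrix.smul_mulVec]
    exact Submodule.smul_mem _ c (hA k v hv)

/-- `Gr_F^{-1} L = F^{-1} L / F^0 L`, for a subspace `L ⊆ End(V_ℂ)` with the induced filtration
`F^k L = L ∩ F^k End(V_ℂ)`. -/
abbrev GrNegOne {n : ℕ} (F : Fil n) (L : Submodule ℂ (Matrix (Fin n) (Fin n) ℂ)) : Type :=
  ↥(L ⊓ endF F (-1)) ⧸ (L ⊓ endF F 0).submoduleOf (L ⊓ endF F (-1))

/- ### Holomorphic families of filtrations -/

/-- `g` is a holomorphic map from a neighbourhood of `x` to `n × n` matrices with `g(x) = 1` such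
that `f(y) = g(y) f(x)` for all `y` near `x`. -/
def IsHolFrame (E : Type*) [NormedAddCommGroup E] [NormedSpace ℂ E]
    {M : Type*} [TopologicalSpace M] [ChartedSpace E M] {n : ℕ}
    (f : M → Fil n) (x : M) (g : M → Matrix (Fin n) (Fin n) ℂ) : Prop :=
  g x = 1 ∧
  (∀ᶠ y in 𝓝 x, ∀ i j, MDifferentiableAt 𝓘(ℂ, E) 𝓘(ℂ, ℂ) (fun y' => g y' i j) y) ∧
  ∀ᶠ y in 𝓝 x, f y = Fil.act (g y) (f x)

/-- A family of filtrations is holomorphic near `x` (its steps are holomorphic subbundles of the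
trivial bundle; equivalently it is a holomorphic map to a flag variety, the latter being
homogeneous under `GL_n(ℂ)`, with local holomorphic sections of the orbit maps). -/
def HolAt (E : Type*) [NormedAddCommGroup E] [NormedSpace ℂ E]
    {M : Type*} [TopologicalSpace M] [ChartedSpace E M] {n : ℕ}
    (f : M → Fil n) (x : M) : Prop :=
  ∃ g, IsHolFrame E f x g

/-- The (entrywise) derivative of a matrix-valued map. -/
def matrixDeriv (E : Type*) [NormedAddCommGroup E] [NormedSpace ℂ E]
    {M : Type*} [TopologicalSpace M] [ChartedSpace E M] {n : ℕ}
    (g : M → Matrix (Fin n) (Fin n) ℂ) (x : M) :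
    TangentSpace 𝓘(ℂ, E) x →ₗ[ℂ] Matrix (Fin n) (Fin n) ℂ where
  toFun v := Matrix.of fun i j => (mfderiv 𝓘(ℂ, E) 𝓘(ℂ, ℂ) (fun y => g y i j) x v : ℂ)
  map_add' := by
    intro v w
    ext i j
    exact map_add (mfderiv 𝓘(ℂ, E) 𝓘(ℂ, ℂ) (fun y => g y i j) x) v w
  map_smul' := by
    intro c v
    ext i j
    exact map_smul (mfderiv 𝓘(ℂ, E) 𝓘(ℂ, ℂ) (fun y => g y i j) x) c v

open Classical in
/-- The differential at `x` of a holomorphic family of filtrations `f`, with values in the tangent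
space `End(V_ℂ) / F^0 End(V_ℂ)` of the flag variety at `F = f(x)`: if `f = g f(x)` near `x` with `g`
holomorphic and `g(x) = 1`, it is `v ↦ dg_x(v) mod F^0`, which does not depend on `g`. -/
def filDeriv (E : Type*) [NormedAddCommGroup E] [NormedSpace ℂ E]
    {M : Type*} [TopologicalSpace M] [ChartedSpace E M] {n : ℕ}
    (f : M → Fil n) (x : M) :
    TangentSpace 𝓘(ℂ, E) x →ₗ[ℂ] (Matrix (Fin n) (Fin n) ℂ ⧸ endF (f x) 0) :=
  if h : HolAt E f x then (endF (f x) 0).mkQ ∘ₗ matrixDeriv E h.choose x else 0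

/-- `σ` is, near `x`, a holomorphic section of the bundle `F^p` (all bundles being written in a flat
trivialization of `𝒱`, so that the flat connection is the usual differential `d`). -/
def IsHolSection (E : Type*) [NormedAddCommGroup E] [NormedSpace ℂ E]
    {M : Type*} [TopologicalSpace M] [ChartedSpace E M] {n : ℕ}
    (f : M → Fil n) (x : M) (p : ℤ) (σ : M → Fin n → ℂ) : Prop :=
  ∀ᶠ y in 𝓝 x, MDifferentiableAt 𝓘(ℂ, E) 𝓘(ℂ, Fin n → ℂ) σ y ∧ σ y ∈ f y p

/-- The derivative `∇_v σ` of a section, in a flat trivialization. -/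
def nabla (E : Type*) [NormedAddCommGroup E] [NormedSpace ℂ E]
    {M : Type*} [TopologicalSpace M] [ChartedSpace E M] {n : ℕ}
    (σ : M → Fin n → ℂ) (x : M) (v : TangentSpace 𝓘(ℂ, E) x) : Fin n → ℂ :=
  mfderiv 𝓘(ℂ, E) 𝓘(ℂ, Fin n → ℂ) σ x v

/- ### Mixed Mumford-Tate domains and connected mixed Hodge varieties -/

section Domain

variable {n : ℕ}

/-- The mixed Mumford-Tate domain of the mixed Hodge datum `(P, X)`, where `X` is the
`P(ℝ) 𝐖(ℂ)`-conjugacy class of the morphism `φ_ℂ` of a mixed Hodge structure `(W, F₀)`. The mixed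
Hodge structure defined by `g φ_ℂ g⁻¹` is `(W, g F₀)`; so the domain is the orbit of `F₀`. -/
def MTDomain (P : Subgroup (GL (Fin n) ℂ)) (F₀ : Fil n) : Type :=
  {F : Fil n // ∃ g : realUnipotent P, F = Fil.act g.1.1 F₀}

/-- The orbit map `P(ℝ) 𝐖(ℂ) → D`. -/
def orbitMap (P : Subgroup (GL (Fin n) ℂ)) (F₀ : Fil n) (g : realUnipotent P) : MTDomain P F₀ :=
  ⟨Fil.act g.1.1 F₀, g, rfl⟩

/-- `D` carries the topology of a homogeneous space of the topological group `P(ℝ) 𝐖(ℂ)`. -/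
instance (P : Subgroup (GL (Fin n) ℂ)) (F₀ : Fil n) : TopologicalSpace (MTDomain P F₀) :=
  TopologicalSpace.coinduced (orbitMap P F₀) inferInstance

/-- The connected component `D⁺` of `D` containing `F₀`. -/
def DPlus (P : Subgroup (GL (Fin n) ℂ)) (F₀ : Fil n) : Set (MTDomain P F₀) :=
  connectedComponent (orbitMap P F₀ 1)

/-- The arithmetic group `Γ = P(ℚ) ∩ GL(V_ℤ)`, `V_ℤ = ℤⁿ`. -/
def arithGroup (P : Subgroup (GL (Fin n) ℂ)) : Subgroup (GL (Fin n) ℤ) :=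
  P.comap (Matrix.GeneralLinearGroup.map (Int.castRingHom ℂ))

/-- The connected mixed Hodge variety `Γ \ D⁺`. (An element of `Γ` mapping one point of `D⁺` into
`D⁺` permutes the components of `D` and so stabilizes `D⁺`.) -/
def HodgeVariety (P : Subgroup (GL (Fin n) ℂ)) (F₀ : Fil n) : Type :=
  Quot fun y y' : DPlus P F₀ => ∃ γ ∈ arithGroup P,
    y'.1.1 = Fil.act (Matrix.GeneralLinearGroup.map (Int.castRingHom ℂ) γ).1 y.1.1

/-- The projection `D⁺ → Γ \ D⁺`. -/
def HodgeVariety.mk {P : Subgroup (GL (Fin n) ℂ)} {F₀ : Fil n} (y : DPlus P F₀) :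
    HodgeVariety P F₀ := Quot.mk _ y

/-- The fibre at a point `F` of `D` of the horizontal tangent bundle `T_h D = F^{-1} TD`, inside the
tangent space `End(V_ℂ) / F^0 End(V_ℂ)` of the flag variety. Here `T_F D = 𝔭_ℂ / F^0 𝔭_ℂ` and
`F^{-1} T_F D = F^{-1} 𝔭_ℂ / F^0 𝔭_ℂ`, with `F^k 𝔭_ℂ = 𝔭_ℂ ∩ F^k End(V_ℂ)`. -/
def horizontalTangent (P : Subgroup (GL (Fin n) ℂ)) (F : Fil n) :
    Submodule ℂ (Matrix (Fin n) (Fin n) ℂ ⧸ endF F 0) :=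
  (lieAlgC P ⊓ endF F (-1)).map (endF F 0).mkQ

/-- The complex dimension of a subset `A` of `D⁺`: the largest `d` such that `A` contains an
immersed complex submanifold (parametrized by a neighbourhood of `0` in `ℂᵈ`) of dimension `d`. -/
def complexDim {P : Subgroup (GL (Fin n) ℂ)} {F₀ : Fil n} (A : Set (DPlus P F₀)) : ℕ :=
  sSup {d : ℕ | ∃ f : (Fin d → ℂ) → DPlus P F₀, ∀ᶠ u in 𝓝 (0 : Fin d → ℂ),
    f u ∈ A ∧ HolAt (Fin d → ℂ) (fun u' => (f u').1.1) u ∧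
      Function.Injective (filDeriv (Fin d → ℂ) (fun u' => (f u').1.1) u)}

/-- The complex dimension of a subset of `Γ \ D⁺`, measured by holomorphic immersions to `Γ \ D⁺`
that lift to `D⁺`; that is, the dimension of its preimage in `D⁺`. -/
def HodgeVariety.complexDim {P : Subgroup (GL (Fin n) ℂ)} {F₀ : Fil n}
    (B : Set (HodgeVariety P F₀)) : ℕ :=
  _root_.complexDim (HodgeVariety.mk ⁻¹' B)

/-- Near its point `y`, the subset `A` of `D⁺` is a complex submanifold, with tangent space `T`
at `y`: there is a holomorphic `f` defined near `0 ∈ ℂᵈ` with `f(0) = y`, an immersion at `0` with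
`df_0(ℂᵈ) = T` (an equality of subspaces of `End(V_ℂ) / F^0`, stated for their preimages in
`End(V_ℂ)`), which maps the small neighbourhoods of `0` to the small neighbourhoods of `y`
in `A`. -/
def IsSmoothPoint {P : Subgroup (GL (Fin n) ℂ)} {F₀ : Fil n} (A : Set (DPlus P F₀))
    (y : DPlus P F₀) (T : Submodule ℂ (Matrix (Fin n) (Fin n) ℂ ⧸ endF y.1.1 0)) : Prop :=
  ∃ (d : ℕ) (f : (Fin d → ℂ) → DPlus P F₀), f 0 = y ∧
    (∀ᶠ u in 𝓝 (0 : Fin d → ℂ), HolAt (Fin d → ℂ) (fun u' => (f u').1.1) u) ∧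
    Function.Injective (filDeriv (Fin d → ℂ) (fun u' => (f u').1.1) 0) ∧
    Filter.map f (𝓝 0) = 𝓝[A] y ∧
    (LinearMap.range (filDeriv (Fin d → ℂ) (fun u' => (f u').1.1) 0)).comap
      (endF (f 0).1.1 0).mkQ = T.comap (endF y.1.1 0).mkQ

end Domain

/- ### Variations of mixed Hodge structure -/

/-- The group of deck transformations of `π : X → S`. -/
def Deck {X S : Type*} [TopologicalSpace X] (π : X → S) : Subgroup (X ≃ₜ X) where
  carrier := {γ | ∀ x, π (γ x) = π x}
  mul_mem' := by
    intro a b ha hb x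
    exact (ha (b x)).trans (hb x)
  one_mem' := by
    intro x
    rfl
  inv_mem' := by
    intro a ha x
    have h := ha (a⁻¹ x)
    have h2 : a (a⁻¹ x) = x := a.apply_symm_apply x
    rw [h2] at h
    exact h.symm

/-- A variation of mixed `ℤ`-Hodge structure on the complex manifold `S` with universal covering
`π : X → S`. The local system `𝕍` (modulo torsion, of rank `n`) is given by its flat trivialization
`π^* 𝕍 = X × ℤⁿ` and its monodromy representation `ρ`; the weight filtration by a
`ρ`-stable filtration of `ℚⁿ`, the Hodge filtration by a `ρ`-equivariant holomorphic family of
filtrations of `ℂⁿ` on `X`, satisfying Griffiths transversality `∇ F^p ⊆ F^{p-1} ⊗ Ω¹`. -/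
structure ZVMHS (E : Type*) [NormedAddCommGroup E] [NormedSpace ℂ E]
    {X S : Type*} [TopologicalSpace X] [ChartedSpace E X] (π : X → S) (n : ℕ) where
  ρ : Deck π →* GL (Fin n) ℤ
  W : ℤ → Submodule ℚ (Fin n → ℚ)
  F : X → Fil n
  W_flat : ∀ γ k, ∀ v ∈ W k, ((ρ γ).1.map (Int.cast : ℤ → ℚ)) *ᵥ v ∈ W k
  F_equivariant : ∀ (γ : Deck π) (x : X),
    F (γ.1 x) = Fil.act (Matrix.GeneralLinearGroup.map (Int.castRingHom ℂ) (ρ γ)).1 (F x)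
  isMHS : ∀ x, IsMHS W (F x)
  holomorphic : ∀ x, HolAt E F x
  griffiths : ∀ (x : X) (p : ℤ) (σ : X → Fin n → ℂ), IsHolSection E F x p σ →
    ∀ v : TangentSpace 𝓘(ℂ, E) x, nabla E σ x v ∈ F x (p - 1)

namespace ZVMHS

variable {E : Type*} [NormedAddCommGroup E] [NormedSpace ℂ E]
  {X S : Type*} [TopologicalSpace X] [ChartedSpace E X] {π : X → S} {n : ℕ}

/-- Graded-polarizability. A polarization of `Gr_k^W` is given by a rational bilinear form `xᵀ Q y`
on `W_k`, which factors through `Gr_k^W`, is flat and `(-1)^k`-symmetric, and satisfies the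
Riemann bilinear relations at every point: `Q(F^p, F^{k+1-p}) = 0`, and
`i^{p-q} Q(x, conj x) > 0` for `0 ≠ x ∈ (Gr_k^W)^{p,q}`, `p + q = k`. -/
def GradedPolarizable (V : ZVMHS E π n) : Prop :=
  ∀ k : ℤ, ∃ Q : Matrix (Fin n) (Fin n) ℚ,
    (∀ x ∈ V.W k, ∀ y ∈ V.W (k - 1), x ⬝ᵥ Q *ᵥ y = 0) ∧
    (∀ x ∈ V.W k, ∀ y ∈ V.W k, x ⬝ᵥ Q *ᵥ y = (-1 : ℚ) ^ k * (y ⬝ᵥ Q *ᵥ x)) ∧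
    (∀ γ, ∀ x ∈ V.W k, ∀ y ∈ V.W k,
      (((V.ρ γ).1.map (Int.cast : ℤ → ℚ)) *ᵥ x) ⬝ᵥ
        Q *ᵥ (((V.ρ γ).1.map (Int.cast : ℤ → ℚ)) *ᵥ y) = x ⬝ᵥ Q *ᵥ y) ∧
    (∀ s p, ∀ x ∈ V.F s p ⊓ complexify (V.W k), ∀ y ∈ V.F s (k + 1 - p) ⊓ complexify (V.W k),
      x ⬝ᵥ (Q.map (algebraMap ℚ ℂ)) *ᵥ y = 0) ∧
    (∀ s p, ∀ x ∈ V.F s p ⊓ complexify (V.W k),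
      x ∈ (conjSub (V.F s (k - p)) ⊓ complexify (V.W k)) ⊔ complexify (V.W (k - 1)) →
      x ∉ complexify (V.W (k - 1)) →
      0 < (Complex.I ^ (p - (k - p)) * (x ⬝ᵥ (Q.map (algebraMap ℚ ℂ)) *ᵥ (star x))).re)

/-- The Mumford-Tate group of the fibre at (the image in `S` of) `x`, in the flat trivialization. -/
def mtGroup (V : ZVMHS E π n) (x : X) : Subgroup (GL (Fin n) ℂ) := mumfordTate V.W (V.F x)

/-- `x` (i.e. its image in `S`) is Hodge generic: its Mumford-Tate group is the largest one. It is
then the generic Mumford-Tate group `P_S`. -/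
def IsHodgeGeneric (V : ZVMHS E π n) (x : X) : Prop := ∀ x', V.mtGroup x' ≤ V.mtGroup x

/-- `A ∈ End(V_ℂ)` induces `∇̄_v` at `x`: one has `∇_v σ ≡ A σ(x) mod F^p` for all `p` and all local
holomorphic sections `σ` of `F^p`. -/
def RepresentsKS (V : ZVMHS E π n) (x : X) (v : TangentSpace 𝓘(ℂ, E) x)
    (A : Matrix (Fin n) (Fin n) ℂ) : Prop :=
  ∀ (p : ℤ) (σ : X → Fin n → ℂ), IsHolSection E V.F x p σ →
    nabla E σ x v - A *ᵥ σ x ∈ V.F x p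

/-- The image at `x` of the Kodaira-Spencer map `∇̄ : TS → Gr_F^{-1}(W_0 End 𝕍 ⊗ 𝒪)`, which sends
`v` to the class of any `A ∈ F^{-1} W_0 End(V_ℂ)` inducing `∇̄_v`. (As `π` is a local biholomorphism
it may be computed on `X`.) -/
def ksImage (V : ZVMHS E π n) (x : X) : Submodule ℂ (GrNegOne (V.F x) (endW V.W)) :=
  Submodule.span ℂ {ξ | ∃ (v : TangentSpace 𝓘(ℂ, E) x) (A : ↥(endW V.W ⊓ endF (V.F x) (-1))),
    V.RepresentsKS x v A.1 ∧ ξ = Submodule.Quotient.mk A}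

/-- `rk Im ∇̄`, the generic, i.e. maximal, rank of the Kodaira-Spencer map. -/
def ksRank (V : ZVMHS E π n) : ℕ := ⨆ x : X, Module.finrank ℂ (V.ksImage x)

/-- The Hodge codimension `H-cd(S, 𝕍) = dim Gr_F^{-1}(𝔭_S ⊗ ℂ) - rk Im ∇̄`, where
`𝔭_S` has its Hodge structure at the Hodge generic point `x₀`. -/
def hodgeCodim (V : ZVMHS E π n) (x₀ : X) : ℤ :=
  (Module.finrank ℂ (GrNegOne (V.F x₀) (lieAlgC (V.mtGroup x₀))) : ℤ) - (V.ksRank : ℤ)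

/-- The connected component `D_S⁺` of the mixed Mumford-Tate domain of `𝕍`, for the Hodge generic
base point `x₀`. -/
abbrev domain (V : ZVMHS E π n) (x₀ : X) : Set (MTDomain (V.mtGroup x₀) (V.F x₀)) :=
  DPlus (V.mtGroup x₀) (V.F x₀)

/-- The connected mixed Hodge variety `Hod⁰(S, 𝕍) = Γ \ D_S⁺`. -/
abbrev Hod (V : ZVMHS E π n) (x₀ : X) : Type := HodgeVariety (V.mtGroup x₀) (V.F x₀)

/-- `Φ` is the period map `Φ_S : S → Hod⁰(S, 𝕍)`, sending `π(x)` to the class of the Hodge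
filtration at `x`. -/
def IsPeriodMap (V : ZVMHS E π n) (x₀ : X) (Φ : S → V.Hod x₀) : Prop :=
  ∀ x, ∃ y : V.domain x₀, y.1.1 = V.F x ∧ Φ (π x) = HodgeVariety.mk y

end ZVMHS

end

/-!
The Deligne splitting of the mixed Hodge structures `F_x` yields, locally on `X`, bases `β` of `V_ℂ`
that are adapted to the weight and Hodge filtrations and depend real analytically on the point
(`HolAt.exists_analytic_isAdapted`). The Mumford–Tate group of `F_x` is generated, as an algebraic
group over `ℚ`, by the torus elements `β D β⁻¹` with `D` diagonal. Hence a rational polynomial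
equation holds for the tori of all points, or only for those of a closed set without interior.
There are countably many such equations, so by Baire's theorem Hodge generic points are dense
(`ZVMHS.dense_isHodgeGeneric`). The points at which `dF` has maximal rank form an open dense set
(`ZVMHS.isOpen_dense_maximal_rank`), so that some Hodge generic point has maximal rank.

Let `P` be the generic Mumford–Tate group and `𝔭` its Lie algebra. All tori lie in `P`;
differentiating `β D β⁻¹ ∈ P` and separating Hodge types shows that the components of `β' β⁻¹` of
type `(m, l)` with `m < 0` lie in `𝔭_ℂ` (`negComponent_mem_lieAlgC`). Let `A` be their sum. Modulo
endomorphisms preserving `F`, `β' β⁻¹` is the sum of the real element `A + Ā` and of an element of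
`𝔭_ℂ` of negative weight that cancels the negative weight part of `Ā`
(`IsAdapted.coord_realComponent_add_nilComponent`). The linear differential equation with this
coefficient is solved in `P(ℝ) 𝐖(ℂ)`, and its solution transports `F_x` to `F_y`
(`transport_mem_realUnipotent`, `exists_local_lift`). Therefore the period map is a continuous map to
the domain `D_S⁺` (`IsHodgeGeneric.exists_continuous_lift`), and its differential, which takes values
in `𝔭_ℂ / F^0` by the same computation and in `F^{-1} / F^0` by Griffiths transversality, is
horizontal (`IsHodgeGeneric.range_filDeriv_le`). The algebraic group theory needed is that the
equations of a group defined over `ℚ` are spanned by rational ones (`mem_span_rational_of_stable`,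
`IsRatAlgebraic.mem_lieAlgC_iff`), and that a linear equation with coefficients in `𝔭_ℂ` is solved
inside the group (`IsRatAlgebraic.mem_of_ode`).

The Kodaira–Spencer map has the rank of the differential of the period map (`ZVMHS.finrank_ksImage`,
`IsHodgeGeneric.ksRank_eq`), and the horizontal tangent spaces have constant dimension on the orbit
(`IsRatAlgebraic.finrank_horizontalTangent_act`). It remains to see that the image of the period map
has the dimension `r = rk ∇̄`. A slice through a point of maximal rank is an immersed submanifold of
dimension `r` (`exists_slice`). Conversely, in flag coordinates an immersed submanifold of dimension
`d > r` contained in the preimage of the image would be covered by the countably many translates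
of the image by integral matrices, whose projections to `ℂ^d` are null sets by Sard's theorem
(`volume_image_eq_zero_of_fderiv_not_surjective`, `exists_le_finrank_of_immersion`).

Near a smooth point of the image, the period map factors holomorphically through a parametrization
(`exists_holomorphic_factor`). At nearby points of maximal rank the factorization is a submersion, so
the tangent space is the image of the differential, hence horizontal; a limit over such points gives
the assertion at the smooth point (`IsHodgeGeneric.parametrization_horizontal`).

If the monodromy lies in `P`, the period map descends to `S` because the deck transformations of a
simply connected covering act transitively on the fibres (`IsCoveringMap.exists_deck`).
-/

open scoped Manifold ContDiff Topology Matrix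

noncomputable section

/-! ### Holomorphic functions of several variables -/

section Osgood

open Metric Set

variable {E F : Type*} [NormedAddCommGroup E] [NormedSpace ℂ E]
  [NormedAddCommGroup F] [NormedSpace ℂ F]

/-- Cauchy's estimate for the first derivative. -/
theorem norm_fderiv_le_of_forall_ball {f : E → F} {c : E} {R M : ℝ} (hR : 0 < R)
    (hf : DifferentiableOn ℂ f (ball c R)) (hM : ∀ z ∈ ball c R, ‖f z‖ ≤ M) :
    ‖fderiv ℂ f c‖ ≤ 2 * M / R := by
  apply Complex.norm_fderiv_le_div_of_mapsTo_ball hf _ hR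
  intro z hz
  rw [mem_closedBall, dist_eq_norm]
  calc ‖f z - f c‖ ≤ ‖f z‖ + ‖f c‖ := norm_sub_le _ _
    _ ≤ 2 * M := by linarith [hM z hz, hM c (mem_ball_self hR)]

/-- A complex differentiable function is continuously differentiable: Cauchy's estimate applied to
`z ↦ f (z + h) - f z` bounds `fderiv ℂ f (x + h) - fderiv ℂ f x`. -/
theorem continuousOn_fderiv_of_differentiableOn [FiniteDimensional ℂ E] {f : E → F}
    {U : Set E} (hU : IsOpen U) (hf : DifferentiableOn ℂ f U) :
    ContinuousOn (fderiv ℂ f) U := by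
  intro x hx
  apply ContinuousAt.continuousWithinAt
  have : ProperSpace E := FiniteDimensional.proper ℂ E
  obtain ⟨r, hr, hrU⟩ := (nhds_basis_closedBall.mem_iff).1 (hU.mem_nhds hx)
  have huc : UniformContinuousOn f (closedBall x r) :=
    (isCompact_closedBall x r).uniformContinuousOn_of_continuous (hf.continuousOn.mono hrU)
  rw [Metric.continuousAt_iff]
  intro ε hε
  -- the factor `1 / 8` leaves `2 * (ε * r / 8) / (r / 2) = ε / 2` in the estimate on the ball of
  -- radius `r / 2`
  obtain ⟨δ, hδ, hd⟩ := Metric.uniformContinuousOn_iff.1 huc (ε * r / 8) (by positivity)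
  refine ⟨min δ (r / 2), by positivity, fun {y} hy => ?_⟩
  have hyδ : dist y x < δ := hy.trans_le (min_le_left _ _)
  have hyr : dist y x < r / 2 := hy.trans_le (min_le_right _ _)
  set h := y - x with hh
  have hnh : ‖h‖ = dist y x := by rw [hh, dist_eq_norm]
  have hin : ∀ z ∈ ball x (r / 2), z ∈ closedBall x r ∧ z + h ∈ closedBall x r := by
    intro z hz
    rw [mem_ball] at hz
    constructor
    · rw [mem_closedBall]; linarith
    · rw [mem_closedBall, dist_eq_norm]
      calc ‖z + h - x‖ = ‖(z - x) + h‖ := by congr 1; abel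
        _ ≤ ‖z - x‖ + ‖h‖ := norm_add_le _ _
        _ ≤ r := by rw [hnh, ← dist_eq_norm]; linarith
  have hdz : ∀ z ∈ closedBall x r, DifferentiableAt ℂ f z := fun z hz =>
    hf.differentiableAt (hU.mem_nhds (hrU hz))
  have hcomp : ∀ z, DifferentiableAt ℂ f (z + h) →
      HasFDerivAt (fun w => f (w + h)) (fderiv ℂ f (z + h)) z := by
    intro z hz
    have := hz.hasFDerivAt.comp z ((hasFDerivAt_id z).add_const h)
    simpa [Function.comp_def] using this
  have hg : DifferentiableOn ℂ (fun z => f (z + h) - f z) (ball x (r / 2)) := by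
    intro z hz
    obtain ⟨h1, h2⟩ := hin z hz
    exact ((hcomp z (hdz _ h2)).differentiableAt.sub (hdz _ h1)).differentiableWithinAt
  have hb : ∀ z ∈ ball x (r / 2), ‖f (z + h) - f z‖ ≤ ε * r / 8 := by
    intro z hz
    obtain ⟨h1, h2⟩ := hin z hz
    rw [← dist_eq_norm]
    apply (hd _ h2 _ h1 _).le
    rw [dist_eq_norm, add_sub_cancel_left, hnh]; exact hyδ
  have key := norm_fderiv_le_of_forall_ball (by positivity) hg hb
  have hx0 := hin x (mem_ball_self (by positivity))
  have e : fderiv ℂ (fun z => f (z + h) - f z) x = fderiv ℂ f y - fderiv ℂ f x := by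
    have := ((hcomp x (hdz _ hx0.2)).sub (hdz _ hx0.1).hasFDerivAt).fderiv
    have hy' : x + h = y := by rw [hh]; abel
    rw [hy'] at this
    exact this
  rw [e] at key
  rw [dist_eq_norm]
  calc _ ≤ _ := key
    _ = ε / 2 := by field_simp; norm_num
    _ < ε := by linarith

/-- The partial derivatives of a complex differentiable function are complex differentiable: near
each point the derivative in the direction `v` is given by Cauchy's integral formula on the line in
the direction `v`, which can be differentiated under the integral sign. -/
theorem differentiableOn_fderiv_apply [FiniteDimensional ℂ E] [CompleteSpace F] {f : E → F}
    {U : Set E} (hU : IsOpen U) (hf : DifferentiableOn ℂ f U) (v : E) :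
    DifferentiableOn ℂ (fun y => fderiv ℂ f y v) U := by
  intro x hx
  apply DifferentiableAt.differentiableWithinAt
  have : ProperSpace E := FiniteDimensional.proper ℂ E
  obtain ⟨r, hr, hrU⟩ := (nhds_basis_closedBall.mem_iff).1 (hU.mem_nhds hx)
  -- the discs `y + ζ • v`, `‖ζ‖ ≤ ρ`, with centre `y` in the ball of radius `r / 2` stay in the
  -- closed ball of radius `r`
  set ρ : ℝ := r / (2 * (‖v‖ + 1)) with hρ
  have hv1 : 0 < ‖v‖ + 1 := by positivity
  have hρ0 : 0 < ρ := by positivity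
  have hρv : ρ * ‖v‖ < r / 2 := by
    rw [hρ, div_mul_eq_mul_div, div_lt_div_iff₀ (by positivity) (by norm_num)]
    nlinarith
  have hin : ∀ y ∈ ball x (r / 2), ∀ ζ : ℂ, ‖ζ‖ ≤ ρ → y + ζ • v ∈ closedBall x r := by
    intro y hy ζ hζ
    rw [mem_closedBall, dist_eq_norm]
    calc ‖y + ζ • v - x‖ = ‖(y - x) + ζ • v‖ := by congr 1; abel
      _ ≤ ‖y - x‖ + ‖ζ • v‖ := norm_add_le _ _
      _ ≤ r / 2 + ρ * ‖v‖ := by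
        rw [norm_smul, ← dist_eq_norm]
        exact add_le_add (mem_ball.1 hy).le (by gcongr)
      _ ≤ r := by linarith
  have hdz : ∀ z ∈ closedBall x r, DifferentiableAt ℂ f z := fun z hz =>
    hf.differentiableAt (hU.mem_nhds (hrU hz))
  have hcl : ∀ θ, ‖circleMap 0 ρ θ‖ ≤ ρ := by
    intro θ; simp [abs_of_pos hρ0]
  have hcf : ContinuousOn (fderiv ℂ f) (closedBall x r) :=
    (continuousOn_fderiv_of_differentiableOn hU hf).mono hrU
  obtain ⟨M, hM⟩ := (isCompact_closedBall x r).exists_bound_of_continuousOn hcf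
  have cauchy : ∀ y ∈ ball x (r / 2), fderiv ℂ f y v =
      (2 * Real.pi * Complex.I : ℂ)⁻¹ •
        ∮ ζ in C(0, ρ), ((ζ - 0) ^ 2)⁻¹ • f (y + ζ • v) := by
    intro y hy
    have hd : DifferentiableOn ℂ (fun ζ : ℂ => f (y + ζ • v)) {ζ | y + ζ • v ∈ U} := by
      intro ζ hζ
      apply DifferentiableAt.differentiableWithinAt
      have h1 := hf.differentiableAt (hU.mem_nhds hζ)
      exact h1.comp ζ (by fun_prop)
    have h2 := Complex.two_pi_I_inv_smul_circleIntegral_sub_sq_inv_smul_of_differentiable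
      (hU.preimage (by fun_prop)) (fun ζ hζ => hrU (hin y hy ζ (mem_closedBall_zero_iff.1 hζ))) hd
      (mem_ball_self hρ0)
    rw [h2]
    have h1 : DifferentiableAt ℂ f (y + (0 : ℂ) • v) :=
      hdz _ (hin y hy 0 (by simpa using hρ0.le))
    have h3 : HasDerivAt (fun ζ : ℂ => y + ζ • v) v 0 := by
      simpa using ((hasDerivAt_id (0 : ℂ)).smul_const v).const_add y
    have h4 := (h1.hasFDerivAt.comp_hasDerivAt (0 : ℂ) h3).deriv
    have h5 : (f ∘ fun ζ : ℂ => y + ζ • v) = fun ζ : ℂ => f (y + ζ • v) := rfl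
    rw [← h5, h4]; simp
  have hev : (fun y => fderiv ℂ f y v) =ᶠ[𝓝 x] fun y => (2 * Real.pi * Complex.I : ℂ)⁻¹ •
        ∮ ζ in C(0, ρ), ((ζ - 0) ^ 2)⁻¹ • f (y + ζ • v) := by
    filter_upwards [ball_mem_nhds x (half_pos hr)] with y hy using cauchy y hy
  refine DifferentiableAt.congr_of_eventuallyEq ?_ hev
  refine DifferentiableAt.const_smul ?_ _
  have hcm : ∀ θ, circleMap 0 ρ θ ≠ 0 := fun θ => by
    simp [circleMap, hρ0.ne']
  have hc1 : Continuous fun θ : ℝ => deriv (circleMap 0 ρ) θ * ((circleMap 0 ρ θ - 0) ^ 2)⁻¹ := by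
    simp only [deriv_circleMap, sub_zero]
    refine ((continuous_circleMap 0 ρ).mul continuous_const).mul
      (((continuous_circleMap 0 ρ).pow 2).inv₀ fun θ => pow_ne_zero _ (hcm θ))
  have hc2 : ∀ y ∈ ball x (r / 2), Continuous fun θ : ℝ => f (y + circleMap 0 ρ θ • v) := by
    intro y hy
    refine (hf.continuousOn.mono hrU).comp_continuous
      (continuous_const.add ((continuous_circleMap 0 ρ).smul continuous_const))
      (fun θ => hin y hy _ (hcl θ))
  have hc3 : ∀ y ∈ ball x (r / 2),
      Continuous fun θ : ℝ => fderiv ℂ f (y + circleMap 0 ρ θ • v) := by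
    intro y hy
    refine hcf.comp_continuous
      (continuous_const.add ((continuous_circleMap 0 ρ).smul continuous_const))
      (fun θ => hin y hy _ (hcl θ))
  have := (intervalIntegral.hasFDerivAt_integral_of_dominated_of_fderiv_le (𝕜 := ℂ)
    (μ := MeasureTheory.volume) (a := 0) (b := 2 * Real.pi)
    (F := fun y θ => (deriv (circleMap 0 ρ) θ * ((circleMap 0 ρ θ - 0) ^ 2)⁻¹) •
      f (y + circleMap 0 ρ θ • v))
    (F' := fun y θ => (deriv (circleMap 0 ρ) θ * ((circleMap 0 ρ θ - 0) ^ 2)⁻¹) •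
      fderiv ℂ f (y + circleMap 0 ρ θ • v)) (x₀ := x)
    (bound := fun θ => ‖deriv (circleMap 0 ρ) θ * ((circleMap 0 ρ θ - 0) ^ 2)⁻¹‖ * M)
    (s := ball x (r / 2)) (ball_mem_nhds x (half_pos hr)) ?_ ?_ ?_ ?_ ?_ ?_).differentiableAt
  · simpa only [circleIntegral, smul_smul] using this
  · filter_upwards [ball_mem_nhds x (half_pos hr)] with y hy
    exact (hc1.smul (hc2 y hy)).aestronglyMeasurable
  · exact (hc1.smul (hc2 x (mem_ball_self (half_pos hr)))).intervalIntegrable _ _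
  · exact (hc1.smul (hc3 x (mem_ball_self (half_pos hr)))).aestronglyMeasurable
  · refine Filter.Eventually.of_forall fun θ _ y hy => ?_
    rw [norm_smul]
    gcongr
    exact hM _ (hin y hy _ (hcl θ))
  · exact (hc1.norm.mul continuous_const).intervalIntegrable _ _
  · refine Filter.Eventually.of_forall fun θ _ y hy => ?_
    have h1 := (hdz _ (hin y hy _ (hcl θ))).hasFDerivAt
    have h2 := h1.comp y ((hasFDerivAt_id y).add_const (circleMap 0 ρ θ • v))
    exact (h2.const_smul _)

theorem differentiableOn_fderiv [FiniteDimensional ℂ E] [CompleteSpace F] {f : E → F}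
    {U : Set E} (hU : IsOpen U) (hf : DifferentiableOn ℂ f U) :
    DifferentiableOn ℂ (fderiv ℂ f) U := by
  set b := Module.finBasis ℂ E with hb
  have e : fderiv ℂ f = fun y => ∑ i, ContinuousLinearMap.smulRightL ℂ E F
      (LinearMap.toContinuousLinearMap (b.coord i)) (fderiv ℂ f y (b i)) := by
    funext y
    ext v
    simp only [sum_apply, ContinuousLinearMap.smulRightL_apply_apply]
    conv_lhs => rw [← b.sum_repr v, map_sum]
    simp_rw [map_smul]
    rfl
  rw [e]
  refine DifferentiableOn.fun_sum fun i _ => ?_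
  exact (ContinuousLinearMap.differentiable _).comp_differentiableOn
    (differentiableOn_fderiv_apply hU hf (b i))

theorem differentiableOn_iteratedFDeriv [FiniteDimensional ℂ E] [CompleteSpace F]
    {f : E → F} {U : Set E} (hU : IsOpen U) (hf : DifferentiableOn ℂ f U) (k : ℕ) :
    DifferentiableOn ℂ (iteratedFDeriv ℂ k f) U := by
  induction k with
  | zero =>
    rw [iteratedFDeriv_zero_eq_comp]
    exact (LinearIsometryEquiv.comp_differentiableOn_iff _).2 hf
  | succ k ih =>
    rw [iteratedFDeriv_succ_eq_comp_left]
    have h := differentiableOn_fderiv (F := E [×k]→L[ℂ] F) hU ih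
    have key : ∀ J : (E →L[ℂ] E [×k]→L[ℂ] F) →L[ℂ] E [×(k + 1)]→L[ℂ] F,
        DifferentiableOn ℂ (J ∘ fderiv ℂ (iteratedFDeriv ℂ k f)) U := fun J => by
      exact J.differentiable.comp_differentiableOn h
    exact key (continuousMultilinearCurryLeftEquiv ℂ (fun _ : Fin (k + 1) => E) F).symm

/-- Cauchy's estimate for the derivatives of order `n`, obtained by applying the estimate for the
first derivative on `n` nested balls whose radii decrease from `R` to `R / 2`. -/
theorem norm_iteratedFDeriv_le_of_forall_ball [FiniteDimensional ℂ E] [CompleteSpace F]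
    {f : E → F} {c : E} {R M : ℝ} (hR : 0 < R) (hf : DifferentiableOn ℂ f (ball c R))
    (hM : ∀ z ∈ ball c R, ‖f z‖ ≤ M) (n : ℕ) :
    ‖iteratedFDeriv ℂ n f c‖ ≤ M * (4 * n / R) ^ n := by
  rcases Nat.eq_zero_or_pos n with rfl | hn
  · simpa using hM c (mem_ball_self hR)
  have hn' : (0 : ℝ) < n := by exact_mod_cast hn
  -- `n` steps of length `δ` lead from the radius `R` to `R / 2`
  set δ : ℝ := R / (2 * n) with hδ
  have hδ0 : 0 < δ := by positivity
  have key : ∀ k : ℕ, k ≤ n → ∀ y ∈ ball c (R - k * δ),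
      ‖iteratedFDeriv ℂ k f y‖ ≤ M * (4 * n / R) ^ k := by
    intro k
    induction k with
    | zero =>
      intro _ y hy
      simpa using hM y (by simpa using hy)
    | succ k ih =>
      intro hk y hy
      have hsub : ball y δ ⊆ ball c (R - k * δ) := by
        apply ball_subset_ball'
        have : dist y c < R - (k + 1 : ℕ) * δ := hy
        push_cast at this
        linarith
      have h1 := norm_fderiv_le_of_forall_ball hδ0
        ((differentiableOn_iteratedFDeriv isOpen_ball hf k).mono
          (hsub.trans (ball_subset_ball (by
            have : 0 ≤ (k : ℝ) * δ := by positivity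
            linarith))))
        (fun z hz => ih (by omega) z (hsub hz))
      rw [norm_fderiv_iteratedFDeriv] at h1
      refine h1.trans (le_of_eq ?_)
      rw [hδ, pow_succ]
      field_simp
      norm_num [mul_comm]
  refine key n le_rfl c (mem_ball_self ?_)
  rw [hδ]
  have : (n : ℝ) * (R / (2 * n)) = R / 2 := by field_simp
  rw [this]; linarith

/-- The derivatives of the restriction of `f` to a complex line. -/
theorem iteratedDeriv_line_eq [FiniteDimensional ℂ E] [CompleteSpace F]
    {f : E → F} {U : Set E} (hU : IsOpen U) (hf : DifferentiableOn ℂ f U) (c y : E) (n : ℕ) :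
    ∀ ζ : ℂ, c + ζ • y ∈ U → iteratedDeriv n (fun ζ : ℂ => f (c + ζ • y)) ζ =
      iteratedFDeriv ℂ n f (c + ζ • y) (fun _ => y) := by
  induction n with
  | zero => intro ζ _; simp
  | succ n ih =>
    intro ζ hζ
    have hop : IsOpen {ζ : ℂ | c + ζ • y ∈ U} := hU.preimage (by fun_prop)
    have hev : iteratedDeriv n (fun ζ : ℂ => f (c + ζ • y)) =ᶠ[𝓝 ζ]
        fun ζ => iteratedFDeriv ℂ n f (c + ζ • y) (fun _ => y) := by
      filter_upwards [hop.mem_nhds hζ] with η hη using ih η hη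
    rw [iteratedDeriv_succ, hev.deriv_eq, iteratedFDeriv_succ_apply_left]
    have h1 := ((differentiableOn_iteratedFDeriv hU hf n).differentiableAt
      (hU.mem_nhds hζ)).hasFDerivAt
    have h3 : HasDerivAt (fun ζ : ℂ => c + ζ • y) y ζ := by
      simpa using ((hasDerivAt_id ζ).smul_const y).const_add c
    have h4 := h1.comp_hasDerivAt ζ h3
    have h5 := ((ContinuousMultilinearMap.apply ℂ (fun _ : Fin n => E) F
      (fun _ => y)).hasFDerivAt.comp_hasDerivAt ζ h4).deriv
    exact h5

/-- **Osgood's lemma**: a complex differentiable function of several variables is analytic. Its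
Taylor series converges to it along every complex line, and Cauchy's estimates bound the
coefficients of the series by those of a geometric one. -/
theorem analyticAt_of_eventually_differentiableAt [FiniteDimensional ℂ E] [CompleteSpace F]
    {f : E → F} {c : E} (hf : ∀ᶠ y in 𝓝 c, DifferentiableAt ℂ f y) : AnalyticAt ℂ f c := by
  have : ProperSpace E := FiniteDimensional.proper ℂ E
  obtain ⟨R, hR, hRd⟩ := nhds_basis_closedBall.mem_iff.1 hf
  have hd : DifferentiableOn ℂ f (ball c R) := fun y hy =>
    (hRd (ball_subset_closedBall hy)).differentiableWithinAt
  obtain ⟨M, hM⟩ := (isCompact_closedBall c R).exists_bound_of_continuousOn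
    (f := f) (fun y hy => (hRd hy).continuousAt.continuousWithinAt)
  have hM0 : 0 ≤ M := (norm_nonneg _).trans (hM c (mem_closedBall_self hR.le))
  have hM' : ∀ z ∈ ball c R, ‖f z‖ ≤ M := fun z hz => hM z (ball_subset_closedBall hz)
  set p : FormalMultilinearSeries ℂ E F := fun n => ((n.factorial : ℂ)⁻¹) • iteratedFDeriv ℂ n f c
    with hp
  -- since `n ^ n / n! ≤ e ^ n`, the terms `‖p n‖ * r ^ n` are bounded by `M` for this radius
  set r : NNReal := ⟨R / (4 * Real.exp 1), by positivity⟩ with hr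
  have hrR : (r : ℝ) = R / (4 * Real.exp 1) := rfl
  have hr0 : 0 < (r : ℝ) := by rw [hrR]; positivity
  have hrad : (r : ENNReal) ≤ p.radius := by
    apply p.le_radius_of_bound M
    intro n
    have h1 := norm_iteratedFDeriv_le_of_forall_ball hR hd hM' n
    have h2 : (n : ℝ) ^ n / n.factorial ≤ Real.exp n :=
      Real.pow_div_factorial_le_exp (x := n) (by positivity) n
    have h3 : ‖p n‖ = (n.factorial : ℝ)⁻¹ * ‖iteratedFDeriv ℂ n f c‖ := by
      simp [hp, norm_smul]
    rw [h3, hrR]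
    calc (n.factorial : ℝ)⁻¹ * ‖iteratedFDeriv ℂ n f c‖ * (R / (4 * Real.exp 1)) ^ n
        ≤ (n.factorial : ℝ)⁻¹ * (M * (4 * n / R) ^ n) * (R / (4 * Real.exp 1)) ^ n := by gcongr
      _ = M * ((n : ℝ) ^ n / n.factorial) * (Real.exp 1 ^ n)⁻¹ := by
        simp only [div_pow, mul_pow]
        field_simp
      _ ≤ M * Real.exp n * (Real.exp 1 ^ n)⁻¹ := by gcongr
      _ = M := by
        rw [← Real.exp_one_rpow, Real.rpow_natCast]
        field_simp
  refine ⟨p, r, hrad, by exact_mod_cast hr0, ?_⟩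
  intro y hy
  have hyr : ‖y‖ < r := by simpa using hy
  have hyR : ‖y‖ < R := by
    apply hyr.trans_le
    rw [hrR]
    apply div_le_self hR.le
    have := Real.add_one_le_exp (1 : ℝ)
    linarith
  -- `ζ ↦ f (c + ζ • y)` is holomorphic on a disc of radius larger than `1`; its Taylor series at `ζ
  -- = 1` is the Taylor series of `f` at `y`
  set g : ℂ → F := fun ζ => f (c + ζ • y) with hg
  have hmem : ∀ ζ ∈ ball (0 : ℂ) (R / (‖y‖ + (R - ‖y‖) / 2)), c + ζ • y ∈ ball c R := by
    intro ζ hζ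
    have hpos : 0 < ‖y‖ + (R - ‖y‖) / 2 := by
      have := norm_nonneg y; linarith
    rw [mem_ball_zero_iff, lt_div_iff₀ hpos] at hζ
    rw [mem_ball, dist_eq_norm, add_sub_cancel_left, norm_smul]
    have : ‖ζ‖ * ‖y‖ ≤ ‖ζ‖ * (‖y‖ + (R - ‖y‖) / 2) := by gcongr; linarith
    linarith
  have hgd : DifferentiableOn ℂ g (ball 0 (R / (‖y‖ + (R - ‖y‖) / 2))) := by
    intro ζ hζ
    have h1 : DifferentiableAt ℂ f (c + ζ • y) := hRd (ball_subset_closedBall (hmem ζ hζ))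
    exact (h1.comp ζ (by fun_prop)).differentiableWithinAt
  have h1mem : (1 : ℂ) ∈ ball (0 : ℂ) (R / (‖y‖ + (R - ‖y‖) / 2)) := by
    have hpos : 0 < ‖y‖ + (R - ‖y‖) / 2 := by
      have := norm_nonneg y; linarith
    rw [mem_ball_zero_iff, lt_div_iff₀ hpos]
    simp; linarith
  have hs := Complex.hasSum_taylorSeries_on_ball hgd h1mem
  have e : ∀ n : ℕ, ((n.factorial : ℂ))⁻¹ • ((1 : ℂ) - 0) ^ n • iteratedDeriv n g 0 =
      p n (fun _ => y) := by
    intro n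
    have := iteratedDeriv_line_eq isOpen_ball hd c y n 0 (by simpa using hR)
    simp only [hg, this, hp]
    simp
  simp only [e] at hs
  simpa [hg] using hs

end Osgood

/-! ### The holomorphic inverse function theorem -/

section InverseFunction

variable {E F : Type*} [NormedAddCommGroup E] [NormedSpace ℂ E] [FiniteDimensional ℂ E]
  [NormedAddCommGroup F] [NormedSpace ℂ F] [FiniteDimensional ℂ F]

/-- The holomorphic inverse function theorem. -/
theorem exists_holomorphic_local_inverse {Φ : E → F} {x : E}
    (hΦ : ∀ᶠ y in 𝓝 x, DifferentiableAt ℂ Φ y) (hb : Function.Bijective (fderiv ℂ Φ x)) :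
    ∃ ψ : F → E, ψ (Φ x) = x ∧ (∀ᶠ p in 𝓝 (Φ x), DifferentiableAt ℂ ψ p) ∧
      (∀ᶠ p in 𝓝 (Φ x), Φ (ψ p) = p) ∧ ∀ᶠ y in 𝓝 x, ψ (Φ y) = y := by
  have : CompleteSpace E := FiniteDimensional.complete ℂ E
  have : CompleteSpace F := FiniteDimensional.complete ℂ F
  have hc : ContDiffAt ℂ 1 Φ x := (analyticAt_of_eventually_differentiableAt hΦ).contDiffAt
  let e : E ≃L[ℂ] F := (LinearEquiv.ofBijective (fderiv ℂ Φ x).toLinearMap hb).toContinuousLinearEquiv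
  have he : HasFDerivAt Φ (e : E →L[ℂ] F) x := hΦ.self_of_nhds.hasFDerivAt
  have hs := hc.hasStrictFDerivAt' he one_ne_zero
  refine ⟨hc.localInverse he one_ne_zero, hc.localInverse_apply_image he one_ne_zero, ?_,
    hs.eventually_right_inverse, hs.eventually_left_inverse⟩
  have h2 := (hc.to_localInverse he one_ne_zero).eventually (by simp)
  filter_upwards [h2] with p hp using hp.differentiableAt one_ne_zero

end InverseFunction

/-! ### Sard's theorem for holomorphic maps -/

section Sard

open MeasureTheory Set

/-- By Lindelöf's theorem, the image of a set is negligible if this holds locally on the set. -/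
theorem measure_image_eq_zero_of_locally {E F : Type*} [TopologicalSpace E]
    [SecondCountableTopology E] [MeasurableSpace F] {μ : Measure F} {h : E → F} {A : Set E}
    (hA : ∀ x ∈ A, ∃ U ∈ 𝓝 x, μ (h '' (A ∩ U)) = 0) : μ (h '' A) = 0 := by
  choose! U hU hμ using hA
  obtain ⟨t, htA, htc, hcov⟩ := TopologicalSpace.countable_cover_nhdsWithin
    (fun x hx => mem_nhdsWithin_of_mem_nhds (hU x hx))
  have hsub : h '' A ⊆ ⋃ x ∈ t, h '' (A ∩ U x) := by
    rintro _ ⟨y, hy, rfl⟩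
    obtain ⟨x, hx, hyx⟩ := mem_iUnion₂.1 (hcov hy)
    exact mem_iUnion₂.2 ⟨x, hx, y, ⟨hy, hyx⟩, rfl⟩
  refine measure_mono_null hsub ?_
  exact (measure_biUnion_null_iff htc).2 fun x hx => hμ x (htA hx)

/-- Near a point where `dw ≠ 0`, the function `w` is the first coordinate of a holomorphic
coordinate system. -/
theorem exists_coordinates_of_fderiv_ne_zero {m : ℕ} {w : (Fin (m + 1) → ℂ) → ℂ}
    {x : Fin (m + 1) → ℂ} (hw : ∀ᶠ y in 𝓝 x, DifferentiableAt ℂ w y) (hne : fderiv ℂ w x ≠ 0) :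
    ∃ (ψ : ℂ × (Fin m → ℂ) → Fin (m + 1) → ℂ) (p₀ : ℂ × (Fin m → ℂ)), ψ p₀ = x ∧
      (∀ᶠ p in 𝓝 p₀, DifferentiableAt ℂ ψ p ∧ w (ψ p) = p.1) ∧
      ∀ V ∈ 𝓝 p₀, ψ '' V ∈ 𝓝 x := by
  set ℓ := fderiv ℂ w x with hℓ
  have hsurj : Function.Surjective ℓ.toLinearMap :=
    LinearMap.surjective (by simpa [LinearMap.ext_iff, ContinuousLinearMap.ext_iff] using hne)
  have hker : Module.finrank ℂ (LinearMap.ker ℓ.toLinearMap) = m := by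
    have := LinearMap.finrank_range_add_finrank_ker ℓ.toLinearMap
    rw [LinearMap.range_eq_top.2 hsurj] at this
    simp at this
    omega
  -- a projection onto the kernel of `ℓ` supplies the remaining coordinates
  obtain ⟨P, hP⟩ := (LinearMap.ker ℓ.toLinearMap).subtype.exists_leftInverse_of_injective
    (by simp)
  let κ : LinearMap.ker ℓ.toLinearMap ≃ₗ[ℂ] (Fin m → ℂ) :=
    LinearEquiv.ofFinrankEq _ _ (by simp [hker])
  let L : (Fin (m + 1) → ℂ) →L[ℂ] (Fin m → ℂ) :=
    LinearMap.toContinuousLinearMap (κ.toLinearMap ∘ₗ P)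
  let Φ : (Fin (m + 1) → ℂ) → ℂ × (Fin m → ℂ) := fun y => (w y, L y)
  have hΦ : ∀ᶠ y in 𝓝 x, DifferentiableAt ℂ Φ y := by
    filter_upwards [hw] with y hy using hy.prodMk L.differentiableAt
  have hd : fderiv ℂ Φ x = ℓ.prod L :=
    (hw.self_of_nhds.hasFDerivAt.prodMk L.hasFDerivAt).fderiv
  have hinj : Function.Injective (fderiv ℂ Φ x) := by
    rw [hd]
    refine (injective_iff_map_eq_zero _).2 fun v hv => ?_
    have h1 : ℓ v = 0 := congrArg Prod.fst hv
    have h2 : κ (P v) = 0 := congrArg Prod.snd hv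
    have h3 : P v = 0 := by simpa using h2
    have h4 := LinearMap.congr_fun hP ⟨v, h1⟩
    simp only [LinearMap.comp_apply, Submodule.subtype_apply, LinearMap.id_apply] at h4
    rw [h3] at h4
    exact (congrArg Subtype.val h4).symm
  have hbij : Function.Bijective (fderiv ℂ Φ x) := by
    refine ⟨hinj, ?_⟩
    exact (LinearMap.injective_iff_surjective_of_finrank_eq_finrank
      (f := (fderiv ℂ Φ x).toLinearMap) (by simp [add_comm])).1 hinj
  obtain ⟨ψ, h0, h1, h2, h3⟩ := exists_holomorphic_local_inverse hΦ hbij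
  refine ⟨ψ, Φ x, h0, ?_, ?_⟩
  · filter_upwards [h1, h2] with p hp1 hp2
    exact ⟨hp1, congrArg Prod.fst hp2⟩
  · intro V hV
    filter_upwards [hΦ.self_of_nhds.continuousAt hV, h3] with y hy hy3
    exact ⟨Φ y, hy, hy3⟩

/-- **Sard's theorem** for holomorphic maps with a nowhere surjective differential. By induction on
the dimension of the source: where `dh ≠ 0`, a component of `h` is a coordinate and Fubini's theorem
reduces to its level sets; the points where `dh` vanishes to finite order lie on smooth
hypersurfaces; near the remaining points `h` is constant. -/
theorem volume_image_eq_zero_of_fderiv_not_surjective (m : ℕ) : ∀ (d : ℕ)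
    (h : (Fin m → ℂ) → Fin d → ℂ) (Ω : Set (Fin m → ℂ)), IsOpen Ω →
    (∀ x ∈ Ω, DifferentiableAt ℂ h x) → (∀ x ∈ Ω, ¬ Function.Surjective (fderiv ℂ h x)) →
    volume (h '' Ω) = 0 := by
  induction m with
  | zero =>
    intro d h Ω hΩ hd hns
    rcases Ω.eq_empty_or_nonempty with rfl | ⟨x, hx⟩
    · simp
    rcases Nat.eq_zero_or_pos d with rfl | hd0
    · exact absurd (fun _ => ⟨0, Subsingleton.elim _ _⟩) (hns x hx)
    have : Nonempty (Fin d) := ⟨⟨0, hd0⟩⟩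
    exact ((Set.subsingleton_of_subsingleton (s := Ω)).image h).measure_zero _
  | succ m ih =>
    intro d h Ω hΩ hd hns
    have hdo : DifferentiableOn ℂ h Ω := fun x hx => (hd x hx).differentiableWithinAt
    -- the points are sorted by the order of the first non-vanishing derivative of `h`
    have hsplit : h '' Ω ⊆ (⋃ k : ℕ, h '' {x ∈ Ω | (k ≠ 0 → iteratedFDeriv ℂ k h x = 0) ∧
        iteratedFDeriv ℂ (k + 1) h x ≠ 0}) ∪
        h '' {x ∈ Ω | ∀ k : ℕ, iteratedFDeriv ℂ (k + 1) h x = 0} := by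
      rintro _ ⟨x, hx, rfl⟩
      by_cases hall : ∀ k : ℕ, iteratedFDeriv ℂ (k + 1) h x = 0
      · exact Or.inr ⟨x, ⟨hx, hall⟩, rfl⟩
      · left
        push Not at hall
        classical
        refine mem_iUnion.2 ⟨Nat.find hall, x, ⟨hx, fun hne => ?_, Nat.find_spec hall⟩, rfl⟩
        obtain ⟨j, hj⟩ := Nat.exists_eq_succ_of_ne_zero hne
        have := Nat.find_min hall (m := j) (by omega)
        rw [hj]
        simpa using this
    refine measure_mono_null hsplit (measure_union_null (measure_iUnion_null fun k => ?_) ?_)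
    · apply measure_image_eq_zero_of_locally
      rintro x ⟨hx, hk, hk1⟩
      have hΩx := hΩ.mem_nhds hx
      rcases Nat.eq_zero_or_pos k with rfl | hkpos
      · -- a component of `h` is a coordinate near `x`
        have hdx : fderiv ℂ h x ≠ 0 := by
          intro h0
          apply hk1
          rw [← norm_eq_zero, zero_add, norm_iteratedFDeriv_one, h0]
          exact norm_zero
        obtain ⟨i, hi⟩ : ∃ i, fderiv ℂ (fun y => h y i) x ≠ 0 := by
          by_contra hcon
          push Not at hcon
          apply hdx
          ext v i
          have h1 := (hasFDerivAt_pi'.1 (hd x hx).hasFDerivAt i).fderiv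
          rw [hcon i] at h1
          have := congrArg (fun L => L v) h1
          simpa using this.symm
        have hwi : ∀ᶠ y in 𝓝 x, DifferentiableAt ℂ (fun y => h y i) y := by
          filter_upwards [hΩx] with y hy using differentiableAt_pi.1 (hd y hy) i
        obtain ⟨ψ, p₀, hψ0, hψ, hψn⟩ := exists_coordinates_of_fderiv_ne_zero hwi hi
        cases d with
        | zero => exact i.elim0
        | succ d =>
        have hψc : ContinuousAt ψ p₀ := hψ.self_of_nhds.1.continuousAt
        have hev : ∀ᶠ p in 𝓝 p₀, (DifferentiableAt ℂ ψ p ∧ h (ψ p) i = p.1) ∧ ψ p ∈ Ω :=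
          hψ.and (hψc (by rw [hψ0]; exact hΩx))
        obtain ⟨V, hVsub, hVo, hpV⟩ := mem_nhds_iff.1 hev
        obtain ⟨K, hK, hKV, hKc⟩ := local_compact_nhds (hVo.mem_nhds hpV)
        refine ⟨ψ '' K, hψn K hK, measure_mono_null (t := h '' (ψ '' K))
          (image_mono inter_subset_right) ?_⟩
        set H : ℂ × (Fin m → ℂ) → Fin (d + 1) → ℂ := h ∘ ψ with hH
        have hHd : ∀ p ∈ V, HasFDerivAt H ((fderiv ℂ h (ψ p)).comp (fderiv ℂ ψ p)) p := by
          intro p hp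
          exact (hd _ (hVsub hp).2).hasFDerivAt.comp p (hVsub hp).1.1.hasFDerivAt
        have hHi : ∀ p ∈ V, ∀ v, fderiv ℂ H p v i = v.1 := by
          intro p hp v
          have h1 := hasFDerivAt_pi'.1 (hHd p hp).differentiableAt.hasFDerivAt i
          have h2 : (fun q => H q i) =ᶠ[𝓝 p] fun q => q.1 := by
            filter_upwards [hVo.mem_nhds hp] with q hq using (hVsub hq).1.2
          have h3 := (h1.congr_of_eventuallyEq h2.symm).unique hasFDerivAt_fst
          have := congrArg (fun L => L v) h3
          simpa using this
        have hHns : ∀ p ∈ V, ¬ Function.Surjective (fderiv ℂ H p) := by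
          intro p hp hs
          refine hns _ (hVsub hp).2 fun y => ?_
          obtain ⟨v, hv⟩ := hs y
          rw [(hHd p hp).fderiv] at hv
          exact ⟨_, hv⟩
        have hKcomp : IsCompact (H '' K) := hKc.image_of_continuousOn
          fun p hp => (hHd p (hKV hp)).continuousAt.continuousWithinAt
        rw [← image_comp]
        -- by Fubini's theorem, it suffices that the slices `{y i = t}` of the image are negligible;
        -- the slice is the image of the restriction to `{t} × ℂ^m` of the remaining components of
        -- `H`
        let e := MeasurableEquiv.piFinSuccAbove (fun _ : Fin (d + 1) => ℂ) i
        have hmp := volume_preserving_piFinSuccAbove (fun _ : Fin (d + 1) => ℂ) i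
        have hpre : H '' K = e ⁻¹' (e '' (H '' K)) := (e.injective.preimage_image _).symm
        have hmeas : MeasurableSet (e '' (H '' K)) :=
          (e.measurableSet_image).2 hKcomp.isClosed.measurableSet
        change volume (H '' K) = 0
        rw [hpre, hmp.measure_preimage hmeas.nullMeasurableSet]
        refine (Measure.measure_prod_null hmeas).2 (Filter.Eventually.of_forall fun t => ?_)
        have hrem : Differentiable ℂ (fun y : Fin (d + 1) → ℂ => i.removeNth y) := by
          refine differentiable_pi.2 fun j => ?_
          exact differentiable_apply _
        let R : (Fin (d + 1) → ℂ) →L[ℂ] (Fin d → ℂ) :=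
          ContinuousLinearMap.pi fun j => ContinuousLinearMap.proj (i.succAbove j)
        have hslice : ∀ s, (t, s) ∈ V → HasFDerivAt (fun s => R (H (t, s)))
            ((R.comp (fderiv ℂ H (t, s))).comp (ContinuousLinearMap.inr ℂ ℂ (Fin m → ℂ))) s := by
          intro s hs
          have h1 : HasFDerivAt (fun s : Fin m → ℂ => (t, s))
              (ContinuousLinearMap.inr ℂ ℂ (Fin m → ℂ)) s :=
            hasFDerivAt_prodMk_right t s
          exact (R.hasFDerivAt.comp _ (hHd (t, s) hs).differentiableAt.hasFDerivAt).comp s h1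
        refine measure_mono_null ?_ (ih d (fun s => R (H (t, s))) {s | (t, s) ∈ V}
          (hVo.preimage (by fun_prop)) (fun s hs => (hslice s hs).differentiableAt) ?_)
        · rintro z ⟨_, ⟨⟨t', s⟩, hp, rfl⟩, hz⟩
          have h1 : H (t', s) i = t := congrArg Prod.fst hz
          have h2 : H (t', s) i = t' := (hVsub (hKV hp)).1.2
          have h3 : t' = t := h2.symm.trans h1
          subst h3
          exact ⟨s, hKV hp, congrArg Prod.snd hz⟩
        · intro s hs hsurj
          refine hHns _ hs fun y => ?_
          rw [(hslice s hs).fderiv] at hsurj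
          -- if the restriction were a submersion, then so would be `H`, whose `i`-th component is
          -- `t`
          obtain ⟨s', hs'⟩ := hsurj (R (y - fderiv ℂ H (t, s) (y i, 0)))
          refine ⟨(y i, s'), ?_⟩
          have e1 : ((y i, s') : ℂ × (Fin m → ℂ)) = (y i, 0) + (0, s') := by simp
          rw [e1, map_add]
          funext j
          rcases Fin.eq_self_or_eq_succAbove i j with rfl | ⟨j', rfl⟩
          · simp [hHi _ hs]
          · have := congrFun hs' j'
            simp only [R, ContinuousLinearMap.comp_apply, ContinuousLinearMap.inr_apply,
              ContinuousLinearMap.coe_pi', ContinuousLinearMap.proj_apply, Pi.sub_apply] at this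
            simp [this]
      · -- near `x`, the zeros of the `k`-th derivative lie on a smooth hypersurface
        have hkd := differentiableOn_iteratedFDeriv hΩ hdo k
        have hDne : fderiv ℂ (iteratedFDeriv ℂ k h) x ≠ 0 := by
          intro h0
          apply hk1
          rw [← norm_eq_zero, ← norm_fderiv_iteratedFDeriv, h0]
          exact norm_zero (E := (Fin (m + 1) → ℂ) →L[ℂ] (Fin (m + 1) → ℂ) [×k]→L[ℂ] (Fin d → ℂ))
        obtain ⟨v, hv⟩ : ∃ v, fderiv ℂ (iteratedFDeriv ℂ k h) x v ≠ 0 := by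
          by_contra hcon
          push Not at hcon
          exact hDne (ContinuousLinearMap.ext hcon)
        obtain ⟨ℓ, hℓ⟩ := SeparatingDual.exists_ne_zero (R := ℂ) hv
        have hwd : ∀ y ∈ Ω, HasFDerivAt (fun y => ℓ (iteratedFDeriv ℂ k h y))
            (ℓ.comp (fderiv ℂ (iteratedFDeriv ℂ k h) y)) y := fun y hy => by
          exact ℓ.hasFDerivAt.comp y (hkd.differentiableAt (hΩ.mem_nhds hy)).hasFDerivAt
        have hwi : ∀ᶠ y in 𝓝 x, DifferentiableAt ℂ (fun y => ℓ (iteratedFDeriv ℂ k h y)) y := by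
          filter_upwards [hΩx] with y hy using (hwd y hy).differentiableAt
        have hwne : fderiv ℂ (fun y => ℓ (iteratedFDeriv ℂ k h y)) x ≠ 0 := by
          rw [(hwd x hx).fderiv]
          intro h0
          exact hℓ (congrArg (fun L => L v) h0)
        obtain ⟨ψ, p₀, hψ0, hψ, hψn⟩ := exists_coordinates_of_fderiv_ne_zero hwi hwne
        have hψc : ContinuousAt ψ p₀ := hψ.self_of_nhds.1.continuousAt
        have hev := hψ.and (hψc (by rw [hψ0]; exact hΩx))
        obtain ⟨V, hVsub, hVo, hpV⟩ := mem_nhds_iff.1 hev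
        refine ⟨ψ '' V, hψn V (hVo.mem_nhds hpV), ?_⟩
        have hHd : ∀ s, ((0 : ℂ), s) ∈ V → HasFDerivAt (fun s => h (ψ (0, s)))
            (((fderiv ℂ h (ψ (0, s))).comp (fderiv ℂ ψ (0, s))).comp
              (ContinuousLinearMap.inr ℂ ℂ (Fin m → ℂ))) s := by
          intro s hs
          have h1 : HasFDerivAt (fun s : Fin m → ℂ => ((0 : ℂ), s))
              (ContinuousLinearMap.inr ℂ ℂ (Fin m → ℂ)) s := hasFDerivAt_prodMk_right 0 s
          exact ((hd _ (hVsub hs).2).hasFDerivAt.comp (0, s)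
            (hVsub hs).1.1.hasFDerivAt).comp s h1
        refine measure_mono_null ?_ (ih d (fun s => h (ψ (0, s))) {s | ((0 : ℂ), s) ∈ V}
          (hVo.preimage (by fun_prop)) (fun s hs => (hHd s hs).differentiableAt) ?_)
        · rintro _ ⟨_, ⟨⟨_, hz, _⟩, ⟨t, s⟩, hp, rfl⟩, rfl⟩
          have h1 : ℓ (iteratedFDeriv ℂ k h (ψ (t, s))) = t := (hVsub hp).1.2
          rw [hz hkpos.ne', map_zero] at h1
          subst h1
          exact ⟨s, hp, rfl⟩
        · intro s hs hsurj
          rw [(hHd s hs).fderiv] at hsurj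
          refine hns _ (hVsub hs).2 fun y => ?_
          obtain ⟨v, hv⟩ := hsurj y
          exact ⟨_, hv⟩
    · -- `h` is constant near a point where all its derivatives vanish
      apply measure_image_eq_zero_of_locally
      rintro x ⟨hx, hall⟩
      have hΩx := hΩ.mem_nhds hx
      have han : AnalyticAt ℂ h x := analyticAt_of_eventually_differentiableAt (by
        filter_upwards [hΩx] with y hy using hd y hy)
      have hconst : ∀ᶠ y in 𝓝 x, h y = h x := by
        obtain ⟨p, r, hp⟩ := han
        have hr : Metric.eball x r ∈ 𝓝 x := Metric.eball_mem_nhds x hp.r_pos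
        filter_upwards [hr] with y hy
        have hs := hp.hasSum_iteratedFDeriv (y := y - x) (by simpa [edist_eq_enorm_sub] using hy)
        have hs0 : HasSum (fun n : ℕ => ((1 / n.factorial : ℂ)) •
            iteratedFDeriv ℂ n h x fun _ => y - x) (h x) := by
          convert hasSum_single 0 ?_ using 1
          · simp
          · intro n hn
            obtain ⟨j, rfl⟩ := Nat.exists_eq_succ_of_ne_zero hn
            rw [hall j]; simp
        simpa using hs.unique (by simpa using hs0)
      have hdpos : 0 < d := by
        rcases Nat.eq_zero_or_pos d with rfl | h0
        · exact absurd (fun _ => ⟨0, Subsingleton.elim _ _⟩) (hns x hx)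
        · exact h0
      have : Nonempty (Fin d) := ⟨⟨0, hdpos⟩⟩
      refine ⟨_, hconst, measure_mono_null (t := {h x}) ?_ (measure_singleton _)⟩
      rintro _ ⟨y, ⟨_, hy⟩, rfl⟩
      exact hy

end Sard

/-! ### Deligne's splitting of a mixed Hodge structure -/

section DeligneSplitting

variable {V : Type*} [AddCommGroup V] [Module ℂ V]

/-- Filtrations `W` (increasing) and `F`, `G` (decreasing) of a complex vector space such that `F`
and `G` induce `k`-opposed filtrations on `Gr_k^W` for all `k`. A mixed Hodge structure gives such
a triple, with `G` the complex conjugate of `F`. -/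
structure IsOpposed (W F G : ℤ → Submodule ℂ V) : Prop where
  W_mono : Monotone W
  W_bot : ∃ k, W k = ⊥
  W_top : ∃ k, W k = ⊤
  F_anti : Antitone F
  F_bot : ∃ p, F p = ⊥
  F_top : ∃ p, F p = ⊤
  G_anti : Antitone G
  pure_sup : ∀ k p, ((F p ⊓ W k) ⊔ W (k - 1)) ⊔ ((G (k + 1 - p) ⊓ W k) ⊔ W (k - 1)) = W k
  pure_inf : ∀ k p, ((F p ⊓ W k) ⊔ W (k - 1)) ⊓ ((G (k + 1 - p) ⊓ W k) ⊔ W (k - 1)) = W (k - 1)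

/-- The second factor `G^q ∩ W_{p+q} + ∑_{j ≥ 1} G^{q-j} ∩ W_{p+q-j-1}` of Deligne's formula. -/
def deligneFactor (W G : ℤ → Submodule ℂ V) (p q : ℤ) : Submodule ℂ V :=
  (G q ⊓ W (p + q)) ⊔ ⨆ j : ℕ, G (q - (j + 1)) ⊓ W (p + q - (j + 1) - 1)

/-- Deligne's formula for `V^{p,q}`. -/
def delignePiece (W F G : ℤ → Submodule ℂ V) (p q : ℤ) : Submodule ℂ V :=
  F p ⊓ W (p + q) ⊓ deligneFactor W G p q

namespace IsOpposed

variable {W F G : ℤ → Submodule ℂ V} (h : IsOpposed W F G)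
include h

theorem mem_of_sub_mem {k p : ℤ} {a b : V} (haF : a ∈ F p) (haW : a ∈ W k)
    (hbG : b ∈ G (k + 1 - p)) (hbW : b ∈ W k) (hab : a - b ∈ W (k - 1)) : a ∈ W (k - 1) := by
  rw [← h.pure_inf k p]
  refine ⟨Submodule.mem_sup_left ⟨haF, haW⟩, ?_⟩
  have : a = b + (a - b) := by abel
  rw [this]
  exact Submodule.add_mem_sup ⟨hbG, hbW⟩ hab

theorem exists_decomp {k : ℤ} (p : ℤ) {x : V} (hx : x ∈ W k) :
    ∃ a b c, a ∈ F p ∧ a ∈ W k ∧ b ∈ G (k + 1 - p) ∧ b ∈ W k ∧ c ∈ W (k - 1) ∧ x = a + b + c := by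
  rw [← h.pure_sup k p] at hx
  obtain ⟨y, hy, z, hz, rfl⟩ := Submodule.mem_sup.1 hx
  obtain ⟨a, ha, c, hc, rfl⟩ := Submodule.mem_sup.1 hy
  obtain ⟨b, hb, c', hc', rfl⟩ := Submodule.mem_sup.1 hz
  exact ⟨a, b, c + c', ha.1, ha.2, hb.1, hb.2, add_mem hc hc', by abel⟩

theorem eq_zero_of_forall_mem {k : ℤ} {x : V} (hx : ∀ m : ℕ, x ∈ W (k - m)) : x = 0 := by
  obtain ⟨k₀, hk₀⟩ := h.W_bot
  have h1 := h.W_mono (show k - ((k - k₀).toNat : ℤ) ≤ k₀ by omega) (hx _)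
  simpa [hk₀] using h1

omit h in
theorem mem_deligneFactor_of_mem_G {p q : ℤ} {x : V} (hG : x ∈ G q) (hW : x ∈ W (p + q)) :
    x ∈ deligneFactor W G p q :=
  Submodule.mem_sup_left ⟨hG, hW⟩

theorem mem_deligneFactor {p q : ℤ} (m : ℕ) {x : V} (hG : x ∈ G (q - m))
    (hW : x ∈ W (p + q - m - 1)) : x ∈ deligneFactor W G p q := by
  rcases Nat.eq_zero_or_pos m with rfl | hm
  · exact mem_deligneFactor_of_mem_G (by simpa using hG) (h.W_mono (by simp) hW)
  · obtain ⟨j, rfl⟩ := Nat.exists_eq_succ_of_ne_zero hm.ne'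
    push_cast at hG hW
    exact Submodule.mem_sup_right (Submodule.mem_iSup_of_mem j ⟨hG, hW⟩)

/-- `W_{p+q-m-1}` is contained in the sum of `F^p` and of the second factor of Deligne's formula:
modulo the next smaller step of the weight filtration this is opposedness, and the weight filtration
is finite. -/
theorem exists_add_deligneFactor_of_lt {p q : ℤ} (m : ℕ) {x : V} (hx : x ∈ W (p + q - m - 1)) :
    ∃ v u, v ∈ F p ∧ v ∈ W (p + q - m - 1) ∧ u ∈ deligneFactor W G p q ∧ x = v + u := by
  obtain ⟨k₀, hk₀⟩ := h.W_bot
  have key : ∀ N : ℕ, ∀ m : ℕ, p + q - m - 1 ≤ k₀ + N → ∀ x ∈ W (p + q - m - 1),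
      ∃ v u, v ∈ F p ∧ v ∈ W (p + q - m - 1) ∧ u ∈ deligneFactor W G p q ∧ x = v + u := by
    intro N
    induction N with
    | zero =>
      intro m hm x hx
      have := h.W_mono (by simpa using hm) hx
      rw [hk₀, Submodule.mem_bot] at this
      subst this
      exact ⟨0, 0, zero_mem _, zero_mem _, zero_mem _, by simp⟩
    | succ N ih =>
      intro m hm x hx
      obtain ⟨a, b, c, haF, haW, hbG, hbW, hc, rfl⟩ := h.exists_decomp p hx
      have e : p + q - m - 1 - 1 = p + q - (m + 1 : ℕ) - 1 := by push_cast; ring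
      rw [e] at hc
      obtain ⟨v, u, hvF, hvW, hu, rfl⟩ := ih (m + 1) (by push_cast at hm ⊢; omega) c hc
      refine ⟨a + v, b + u, add_mem haF hvF, add_mem haW (h.W_mono (by push_cast; omega) hvW),
        add_mem (h.mem_deligneFactor m ?_ hbW) hu, by abel⟩
      convert hbG using 2
      ring
  exact key (p + q - m - 1 - k₀).toNat m (by omega) x hx

/-- The two factors of Deligne's formula span `W_{p+q}`. -/
theorem sup_deligneFactor (p q : ℤ) : F p ⊓ W (p + q) ⊔ deligneFactor W G p q = W (p + q) := by
  apply le_antisymm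
  · refine sup_le inf_le_right (sup_le inf_le_right (iSup_le fun j => inf_le_right.trans ?_))
    exact h.W_mono (by omega)
  · intro x hx
    obtain ⟨a, b, c, haF, haW, hbG, hbW, hc, rfl⟩ := h.exists_decomp p hx
    obtain ⟨v, u, hvF, hvW, hu, rfl⟩ := h.exists_add_deligneFactor_of_lt (p := p) (q := q) 0
      (by simpa using hc)
    have e : a + b + (v + u) = (a + v) + (b + u) := by abel
    rw [e]
    refine Submodule.add_mem_sup
      ⟨add_mem haF hvF, add_mem haW (h.W_mono (by simp) hvW)⟩
      (add_mem (mem_deligneFactor_of_mem_G (h.G_anti (by omega) hbG) hbW) hu)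

/-- A class of type `(p, q)` in `Gr^W_{p+q}`, represented by `x ∈ F^p` and by `b ∈ G^q`, lifts to
Deligne's piece `V^{p,q}`. -/
theorem exists_delignePiece {p q : ℤ} {x b : V} (hxF : x ∈ F p) (hxW : x ∈ W (p + q))
    (hbG : b ∈ G q) (hbW : b ∈ W (p + q)) (hxb : x - b ∈ W (p + q - 1)) :
    ∃ v ∈ delignePiece W F G p q, x - v ∈ W (p + q - 1) := by
  obtain ⟨v, u, hvF, hvW, hu, e⟩ := h.exists_add_deligneFactor_of_lt (p := p) (q := q) 0
    (by simpa using hxb)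
  have hvW' : v ∈ W (p + q - 1) := by simpa using hvW
  refine ⟨x - v, ⟨⟨sub_mem hxF hvF, sub_mem hxW (h.W_mono (by omega) hvW')⟩, ?_⟩, by simpa⟩
  have : x - v = b + u := by
    rw [sub_eq_iff_eq_add] at e ⊢
    rw [e]; abel
  rw [this]
  exact add_mem (mem_deligneFactor_of_mem_G hbG hbW) hu

theorem deligneFactor_le (p q : ℤ) :
    deligneFactor W G p q ≤ (G q ⊓ W (p + q)) ⊔ W (p + q - 1) :=
  sup_le le_sup_left (iSup_le fun j => inf_le_right.trans
    ((h.W_mono (by omega)).trans le_sup_right))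

theorem deligneFactor_le_sup (p q : ℤ) (m : ℕ) :
    deligneFactor W G p q ≤ G (q - m) ⊔ W (p + q - 1 - m - 1) := by
  refine sup_le (inf_le_left.trans ((h.G_anti (by omega)).trans le_sup_left))
    (iSup_le fun j => ?_)
  rcases lt_or_ge j m with hj | hj
  · exact inf_le_left.trans ((h.G_anti (by omega)).trans le_sup_left)
  · exact inf_le_right.trans ((h.W_mono (by omega)).trans le_sup_right)

theorem exists_G_of_mem_delignePiece {p q : ℤ} {v : V} (hv : v ∈ delignePiece W F G p q) :
    ∃ b ∈ G q, b ∈ W (p + q) ∧ v - b ∈ W (p + q - 1) := by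
  obtain ⟨b, hb, c, hc, rfl⟩ := Submodule.mem_sup.1 (h.deligneFactor_le p q hv.2)
  exact ⟨b, hb.1, hb.2, by simpa using hc⟩

/-- Deligne's piece `V^{p,q}` maps injectively to `Gr^W_{p+q}`: an element of `V^{p,q} ∩
W_{p+q-1-m}` lies in `F^p` and, modulo lower weights, in `G^{q-m}`, and these are
`(p+q-1-m)`-opposed. -/
theorem eq_zero_of_mem_delignePiece {p q : ℤ} {v : V} (hv : v ∈ delignePiece W F G p q)
    (hv1 : v ∈ W (p + q - 1)) : v = 0 := by
  refine h.eq_zero_of_forall_mem (k := p + q - 1) fun m => ?_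
  induction m with
  | zero => simpa using hv1
  | succ m ih =>
    obtain ⟨a, ha, c, hc, e⟩ := Submodule.mem_sup.1 (h.deligneFactor_le_sup p q m hv.2)
    have ha' : a = v - c := by rw [← e]; abel
    have hcW : c ∈ W (p + q - 1 - m) := h.W_mono (by omega) hc
    have := h.mem_of_sub_mem (k := p + q - 1 - m) (p := p) (a := v) (b := a) hv.1.1 ih
      (by convert ha using 2; ring) (by rw [ha']; exact sub_mem ih hcW)
      (by rw [← e]; simpa using hc)
    convert this using 2
    push_cast; ring

/-- `F^p ∩ W_k` is the sum of the pieces `V^{a,b}` with `a ≥ p` and `a + b ≤ k`; proved by induction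
on `k` and descending induction on `p`. -/
theorem inf_le_iSup_delignePiece (p k : ℤ) :
    F p ⊓ W k ≤ ⨆ t : {t : ℤ × ℤ // p ≤ t.1 ∧ t.1 + t.2 ≤ k}, delignePiece W F G t.1.1 t.1.2 := by
  obtain ⟨k₀, hk₀⟩ := h.W_bot
  obtain ⟨p₁, hp₁⟩ := h.F_bot
  have hmono : ∀ {p p' k k' : ℤ}, p' ≤ p → k ≤ k' →
      (⨆ t : {t : ℤ × ℤ // p ≤ t.1 ∧ t.1 + t.2 ≤ k}, delignePiece W F G t.1.1 t.1.2) ≤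
      ⨆ t : {t : ℤ × ℤ // p' ≤ t.1 ∧ t.1 + t.2 ≤ k'}, delignePiece W F G t.1.1 t.1.2 :=
    fun hp hk => iSup_le fun t => le_iSup_of_le
      (⟨t.1, hp.trans t.2.1, t.2.2.trans hk⟩ : {t : ℤ × ℤ // _}) le_rfl
  have key : ∀ N : ℕ, ∀ k, k ≤ k₀ + N → ∀ M : ℕ, ∀ p, p₁ - M ≤ p → F p ⊓ W k ≤
      ⨆ t : {t : ℤ × ℤ // p ≤ t.1 ∧ t.1 + t.2 ≤ k}, delignePiece W F G t.1.1 t.1.2 := by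
    intro N
    induction N with
    | zero =>
      intro k hk M p _
      have : W k = ⊥ := le_bot_iff.1 ((h.W_mono (by simpa using hk)).trans hk₀.le)
      rw [this, inf_bot_eq]
      exact bot_le
    | succ N ihN =>
      intro k hk M
      induction M with
      | zero =>
        intro p hp
        have : F p = ⊥ := le_bot_iff.1 ((h.F_anti (by simpa using hp)).trans hp₁.le)
        rw [this, bot_inf_eq]
        exact bot_le
      | succ M ihM =>
        rintro p hp x ⟨hxF, hxW⟩
        -- remove from `x` its part `a` in `F^{p+1}` and then a lift `v ∈ V^{p,k-p}` of the
        -- remaining class in `Gr_k^W`; what is left has weight at most `k - 1`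
        obtain ⟨a, b, c, haF, haW, hbG, hbW, hc, e⟩ := h.exists_decomp (p + 1) hxW
        have hy : x - a = b + c := by rw [e]; abel
        have hyF : x - a ∈ F p := sub_mem hxF (h.F_anti (by omega) haF)
        have hyW : x - a ∈ W k := sub_mem hxW haW
        obtain ⟨v, hv, hvy⟩ := h.exists_delignePiece (p := p) (q := k - p) (x := x - a) (b := b)
          hyF (by simpa using hyW) (by convert hbG using 2; ring) (by simpa using hbW)
          (by rw [hy]; simpa using hc)
        have hr : x - a - v ∈ F p ⊓ W (k - 1) := ⟨sub_mem hyF hv.1.1, by simpa using hvy⟩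
        have h1 := hmono (p' := p) (k' := k) (by omega) le_rfl
          (ihM (p + 1) (by push_cast at hp ⊢; omega) ⟨haF, haW⟩)
        have h2 := hmono (p' := p) (k' := k) le_rfl (by omega)
          (ihN (k - 1) (by push_cast at hk ⊢; omega) (p₁ - p).toNat p (by omega) hr)
        have h3 := Submodule.mem_iSup_of_mem
          (p := fun t : {t : ℤ × ℤ // p ≤ t.1 ∧ t.1 + t.2 ≤ k} => delignePiece W F G t.1.1 t.1.2)
          ⟨(p, k - p), le_rfl, by simp⟩ hv
        have : x = a + v + (x - a - v) := by abel
        rw [this]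
        exact add_mem (add_mem h1 h3) h2
  exact key (k - k₀).toNat k (by omega) (p₁ - p).toNat p (by omega)

theorem iSup_delignePiece : ⨆ t : ℤ × ℤ, delignePiece W F G t.1 t.2 = ⊤ := by
  obtain ⟨k₁, hk₁⟩ := h.W_top
  obtain ⟨p₀, hp₀⟩ := h.F_top
  rw [eq_top_iff]
  have := h.inf_le_iSup_delignePiece p₀ k₁
  rw [hk₁, hp₀, inf_top_eq] at this
  exact this.trans (iSup_le fun t => le_iSup_of_le t.1 le_rfl)

/-- The sum of Deligne's pieces is direct. In a vanishing sum of elements of the pieces, consider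
among the non-zero ones of highest weight that with the smallest `p`: the others lie in
`F^{p+1} ∩ W_k + W_{k-1}`, which contradicts the opposedness of the filtrations. -/
theorem iSupIndep_delignePiece : iSupIndep fun t : ℤ × ℤ => delignePiece W F G t.1 t.2 := by
  classical
  rw [iSupIndep_iff_finsetSum_eq_zero_imp_eq_zero]
  intro T x hx hsum
  by_contra hcon
  push Not at hcon
  obtain ⟨t₀, ht₀, hne₀⟩ := hcon
  obtain ⟨t, ht, hmax⟩ := (T.filter fun t => x t ≠ 0).exists_max_image
    (fun t => toLex (t.1 + t.2, -t.1)) ⟨t₀, by simp [ht₀, hne₀]⟩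
  rw [Finset.mem_filter] at ht
  apply ht.2
  have hxt := hx t ht.1
  have hrest : -∑ s ∈ T.erase t, x s ∈ (F (t.1 + 1) ⊓ W (t.1 + t.2)) ⊔ W (t.1 + t.2 - 1) := by
    refine neg_mem (sum_mem fun s hs => ?_)
    rw [Finset.mem_erase] at hs
    by_cases hs0 : x s = 0
    · rw [hs0]; exact zero_mem _
    have hle := hmax s (by simp [hs.2, hs0])
    have hxs := hx s hs.2
    rw [Prod.Lex.toLex_le_toLex] at hle
    rcases hle with hlt | ⟨heq, hle⟩
    · exact Submodule.mem_sup_right (h.W_mono (by simp at hlt; omega) hxs.1.2)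
    · simp only at heq hle
      rcases eq_or_ne s.1 t.1 with h1 | h1
      · exact absurd (Prod.ext h1 (by omega)) hs.1
      · exact Submodule.mem_sup_left ⟨h.F_anti (by omega) hxs.1.1, heq ▸ hxs.1.2⟩
  have hxe : x t = -∑ s ∈ T.erase t, x s := by
    rw [eq_neg_iff_add_eq_zero, Finset.add_sum_erase _ _ ht.1, hsum]
  rw [← hxe] at hrest
  obtain ⟨a, ha, c, hc, e⟩ := Submodule.mem_sup.1 hrest
  obtain ⟨b, hbG, hbW, hb⟩ := h.exists_G_of_mem_delignePiece hxt
  have h1 := h.mem_of_sub_mem (k := t.1 + t.2) (p := t.1 + 1) (a := a) (b := b) ha.1 ha.2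
    (by convert hbG using 2; ring) hbW (by
      have : a - b = (x t - b) - c := by rw [← e]; abel
      rw [this]; exact sub_mem hb hc)
  refine h.eq_zero_of_mem_delignePiece hxt ?_
  rw [← e]
  exact add_mem h1 hc

end IsOpposed
end DeligneSplitting

/-! ### Bases adapted to Deligne's splitting -/

section AdaptedFrames

variable {n : ℕ}

theorem mem_conjSub {U : Submodule ℂ (Fin n → ℂ)} {v : Fin n → ℂ} : v ∈ conjSub U ↔ star v ∈ U :=
  Iff.rfl

theorem conjSub_mono {U U' : Submodule ℂ (Fin n → ℂ)} (h : U ≤ U') : conjSub U ≤ conjSub U' :=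
  fun _ hv => h hv

theorem star_mem_complexify {U : Submodule ℚ (Fin n → ℚ)} {v : Fin n → ℂ}
    (hv : v ∈ complexify U) : star v ∈ complexify U := by
  have : complexify U ≤ conjSub (complexify U) := by
    refine Submodule.span_le.2 ?_
    rintro _ ⟨w, hw, rfl⟩
    refine mem_conjSub.2 (Submodule.subset_span ⟨w, hw, ?_⟩)
    funext i
    simp
  exact this hv

theorem complexify_mono {U U' : Submodule ℚ (Fin n → ℚ)} (h : U ≤ U') :
    complexify U ≤ complexify U' :=
  Submodule.span_mono (Set.image_mono h)

theorem complexify_bot : complexify (⊥ : Submodule ℚ (Fin n → ℚ)) = ⊥ := by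
  refine le_bot_iff.1 (Submodule.span_le.2 ?_)
  rintro _ ⟨w, hw, rfl⟩
  rw [SetLike.mem_coe, Submodule.mem_bot] at hw
  subst hw
  simp [funext_iff]

theorem complexify_top : complexify (⊤ : Submodule ℚ (Fin n → ℚ)) = ⊤ := by
  rw [eq_top_iff]
  intro v _
  have hv : v = ∑ i, v i • (fun j => ((Pi.single i 1 : Fin n → ℚ) j : ℂ)) := by
    funext j
    simp [Pi.single_apply, apply_ite (Rat.cast : ℚ → ℂ)]
  rw [hv]
  exact sum_mem fun i _ => Submodule.smul_mem _ _ (Submodule.subset_span ⟨_, trivial, rfl⟩)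

theorem IsMHS.isOpposed {W : ℤ → Submodule ℚ (Fin n → ℚ)} {F : Fil n} (h : IsMHS W F) :
    IsOpposed (fun k => complexify (W k)) F (fun p => conjSub (F p)) where
  W_mono := fun _ _ hk => complexify_mono (h.W_mono hk)
  W_bot := h.W_bot.imp fun k hk => by rw [hk, complexify_bot]
  W_top := h.W_top.imp fun k hk => by rw [hk, complexify_top]
  F_anti := h.F_anti
  F_bot := h.F_bot
  F_top := h.F_top
  G_anti := fun _ _ hp => conjSub_mono (h.F_anti hp)
  pure_sup := h.pure_sup
  pure_inf := h.pure_inf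

theorem deligneSplitting_eq (W : ℤ → Submodule ℚ (Fin n → ℚ)) (F : Fil n) (p q : ℤ) :
    deligneSplitting W F p q =
      delignePiece (fun k => complexify (W k)) F (fun p => conjSub (F p)) p q := rfl

/-- The subspace spanned by the columns of `β` with index in `T`, for an invertible matrix `β`. -/
def coordSub (β : Matrix (Fin n) (Fin n) ℂ) (T : Set (Fin n)) : Submodule ℂ (Fin n → ℂ) where
  carrier := {v | ∀ i, i ∉ T → (β⁻¹ *ᵥ v) i = 0}
  add_mem' := by
    intro a b ha hb i hi
    rw [Matrix.mulVec_add, Pi.add_apply, ha i hi, hb i hi, add_zero]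
  zero_mem' := by simp
  smul_mem' := by
    intro c a ha i hi
    rw [Matrix.mulVec_smul, Pi.smul_apply, ha i hi, smul_zero]

theorem mulVec_inv_mulVec {β : Matrix (Fin n) (Fin n) ℂ} (hβ : IsUnit β.det) (v : Fin n → ℂ) :
    β *ᵥ (β⁻¹ *ᵥ v) = v := by
  rw [Matrix.mulVec_mulVec, Matrix.mul_nonsing_inv _ hβ, Matrix.one_mulVec]

theorem inv_mulVec_mulVec {β : Matrix (Fin n) (Fin n) ℂ} (hβ : IsUnit β.det) (v : Fin n → ℂ) :
    β⁻¹ *ᵥ (β *ᵥ v) = v := by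
  rw [Matrix.mulVec_mulVec, Matrix.nonsing_inv_mul _ hβ, Matrix.one_mulVec]

theorem inv_mulVec_mulVec_apply {β : Matrix (Fin n) (Fin n) ℂ} (hβ : IsUnit β.det)
    (A : Matrix (Fin n) (Fin n) ℂ) (v : Fin n → ℂ) (i : Fin n) :
    (β⁻¹ *ᵥ (A *ᵥ v)) i = ∑ j, (β⁻¹ * A * β) i j * (β⁻¹ *ᵥ v) j := by
  have : β⁻¹ *ᵥ (A *ᵥ v) = (β⁻¹ * A * β) *ᵥ (β⁻¹ *ᵥ v) := by
    rw [Matrix.mulVec_mulVec, Matrix.mulVec_mulVec, Matrix.mul_assoc _ β,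
      Matrix.mul_nonsing_inv _ hβ, Matrix.mul_one]
  rw [this]
  rfl

theorem mulVec_eq_sum_col (β : Matrix (Fin n) (Fin n) ℂ) (c : Fin n → ℂ) :
    β *ᵥ c = ∑ i, c i • β.col i := by
  funext k
  simp [Matrix.mulVec, dotProduct, Matrix.col, mul_comm]

/-- A subspace that contains the columns of `β` with index in `T` contains `coordSub β T`. -/
theorem coordSub_le {β : Matrix (Fin n) (Fin n) ℂ} (hβ : IsUnit β.det) {T : Set (Fin n)}
    {U : Submodule ℂ (Fin n → ℂ)} (hU : ∀ i ∈ T, β.col i ∈ U) : coordSub β T ≤ U := by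
  classical
  intro v hv
  rw [← mulVec_inv_mulVec hβ v, mulVec_eq_sum_col]
  refine sum_mem fun i _ => ?_
  by_cases hi : i ∈ T
  · exact U.smul_mem _ (hU i hi)
  · rw [hv i hi, zero_smul]
    exact zero_mem _

/-- `β` is a basis of `ℂⁿ` adapted to Deligne's splitting of `(W, F)`: its `i`-th column lies in
`V^{p_i, q_i}`. -/
structure IsAdapted (W : ℤ → Submodule ℚ (Fin n → ℚ)) (F : Fil n)
    (β : Matrix (Fin n) (Fin n) ℂ) (p q : Fin n → ℤ) : Prop where
  isMHS : IsMHS W F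
  det : IsUnit β.det
  col_mem : ∀ i, β.col i ∈ deligneSplitting W F (p i) (q i)

/-- Deligne's pieces span `ℂⁿ`, which therefore has a basis consisting of elements of the pieces. -/
theorem IsMHS.exists_isAdapted {W : ℤ → Submodule ℚ (Fin n → ℚ)} {F : Fil n} (h : IsMHS W F) :
    ∃ β p q, IsAdapted W F β p q := by
  have hspan : ⊤ ≤ Submodule.span ℂ {v : Fin n → ℂ | ∃ t : ℤ × ℤ, v ∈ deligneSplitting W F t.1 t.2} := by
    rw [← h.isOpposed.iSup_delignePiece]
    refine iSup_le fun t v hv => Submodule.subset_span ⟨t, hv⟩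
  let b₀ := Module.Basis.ofSpan hspan
  have : Fintype ((linearIndepOn_empty ℂ id).extend (Set.empty_subset
      {v : Fin n → ℂ | ∃ t : ℤ × ℤ, v ∈ deligneSplitting W F t.1 t.2})) :=
    FiniteDimensional.fintypeBasisIndex b₀
  let e := Fintype.equivFinOfCardEq (α := ((linearIndepOn_empty ℂ id).extend (Set.empty_subset
      {v : Fin n → ℂ | ∃ t : ℤ × ℤ, v ∈ deligneSplitting W F t.1 t.2}))) (n := n)
      (by rw [← Module.finrank_eq_card_basis b₀]; simp)
  let b := b₀.reindex e
  have hb : ∀ i, ∃ t : ℤ × ℤ, b i ∈ deligneSplitting W F t.1 t.2 := by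
    intro i
    have h1 : b i ∈ Set.range b₀ := by simp [b]
    exact Module.Basis.ofSpan_subset hspan h1
  choose t ht using hb
  refine ⟨(Pi.basisFun ℂ (Fin n)).toMatrix b, fun i => (t i).1, fun i => (t i).2, h, ?_, ?_⟩
  · have := (Pi.basisFun ℂ (Fin n)).invertibleToMatrix b
    exact (Matrix.isUnit_iff_isUnit_det _).1 (isUnit_of_invertible _)
  · intro i
    have e : ((Pi.basisFun ℂ (Fin n)).toMatrix b).col i = b i := by
      funext k
      simp [Matrix.col, Module.Basis.toMatrix_apply]
    rw [e]
    exact ht i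

namespace IsAdapted

variable {W : ℤ → Submodule ℚ (Fin n → ℚ)} {F : Fil n} {β : Matrix (Fin n) (Fin n) ℂ}
  {p q : Fin n → ℤ} (h : IsAdapted W F β p q)
include h

/-- Deligne's pieces are coordinate subspaces in an adapted basis. -/
theorem deligneSplitting_eq_coordSub (a b : ℤ) :
    deligneSplitting W F a b = coordSub β {i | p i = a ∧ q i = b} := by
  classical
  apply le_antisymm
  · intro v hv i hi
    have hi' : ((p i, q i) : ℤ × ℤ) ≠ (a, b) := by
      intro e
      exact hi ⟨congrArg Prod.fst e, congrArg Prod.snd e⟩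
    set c := β⁻¹ *ᵥ v with hc
    -- the component of `v` of type `(p i, q i)`
    set c₁ : Fin n → ℂ := fun j => if p j = p i ∧ q j = q i then c j else 0 with hc₁
    have h1 : β *ᵥ c₁ ∈ deligneSplitting W F (p i) (q i) := by
      rw [mulVec_eq_sum_col]
      refine sum_mem fun j _ => ?_
      by_cases hj : p j = p i ∧ q j = q i
      · exact Submodule.smul_mem _ _ (by rw [← hj.1, ← hj.2]; exact h.col_mem j)
      · simp [hc₁, hj]
    have h2 : β *ᵥ c₁ ∈ ⨆ t : ℤ × ℤ, ⨆ _ : t ≠ (p i, q i), deligneSplitting W F t.1 t.2 := by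
      have e : β *ᵥ c₁ = v - β *ᵥ (c - c₁) := by
        rw [Matrix.mulVec_sub, hc, mulVec_inv_mulVec h.det]; abel
      rw [e]
      refine sub_mem ?_ ?_
      · exact Submodule.mem_iSup_of_mem (a, b) (Submodule.mem_iSup_of_mem hi'.symm hv)
      · rw [mulVec_eq_sum_col]
        refine sum_mem fun j _ => ?_
        by_cases hj : p j = p i ∧ q j = q i
        · simp [hc₁, hj]
        · refine Submodule.smul_mem _ _ (Submodule.mem_iSup_of_mem (p j, q j)
            (Submodule.mem_iSup_of_mem ?_ (h.col_mem j)))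
          rintro e
          exact hj ⟨congrArg Prod.fst e, congrArg Prod.snd e⟩
    have h3 := (h.isMHS.isOpposed.iSupIndep_delignePiece (p i, q i)).le_bot ⟨h1, h2⟩
    rw [Submodule.mem_bot] at h3
    have h4 : c₁ = 0 := by
      rw [← inv_mulVec_mulVec h.det c₁, h3, Matrix.mulVec_zero]
    have := congrFun h4 i
    simpa [hc₁] using this
  · refine coordSub_le h.det ?_
    rintro i ⟨rfl, rfl⟩
    exact h.col_mem i

theorem inf_eq_coordSub (a k : ℤ) :
    F a ⊓ complexify (W k) = coordSub β {i | a ≤ p i ∧ p i + q i ≤ k} := by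
  apply le_antisymm
  · refine (h.isMHS.isOpposed.inf_le_iSup_delignePiece a k).trans (iSup_le fun t => ?_)
    have := h.deligneSplitting_eq_coordSub t.1.1 t.1.2
    rw [deligneSplitting_eq] at this
    rw [this]
    refine coordSub_le h.det ?_
    rintro i ⟨h1, h2⟩ j hj
    have hone : β⁻¹ *ᵥ β.col i = Pi.single i 1 := by
      rw [← Matrix.mulVec_single_one, inv_mulVec_mulVec h.det]
    rw [hone, Pi.single_eq_of_ne]
    rintro rfl
    exact hj ⟨h1 ▸ t.2.1, h1 ▸ h2 ▸ t.2.2⟩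
  · refine coordSub_le h.det ?_
    rintro i ⟨h1, h2⟩
    have := h.col_mem i
    exact ⟨h.isMHS.F_anti h1 this.1.1, complexify_mono (h.isMHS.W_mono h2) this.1.2⟩

theorem F_eq_coordSub (a : ℤ) : F a = coordSub β {i | a ≤ p i} := by
  apply le_antisymm
  · obtain ⟨k, hk⟩ := h.isMHS.W_top
    have : F a = F a ⊓ complexify (W k) := by rw [hk, complexify_top, inf_top_eq]
    rw [this, h.inf_eq_coordSub]
    exact fun v hv i hi => hv i fun hi' => hi hi'.1
  · refine coordSub_le h.det fun i hi => ?_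
    exact h.isMHS.F_anti hi (h.col_mem i).1.1

theorem W_eq_coordSub (k : ℤ) : complexify (W k) = coordSub β {i | p i + q i ≤ k} := by
  apply le_antisymm
  · obtain ⟨a, ha⟩ := h.isMHS.F_top
    have : complexify (W k) = F a ⊓ complexify (W k) := by rw [ha, top_inf_eq]
    rw [this, h.inf_eq_coordSub]
    exact fun v hv i hi => hv i fun hi' => hi hi'.2
  · refine coordSub_le h.det fun i hi => ?_
    exact complexify_mono (h.isMHS.W_mono hi) (h.col_mem i).1.2

/-- The columns of type `(a, b)` with `a + b ≤ k`, and `b ≥ s` if `a + b = k`, lie in `conj F^s ∩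
W_k + W_{k-1}`. -/
theorem col_mem_sup {s k : ℤ} {i : Fin n} (hi : p i + q i < k ∨ p i + q i = k ∧ s ≤ q i) :
    β.col i ∈ (conjSub (F s) ⊓ complexify (W k)) ⊔ complexify (W (k - 1)) := by
  rcases hi with hi | ⟨hi, hs⟩
  · exact Submodule.mem_sup_right (complexify_mono (h.isMHS.W_mono (by omega)) (h.col_mem i).1.2)
  · obtain ⟨b, hbG, hbW, hb⟩ := h.isMHS.isOpposed.exists_G_of_mem_delignePiece (h.col_mem i)
    rw [hi] at hbW hb
    have e : β.col i = b + (β.col i - b) := by abel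
    rw [e]
    exact Submodule.add_mem_sup ⟨conjSub_mono (h.isMHS.F_anti hs) hbG, hbW⟩ hb

/-- Modulo `W_{k-1}`, the subspace `conj F^s ∩ W_k` is spanned by the `V^{a,b}` with `a + b = k` and
`b ≥ s`. -/
theorem coord_eq_zero_of_mem_conjSub {s k : ℤ} {v : Fin n → ℂ} (hvG : v ∈ conjSub (F s))
    (hvW : v ∈ complexify (W k)) {i : Fin n} (hik : p i + q i = k) (his : q i < s) :
    (β⁻¹ *ᵥ v) i = 0 := by
  classical
  have ho := h.isMHS.isOpposed
  set c := β⁻¹ *ᵥ v with hc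
  have hv : v = β *ᵥ c := (mulVec_inv_mulVec h.det v).symm
  have hcW : ∀ j, k < p j + q j → c j = 0 := by
    intro j hj
    rw [h.W_eq_coordSub] at hvW
    exact hvW j (by simpa using hj)
  set T : Set (Fin n) := {j | p j + q j = k ∧ q j < s}
  -- the part of `v` of weight `k` and type `(a, b)` with `b < s`; it lies in `F^{k-s+1}` and,
  -- modulo `W_{k-1}`, in `conj F^s`, and these are opposed
  set c₁ : Fin n → ℂ := fun j => if j ∈ T then c j else 0 with hc₁
  have hy : β *ᵥ c₁ ∈ coordSub β T := by
    intro j hj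
    rw [inv_mulVec_mulVec h.det]
    simp [hc₁, hj]
  have hyF : β *ᵥ c₁ ∈ F (k - s + 1) ⊓ complexify (W k) := by
    rw [h.inf_eq_coordSub]
    intro j hj
    refine hy j fun hj' => hj ⟨?_, hj'.1.le⟩
    have := hj'.1
    have := hj'.2
    omega
  have hyG : β *ᵥ c₁ ∈ (conjSub (F s) ⊓ complexify (W k)) ⊔ complexify (W (k - 1)) := by
    have e : β *ᵥ c₁ = v - β *ᵥ (c - c₁) := by
      rw [Matrix.mulVec_sub, ← hv]; abel
    rw [e]
    refine sub_mem (Submodule.mem_sup_left ⟨hvG, hvW⟩) ?_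
    rw [mulVec_eq_sum_col]
    refine sum_mem fun j _ => ?_
    by_cases hj : j ∈ T
    · simp [hc₁, hj]
    rcases lt_trichotomy (p j + q j) k with hlt | heq | hgt
    · exact Submodule.smul_mem _ _ (h.col_mem_sup (Or.inl hlt))
    · refine Submodule.smul_mem _ _ (h.col_mem_sup (Or.inr ⟨heq, ?_⟩))
      exact not_lt.1 fun hjs => hj ⟨heq, hjs⟩
    · simp [hc₁, hcW j hgt]
  obtain ⟨b, hb, d, hd, e⟩ := Submodule.mem_sup.1 hyG
  have h1 := ho.mem_of_sub_mem (k := k) (p := k - s + 1) (a := β *ᵥ c₁) (b := b) hyF.1 hyF.2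
    (by rw [show k + 1 - (k - s + 1) = s by ring]; exact hb.1) hb.2 (by rw [← e]; simpa using hd)
  have h2 : β *ᵥ c₁ ∈ coordSub β {i | p i + q i ≤ k - 1} := by
    rw [← h.W_eq_coordSub]; exact h1
  have h3 := h2 i (by simp [hik])
  rw [inv_mulVec_mulVec h.det] at h3
  simpa [hc₁, T, hik, his] using h3

/-- If the endomorphism `A` only has components of type `(a, b)` with `a < 0`, `a + b ≤ 0`, then on
`Gr^W` its complex conjugate only has components of type `(a, b)` with `a > 0`. -/
theorem coord_conj_eq_zero {A : Matrix (Fin n) (Fin n) ℂ}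
    (hA : ∀ i j, (β⁻¹ * A * β) i j ≠ 0 → p i < p j ∧ p i + q i ≤ p j + q j) {i j : Fin n}
    (hij : p i + q i = p j + q j) (hp : p i ≤ p j) :
    (β⁻¹ * A.map (starRingEnd ℂ) * β) i j = 0 := by
  set k := p j + q j with hk
  have hβj : β.col j ∈ F (p j) ⊓ complexify (W k) := (h.col_mem j).1
  set x := star (β.col j) with hx
  have hxG : x ∈ conjSub (F (p j)) := by
    rw [mem_conjSub, hx, star_star]; exact hβj.1
  have hxW : x ∈ complexify (W k) := star_mem_complexify hβj.2
  -- `conj β_j` is of type `(a, b)` with `b ≥ p_j` modulo lower weights; as `A` lowers the first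
  -- index and does not raise the weight, in the top weight it raises the second index
  have hAx : A *ᵥ x ∈ (conjSub (F (p j + 1)) ⊓ complexify (W k)) ⊔ complexify (W (k - 1)) := by
    rw [← mulVec_inv_mulVec h.det (A *ᵥ x), mulVec_eq_sum_col]
    refine sum_mem fun l _ => ?_
    by_cases hl : (β⁻¹ *ᵥ (A *ᵥ x)) l = 0
    · rw [hl, zero_smul]; exact zero_mem _
    refine Submodule.smul_mem _ _ (h.col_mem_sup ?_)
    rw [inv_mulVec_mulVec_apply h.det] at hl
    obtain ⟨m, -, hm⟩ := Finset.exists_ne_zero_of_sum_ne_zero hl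
    have hm1 := hA l m (left_ne_zero_of_mul hm)
    have hm2 := right_ne_zero_of_mul hm
    have hmk : p m + q m ≤ k := by
      by_contra hcon
      rw [h.W_eq_coordSub] at hxW
      exact hm2 (hxW m hcon)
    rcases (hm1.2.trans hmk).lt_or_eq with hlt | heq
    · exact Or.inl hlt
    · refine Or.inr ⟨heq, ?_⟩
      have hqm : p j ≤ q m := by
        by_contra hcon
        exact hm2 (h.coord_eq_zero_of_mem_conjSub hxG hxW (by omega) (not_le.1 hcon))
      omega
  obtain ⟨b, hb, c, hc, e⟩ := Submodule.mem_sup.1 hAx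
  have hstar : A.map (starRingEnd ℂ) *ᵥ β.col j = star b + star c := by
    rw [← star_add, e, hx]
    funext l
    simp [Matrix.mulVec, dotProduct]
  have e2 : (β⁻¹ * A.map (starRingEnd ℂ) * β) i j =
      (β⁻¹ *ᵥ (A.map (starRingEnd ℂ) *ᵥ β.col j)) i := by
    rw [Matrix.mulVec_mulVec]
    rfl
  rw [e2, hstar, Matrix.mulVec_add, Pi.add_apply]
  have h1 : (β⁻¹ *ᵥ star b) i = 0 := by
    have : star b ∈ F (p j + 1) := hb.1
    rw [h.F_eq_coordSub] at this
    exact this i (by simp; omega)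
  have h2 : (β⁻¹ *ᵥ star c) i = 0 := by
    have := star_mem_complexify hc
    rw [h.W_eq_coordSub] at this
    exact this i (by simp; omega)
  rw [h1, h2, add_zero]

/-- In an adapted basis, `φ_ℂ(z, w)` is the diagonal matrix with entries `z^{-p_i} w^{-q_i}`. -/
theorem isTorusElement_iff {z w : ℂˣ} {g : GL (Fin n) ℂ} :
    IsTorusElement W F z w g ↔
      g.1 = β * Matrix.diagonal (fun i => (z : ℂ) ^ (-p i) * (w : ℂ) ^ (-q i)) * β⁻¹ := by
  set D := Matrix.diagonal (fun i => (z : ℂ) ^ (-p i) * (w : ℂ) ^ (-q i))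
  constructor
  · intro hg
    have h1 : g.1 * β = β * D := by
      ext k i
      have := congrFun (hg (p i) (q i) _ (h.col_mem i)) k
      simp only [D, Matrix.mul_diagonal]
      simpa [Matrix.mulVec, dotProduct, Matrix.col, Matrix.mul_apply, mul_comm] using this
    rw [← h1, Matrix.mul_assoc, Matrix.mul_nonsing_inv _ h.det, Matrix.mul_one]
  · intro hg a b v hv
    rw [h.deligneSplitting_eq_coordSub] at hv
    rw [hg, ← Matrix.mulVec_mulVec, ← Matrix.mulVec_mulVec]
    have : D *ᵥ (β⁻¹ *ᵥ v) = ((z : ℂ) ^ (-a) * (w : ℂ) ^ (-b)) • (β⁻¹ *ᵥ v) := by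
      funext i
      rw [Matrix.mulVec_diagonal, Pi.smul_apply, smul_eq_mul]
      by_cases hi : p i = a ∧ q i = b
      · rw [hi.1, hi.2]
      · rw [hv i hi]; simp
    rw [this, Matrix.mulVec_smul, mulVec_inv_mulVec h.det]

theorem mem_endF_iff {k : ℤ} {A : Matrix (Fin n) (Fin n) ℂ} :
    A ∈ endF F k ↔ ∀ i j, p i < p j + k → (β⁻¹ * A * β) i j = 0 := by
  constructor
  · intro hA i j hij
    have h1 : β.col j ∈ F (p j) := (h.col_mem j).1.1
    have h2 := hA _ _ h1
    rw [h.F_eq_coordSub] at h2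
    have h3 := h2 i (by simpa using hij)
    rw [Matrix.mulVec_mulVec] at h3
    exact h3
  · intro hA a v hv
    rw [h.F_eq_coordSub] at hv ⊢
    intro i hi
    rw [inv_mulVec_mulVec_apply h.det]
    refine Finset.sum_eq_zero fun j _ => ?_
    by_cases hj : a ≤ p j
    · have hi' : p i < a + k := by simpa using hi
      rw [hA i j (by omega), zero_mul]
    · rw [hv j hj, mul_zero]

/-- The endomorphisms mapping `W_l` into `W_{l+k}` for all `l`, in an adapted basis. -/
theorem forall_mulVec_mem_iff {k : ℤ} {A : Matrix (Fin n) (Fin n) ℂ} :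
    (∀ l, ∀ v ∈ complexify (W l), A *ᵥ v ∈ complexify (W (l + k))) ↔
      ∀ i j, p j + q j + k < p i + q i → (β⁻¹ * A * β) i j = 0 := by
  constructor
  · intro hA i j hij
    have h1 : β.col j ∈ complexify (W (p j + q j)) := (h.col_mem j).1.2
    have h2 := hA _ _ h1
    rw [h.W_eq_coordSub] at h2
    have h3 := h2 i (by simpa using hij)
    rw [Matrix.mulVec_mulVec] at h3
    exact h3
  · intro hA a v hv
    rw [h.W_eq_coordSub] at hv ⊢
    intro i hi
    rw [inv_mulVec_mulVec_apply h.det]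
    refine Finset.sum_eq_zero fun j _ => ?_
    by_cases hj : p j + q j ≤ a
    · have hi' : a + k < p i + q i := by simpa using hi
      rw [hA i j (by omega), zero_mul]
    · rw [hv j hj, mul_zero]

end IsAdapted
end AdaptedFrames

/-! ### Real analytic families of matrices -/

section AnalyticMatrices

variable {E : Type*} [NormedAddCommGroup E] [NormedSpace ℝ E] {ι κ μ : Type*}

/-- Entrywise real analyticity of a family of complex matrices. -/
def MatAnalyticAt (M : E → Matrix ι κ ℂ) (x : E) : Prop :=
  ∀ i j, AnalyticAt ℝ (fun y => M y i j) x

theorem MatAnalyticAt.mul [Fintype κ] {M : E → Matrix ι κ ℂ} {N : E → Matrix κ μ ℂ} {x : E}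
    (hM : MatAnalyticAt M x) (hN : MatAnalyticAt N x) : MatAnalyticAt (fun y => M y * N y) x := by
  intro i j
  simp only [Matrix.mul_apply]
  exact Finset.univ.analyticAt_fun_sum fun k _ => (hM i k).mul (hN k j)

theorem MatAnalyticAt.add {M N : E → Matrix ι κ ℂ} {x : E}
    (hM : MatAnalyticAt M x) (hN : MatAnalyticAt N x) : MatAnalyticAt (fun y => M y + N y) x :=
  fun i j => (hM i j).add (hN i j)

theorem matAnalyticAt_const (M : Matrix ι κ ℂ) (x : E) : MatAnalyticAt (fun _ : E => M) x :=
  fun _ _ => analyticAt_const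

theorem AnalyticAt.star_complex {f : E → ℂ} {x : E} (hf : AnalyticAt ℝ f x) :
    AnalyticAt ℝ (fun y => starRingEnd ℂ (f y)) x :=
  (Complex.conjCLE.toContinuousLinearMap.analyticAt _).comp hf

theorem MatAnalyticAt.conj {M : E → Matrix ι κ ℂ} {x : E} (hM : MatAnalyticAt M x) :
    MatAnalyticAt (fun y => (M y).map (starRingEnd ℂ)) x :=
  fun i j => (hM i j).star_complex

theorem MatAnalyticAt.det [Fintype ι] [DecidableEq ι] {M : E → Matrix ι ι ℂ} {x : E}
    (hM : MatAnalyticAt M x) : AnalyticAt ℝ (fun y => (M y).det) x := by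
  simp only [Matrix.det_apply']
  exact Finset.univ.analyticAt_fun_sum fun σ _ => analyticAt_const.mul
    (Finset.univ.analyticAt_fun_prod fun k _ => hM _ _)

theorem MatAnalyticAt.inv [Fintype ι] [DecidableEq ι] {M : E → Matrix ι ι ℂ} {x : E}
    (hM : MatAnalyticAt M x) (hx : IsUnit (M x).det) : MatAnalyticAt (fun y => (M y)⁻¹) x := by
  intro i j
  simp only [Matrix.inv_def, Matrix.smul_apply, smul_eq_mul, Matrix.adjugate_apply,
    Ring.inverse_eq_inv']
  refine (hM.det.inv hx.ne_zero).mul (MatAnalyticAt.det fun k l => ?_)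
  by_cases hk : k = j
  · subst hk
    simp only [Matrix.updateRow_self]
    exact analyticAt_const
  · simp only [Matrix.updateRow_ne hk]
    exact hM k l

theorem MatAnalyticAt.eventually_isUnit_det [Fintype ι] [DecidableEq ι] {M : E → Matrix ι ι ℂ}
    {x : E} (hM : MatAnalyticAt M x) (hx : IsUnit (M x).det) :
    ∀ᶠ y in 𝓝 x, IsUnit (M y).det := by
  have := hM.det.continuousAt.eventually_ne hx.ne_zero
  filter_upwards [this] with y hy using hy.isUnit

theorem MatAnalyticAt.mulVec [Fintype κ] {M : E → Matrix ι κ ℂ} {x : E} (hM : MatAnalyticAt M x)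
    [Fintype ι] {v : E → κ → ℂ} (hv : AnalyticAt ℝ v x) : AnalyticAt ℝ (fun y => M y *ᵥ v y) x := by
  rw [analyticAt_pi_iff]
  intro i
  simp only [Matrix.mulVec, dotProduct]
  exact Finset.univ.analyticAt_fun_sum fun k _ => (hM i k).mul (analyticAt_pi_iff.1 hv k)

end AnalyticMatrices

/-! ### Real analytic families of subspaces -/

section AnalyticSections

variable {E : Type*} [NormedAddCommGroup E] [NormedSpace ℝ E] {n : ℕ}

/-- Every element of `U x` extends to a real analytic section of the family of subspaces `U`. -/
def HasAnalyticSections (U : E → Submodule ℂ (Fin n → ℂ)) (x : E) : Prop :=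
  ∀ v ∈ U x, ∃ s : E → Fin n → ℂ, AnalyticAt ℝ s x ∧ s x = v ∧ ∀ᶠ y in 𝓝 x, s y ∈ U y

variable {U U' : E → Submodule ℂ (Fin n → ℂ)} {x : E}

theorem hasAnalyticSections_const (U₀ : Submodule ℂ (Fin n → ℂ)) (x : E) :
    HasAnalyticSections (fun _ : E => U₀) x :=
  fun v hv => ⟨fun _ => v, analyticAt_const, rfl, Filter.Eventually.of_forall fun _ => hv⟩

theorem HasAnalyticSections.sup (hU : HasAnalyticSections U x) (hU' : HasAnalyticSections U' x) :
    HasAnalyticSections (fun y => U y ⊔ U' y) x := by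
  intro v hv
  obtain ⟨a, ha, b, hb, rfl⟩ := Submodule.mem_sup.1 hv
  obtain ⟨s, hs, rfl, hsU⟩ := hU a ha
  obtain ⟨t, ht, rfl, htU⟩ := hU' b hb
  refine ⟨fun y => s y + t y, hs.add ht, rfl, ?_⟩
  filter_upwards [hsU, htU] with y h1 h2 using Submodule.add_mem_sup h1 h2

theorem HasAnalyticSections.iSup {ι : Type*} {U : ι → E → Submodule ℂ (Fin n → ℂ)}
    (hU : ∀ i, HasAnalyticSections (U i) x) : HasAnalyticSections (fun y => ⨆ i, U i y) x := by
  intro v hv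
  refine Submodule.iSup_induction (fun i => U i x) (motive := fun v => ∃ s : E → Fin n → ℂ,
    AnalyticAt ℝ s x ∧ s x = v ∧ ∀ᶠ y in 𝓝 x, s y ∈ ⨆ i, U i y) hv ?_ ?_ ?_
  · intro i v hv
    obtain ⟨s, hs, rfl, hsU⟩ := hU i v hv
    refine ⟨s, hs, rfl, ?_⟩
    filter_upwards [hsU] with y hy using Submodule.mem_iSup_of_mem i hy
  · exact ⟨fun _ => 0, analyticAt_const, rfl, Filter.Eventually.of_forall fun _ => zero_mem _⟩
  · rintro _ _ ⟨s, hs, rfl, hsU⟩ ⟨t, ht, rfl, htU⟩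
    refine ⟨fun y => s y + t y, hs.add ht, rfl, ?_⟩
    filter_upwards [hsU, htU] with y h1 h2 using add_mem h1 h2

theorem HasAnalyticSections.conj (hU : HasAnalyticSections U x) :
    HasAnalyticSections (fun y => conjSub (U y)) x := by
  intro v hv
  obtain ⟨s, hs, hsx, hsU⟩ := hU (star v) hv
  refine ⟨fun y => star (s y), ?_, by show star (s x) = v; rw [hsx, star_star], ?_⟩
  · rw [analyticAt_pi_iff] at hs ⊢
    exact fun i => (hs i).star_complex
  · filter_upwards [hsU] with y hy
    rw [mem_conjSub, star_star]
    exact hy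

/-- A basis of the fibre extends to sections, which remain linearly independent nearby. -/
theorem exists_linearIndependent_sections (hU : HasAnalyticSections U x) :
    ∃ s : Fin (Module.finrank ℂ (U x)) → E → Fin n → ℂ, (∀ i, AnalyticAt ℝ (s i) x) ∧
      (∀ᶠ y in 𝓝 x, ∀ i, s i y ∈ U y) ∧ LinearIndependent ℂ (fun i => s i x) ∧
      ∀ᶠ y in 𝓝 x, LinearIndependent ℂ (fun i => s i y) := by
  set b := Module.finBasis ℂ (U x)
  choose s hs hsx hsU using fun i => hU (b i) (b i).2
  have hlin : LinearIndependent ℂ (fun i => s i x) := by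
    have h1 := b.linearIndependent.map' (U x).subtype (by simp)
    have e : (fun i => s i x) = (U x).subtype ∘ b := by
      funext i
      simp [hsx i]
    rw [e]
    exact h1
  refine ⟨s, hs, Filter.eventually_all.2 hsU, hlin, ?_⟩
  have hcont : ContinuousAt (fun y i => s i y) x :=
    continuousAt_pi.2 fun i => (hs i).continuousAt
  exact hcont.eventually (isOpen_setOfPred_linearIndependent.mem_nhds hlin)

/-- The dimension of an analytic family of subspaces is lower semicontinuous. -/
theorem HasAnalyticSections.eventually_finrank_le (hU : HasAnalyticSections U x) :
    ∀ᶠ y in 𝓝 x, Module.finrank ℂ (U x) ≤ Module.finrank ℂ (U y) := by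
  obtain ⟨s, -, hsU, -, hlin⟩ := exists_linearIndependent_sections hU
  filter_upwards [hsU, hlin] with y h1 h2
  have h3 : LinearIndependent ℂ (fun i => (⟨s i y, h1 i⟩ : U y)) := by
    apply LinearIndependent.of_comp (U y).subtype
    exact h2
  simpa using h3.fintype_card_le_finrank

/-- An intersection of analytic families of subspaces is analytic if the dimension of their sum
does not jump. -/
theorem HasAnalyticSections.inf (hU : HasAnalyticSections U x) (hU' : HasAnalyticSections U' x)
    (hdim : ∀ᶠ y in 𝓝 x, Module.finrank ℂ ↥(U y ⊔ U' y) ≤ Module.finrank ℂ ↥(U x ⊔ U' x)) :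
    HasAnalyticSections (fun y => U y ⊓ U' y) x := by
  rintro v ⟨hv, hv'⟩
  obtain ⟨u, hu, hux, huU⟩ := hU v hv
  obtain ⟨u', hu', hux', huU'⟩ := hU' v hv'
  set d := Module.finrank ℂ ↥(U x ⊔ U' x) with hd
  set b := Module.finBasis ℂ ↥(U x ⊔ U' x)
  have hb : ∀ i, ∃ s t : E → Fin n → ℂ, AnalyticAt ℝ s x ∧ AnalyticAt ℝ t x ∧
      s x + t x = b i ∧ (∀ᶠ y in 𝓝 x, s y ∈ U y) ∧ ∀ᶠ y in 𝓝 x, t y ∈ U' y := by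
    intro i
    obtain ⟨a, ha, c, hc, e⟩ := Submodule.mem_sup.1 (b i).2
    obtain ⟨s, hs, rfl, hsU⟩ := hU a ha
    obtain ⟨t, ht, rfl, htU⟩ := hU' c hc
    exact ⟨s, t, hs, ht, e, hsU, htU⟩
  choose s t hs ht hst hsU htU using hb
  -- the matrix with columns `s i + t i`, a basis of the sum of the two subspaces
  let C : E → Matrix (Fin n) (Fin d) ℂ := fun y => Matrix.of fun k i => s i y k + t i y k
  have hC : MatAnalyticAt C x := fun k i =>
    (analyticAt_pi_iff.1 (hs i) k).add (analyticAt_pi_iff.1 (ht i) k)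
  have hCcol : ∀ y i, (C y).col i = s i y + t i y := fun y i => rfl
  have hlinx : LinearIndependent ℂ (fun i => (C x).col i) := by
    have h1 := b.linearIndependent.map' (U x ⊔ U' x).subtype (by simp)
    have e : (fun i => (C x).col i) = (U x ⊔ U' x).subtype ∘ b := by
      funext i
      simp [hCcol, hst i]
    rw [e]
    exact h1
  have hlin : ∀ᶠ y in 𝓝 x, LinearIndependent ℂ (fun i => (C y).col i) := by
    have hcont : ContinuousAt (fun y i => (C y).col i) x :=
      continuousAt_pi.2 fun i => continuousAt_pi.2 fun k => (hC k i).continuousAt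
    exact hcont.eventually (isOpen_setOfPred_linearIndependent.mem_nhds hlinx)
  have hinjx : Function.Injective (Matrix.mulVecLin (C x)) :=
    Matrix.mulVec_injective_iff.2 hlinx
  -- a left inverse `L` of `C x`; then `(L * C y)⁻¹ * L` is a left inverse of `C y` for `y` near `x`
  obtain ⟨Lf, hLf⟩ := (Matrix.mulVecLin (C x)).exists_leftInverse_of_injective
    (LinearMap.ker_eq_bot.2 hinjx)
  let L : Matrix (Fin d) (Fin n) ℂ := LinearMap.toMatrix' Lf
  have hLC : L * C x = 1 := by
    have : Matrix.toLin' (L * C x) = Matrix.toLin' 1 := by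
      rw [Matrix.toLin'_mul, Matrix.toLin'_one, Matrix.toLin'_toMatrix', Matrix.toLin'_apply', hLf]
    exact Matrix.toLin'.injective this
  have hN : MatAnalyticAt (fun y => L * C y) x := (matAnalyticAt_const L x).mul hC
  have hNx : IsUnit (L * C x).det := by rw [hLC]; simp
  have hNy := hN.eventually_isUnit_det hNx
  -- the coefficients of `u - u'` in the basis `s i + t i` of the sum
  let c : E → Fin d → ℂ := fun y => (L * C y)⁻¹ *ᵥ (L *ᵥ (u y - u' y))
  have hc : AnalyticAt ℝ c x :=
    (hN.inv hNx).mulVec ((matAnalyticAt_const L x).mulVec (hu.sub hu'))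
  have hcx : c x = 0 := by simp [c, hux, hux']
  have hkey : ∀ᶠ y in 𝓝 x, C y *ᵥ c y = u y - u' y := by
    filter_upwards [hdim, hlin, hNy, huU, huU', Filter.eventually_all.2 hsU,
      Filter.eventually_all.2 htU] with y h1 h2 h3 h4 h5 h6 h7
    have hspan : Submodule.span ℂ (Set.range (C y).col) = U y ⊔ U' y := by
      apply Submodule.eq_of_le_of_finrank_le
      · refine Submodule.span_le.2 ?_
        rintro _ ⟨i, rfl⟩
        rw [hCcol]
        exact Submodule.add_mem_sup (h6 i) (h7 i)
      · rw [finrank_span_eq_card h2]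
        simpa using h1
    have hmem : u y - u' y ∈ Submodule.span ℂ (Set.range (C y).col) := by
      rw [hspan]
      exact sub_mem (Submodule.mem_sup_left h4) (Submodule.mem_sup_right h5)
    rw [← Matrix.range_mulVecLin] at hmem
    obtain ⟨e, he⟩ := hmem
    rw [Matrix.mulVecLin_apply] at he
    have : c y = e := by
      simp only [c]
      rw [← he, Matrix.mulVec_mulVec, Matrix.mulVec_mulVec, Matrix.mul_assoc,
        Matrix.nonsing_inv_mul _ h3, Matrix.one_mulVec]
    rw [this, he]
  -- `u - ∑ c_i s_i = u' + ∑ c_i t_i` lies in both subspaces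
  refine ⟨fun y => u y - ∑ i, c y i • s i y, ?_, by simp [hcx, hux], ?_⟩
  · refine hu.sub (Finset.univ.analyticAt_fun_sum fun i _ => ?_)
    exact (analyticAt_pi_iff.1 hc i).smul (hs i)
  · filter_upwards [hkey, huU, huU', Filter.eventually_all.2 hsU,
      Filter.eventually_all.2 htU] with y h0 h4 h5 h6 h7
    refine ⟨sub_mem h4 (sum_mem fun i _ => Submodule.smul_mem _ _ (h6 i)), ?_⟩
    have e : u y - ∑ i, c y i • s i y = u' y + ∑ i, c y i • t i y := by
      rw [sub_eq_iff_eq_add, add_assoc, ← Finset.sum_add_distrib, ← sub_eq_iff_eq_add', ← h0]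
      funext k
      have e1 : (C y *ᵥ c y) k = ∑ i, C y k i * c y i := rfl
      rw [e1, Finset.sum_apply]
      refine Finset.sum_congr rfl fun i _ => ?_
      simp only [C, Matrix.of_apply, Pi.add_apply, Pi.smul_apply, smul_eq_mul]
      ring
    rw [e]
    exact add_mem h5 (sum_mem fun i _ => Submodule.smul_mem _ _ (h7 i))

end AnalyticSections

/-! ### Deligne's splitting in holomorphic families -/

section AdaptedFrames

theorem finrank_conjSub {n : ℕ} (U : Submodule ℂ (Fin n → ℂ)) :
    Module.finrank ℂ (conjSub U) = Module.finrank ℂ U := by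
  refine congrArg Cardinal.toNat ?_
  let j : conjSub U ≃+ U :=
    { toFun := fun v => ⟨star v.1, v.2⟩
      invFun := fun v => ⟨star v.1, by rw [mem_conjSub, star_star]; exact v.2⟩
      left_inv := fun v => Subtype.ext (star_star v.1)
      right_inv := fun v => Subtype.ext (star_star v.1)
      map_add' := fun v w => Subtype.ext (star_add v.1 w.1) }
  refine rank_eq_of_equiv_equiv (starRingEnd ℂ) j (Function.Involutive.bijective fun z => Complex.conj_conj z) ?_
  intro r v
  exact Subtype.ext (star_smul r v.1)

theorem conjSub_complexify {n : ℕ} (U : Submodule ℚ (Fin n → ℚ)) :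
    conjSub (complexify U) = complexify U := by
  apply le_antisymm
  · intro v hv
    simpa using star_mem_complexify hv
  · exact fun v hv => star_mem_complexify hv

theorem conjSub_inf {n : ℕ} (U U' : Submodule ℂ (Fin n → ℂ)) :
    conjSub (U ⊓ U') = conjSub U ⊓ conjSub U' := rfl

/-- The equality `dim F^p Gr_k^W + dim F^{k+1-p} Gr_k^W = dim Gr_k^W`, without subtractions. -/
theorem IsMHS.finrank_identity {n : ℕ} {W : ℤ → Submodule ℚ (Fin n → ℚ)} {F : Fil n}
    (h : IsMHS W F) (k p : ℤ) :
    Module.finrank ℂ ↥(F p ⊓ complexify (W k)) +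
      Module.finrank ℂ ↥(F (k + 1 - p) ⊓ complexify (W k)) +
        Module.finrank ℂ (complexify (W (k - 1))) =
    Module.finrank ℂ ↥(F p ⊓ complexify (W (k - 1))) +
      Module.finrank ℂ ↥(F (k + 1 - p) ⊓ complexify (W (k - 1))) +
        Module.finrank ℂ (complexify (W k)) := by
  have hW : complexify (W (k - 1)) ≤ complexify (W k) := complexify_mono (h.W_mono (by omega))
  have h1 := Submodule.finrank_sup_add_finrank_inf_eq
    ((F p ⊓ complexify (W k)) ⊔ complexify (W (k - 1)))
    ((conjSub (F (k + 1 - p)) ⊓ complexify (W k)) ⊔ complexify (W (k - 1)))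
  rw [h.pure_sup, h.pure_inf] at h1
  have h2 := Submodule.finrank_sup_add_finrank_inf_eq (F p ⊓ complexify (W k))
    (complexify (W (k - 1)))
  have h3 := Submodule.finrank_sup_add_finrank_inf_eq
    (conjSub (F (k + 1 - p)) ⊓ complexify (W k)) (complexify (W (k - 1)))
  have e : ∀ j, conjSub (F (k + 1 - p)) ⊓ complexify (W j) =
      conjSub (F (k + 1 - p) ⊓ complexify (W j)) := fun j => by
    rw [conjSub_inf, conjSub_complexify]
  rw [inf_assoc, inf_eq_right.2 hW] at h2 h3
  rw [e (k - 1), finrank_conjSub, e k, finrank_conjSub] at h3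
  rw [← e k] at h3
  omega

variable {E : Type*} [NormedAddCommGroup E] [NormedSpace ℂ E] {n : ℕ}

theorem IsHolFrame.eventually_differentiableAt {F : E → Fil n} {x : E}
    {g : E → Matrix (Fin n) (Fin n) ℂ} (hg : IsHolFrame E F x g) :
    ∀ᶠ y in 𝓝 x, ∀ i j, DifferentiableAt ℂ (fun y' => g y' i j) y := by
  filter_upwards [hg.2.1] with y hy i j
  exact mdifferentiableAt_iff_differentiableAt.1 (hy i j)

theorem IsHolFrame.matAnalyticAt [FiniteDimensional ℂ E] {F : E → Fil n} {x : E}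
    {g : E → Matrix (Fin n) (Fin n) ℂ} (hg : IsHolFrame E F x g) : MatAnalyticAt g x := by
  intro i j
  have : AnalyticAt ℂ (fun y => g y i j) x := by
    apply analyticAt_of_eventually_differentiableAt
    filter_upwards [hg.eventually_differentiableAt] with y hy using hy i j
  exact this.restrictScalars

theorem IsHolFrame.eventually_isUnit_det [FiniteDimensional ℂ E] {F : E → Fil n} {x : E}
    {g : E → Matrix (Fin n) (Fin n) ℂ} (hg : IsHolFrame E F x g) :
    ∀ᶠ y in 𝓝 x, IsUnit (g y).det :=
  hg.matAnalyticAt.eventually_isUnit_det (by rw [hg.1]; simp)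

variable {F : E → Fil n} {x : E}

theorem HolAt.hasAnalyticSections [FiniteDimensional ℂ E] (h : HolAt E F x) (p : ℤ) :
    HasAnalyticSections (fun y => F y p) x := by
  obtain ⟨g, hg⟩ := h
  intro v hv
  refine ⟨fun y => g y *ᵥ v, hg.matAnalyticAt.mulVec analyticAt_const, by simp [hg.1], ?_⟩
  filter_upwards [hg.2.2] with y hy
  rw [hy]
  exact ⟨v, hv, rfl⟩

theorem finrank_act {g : Matrix (Fin n) (Fin n) ℂ} (hg : IsUnit g.det) (F : Fil n) (p : ℤ) :
    Module.finrank ℂ (Fil.act g F p) = Module.finrank ℂ (F p) := by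
  refine ((F p).equivMapOfInjective (Matrix.mulVecLin g) fun v w hvw => ?_).finrank_eq.symm
  have := congrArg (fun u => g⁻¹ *ᵥ u) hvw
  simpa [inv_mulVec_mulVec hg] using this

theorem HolAt.eventually_finrank_eq [FiniteDimensional ℂ E] (h : HolAt E F x) (p : ℤ) :
    ∀ᶠ y in 𝓝 x, Module.finrank ℂ (F y p) = Module.finrank ℂ (F x p) := by
  obtain ⟨g, hg⟩ := h
  filter_upwards [hg.2.2, hg.eventually_isUnit_det] with y h1 h2
  rw [h1, finrank_act h2]

variable [FiniteDimensional ℂ E] {W : ℤ → Submodule ℚ (Fin n → ℚ)}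

/-- The dimensions of `F^p ∩ W_k` are locally constant: they are upper semicontinuous, and for each
`k` the Hodge numbers of weight `k` are constrained by `d_k^p + d_k^{k+1-p}`, which allows a downward
induction on `k`. -/
theorem HolAt.eventually_finrank_inf_eq (h : HolAt E F x) (hM : ∀ᶠ y in 𝓝 x, IsMHS W (F y))
    (k p : ℤ) : ∀ᶠ y in 𝓝 x, Module.finrank ℂ ↥(F y p ⊓ complexify (W k)) =
      Module.finrank ℂ ↥(F x p ⊓ complexify (W k)) := by
  obtain ⟨k₁, hk₁⟩ := hM.self_of_nhds.W_top
  have hle : ∀ k p, ∀ᶠ y in 𝓝 x, Module.finrank ℂ ↥(F y p ⊓ complexify (W k)) ≤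
      Module.finrank ℂ ↥(F x p ⊓ complexify (W k)) := by
    intro k p
    filter_upwards [((h.hasAnalyticSections p).sup
      (hasAnalyticSections_const (complexify (W k)) x)).eventually_finrank_le,
      h.eventually_finrank_eq p] with y h1 h2
    have h3 := Submodule.finrank_sup_add_finrank_inf_eq (F y p) (complexify (W k))
    have h4 := Submodule.finrank_sup_add_finrank_inf_eq (F x p) (complexify (W k))
    omega
  have key : ∀ N : ℕ, ∀ k p, k₁ ≤ k + N → ∀ᶠ y in 𝓝 x,
      Module.finrank ℂ ↥(F y p ⊓ complexify (W k)) =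
        Module.finrank ℂ ↥(F x p ⊓ complexify (W k)) := by
    intro N
    induction N with
    | zero =>
      intro k p hk
      have hW : complexify (W k) = ⊤ := by
        have : W k = ⊤ := top_le_iff.1 (hk₁ ▸ hM.self_of_nhds.W_mono (by simpa using hk))
        rw [this, complexify_top]
      filter_upwards [h.eventually_finrank_eq p] with y hy
      rw [hW, inf_top_eq, inf_top_eq]
      exact hy
    | succ N ih =>
      intro k p hk
      push_cast at hk
      filter_upwards [hM, ih (k + 1) p (by omega), ih (k + 1) (k + 1 + 1 - p) (by omega),
        hle k p, hle k (k + 1 + 1 - p)] with y h0 h1 h2 h3 h4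
      have e1 := h0.finrank_identity (k + 1) p
      have e2 := hM.self_of_nhds.finrank_identity (k + 1) p
      rw [add_sub_cancel_right] at e1 e2
      omega
  refine key (k₁ - k).toNat k p (by omega)

theorem HolAt.hasAnalyticSections_inf (h : HolAt E F x) (hM : ∀ᶠ y in 𝓝 x, IsMHS W (F y))
    (k p : ℤ) : HasAnalyticSections (fun y => F y p ⊓ complexify (W k)) x := by
  refine (h.hasAnalyticSections p).inf (hasAnalyticSections_const _ x) ?_
  filter_upwards [h.eventually_finrank_inf_eq hM k p, h.eventually_finrank_eq p] with y h1 h2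
  have h3 := Submodule.finrank_sup_add_finrank_inf_eq (F y p) (complexify (W k))
  have h4 := Submodule.finrank_sup_add_finrank_inf_eq (F x p) (complexify (W k))
  omega

/-- Deligne's pieces of a holomorphic family vary real analytically: each is the intersection of two
factors whose sum `W_{p+q}` is constant. -/
theorem HolAt.hasAnalyticSections_deligneSplitting (h : HolAt E F x)
    (hM : ∀ᶠ y in 𝓝 x, IsMHS W (F y)) (p q : ℤ) :
    HasAnalyticSections (fun y => deligneSplitting W (F y) p q) x := by
  have hconj : ∀ q k, HasAnalyticSections (fun y => conjSub (F y q) ⊓ complexify (W k)) x := by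
    intro q k
    have := (h.hasAnalyticSections_inf hM k q).conj
    simp only [conjSub_inf, conjSub_complexify] at this
    exact this
  refine (h.hasAnalyticSections_inf hM (p + q) p).inf
    (U' := fun y => deligneFactor (fun k => complexify (W k)) (fun p => conjSub (F y p)) p q)
    ((hconj q _).sup (HasAnalyticSections.iSup fun j : ℕ => hconj _ _)) ?_
  filter_upwards [hM] with y hy
  rw [hy.isOpposed.sup_deligneFactor, hM.self_of_nhds.isOpposed.sup_deligneFactor]

/-- A holomorphic family of mixed Hodge structures admits, locally, a real analytic frame adapted to
the Deligne splittings. -/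
theorem HolAt.exists_analytic_isAdapted (h : HolAt E F x) (hM : ∀ᶠ y in 𝓝 x, IsMHS W (F y)) :
    ∃ (β : E → Matrix (Fin n) (Fin n) ℂ) (p q : Fin n → ℤ), MatAnalyticAt β x ∧
      ∀ᶠ y in 𝓝 x, IsAdapted W (F y) (β y) p q := by
  obtain ⟨β₀, p, q, hβ₀⟩ := hM.self_of_nhds.exists_isAdapted
  choose s hs hsx hsU using fun i =>
    h.hasAnalyticSections_deligneSplitting hM (p i) (q i) _ (hβ₀.col_mem i)
  let β : E → Matrix (Fin n) (Fin n) ℂ := fun y => Matrix.of fun k i => s i y k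
  have hβ : MatAnalyticAt β x := fun k i => analyticAt_pi_iff.1 (hs i) k
  have hβx : β x = β₀ := by
    ext k i
    exact congrFun (hsx i) k
  refine ⟨β, p, q, hβ, ?_⟩
  filter_upwards [hM, hβ.eventually_isUnit_det (hβx ▸ hβ₀.det), Filter.eventually_all.2 hsU]
    with y h1 h2 h3
  exact ⟨h1, h2, h3⟩

end AdaptedFrames

/-! ### Rationality -/

section Descent

/-- An automorphism of a polynomial subring of `ℂ` generated by a transcendence basis extends to
`ℂ`, an algebraic closure of that subring. -/
theorem exists_ringEquiv_extending {R : Type*} [CommRing R] [Algebra R ℂ] {ι : Type*} {v : ι → ℂ}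
    (hv : IsTranscendenceBasis R v) (e : MvPolynomial ι R ≃+* MvPolynomial ι R) :
    ∃ τ : ℂ ≃+* ℂ, ∀ f, τ (MvPolynomial.aeval v f) = MvPolynomial.aeval v (e f) := by
  let := IsAlgClosed.isAlgClosure_of_transcendence_basis v hv
  let e' : Algebra.adjoin R (Set.range v) ≃+* Algebra.adjoin R (Set.range v) :=
    (hv.1.aevalEquiv.symm.toRingEquiv.trans e).trans hv.1.aevalEquiv.toRingEquiv
  refine ⟨IsAlgClosure.equivOfEquiv ℂ ℂ e', fun f => ?_⟩
  have h1 := IsAlgClosure.equivOfEquiv_algebraMap ℂ ℂ e' (hv.1.aevalEquiv f)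
  have h2 : e' (hv.1.aevalEquiv f) = hv.1.aevalEquiv (e f) := by
    change hv.1.aevalEquiv (e (hv.1.aevalEquiv.symm (hv.1.aevalEquiv f))) = _
    rw [AlgEquiv.symm_apply_apply]
  rw [h2] at h1
  have h3 : ∀ f, algebraMap (Algebra.adjoin R (Set.range v)) ℂ (hv.1.aevalEquiv f) =
      MvPolynomial.aeval v f := fun f => hv.1.algebraMap_aevalEquiv f
  rwa [h3, h3] at h1

/-- A transcendental number belongs to a transcendence basis, and the change of its sign extends to
an automorphism of `ℂ`. -/
theorem exists_ringEquiv_ne_of_transcendental {z : ℂ} (hz : Transcendental ℚ z) :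
    ∃ τ : ℂ ≃+* ℂ, τ z ≠ z := by
  classical
  have hs : AlgebraicIndepOn ℚ id ({z} : Set ℂ) := by
    have := (algebraicIndependent_unique_type_iff (ι := ({z} : Set ℂ)) (R := ℚ)
      (x := fun i : ({z} : Set ℂ) => (i : ℂ))).2 hz
    exact this
  obtain ⟨B, hzB, hB⟩ := exists_isTranscendenceBasis_superset hs
  have hzB : z ∈ B := hzB rfl
  let a : MvPolynomial B ℚ →ₐ[ℚ] MvPolynomial B ℚ :=
    MvPolynomial.aeval fun b => if b.1 = z then -MvPolynomial.X b else MvPolynomial.X b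
  have ha : a.comp a = AlgHom.id ℚ _ := by
    refine MvPolynomial.algHom_ext fun b => ?_
    by_cases hb : b.1 = z <;> simp [a, hb]
  obtain ⟨τ, hτ⟩ := exists_ringEquiv_extending hB (AlgEquiv.ofAlgHom a a ha ha).toRingEquiv
  refine ⟨τ, fun h => ?_⟩
  have h1 := hτ (MvPolynomial.X ⟨z, hzB⟩)
  have h2 : (AlgEquiv.ofAlgHom a a ha ha).toRingEquiv (MvPolynomial.X ⟨z, hzB⟩) =
      -MvPolynomial.X ⟨z, hzB⟩ := by
    change a _ = _
    simp [a]
  rw [h2] at h1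
  simp only [MvPolynomial.aeval_X, map_neg] at h1
  rw [h] at h1
  have h3 : z = 0 := by
    have : (2 : ℂ) * z = 0 := by linear_combination h1
    simpa using this
  rw [h3] at hz
  exact hz isAlgebraic_zero

/-- The field of complex numbers fixed by all field automorphisms is `ℚ`. -/
theorem mem_range_ratCast_of_forall_ringEquiv {z : ℂ} (hz : ∀ τ : ℂ ≃+* ℂ, τ z = z) :
    ∃ r : ℚ, (r : ℂ) = z := by
  by_cases hzt : Transcendental ℚ z
  · obtain ⟨τ, hτ⟩ := exists_ringEquiv_ne_of_transcendental hzt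
    exact absurd (hz τ) hτ
  have hza : IsAlgebraic ℚ z := by
    by_contra h
    exact hzt h
  -- for an algebraic number, use that the automorphisms of the algebraic closure of `ℚ` extend to
  -- `ℂ` and that `ℚ` is their fixed field
  let L := algebraicClosure ℚ ℂ
  have hzL : z ∈ L := mem_algebraicClosure_iff.2 hza
  have : IsAlgClosure ℚ L := algebraicClosure.isAlgClosure ℚ ℂ
  have : IsAlgClosed L := IsAlgClosure.isAlgClosed ℚ
  have : Algebra.IsAlgebraic ℚ L := IsAlgClosure.isAlgebraic
  have : Normal ℚ L := normal_iff.2 fun x =>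
    ⟨(Algebra.IsAlgebraic.isAlgebraic x).isIntegral, IsAlgClosed.splits _⟩
  have : IsGalois ℚ L := ⟨⟩
  have hfix := (InfiniteGalois.mem_range_algebraMap_iff_fixed (k := ℚ) (⟨z, hzL⟩ : L)).2 (by
    intro f
    obtain ⟨B, hB⟩ := exists_isTranscendenceBasis L ℂ
    obtain ⟨τ, hτ⟩ := exists_ringEquiv_extending hB (MvPolynomial.mapEquiv B f.toRingEquiv)
    have h1 := hτ (MvPolynomial.C ⟨z, hzL⟩)
    rw [MvPolynomial.mapEquiv_apply, MvPolynomial.map_C, MvPolynomial.aeval_C,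
      MvPolynomial.aeval_C] at h1
    have h2 : τ z = ((f ⟨z, hzL⟩ : L) : ℂ) := h1
    rw [hz] at h2
    exact Subtype.ext h2.symm)
  obtain ⟨r, hr⟩ := hfix
  refine ⟨r, ?_⟩
  have := congrArg (Subtype.val) hr
  simpa using this

/-- A subspace of complex polynomials that is stable under the automorphisms of `ℂ` is spanned by
its elements with rational coefficients: among the elements with support in a given finite set,
one with minimal support and a coefficient equal to `1` has to be invariant. -/
theorem mem_span_rational_of_stable {σ : Type*} (U : Submodule ℂ (MvPolynomial σ ℂ))
    (hU : ∀ τ : ℂ ≃+* ℂ, ∀ f ∈ U, MvPolynomial.map (τ : ℂ →+* ℂ) f ∈ U)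
    {f : MvPolynomial σ ℂ} (hf : f ∈ U) :
    f ∈ Submodule.span ℂ {h | h ∈ U ∧ ∃ h₀ : MvPolynomial σ ℚ,
      h = MvPolynomial.map (algebraMap ℚ ℂ) h₀} := by
  classical
  induction hN : f.support.card using Nat.strong_induction_on generalizing f with
  | _ N ih =>
  subst hN
  by_cases hf0 : f = 0
  · rw [hf0]; exact zero_mem _
  -- an element of minimal support among the nonzero elements supported in the support of `f`
  obtain ⟨h, ⟨hhU, hh0, hhf⟩, hmin⟩ := WellFounded.has_min
    (measure fun h : MvPolynomial σ ℂ => h.support.card).wf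
    {h | h ∈ U ∧ h ≠ 0 ∧ h.support ⊆ f.support} ⟨f, hf, hf0, subset_rfl⟩
  obtain ⟨m, hm⟩ := Finset.nonempty_iff_ne_empty.2
    (fun e => hh0 (MvPolynomial.support_eq_empty.1 e))
  set h' := (h.coeff m)⁻¹ • h with hh'
  have hm0 : h.coeff m ≠ 0 := MvPolynomial.mem_support_iff.1 hm
  have hh'U : h' ∈ U := U.smul_mem _ hhU
  have hh'm : h'.coeff m = 1 := by simp [hh', hm0]
  have hh's : h'.support ⊆ h.support := MvPolynomial.support_smul
  have hfix : ∀ τ : ℂ ≃+* ℂ, MvPolynomial.map (τ : ℂ →+* ℂ) h' = h' := by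
    intro τ
    by_contra hne
    -- the coefficient at `m` being `1`, the difference `τ h' - h'` has smaller support
    set u := MvPolynomial.map (τ : ℂ →+* ℂ) h' - h' with hu
    have hus : u.support ⊆ h.support.erase m := by
      intro k hk
      rw [MvPolynomial.mem_support_iff, hu, MvPolynomial.coeff_sub, MvPolynomial.coeff_map] at hk
      rw [Finset.mem_erase]
      constructor
      · rintro rfl
        simp [hh'm] at hk
      · by_contra hkh
        have : h'.coeff k = 0 := by
          by_contra h0
          exact hkh (hh's (MvPolynomial.mem_support_iff.2 h0))
        simp [this] at hk
    refine hmin u ⟨U.sub_mem (hU τ _ hh'U) hh'U, sub_ne_zero.2 hne,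
      hus.trans ((Finset.erase_subset _ _).trans hhf)⟩ ?_
    exact (Finset.card_le_card hus).trans_lt (Finset.card_erase_lt_of_mem hm)
  have hrat : ∃ h₀ : MvPolynomial σ ℚ, h' = MvPolynomial.map (algebraMap ℚ ℂ) h₀ := by
    have hc : ∀ k, ∃ r : ℚ, (r : ℂ) = h'.coeff k := fun k =>
      mem_range_ratCast_of_forall_ringEquiv fun τ => by
        have := congrArg (MvPolynomial.coeff k) (hfix τ)
        rwa [MvPolynomial.coeff_map] at this
    choose r hr using hc
    refine ⟨∑ k ∈ h'.support, MvPolynomial.monomial k (r k), ?_⟩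
    conv_lhs => rw [h'.as_sum]
    rw [map_sum]
    refine Finset.sum_congr rfl fun k _ => ?_
    rw [MvPolynomial.map_monomial, ← hr k]
    simp
  -- subtracting a multiple of `h'` removes the monomial `m` from `f`
  have h1 : f - f.coeff m • h' ∈ Submodule.span ℂ {h | h ∈ U ∧ ∃ h₀ : MvPolynomial σ ℚ,
      h = MvPolynomial.map (algebraMap ℚ ℂ) h₀} := by
    refine ih _ ?_ (U.sub_mem hf (U.smul_mem _ hh'U)) rfl
    have hsub : (f - f.coeff m • h').support ⊆ f.support.erase m := by
      intro k hk
      rw [MvPolynomial.mem_support_iff, MvPolynomial.coeff_sub, MvPolynomial.coeff_smul] at hk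
      rw [Finset.mem_erase]
      constructor
      · rintro rfl
        simp [hh'm] at hk
      · by_contra hkf
        have h0 : f.coeff k = 0 := by
          by_contra h0
          exact hkf (MvPolynomial.mem_support_iff.2 h0)
        have h0' : h'.coeff k = 0 := by
          by_contra h0'
          exact hkf (hhf (hh's (MvPolynomial.mem_support_iff.2 h0')))
        simp [h0, h0'] at hk
    exact (Finset.card_le_card hsub).trans_lt (Finset.card_erase_lt_of_mem (hhf hm))
  have h2 : f = (f - f.coeff m • h') + f.coeff m • h' := by abel
  rw [h2]
  exact add_mem h1 (Submodule.smul_mem _ _ (Submodule.subset_span ⟨hh'U, hrat⟩))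

/-- A complex vector is a combination of rational vectors that satisfy all the rational linear
equations satisfied by it. -/
theorem exists_rational_expansion {ι : Type*} [Fintype ι] (v : ι → ℂ) :
    ∃ (s : Finset ℂ) (w : ℂ → ι → ℚ), (∀ i, v i = ∑ b ∈ s, b * (w b i : ℂ)) ∧
      ∀ ℓ : ι → ℚ, ∑ i, (ℓ i : ℂ) * v i = 0 → ∀ b ∈ s, ∑ i, ℓ i * w b i = 0 := by
  classical
  -- expand the coordinates of `v` in a basis of `ℂ` over `ℚ`
  let B := Module.Basis.ofVectorSpace ℚ ℂ
  let T := Finset.univ.biUnion fun i => (B.repr (v i)).support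
  have hT : ∀ i, v i = ∑ k ∈ T, B k * ((B.repr (v i) k : ℚ) : ℂ) := by
    intro i
    conv_lhs => rw [← B.linearCombination_repr (v i)]
    rw [Finsupp.linearCombination_apply, Finsupp.sum_of_support_subset (s := T)]
    · refine Finset.sum_congr rfl fun k _ => ?_
      rw [Rat.smul_def, mul_comm]
    · exact Finset.subset_biUnion_of_mem (fun i => (B.repr (v i)).support) (Finset.mem_univ i)
    · simp
  have hinj : Function.Injective B := B.injective
  let w : ℂ → ι → ℚ := fun b i => if h : ∃ k, B k = b then B.repr (v i) h.choose else 0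
  have hw : ∀ k i, w (B k) i = B.repr (v i) k := by
    intro k i
    have h : ∃ k', B k' = B k := ⟨k, rfl⟩
    simp only [w, dif_pos h]
    rw [hinj h.choose_spec]
  refine ⟨T.image B, w, ?_, ?_⟩
  · intro i
    rw [Finset.sum_image (fun a _ b _ h => hinj h)]
    simp only [hw]
    exact hT i
  · intro ℓ hℓ b hb
    obtain ⟨k, -, rfl⟩ := Finset.mem_image.1 hb
    have h1 : B.repr (∑ i, ℓ i • v i) k = 0 := by
      have : ∑ i, ℓ i • v i = 0 := by simpa [Rat.smul_def] using hℓ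
      rw [this]; simp
    rw [map_sum, Finsupp.finsetSum_apply] at h1
    simpa [hw] using h1

end Descent

/-! ### Uniqueness for linear differential equations -/

section LinearODE

/-- Uniqueness for linear differential equations, in the form used here: a solution that vanishes
at the initial time vanishes. -/
theorem eq_zero_of_linear_ode {ι : Type*} [Fintype ι] {u : ℝ → ι → ℂ} {M : ℝ → Matrix ι ι ℂ}
    {T : ℝ} (hM : ContinuousOn M (Set.Icc 0 T))
    (hu : ∀ t ∈ Set.Icc 0 T, ∀ i, HasDerivAt (fun s => u s i) ((M t *ᵥ u t) i) t)
    (h0 : u 0 = 0) : ∀ t ∈ Set.Icc 0 T, u t = 0 := by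
  have hMij : ∀ i j, ContinuousOn (fun t => M t i j) (Set.Icc 0 T) := fun i j =>
    continuousOn_pi.1 (continuousOn_pi.1 hM i) j
  obtain ⟨K, hK⟩ := (isCompact_Icc (a := (0 : ℝ)) (b := T)).exists_bound_of_continuousOn
    (f := fun t => ∑ i, ∑ j, ‖M t i j‖)
    (continuousOn_finsetSum _ fun i _ => continuousOn_finsetSum _ fun j _ => (hMij i j).norm)
  have hd : ∀ t ∈ Set.Icc 0 T, HasDerivAt u (M t *ᵥ u t) t := fun t ht =>
    hasDerivAt_pi.2 fun i => hu t ht i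
  refine eq_zero_of_abs_deriv_le_mul_abs_self_of_eq_zero_right (K := K)
    (fun t ht => (hd t ht).continuousAt.continuousWithinAt)
    (fun t ht => (hd t ⟨ht.1, ht.2.le⟩).hasDerivWithinAt) h0 fun t ht => ?_
  have hK' := hK t ⟨ht.1, ht.2.le⟩
  rw [Real.norm_of_nonneg (by positivity)] at hK'
  refine (pi_norm_le_iff_of_nonneg (mul_nonneg (le_trans (by positivity) hK') (norm_nonneg _))).2
    fun i => ?_
  calc ‖(M t *ᵥ u t) i‖ ≤ ∑ j, ‖M t i j * u t j‖ := norm_sum_le _ _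
    _ ≤ ∑ j, ‖M t i j‖ * ‖u t‖ := by
        refine Finset.sum_le_sum fun j _ => ?_
        rw [norm_mul]
        exact mul_le_mul_of_nonneg_left (norm_le_pi_norm _ _) (norm_nonneg _)
    _ = (∑ j, ‖M t i j‖) * ‖u t‖ := by rw [Finset.sum_mul]
    _ ≤ K * ‖u t‖ := by
        refine mul_le_mul_of_nonneg_right (le_trans ?_ hK') (norm_nonneg _)
        exact Finset.single_le_sum (f := fun i => ∑ j, ‖M t i j‖)
          (fun i _ => Finset.sum_nonneg fun j _ => norm_nonneg _) (Finset.mem_univ i)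

end LinearODE

/-! ### Algebraic groups over the rational numbers and their Lie algebras -/

section LieAlgebra

variable {n : ℕ}

/-- The value of a polynomial in the matrix entries. -/
def polyVal (f : MvPolynomial (Fin n × Fin n) ℂ) (g : Matrix (Fin n) (Fin n) ℂ) : ℂ :=
  MvPolynomial.eval (fun ij => g ij.1 ij.2) f

/-- The derivative at `g`, in the direction `A`, of a polynomial in the matrix entries. -/
def polyDer (f : MvPolynomial (Fin n × Fin n) ℂ) (g A : Matrix (Fin n) (Fin n) ℂ) : ℂ :=
  ∑ ij : Fin n × Fin n, A ij.1 ij.2 * polyVal (MvPolynomial.pderiv ij f) g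

theorem polyVal_map (f : MvPolynomial (Fin n × Fin n) ℚ) (g : Matrix (Fin n) (Fin n) ℂ) :
    polyVal (MvPolynomial.map (algebraMap ℚ ℂ) f) g =
      MvPolynomial.aeval (fun ij => g ij.1 ij.2) f := by
  rw [polyVal, MvPolynomial.eval_map, MvPolynomial.aeval_def]

/-- The ideal of complex polynomials vanishing on a group of matrices. -/
def vanishing (P : Subgroup (GL (Fin n) ℂ)) : Ideal (MvPolynomial (Fin n × Fin n) ℂ) where
  carrier := {f | ∀ g ∈ P, polyVal f g.1 = 0}
  add_mem' := by
    intro f f' hf hf' g hg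
    rw [polyVal, map_add, ← polyVal, ← polyVal, hf g hg, hf' g hg, add_zero]
  zero_mem' := fun g _ => map_zero _
  smul_mem' := by
    intro a f hf g hg
    rw [smul_eq_mul, polyVal, map_mul, ← polyVal, ← polyVal, hf g hg, mul_zero]

theorem IsRatAlgebraic.mem_of_vanishing {P : Subgroup (GL (Fin n) ℂ)} (hP : IsRatAlgebraic P)
    {g : GL (Fin n) ℂ} (hg : ∀ f ∈ vanishing P, polyVal f g.1 = 0) : g ∈ P := by
  obtain ⟨I, hI⟩ := hP
  refine (hI g).2 fun f hf => ?_
  rw [← polyVal_map]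
  refine hg _ fun g' hg' => ?_
  rw [polyVal_map]
  exact (hI g').1 hg' f hf

/-- The chain rule for polynomials in the matrix entries. -/
theorem hasDerivAt_polyVal (f : MvPolynomial (Fin n × Fin n) ℂ)
    {c : ℝ → Matrix (Fin n) (Fin n) ℂ} {c' : Matrix (Fin n) (Fin n) ℂ} {t : ℝ}
    (hc : ∀ i j, HasDerivAt (fun s => c s i j) (c' i j) t) :
    HasDerivAt (fun s => polyVal f (c s)) (polyDer f (c t) c') t := by
  classical
  simp only [polyVal, polyDer]
  induction f using MvPolynomial.induction_on with
  | C a => simpa using hasDerivAt_const t a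
  | add p q hp hq =>
    simp only [map_add, mul_add, Finset.sum_add_distrib]
    exact hp.add hq
  | mul_X p i hp =>
    simp only [map_mul, MvPolynomial.eval_X]
    have h := hp.mul (hc i.1 i.2)
    refine h.congr_deriv ?_
    have e : ∀ ij : Fin n × Fin n, c' ij.1 ij.2 * MvPolynomial.eval (fun ij => c t ij.1 ij.2)
        (MvPolynomial.pderiv ij (p * MvPolynomial.X i)) =
        (c' ij.1 ij.2 * MvPolynomial.eval (fun ij => c t ij.1 ij.2) (MvPolynomial.pderiv ij p)) *
          c t i.1 i.2 + if ij = i then MvPolynomial.eval (fun ij => c t ij.1 ij.2) p * c' i.1 i.2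
            else 0 := by
      intro ij
      rw [Derivation.leibniz, map_add, smul_eq_mul, smul_eq_mul, map_mul, map_mul,
        MvPolynomial.eval_X, MvPolynomial.pderiv_X]
      by_cases h : ij = i
      · subst h
        simp
        ring
      · rw [if_neg h, Pi.single_eq_of_ne (Ne.symm h)]
        simp
        ring
    rw [Finset.sum_congr rfl fun ij _ => e ij, Finset.sum_add_distrib, Finset.sum_mul]
    simp

/-- The polynomial `g ↦ f (h g h')`. -/
def substPoly (h h' : Matrix (Fin n) (Fin n) ℂ) (f : MvPolynomial (Fin n × Fin n) ℂ) :
    MvPolynomial (Fin n × Fin n) ℂ :=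
  MvPolynomial.bind₁ (fun ij => ∑ l, (∑ k, MvPolynomial.C (h ij.1 k) * MvPolynomial.X (k, l)) *
    MvPolynomial.C (h' l ij.2)) f

theorem polyVal_substPoly (h h' : Matrix (Fin n) (Fin n) ℂ)
    (f : MvPolynomial (Fin n × Fin n) ℂ) (g : Matrix (Fin n) (Fin n) ℂ) :
    polyVal (substPoly h h' f) g = polyVal f (h * g * h') := by
  refine (MvPolynomial.eval₂Hom_bind₁ (RingHom.id ℂ) _ _ f).trans ?_
  have e : (fun ij : Fin n × Fin n => MvPolynomial.eval₂Hom (RingHom.id ℂ)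
      (fun ij : Fin n × Fin n => g ij.1 ij.2)
      (∑ l, (∑ k, MvPolynomial.C (h ij.1 k) * MvPolynomial.X (k, l)) *
        MvPolynomial.C (h' l ij.2))) = fun ij => (h * g * h') ij.1 ij.2 := by
    funext ij
    simp [Matrix.mul_apply]
  rw [e]
  rfl

theorem substPoly_mem_vanishing {P : Subgroup (GL (Fin n) ℂ)}
    {f : MvPolynomial (Fin n × Fin n) ℂ} (hf : f ∈ vanishing P) {h h' : GL (Fin n) ℂ}
    (hh : h ∈ P) (hh' : h' ∈ P) : substPoly h.1 h'.1 f ∈ vanishing P := by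
  intro g hg
  rw [polyVal_substPoly]
  have h1 := hf (h * g * h') (P.mul_mem (P.mul_mem hh hg) hh')
  rwa [Units.val_mul, Units.val_mul] at h1

theorem hasDerivAt_one_add_smul (A h h' : Matrix (Fin n) (Fin n) ℂ) (i j : Fin n) :
    HasDerivAt (fun s : ℝ => (h * (1 + (s : ℂ) • A) * h') i j) ((h * A * h') i j) 0 := by
  have e : (fun s : ℝ => (h * (1 + (s : ℂ) • A) * h') i j) =
      fun s : ℝ => (h * h') i j + (s : ℂ) * (h * A * h') i j := by
    funext s
    simp [Matrix.mul_add, Matrix.add_mul]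
  rw [e]
  have h1 : HasDerivAt (fun s : ℝ => (s : ℂ)) 1 0 := Complex.ofRealCLM.hasDerivAt
  simpa using (h1.mul_const ((h * A * h') i j)).const_add ((h * h') i j)

/-- The chain rule for `g ↦ f (h g h')` at `g = 1`. -/
theorem polyDer_substPoly (h h' : Matrix (Fin n) (Fin n) ℂ)
    (f : MvPolynomial (Fin n × Fin n) ℂ) (A : Matrix (Fin n) (Fin n) ℂ) :
    polyDer (substPoly h h' f) 1 A = polyDer f (h * h') (h * A * h') := by
  have h1 := hasDerivAt_polyVal (substPoly h h' f) (c := fun s : ℝ => 1 + (s : ℂ) • A) (c' := A)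
    (t := 0) (fun i j => by simpa using hasDerivAt_one_add_smul A 1 1 i j)
  have h2 := hasDerivAt_polyVal f (hasDerivAt_one_add_smul A h h')
  simp only [polyVal_substPoly] at h1
  have := h1.unique h2
  simpa using this

theorem polyDer_add (f f' : MvPolynomial (Fin n × Fin n) ℂ) (g A : Matrix (Fin n) (Fin n) ℂ) :
    polyDer (f + f') g A = polyDer f g A + polyDer f' g A := by
  simp [polyDer, polyVal, mul_add, Finset.sum_add_distrib]

theorem polyDer_smul (c : ℂ) (f : MvPolynomial (Fin n × Fin n) ℂ)
    (g A : Matrix (Fin n) (Fin n) ℂ) : polyDer (c • f) g A = c * polyDer f g A := by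
  simp only [polyDer, polyVal, Derivation.map_smul, MvPolynomial.smul_eval, Finset.mul_sum]
  exact Finset.sum_congr rfl fun _ _ => by ring

theorem eval_map_comp {R S σ : Type*} [CommRing R] [CommRing S] (φ : R →+* S) (a : σ → R)
    (f : MvPolynomial σ R) :
    MvPolynomial.eval (fun i => φ (a i)) (MvPolynomial.map φ f) = φ (MvPolynomial.eval a f) := by
  rw [MvPolynomial.eval_map]
  exact (MvPolynomial.eval₂_comp φ a f).symm

theorem polyVal_map_one (f : MvPolynomial (Fin n × Fin n) ℚ) :
    polyVal (MvPolynomial.map (algebraMap ℚ ℂ) f) 1 =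
      ((MvPolynomial.eval (fun kl => (1 : Matrix (Fin n) (Fin n) ℚ) kl.1 kl.2) f : ℚ) : ℂ) := by
  have e : (fun ij : Fin n × Fin n => (1 : Matrix (Fin n) (Fin n) ℂ) ij.1 ij.2) =
      fun ij => algebraMap ℚ ℂ ((1 : Matrix (Fin n) (Fin n) ℚ) ij.1 ij.2) := by
    funext ij
    rw [Matrix.one_apply, Matrix.one_apply]
    split_ifs <;> simp
  rw [polyVal, e, eval_map_comp]
  rfl

theorem polyDer_map_map (f : MvPolynomial (Fin n × Fin n) ℚ) (A : Matrix (Fin n) (Fin n) ℚ) :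
    polyDer (MvPolynomial.map (algebraMap ℚ ℂ) f) 1 (A.map (algebraMap ℚ ℂ)) =
      ((∑ ij : Fin n × Fin n, A ij.1 ij.2 *
      MvPolynomial.eval (fun kl => (1 : Matrix (Fin n) (Fin n) ℚ) kl.1 kl.2)
        (MvPolynomial.pderiv ij f) : ℚ) : ℂ) := by
  rw [polyDer, Rat.cast_sum]
  refine Finset.sum_congr rfl fun ij _ => ?_
  rw [Rat.cast_mul, MvPolynomial.pderiv_map, polyVal_map_one]
  rfl

variable {P : Subgroup (GL (Fin n) ℂ)}

/-- The ideal of an algebraic `ℚ`-group is spanned by rational polynomials. -/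
theorem IsRatAlgebraic.mem_span_of_mem_vanishing (hP : IsRatAlgebraic P)
    {f : MvPolynomial (Fin n × Fin n) ℂ} (hf : f ∈ vanishing P) :
    f ∈ Submodule.span ℂ {h | h ∈ vanishing P ∧ ∃ h₀ : MvPolynomial (Fin n × Fin n) ℚ,
      h = MvPolynomial.map (algebraMap ℚ ℂ) h₀} := by
  refine mem_span_rational_of_stable ((vanishing P).restrictScalars ℂ) ?_ hf
  intro τ f hf g hg
  obtain ⟨I, hI⟩ := hP
  let g' : GL (Fin n) ℂ := Matrix.GeneralLinearGroup.map (τ.symm : ℂ →+* ℂ) g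
  have hval : ∀ f' : MvPolynomial (Fin n × Fin n) ℂ,
      polyVal (MvPolynomial.map (τ : ℂ →+* ℂ) f') g.1 = τ (polyVal f' g'.1) := by
    intro f'
    have e : (fun ij : Fin n × Fin n => g.1 ij.1 ij.2) =
        fun ij => (τ : ℂ →+* ℂ) (g'.1 ij.1 ij.2) := by
      funext ij
      exact (τ.apply_symm_apply _).symm
    rw [polyVal, e, eval_map_comp]
    rfl
  have hg' : g' ∈ P := by
    refine (hI g').2 fun f₀ hf₀ => ?_
    have h1 := hval (MvPolynomial.map (algebraMap ℚ ℂ) f₀)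
    rw [MvPolynomial.map_map, Subsingleton.elim ((τ : ℂ →+* ℂ).comp (algebraMap ℚ ℂ))
      (algebraMap ℚ ℂ), polyVal_map, polyVal_map, (hI g).1 hg f₀ hf₀] at h1
    exact (map_eq_zero_iff τ τ.injective).1 h1.symm
  rw [hval, hf g' hg', map_zero]

/-- The complexified Lie algebra is the tangent space at `1` defined by the ideal of all complex
polynomials vanishing on the group. -/
theorem IsRatAlgebraic.mem_lieAlgC_iff (hP : IsRatAlgebraic P) {A : Matrix (Fin n) (Fin n) ℂ} :
    A ∈ lieAlgC P ↔ ∀ f ∈ vanishing P, polyDer f 1 A = 0 := by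
  constructor
  · intro hA f hf₁
    have hf' := hP.mem_span_of_mem_vanishing hf₁
    clear hf₁
    induction hA using Submodule.span_induction with
    | mem A hA =>
      obtain ⟨A, hA, rfl⟩ := hA
      induction hf' using Submodule.span_induction with
      | mem f hf =>
        obtain ⟨hf, f₀, rfl⟩ := hf
        dsimp only
        rw [polyDer_map_map, hA f₀ fun g hg => by rw [← polyVal_map]; exact hf g hg, Rat.cast_zero]
      | zero => simp [polyDer, polyVal]
      | add f f' h1 h2 hf hf' =>
        rw [polyDer_add, hf, hf', add_zero]
      | smul c f h1 hf =>
        rw [polyDer_smul, hf, mul_zero]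
    | zero => simp [polyDer]
    | add A B _ _ hA hB =>
      have : polyDer f 1 (A + B) = polyDer f 1 A + polyDer f 1 B := by
        simp [polyDer, add_mul, Finset.sum_add_distrib]
      rw [this, hA, hB, add_zero]
    | smul c A _ hA =>
      have : polyDer f 1 (c • A) = c * polyDer f 1 A := by
        simp [polyDer, Finset.mul_sum, mul_assoc]
      rw [this, hA, mul_zero]
  · intro hA
    obtain ⟨s, w, hw, hℓ⟩ := exists_rational_expansion
      (fun ij : Fin n × Fin n => A ij.1 ij.2)
    have e : A = ∑ b ∈ s, b • (Matrix.of fun i j => w b (i, j)).map (algebraMap ℚ ℂ) := by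
      ext i j
      rw [hw (i, j), Matrix.sum_apply]
      rfl
    rw [e]
    refine sum_mem fun b hb => Submodule.smul_mem _ _ (Submodule.subset_span ⟨_, ?_, rfl⟩)
    intro f hf
    have h1 := hA (MvPolynomial.map (algebraMap ℚ ℂ) f)
      fun g hg => by rw [polyVal_map]; exact hf g hg
    have h2 := hℓ (fun ij => MvPolynomial.eval
      (fun kl => (1 : Matrix (Fin n) (Fin n) ℚ) kl.1 kl.2) (MvPolynomial.pderiv ij f)) ?_ b hb
    · rw [← h2]
      exact Finset.sum_congr rfl fun ij _ => mul_comm _ _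
    · rw [← h1, polyDer]
      refine Finset.sum_congr rfl fun ij _ => ?_
      rw [mul_comm, MvPolynomial.pderiv_map, polyVal_map_one]

/-- The Lie algebra is stable under the adjoint action of the group. -/
theorem IsRatAlgebraic.conj_mem_lieAlgC (hP : IsRatAlgebraic P) {h : GL (Fin n) ℂ} (hh : h ∈ P)
    {A : Matrix (Fin n) (Fin n) ℂ} (hA : A ∈ lieAlgC P) : h.1 * A * h⁻¹.1 ∈ lieAlgC P := by
  rw [hP.mem_lieAlgC_iff] at hA ⊢
  intro f hf
  have := hA _ (substPoly_mem_vanishing hf hh (P.inv_mem hh))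
  rw [polyDer_substPoly] at this
  rwa [show h.1 * h⁻¹.1 = 1 from h.mul_inv] at this

/-- The complexified Lie algebra, being defined over `ℚ`, is stable under complex conjugation. -/
theorem map_star_mem_lieAlgC {A : Matrix (Fin n) (Fin n) ℂ} (hA : A ∈ lieAlgC P) :
    A.map (starRingEnd ℂ) ∈ lieAlgC P := by
  induction hA using Submodule.span_induction with
  | mem A hA =>
    obtain ⟨A, hA, rfl⟩ := hA
    refine Submodule.subset_span ⟨A, hA, ?_⟩
    ext i j
    simp
  | zero => simp
  | add A B _ _ hA hB =>
    rw [Matrix.map_add _ (map_add _)]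
    exact add_mem hA hB
  | smul c A _ hA =>
    have : (c • A).map (starRingEnd ℂ) = (starRingEnd ℂ c) • A.map (starRingEnd ℂ) := by
      ext i j; simp
    rw [this]
    exact Submodule.smul_mem _ _ hA

/-- The logarithmic derivative of a curve in an algebraic group lies in its Lie algebra. -/
theorem IsRatAlgebraic.deriv_mul_inv_mem_lieAlgC (hP : IsRatAlgebraic P)
    {c : ℝ → Matrix (Fin n) (Fin n) ℂ} {c' : Matrix (Fin n) (Fin n) ℂ} {t : ℝ}
    (hc : ∀ i j, HasDerivAt (fun s => c s i j) (c' i j) t)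
    (hcP : ∀ᶠ s in 𝓝 t, ∃ g ∈ P, g.1 = c s) : c' * (c t)⁻¹ ∈ lieAlgC P := by
  obtain ⟨g, hg, hgc⟩ := hcP.self_of_nhds
  have hinv : (c t)⁻¹ = g⁻¹.1 := by rw [← hgc, Matrix.coe_units_inv]
  rw [hP.mem_lieAlgC_iff, hinv]
  intro f hf
  have h1 := substPoly_mem_vanishing hf P.one_mem (P.inv_mem hg)
  have hd : ∀ i j, HasDerivAt (fun s => (c s * g⁻¹.1) i j) ((c' * g⁻¹.1) i j) t := by
    intro i j
    simp only [Matrix.mul_apply]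
    exact HasDerivAt.fun_sum fun k _ => (hc i k).mul_const _
  have h2 := hasDerivAt_polyVal f hd
  have h3 : (fun s => polyVal f (c s * g⁻¹.1)) =ᶠ[𝓝 t] fun _ => (0 : ℂ) := by
    filter_upwards [hcP] with s hs
    obtain ⟨g', hg', hgs⟩ := hs
    rw [← hgs]
    have h1 := hf (g' * g⁻¹) (P.mul_mem hg' (P.inv_mem hg))
    rwa [Units.val_mul] at h1
  have h4 := h2.unique ((hasDerivAt_const t (0 : ℂ)).congr_of_eventuallyEq h3)
  rwa [← hgc, show g.1 * g⁻¹.1 = 1 from g.mul_inv] at h4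

/-- The polynomial `g ↦ df_g(A g)`. -/
def lieDer (A : Matrix (Fin n) (Fin n) ℂ) (f : MvPolynomial (Fin n × Fin n) ℂ) :
    MvPolynomial (Fin n × Fin n) ℂ :=
  ∑ ij : Fin n × Fin n, (∑ k, MvPolynomial.C (A ij.1 k) * MvPolynomial.X (k, ij.2)) *
    MvPolynomial.pderiv ij f

theorem polyVal_lieDer (A : Matrix (Fin n) (Fin n) ℂ) (f : MvPolynomial (Fin n × Fin n) ℂ)
    (g : Matrix (Fin n) (Fin n) ℂ) : polyVal (lieDer A f) g = polyDer f g (A * g) := by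
  simp only [polyVal, lieDer, polyDer, Matrix.mul_apply, map_sum, map_mul, MvPolynomial.eval_C,
    MvPolynomial.eval_X]

/-- The right invariant vector fields given by the Lie algebra preserve the ideal of the group. -/
theorem IsRatAlgebraic.lieDer_mem_vanishing (hP : IsRatAlgebraic P)
    {A : Matrix (Fin n) (Fin n) ℂ} (hA : A ∈ lieAlgC P) {f : MvPolynomial (Fin n × Fin n) ℂ}
    (hf : f ∈ vanishing P) : lieDer A f ∈ vanishing P := by
  intro h hh
  have h1 := hP.mem_lieAlgC_iff.1 hA _ (substPoly_mem_vanishing hf P.one_mem hh)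
  rw [polyDer_substPoly] at h1
  rw [polyVal_lieDer]
  simpa using h1

theorem lieDer_sum_smul {m : ℕ} (α : Fin m → ℂ) (B : Fin m → Matrix (Fin n) (Fin n) ℂ)
    (f : MvPolynomial (Fin n × Fin n) ℂ) (g : Matrix (Fin n) (Fin n) ℂ) :
    polyDer f g ((∑ k, α k • B k) * g) = ∑ k, α k * polyVal (lieDer (B k) f) g := by
  simp only [polyVal_lieDer]
  simp only [polyDer, Finset.sum_mul, Matrix.sum_apply, Matrix.smul_mul, Matrix.smul_apply,
    smul_eq_mul, Finset.mul_sum, mul_assoc]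
  exact Finset.sum_comm

/-- A solution of `g' = A(t) g`, `g(0) = 1`, where `A(t)` lies in the Lie algebra of an algebraic
group, stays in the group: the values at `g(t)` of generators of its ideal solve a linear system of
differential equations. -/
theorem IsRatAlgebraic.mem_of_ode (hP : IsRatAlgebraic P) {A g : ℝ → Matrix (Fin n) (Fin n) ℂ}
    {T : ℝ} (hA : ∀ t ∈ Set.Icc 0 T, A t ∈ lieAlgC P) (hAc : ContinuousOn A (Set.Icc 0 T))
    (hg : ∀ t ∈ Set.Icc 0 T, ∀ i j, HasDerivAt (fun s => g s i j) ((A t * g t) i j) t)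
    (h0 : g 0 = 1) {t : ℝ} (ht : t ∈ Set.Icc 0 T) {h : GL (Fin n) ℂ} (hh : h.1 = g t) :
    h ∈ P := by
  obtain ⟨r, f, hf⟩ := Submodule.fg_iff_exists_fin_generating_family.1
    (IsNoetherian.noetherian (vanishing P))
  have hfP : ∀ k, f k ∈ vanishing P := fun k => hf ▸ Submodule.subset_span ⟨k, rfl⟩
  let B := Module.finBasis ℂ (lieAlgC P)
  have hder : ∀ m k, ∃ a : Fin r → MvPolynomial (Fin n × Fin n) ℂ,
      lieDer (B m).1 (f k) = ∑ l, a l * f l := by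
    intro m k
    have h1 : lieDer (B m).1 (f k) ∈
        Submodule.span (MvPolynomial (Fin n × Fin n) ℂ) (Set.range f) := by
      rw [hf]
      exact hP.lieDer_mem_vanishing (B m).2 (hfP k)
    obtain ⟨a, ha⟩ := (Submodule.mem_span_range_iff_exists_fun (MvPolynomial (Fin n × Fin n) ℂ)).1 h1
    exact ⟨a, ha.symm⟩
  choose a ha using hder
  -- linear functions extending the coordinates with respect to the basis `B` of the Lie algebra
  obtain ⟨α, hα⟩ := LinearMap.exists_extend B.equivFun.toLinearMap
  have hAα : ∀ t ∈ Set.Icc 0 T, A t = ∑ m, α (A t) m • (B m).1 := by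
    intro t ht
    have h1 : α (A t) = B.equivFun ⟨A t, hA t ht⟩ :=
      LinearMap.congr_fun hα (⟨A t, hA t ht⟩ : lieAlgC P)
    have h2 := congrArg Subtype.val (B.sum_equivFun ⟨A t, hA t ht⟩)
    rw [h1]
    refine h2.symm.trans ?_
    rw [AddSubmonoidClass.coe_finsetSum]
    rfl
  have hαc : ContinuousOn (fun t => α (A t)) (Set.Icc 0 T) :=
    (LinearMap.continuous_of_finiteDimensional α).comp_continuousOn hAc
  have hgc : ∀ q : MvPolynomial (Fin n × Fin n) ℂ,
      ContinuousOn (fun t => polyVal q (g t)) (Set.Icc 0 T) := fun q t ht =>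
    (hasDerivAt_polyVal q (hg t ht)).continuousAt.continuousWithinAt
  -- the matrix of the linear system satisfied by the functions `t ↦ f_k (g t)`
  let M : ℝ → Matrix (Fin r) (Fin r) ℂ := fun t => Matrix.of fun k l =>
    ∑ m, α (A t) m * polyVal (a m k l) (g t)
  have hM : ContinuousOn M (Set.Icc 0 T) :=
    continuousOn_pi.2 fun k => continuousOn_pi.2 fun l =>
      continuousOn_finsetSum Finset.univ fun m _ =>
        (continuousOn_pi.1 hαc m).fun_mul (hgc (a m k l))
  have hu : ∀ t ∈ Set.Icc 0 T, (fun k => polyVal (f k) (g t)) = 0 := by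
    refine eq_zero_of_linear_ode (u := fun t k => polyVal (f k) (g t)) hM ?_ ?_
    · intro t ht k
      refine (hasDerivAt_polyVal (f k) (hg t ht)).congr_deriv ?_
      conv_lhs => rw [hAα t ht]
      rw [lieDer_sum_smul]
      have e : ∀ m, polyVal (lieDer (B m).1 (f k)) (g t) =
          ∑ l, polyVal (a m k l) (g t) * polyVal (f l) (g t) := by
        intro m
        rw [ha, polyVal, map_sum]
        exact Finset.sum_congr rfl fun l _ => map_mul _ _ _
      simp only [e, Finset.mul_sum, Matrix.mulVec, dotProduct, M, Matrix.of_apply, Finset.sum_mul,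
        mul_assoc]
      exact Finset.sum_comm
    · funext k
      change polyVal (f k) (g 0) = 0
      rw [h0]
      exact hfP k 1 P.one_mem
  refine hP.mem_of_vanishing fun q hq => ?_
  rw [hh]
  rw [← hf] at hq
  obtain ⟨b, rfl⟩ := (Submodule.mem_span_range_iff_exists_fun (MvPolynomial (Fin n × Fin n) ℂ)).1 hq
  rw [polyVal, map_sum]
  refine Finset.sum_eq_zero fun l _ => ?_
  rw [smul_eq_mul, map_mul]
  have : polyVal (f l) (g t) = 0 := congrFun (hu t ht) l
  rw [polyVal] at this
  rw [this, mul_zero]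

end LieAlgebra

/-! ### Mumford–Tate groups and the weight filtration -/

section Groups

variable {n : ℕ} {W : ℤ → Submodule ℚ (Fin n → ℚ)} {F : Fil n}

/-- An intersection of algebraic `ℚ`-groups is defined by all rational polynomials vanishing on it.
-/
theorem isRatAlgebraic_sInf {S : Set (Subgroup (GL (Fin n) ℂ))}
    (hS : ∀ H ∈ S, IsRatAlgebraic H) : IsRatAlgebraic (sInf S) := by
  refine ⟨{f | ∀ g ∈ sInf S, MvPolynomial.aeval (fun ij => g.1 ij.1 ij.2) f = 0}, fun g =>
    ⟨fun hg f hf => hf g hg, fun hg => Subgroup.mem_sInf.2 fun H hH => ?_⟩⟩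
  obtain ⟨I, hI⟩ := hS H hH
  exact (hI g).2 fun f hf => hg f fun g' hg' => (hI g').1 (Subgroup.mem_sInf.1 hg' H hH) f hf

theorem IsRatAlgebraic.inf {H H' : Subgroup (GL (Fin n) ℂ)} (hH : IsRatAlgebraic H)
    (hH' : IsRatAlgebraic H') : IsRatAlgebraic (H ⊓ H') := by
  rw [← sInf_pair]
  refine isRatAlgebraic_sInf ?_
  rintro _ (rfl | rfl)
  exacts [hH, hH']

theorem mumfordTate_isRatAlgebraic (W : ℤ → Submodule ℚ (Fin n → ℚ)) (F : Fil n) :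
    IsRatAlgebraic (mumfordTate W F) :=
  isRatAlgebraic_sInf fun _ h => h.1

theorem IsTorusElement.mem_mumfordTate {z w : ℂˣ} {g : GL (Fin n) ℂ}
    (hg : IsTorusElement W F z w g) : g ∈ mumfordTate W F :=
  Subgroup.mem_sInf.2 fun _ h => h.2 z w g hg

theorem mumfordTate_le {H : Subgroup (GL (Fin n) ℂ)} (hH : IsRatAlgebraic H)
    (h : ∀ z w g, IsTorusElement W F z w g → g ∈ H) : mumfordTate W F ≤ H :=
  sInf_le ⟨hH, h⟩

/-- A rational subspace is the zero set of the linear forms vanishing on it. -/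
theorem mem_of_forall_annihilator {U : Submodule ℚ (Fin n → ℚ)} {w : Fin n → ℚ}
    (hw : ∀ ℓ : Fin n → ℚ, (∀ u ∈ U, ∑ i, ℓ i * u i = 0) → ∑ i, ℓ i * w i = 0) : w ∈ U := by
  by_contra h
  obtain ⟨f, hfw, hfU⟩ := Submodule.exists_le_ker_of_notMem h
  have hf : ∀ u, f u = ∑ i, f (Pi.single i 1) * u i := by
    intro u
    conv_lhs => rw [← Finset.univ_sum_single u, map_sum]
    refine Finset.sum_congr rfl fun i _ => ?_
    have : Pi.single i (u i) = u i • (Pi.single i 1 : Fin n → ℚ) := by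
      rw [← Pi.single_smul, smul_eq_mul, mul_one]
    rw [this, map_smul, smul_eq_mul, mul_comm]
  refine hfw ?_
  rw [hf]
  exact hw _ fun u hu => by rw [← hf]; exact hfU hu

/-- The complexification of a rational subspace is cut out by the rational linear forms vanishing
on the subspace. -/
theorem mem_complexify_iff {U : Submodule ℚ (Fin n → ℚ)} {v : Fin n → ℂ} :
    v ∈ complexify U ↔
      ∀ ℓ : Fin n → ℚ, (∀ u ∈ U, ∑ i, ℓ i * u i = 0) → ∑ i, (ℓ i : ℂ) * v i = 0 := by
  constructor
  · intro hv ℓ hℓ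
    induction hv using Submodule.span_induction with
    | mem v hv =>
      obtain ⟨u, hu, rfl⟩ := hv
      dsimp only
      exact_mod_cast hℓ u hu
    | zero => simp
    | add v w _ _ hv hw => simp [mul_add, Finset.sum_add_distrib, hv, hw]
    | smul c v _ hv =>
      have : ∑ i, (ℓ i : ℂ) * (c • v) i = c * ∑ i, (ℓ i : ℂ) * v i := by
        rw [Finset.mul_sum]
        exact Finset.sum_congr rfl fun i _ => by simp; ring
      rw [this, hv, mul_zero]
  · intro hv
    obtain ⟨s, w, hw, hℓ⟩ := exists_rational_expansion v
    have e : v = ∑ b ∈ s, b • (fun i => (w b i : ℂ)) := by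
      funext i
      rw [hw i, Finset.sum_apply]
      rfl
    rw [e]
    refine sum_mem fun b hb => Submodule.smul_mem _ _ (Submodule.subset_span ⟨w b, ?_, rfl⟩)
    exact mem_of_forall_annihilator fun ℓ h => hℓ ℓ (hv ℓ h) b hb

/-- The condition that a matrix maps one rational subspace into another is given by rational linear
equations in its entries. -/
theorem mulVec_mem_complexify_iff {U U' : Submodule ℚ (Fin n → ℚ)}
    {A : Matrix (Fin n) (Fin n) ℂ} :
    (∀ v ∈ complexify U, A *ᵥ v ∈ complexify U') ↔
      ∀ u ∈ U, ∀ ℓ : Fin n → ℚ, (∀ u' ∈ U', ∑ i, ℓ i * u' i = 0) →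
        ∑ ij : Fin n × Fin n, (ℓ ij.1 : ℂ) * (u ij.2 : ℂ) * A ij.1 ij.2 = 0 := by
  have key : ∀ (u ℓ : Fin n → ℚ),
      ∑ ij : Fin n × Fin n, (ℓ ij.1 : ℂ) * (u ij.2 : ℂ) * A ij.1 ij.2 =
        ∑ i, (ℓ i : ℂ) * (A *ᵥ fun i => (u i : ℂ)) i := by
    intro u ℓ
    rw [Fintype.sum_prod_type]
    refine Finset.sum_congr rfl fun i _ => ?_
    rw [Matrix.mulVec, dotProduct, Finset.mul_sum]
    exact Finset.sum_congr rfl fun j _ => by ring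
  constructor
  · intro h u hu ℓ hℓ
    rw [key]
    exact mem_complexify_iff.1 (h _ (Submodule.subset_span ⟨u, hu, rfl⟩)) ℓ hℓ
  · intro h v hv
    have : complexify U ≤ (complexify U').comap A.mulVecLin := by
      refine Submodule.span_le.2 ?_
      rintro _ ⟨u, hu, rfl⟩
      refine mem_complexify_iff.2 fun ℓ hℓ => ?_
      rw [Matrix.mulVecLin_apply, ← key]
      exact h u hu ℓ hℓ
    exact this hv

theorem inv_mulVec_mem {U : Submodule ℂ (Fin n → ℂ)} {g : GL (Fin n) ℂ}
    (hg : ∀ v ∈ U, g.1 *ᵥ v ∈ U) : ∀ v ∈ U, g⁻¹.1 *ᵥ v ∈ U := by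
  have hinv : ∀ v, g⁻¹.1 *ᵥ (g.1 *ᵥ v) = v := fun v => by
    rw [Matrix.mulVec_mulVec, show g⁻¹.1 * g.1 = 1 from g.inv_mul, Matrix.one_mulVec]
  have hinj : Function.Injective g.1.mulVecLin := fun v w h => by
    rw [← hinv v, ← hinv w]
    exact congrArg (fun u => g⁻¹.1 *ᵥ u) h
  have h1 : U.map g.1.mulVecLin = U := by
    refine Submodule.eq_of_le_of_finrank_eq (Submodule.map_le_iff_le_comap.2 hg) ?_
    exact (U.equivMapOfInjective _ hinj).finrank_eq.symm
  intro v hv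
  rw [← h1] at hv
  obtain ⟨u, hu, rfl⟩ := hv
  rw [Matrix.mulVecLin_apply, hinv]
  exact hu

/-- The stabilizer in `GL_n` of the weight filtration. -/
def weightStab (W : ℤ → Submodule ℚ (Fin n → ℚ)) : Subgroup (GL (Fin n) ℂ) where
  carrier := {g | ∀ k, ∀ v ∈ complexify (W k), g.1 *ᵥ v ∈ complexify (W k)}
  mul_mem' := by
    intro g h hg hh k v hv
    rw [Units.val_mul, ← Matrix.mulVec_mulVec]
    exact hg k _ (hh k v hv)
  one_mem' := fun k v hv => by simpa using hv
  inv_mem' := fun {g} hg k => inv_mulVec_mem (hg k)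

/-- The subgroup of the stabilizer of the weight filtration acting trivially on its graded
pieces. -/
def weightUnipotent (W : ℤ → Submodule ℚ (Fin n → ℚ)) : Subgroup (GL (Fin n) ℂ) where
  carrier := {g | g ∈ weightStab W ∧
    ∀ k, ∀ v ∈ complexify (W k), (g.1 - 1) *ᵥ v ∈ complexify (W (k - 1))}
  mul_mem' := by
    rintro g h ⟨hg, hg'⟩ ⟨hh, hh'⟩
    refine ⟨mul_mem hg hh, fun k v hv => ?_⟩
    have : ((g * h).1 - 1) *ᵥ v = g.1 *ᵥ ((h.1 - 1) *ᵥ v) + (g.1 - 1) *ᵥ v := by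
      rw [Matrix.mulVec_mulVec, ← Matrix.add_mulVec, Units.val_mul]
      congr 1
      noncomm_ring
    rw [this]
    exact add_mem (hg _ _ (hh' k v hv)) (hg' k v hv)
  one_mem' := ⟨one_mem _, fun k v hv => by simp⟩
  inv_mem' := by
    rintro g ⟨hg, hg'⟩
    refine ⟨inv_mem hg, fun k v hv => ?_⟩
    have : (g⁻¹.1 - 1) *ᵥ v = -(g⁻¹.1 *ᵥ ((g.1 - 1) *ᵥ v)) := by
      rw [Matrix.mulVec_mulVec, mul_sub, show g⁻¹.1 * g.1 = 1 from g.inv_mul, mul_one,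
        ← Matrix.neg_mulVec, neg_sub]
    rw [this]
    exact neg_mem ((inv_mem hg) _ _ (hg' k v hv))

/-- The polynomial `∑ ℓ_i u_j X_{ij}`. -/
def linForm (ℓ u : Fin n → ℚ) : MvPolynomial (Fin n × Fin n) ℚ :=
  ∑ ij : Fin n × Fin n, MvPolynomial.C (ℓ ij.1 * u ij.2) * MvPolynomial.X ij

theorem aeval_linForm (ℓ u : Fin n → ℚ) (A : Matrix (Fin n) (Fin n) ℂ) :
    MvPolynomial.aeval (fun ij => A ij.1 ij.2) (linForm ℓ u) =
      ∑ ij : Fin n × Fin n, (ℓ ij.1 : ℂ) * (u ij.2 : ℂ) * A ij.1 ij.2 := by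
  simp [linForm]

theorem polyDer_linForm (ℓ u : Fin n → ℚ) (g A : Matrix (Fin n) (Fin n) ℂ) :
    polyDer (MvPolynomial.map (algebraMap ℚ ℂ) (linForm ℓ u)) g A =
      ∑ ij : Fin n × Fin n, (ℓ ij.1 : ℂ) * (u ij.2 : ℂ) * A ij.1 ij.2 := by
  classical
  refine Finset.sum_congr rfl fun ij _ => ?_
  simp [linForm, polyVal, MvPolynomial.pderiv_X, Pi.single_apply, mul_comm]

theorem weightStab_isRatAlgebraic (W : ℤ → Submodule ℚ (Fin n → ℚ)) :
    IsRatAlgebraic (weightStab W) := by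
  refine ⟨{f | ∃ k, ∃ u ∈ W k, ∃ ℓ : Fin n → ℚ, (∀ u' ∈ W k, ∑ i, ℓ i * u' i = 0) ∧
    f = linForm ℓ u}, fun g => ?_⟩
  constructor
  · rintro hg _ ⟨k, u, hu, ℓ, hℓ, rfl⟩
    rw [aeval_linForm]
    exact mulVec_mem_complexify_iff.1 (hg k) u hu ℓ hℓ
  · intro hg k
    refine mulVec_mem_complexify_iff.2 fun u hu ℓ hℓ => ?_
    rw [← aeval_linForm]
    exact hg _ ⟨k, u, hu, ℓ, hℓ, rfl⟩

/-- In addition to the equations of `weightStab W`, the group is defined by the inhomogeneous linear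
equations expressing that `g - 1` maps `W_k` into `W_{k-1}`. -/
theorem weightUnipotent_isRatAlgebraic (W : ℤ → Submodule ℚ (Fin n → ℚ)) :
    IsRatAlgebraic (weightUnipotent W) := by
  obtain ⟨I, hI⟩ := weightStab_isRatAlgebraic W
  have key : ∀ (ℓ u : Fin n → ℚ) (g : Matrix (Fin n) (Fin n) ℂ),
      MvPolynomial.aeval (fun ij => g ij.1 ij.2) (linForm ℓ u - MvPolynomial.C
        (∑ i, ℓ i * u i)) =
      ∑ ij : Fin n × Fin n, (ℓ ij.1 : ℂ) * (u ij.2 : ℂ) * (g - 1) ij.1 ij.2 := by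
    intro ℓ u g
    rw [map_sub, aeval_linForm]
    simp only [Matrix.sub_apply, mul_sub, Finset.sum_sub_distrib]
    congr 1
    rw [Fintype.sum_prod_type]
    simp [Matrix.one_apply]
  refine ⟨I ∪ {f | ∃ k, ∃ u ∈ W k, ∃ ℓ : Fin n → ℚ,
    (∀ u' ∈ W (k - 1), ∑ i, ℓ i * u' i = 0) ∧
    f = linForm ℓ u - MvPolynomial.C (∑ i, ℓ i * u i)}, fun g => ?_⟩
  constructor
  · rintro hg f (hf | ⟨k, u, hu, ℓ, hℓ, rfl⟩)
    · exact (hI g).1 hg.1 f hf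
    · rw [key]
      exact mulVec_mem_complexify_iff.1 (hg.2 k) u hu ℓ hℓ
  · intro hg
    refine ⟨(hI g).2 fun f hf => hg f (Or.inl hf), fun k => ?_⟩
    refine mulVec_mem_complexify_iff.2 fun u hu ℓ hℓ => ?_
    rw [← key]
    exact hg _ (Or.inr ⟨k, u, hu, ℓ, hℓ, rfl⟩)

theorem isNilpotent_of_mem_weightUnipotent (h : IsMHS W F) {g : GL (Fin n) ℂ}
    (hg : g ∈ weightUnipotent W) : IsNilpotent (g.1 - 1) := by
  obtain ⟨a, ha⟩ := h.W_bot
  obtain ⟨b, hb⟩ := h.W_top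
  have key : ∀ (m : ℕ) (v : Fin n → ℂ), (g.1 - 1) ^ m *ᵥ v ∈ complexify (W (b - m)) := by
    intro m
    induction m with
    | zero => intro v; simp [hb, complexify_top]
    | succ m ih =>
      intro v
      rw [pow_succ', ← Matrix.mulVec_mulVec]
      have := hg.2 _ _ (ih v)
      rwa [show b - (m : ℤ) - 1 = b - ((m + 1 : ℕ) : ℤ) by push_cast; ring] at this
  refine ⟨(b - a).toNat, ?_⟩
  have hz : ∀ v, (g.1 - 1) ^ (b - a).toNat *ᵥ v = 0 := by
    intro v
    have h1 := key (b - a).toNat v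
    have h2 := complexify_mono (h.W_mono (show b - ((b - a).toNat : ℤ) ≤ a by omega)) h1
    rwa [ha, complexify_bot, Submodule.mem_bot] at h2
  exact Matrix.mulVec_injective (funext fun v => by rw [hz, Matrix.zero_mulVec])

variable {P : Subgroup (GL (Fin n) ℂ)}

/-- The elements of `P` acting trivially on the graded pieces form a normal unipotent subgroup,
which lies in the unipotent radical. -/
theorem IsRatAlgebraic.inf_weightUnipotent_le (hP : IsRatAlgebraic P) (hPW : P ≤ weightStab W)
    (h : IsMHS W F) : P ⊓ weightUnipotent W ≤ unipotentRadical P := by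
  refine le_sSup ⟨inf_le_left, hP.inf (weightUnipotent_isRatAlgebraic W), ?_,
    fun g hg => isNilpotent_of_mem_weightUnipotent h hg.2⟩
  rintro g hg u ⟨hu, hu'⟩
  refine ⟨P.mul_mem (P.mul_mem hg hu) (P.inv_mem hg),
    mul_mem (mul_mem (hPW hg) hu'.1) (inv_mem (hPW hg)), fun k v hv => ?_⟩
  have : ((g * u * g⁻¹).1 - 1) *ᵥ v = g.1 *ᵥ ((u.1 - 1) *ᵥ (g⁻¹.1 *ᵥ v)) := by
    rw [Matrix.mulVec_mulVec, Matrix.mulVec_mulVec, Units.val_mul, Units.val_mul, mul_sub, mul_one,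
      sub_mul, show g.1 * g⁻¹.1 = 1 from g.mul_inv]
  rw [this]
  exact hPW hg _ _ (hu'.2 _ _ (hPW (P.inv_mem hg) _ _ hv))

theorem unipotentRadical_le (P : Subgroup (GL (Fin n) ℂ)) : unipotentRadical P ≤ P :=
  sSup_le fun _ h => h.1

theorem realUnipotent_le (P : Subgroup (GL (Fin n) ℂ)) : realUnipotent P ≤ P :=
  sup_le inf_le_left (unipotentRadical_le P)

/-- The equations of the stabilizer of the weight filtration are linear, so the Lie algebra
satisfies them as well. -/
theorem IsRatAlgebraic.lieAlgC_le_endW (hP : IsRatAlgebraic P) (hPW : P ≤ weightStab W) :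
    lieAlgC P ≤ endW W := by
  intro A hA k
  refine mulVec_mem_complexify_iff.2 fun u hu ℓ hℓ => ?_
  rw [← polyDer_linForm ℓ u 1 A]
  refine hP.mem_lieAlgC_iff.1 hA _ fun g hg => ?_
  rw [polyVal_map, aeval_linForm]
  exact mulVec_mem_complexify_iff.1 (hPW hg k) u hu ℓ hℓ

namespace IsAdapted

variable {β : Matrix (Fin n) (Fin n) ℂ} {p q : Fin n → ℤ}

theorem inv_mul_torus (h : IsAdapted W F β p q) {z w : ℂˣ} {g : GL (Fin n) ℂ}
    (hg : IsTorusElement W F z w g) : β⁻¹ * g.1 * β =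
      Matrix.diagonal fun i => (z : ℂ) ^ (-p i) * (w : ℂ) ^ (-q i) := by
  rw [h.isTorusElement_iff.1 hg, Matrix.mul_assoc, Matrix.mul_assoc, Matrix.nonsing_inv_mul _ h.det,
    Matrix.mul_one, ← Matrix.mul_assoc, Matrix.nonsing_inv_mul _ h.det, Matrix.one_mul]

theorem exists_isTorusElement (h : IsAdapted W F β p q) (z w : ℂˣ) :
    ∃ g : GL (Fin n) ℂ, IsTorusElement W F z w g := by
  let D := Matrix.diagonal (fun i => (z : ℂ) ^ (-p i) * (w : ℂ) ^ (-q i))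
  have hD : IsUnit D.det := by
    rw [Matrix.det_diagonal, isUnit_iff_ne_zero, Finset.prod_ne_zero_iff]
    intro i _
    exact mul_ne_zero (zpow_ne_zero _ z.ne_zero) (zpow_ne_zero _ w.ne_zero)
  have hu : IsUnit (β * D * β⁻¹) := by
    rw [Matrix.isUnit_iff_isUnit_det, Matrix.det_mul, Matrix.det_mul]
    exact (h.det.mul hD).mul (Matrix.isUnit_nonsing_inv_det _ h.det)
  exact ⟨hu.unit, h.isTorusElement_iff.2 rfl⟩

end IsAdapted

theorem mumfordTate_le_weightStab (h : IsMHS W F) : mumfordTate W F ≤ weightStab W := by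
  obtain ⟨β, p, q, hβ⟩ := h.exists_isAdapted
  refine mumfordTate_le (weightStab_isRatAlgebraic W) fun z w g hg => ?_
  have := (hβ.forall_mulVec_mem_iff (k := 0) (A := g.1)).2 (fun i j hij => by
    rw [hβ.inv_mul_torus hg, Matrix.diagonal_apply_ne]
    rintro rfl
    omega)
  exact fun k v hv => by simpa using this k v hv

end Groups

/-! ### Differentiation of matrix-valued functions -/

section MatrixCurves

variable {ι : Type*} [Fintype ι] [DecidableEq ι]

section

variable {𝕜 G : Type*} [NontriviallyNormedField 𝕜] [NormedAlgebra 𝕜 ℂ] [NormedAddCommGroup G]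
  [NormedSpace 𝕜 G] {e : G → Matrix ι ι ℂ} {x : G}

omit [Fintype ι] [DecidableEq ι] in
theorem differentiableAt_finsetProd_complex {s : Finset ι} {h : ι → G → ℂ}
    (hh : ∀ i, DifferentiableAt 𝕜 (h i) x) : DifferentiableAt 𝕜 (fun y => ∏ i ∈ s, h i y) x := by
  classical
  induction s using Finset.induction_on with
  | empty => simp
  | insert i s hi ih =>
    simp only [Finset.prod_insert hi]
    exact (hh i).fun_mul ih

theorem differentiableAt_matrix_det (he : ∀ i j, DifferentiableAt 𝕜 (fun s => e s i j) x) :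
    DifferentiableAt 𝕜 (fun s => (e s).det) x := by
  simp only [Matrix.det_apply']
  exact DifferentiableAt.fun_sum fun σ _ => (differentiableAt_const _).fun_mul
    (differentiableAt_finsetProd_complex fun k => he _ _)

theorem differentiableAt_matrix_inv (he : ∀ i j, DifferentiableAt 𝕜 (fun s => e s i j) x)
    (hx : IsUnit (e x).det) (i j : ι) : DifferentiableAt 𝕜 (fun s => (e s)⁻¹ i j) x := by
  simp only [Matrix.inv_def, Matrix.smul_apply, smul_eq_mul, Matrix.adjugate_apply,
    Ring.inverse_eq_inv']
  refine ((differentiableAt_matrix_det he).fun_inv hx.ne_zero).fun_mul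
    (differentiableAt_matrix_det fun k l => ?_)
  by_cases hk : k = j
  · subst hk
    simp only [Matrix.updateRow_self]
    exact differentiableAt_const _
  · simp only [Matrix.updateRow_ne hk]
    exact he k l

omit [DecidableEq ι] in
theorem differentiableAt_matrix_mul {e' : G → Matrix ι ι ℂ}
    (he : ∀ i j, DifferentiableAt 𝕜 (fun s => e s i j) x)
    (he' : ∀ i j, DifferentiableAt 𝕜 (fun s => e' s i j) x) (i j : ι) :
    DifferentiableAt 𝕜 (fun s => (e s * e' s) i j) x := by
  simp only [Matrix.mul_apply]
  exact DifferentiableAt.fun_sum fun k _ => (he i k).fun_mul (he' k j)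

end

/-- Entrywise derivatives of curves of complex matrices. -/
def HasMatDerivAt (c : ℝ → Matrix ι ι ℂ) (c' : Matrix ι ι ℂ) (t : ℝ) : Prop :=
  ∀ i j, HasDerivAt (fun s => c s i j) (c' i j) t

variable {c d : ℝ → Matrix ι ι ℂ} {c' d' : Matrix ι ι ℂ} {t : ℝ}

omit [Fintype ι] [DecidableEq ι] in
theorem hasMatDerivAt_const (A : Matrix ι ι ℂ) (t : ℝ) : HasMatDerivAt (fun _ => A) 0 t :=
  fun _ _ => hasDerivAt_const _ _

omit [Fintype ι] [DecidableEq ι] in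
theorem HasMatDerivAt.unique (hc : HasMatDerivAt c c' t) (hd : HasMatDerivAt c d' t) : c' = d' :=
  Matrix.ext fun i j => (hc i j).unique (hd i j)

omit [DecidableEq ι] in
theorem HasMatDerivAt.mul (hc : HasMatDerivAt c c' t) (hd : HasMatDerivAt d d' t) :
    HasMatDerivAt (fun s => c s * d s) (c' * d t + c t * d') t := by
  intro i j
  simp only [Matrix.mul_apply, Matrix.add_apply, ← Finset.sum_add_distrib]
  exact HasDerivAt.fun_sum fun k _ => (hc i k).fun_mul (hd k j)

omit [DecidableEq ι] in
theorem HasMatDerivAt.mulVec (hc : HasMatDerivAt c c' t) {v : ℝ → ι → ℂ} {v' : ι → ℂ}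
    (hv : HasDerivAt v v' t) :
    HasDerivAt (fun s => c s *ᵥ v s) (c' *ᵥ v t + c t *ᵥ v') t := by
  rw [hasDerivAt_pi] at hv ⊢
  intro i
  simp only [Matrix.mulVec, dotProduct, Pi.add_apply, ← Finset.sum_add_distrib]
  exact HasDerivAt.fun_sum fun k _ => (hc i k).fun_mul (hv k)

theorem HasMatDerivAt.inv (hc : HasMatDerivAt c c' t) (ht : IsUnit (c t).det) :
    HasMatDerivAt (fun s => (c s)⁻¹) (-((c t)⁻¹ * c' * (c t)⁻¹)) t := by
  have hdiff : ∀ i j, DifferentiableAt ℝ (fun s => (c s)⁻¹ i j) t :=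
    differentiableAt_matrix_inv (fun i j => (hc i j).differentiableAt) ht
  let m : Matrix ι ι ℂ := Matrix.of fun i j => deriv (fun s => (c s)⁻¹ i j) t
  have hm : HasMatDerivAt (fun s => (c s)⁻¹) m t := fun i j => (hdiff i j).hasDerivAt
  have hunit : ∀ᶠ s in 𝓝 t, IsUnit (c s).det := by
    have := (differentiableAt_matrix_det
      fun i j => (hc i j).differentiableAt).continuousAt.eventually_ne ht.ne_zero
    filter_upwards [this] with s hs using hs.isUnit
  have h1 : HasMatDerivAt (fun s => (c s)⁻¹ * c s) 0 t := by
    intro i j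
    refine (hasDerivAt_const t ((1 : Matrix ι ι ℂ) i j)).congr_of_eventuallyEq ?_
    filter_upwards [hunit] with s hs
    rw [Matrix.nonsing_inv_mul _ hs]
  have h2 := (hm.mul hc).unique h1
  have h3 : m = -((c t)⁻¹ * c' * (c t)⁻¹) := by
    rw [add_eq_zero_iff_eq_neg] at h2
    have := congrArg (· * (c t)⁻¹) h2
    simpa [Matrix.mul_assoc, Matrix.mul_nonsing_inv _ ht] using this
  rw [← h3]
  exact hm

/-- The derivative of a curve in a linear subspace lies in that subspace. -/
theorem mem_of_hasDerivAt {n : ℕ} {U : Submodule ℂ (Fin n → ℂ)} {γ : ℝ → Fin n → ℂ}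
    {γ' : Fin n → ℂ} {t : ℝ} (h : HasDerivAt γ γ' t) (hU : ∀ᶠ s in 𝓝 t, γ s ∈ U) : γ' ∈ U := by
  have hclosed : IsClosed (U : Set (Fin n → ℂ)) := U.closed_of_finiteDimensional
  refine hclosed.mem_of_tendsto (hasDerivAt_iff_tendsto_slope.1 h) ?_
  filter_upwards [hU.filter_mono nhdsWithin_le_nhds] with s hs
  exact Submodule.smul_of_tower_mem _ _ (sub_mem hs hU.self_of_nhds)

end MatrixCurves

/-! ### Differentials of holomorphic families of filtrations -/

section Manifolds

variable {E : Type*} [NormedAddCommGroup E] [NormedSpace ℂ E]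
  {M : Type*} [TopologicalSpace M] [ChartedSpace E M] [IsManifold 𝓘(ℂ, E) 1 M] {n : ℕ}

/-- Differentiability is tested in a chart. -/
theorem mdifferentiableAt_iff_chart {G : Type*} [NormedAddCommGroup G] [NormedSpace ℂ G]
    {s : M → G} {x y : M} (hy : y ∈ (chartAt E x).source) :
    MDifferentiableAt 𝓘(ℂ, E) 𝓘(ℂ, G) s y ↔
      DifferentiableAt ℂ (s ∘ (chartAt E x).symm) (chartAt E x y) := by
  have hφ := mdifferentiable_chart (I := 𝓘(ℂ, E)) (H := E) x
  constructor
  · intro h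
    rw [← mdifferentiableAt_iff_differentiableAt]
    refine MDifferentiableAt.comp_of_eq _ h ?_ ((chartAt E x).left_inv hy)
    exact hφ.mdifferentiableAt_symm ((chartAt E x).map_source hy)
  · intro h
    rw [← mdifferentiableAt_iff_differentiableAt] at h
    refine (h.comp y (hφ.mdifferentiableAt hy)).congr_of_eventuallyEq ?_
    filter_upwards [(chartAt E x).open_source.mem_nhds hy] with z hz
    simp only [Function.comp_apply, (chartAt E x).left_inv hz]

theorem mfderiv_eq_chart {G : Type*} [NormedAddCommGroup G] [NormedSpace ℂ G]
    {s : M → G} {x y : M} (hy : y ∈ (chartAt E x).source)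
    (hs : MDifferentiableAt 𝓘(ℂ, E) 𝓘(ℂ, G) s y) (v : TangentSpace 𝓘(ℂ, E) y) :
    (mfderiv 𝓘(ℂ, E) 𝓘(ℂ, G) s y v : G) = fderiv ℂ (s ∘ (chartAt E x).symm) (chartAt E x y)
      ((mdifferentiable_chart (I := 𝓘(ℂ, E)) (H := E) x).mfderiv hy v) := by
  have hφ := mdifferentiable_chart (I := 𝓘(ℂ, E)) (H := E) x
  have h1 := mdifferentiableAt_iff_differentiableAt.2 ((mdifferentiableAt_iff_chart hy).1 hs)
  have h2 : s =ᶠ[𝓝 y] (s ∘ (chartAt E x).symm) ∘ chartAt E x := by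
    filter_upwards [(chartAt E x).open_source.mem_nhds hy] with z hz
    simp only [Function.comp_apply, (chartAt E x).left_inv hz]
  have h3 := (h1.hasMFDerivAt.comp y (hφ.mdifferentiableAt hy).hasMFDerivAt).congr_of_eventuallyEq h2
  refine (congrArg (fun L : E →L[ℂ] G => L v) h3.mfderiv).trans ?_
  rw [mfderiv_eq_fderiv]
  rfl

/-- Every tangent vector of a complex manifold is the velocity of a real curve. -/
theorem exists_curve (x : M) (v : TangentSpace 𝓘(ℂ, E) x) :
    ∃ c : ℝ → M, c 0 = x ∧ ContinuousAt c 0 ∧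
      (∀ s : M → ℂ, MDifferentiableAt 𝓘(ℂ, E) 𝓘(ℂ, ℂ) s x →
        HasDerivAt (fun t => s (c t)) (mfderiv 𝓘(ℂ, E) 𝓘(ℂ, ℂ) s x v : ℂ) 0) ∧
      ∀ s : M → Fin n → ℂ, MDifferentiableAt 𝓘(ℂ, E) 𝓘(ℂ, Fin n → ℂ) s x →
        HasDerivAt (fun t => s (c t)) (mfderiv 𝓘(ℂ, E) 𝓘(ℂ, Fin n → ℂ) s x v : Fin n → ℂ) 0 := by
  have hx := mem_chart_source E x
  set w : E := (mdifferentiable_chart (I := 𝓘(ℂ, E)) (H := E) x).mfderiv hx v with hw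
  let ℓ : ℝ → E := fun t => chartAt E x x + (t : ℂ) • w
  have hℓ0 : ℓ 0 = chartAt E x x := by simp [ℓ]
  have hℓ : HasDerivAt ℓ w 0 := by
    have h1 : HasDerivAt (fun t : ℝ => (t : ℂ)) 1 0 := Complex.ofRealCLM.hasDerivAt
    have h2 := (h1.smul_const w).const_add (chartAt E x x)
    rwa [one_smul] at h2
  have key : ∀ {G : Type} [NormedAddCommGroup G] [NormedSpace ℂ G] (s : M → G),
      MDifferentiableAt 𝓘(ℂ, E) 𝓘(ℂ, G) s x →
        HasDerivAt (fun t => s ((chartAt E x).symm (ℓ t)))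
          (mfderiv 𝓘(ℂ, E) 𝓘(ℂ, G) s x v : G) 0 := by
    intro G _ _ s hs
    rw [mfderiv_eq_chart hx hs v]
    have h1 := ((mdifferentiableAt_iff_chart hx).1 hs).hasFDerivAt.restrictScalars ℝ
    rw [← hℓ0] at h1 ⊢
    exact h1.comp_hasDerivAt 0 hℓ
  refine ⟨fun t => (chartAt E x).symm (ℓ t), ?_, ?_, fun s hs => key s hs, fun s hs => key s hs⟩
  · change (chartAt E x).symm (ℓ 0) = x
    rw [hℓ0, (chartAt E x).left_inv hx]
  · refine ContinuousAt.comp ?_ hℓ.continuousAt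
    rw [hℓ0]
    exact (chartAt E x).continuousAt_symm ((chartAt E x).map_source hx)

variable {f : M → Fil n} {x : M} {g g' : M → Matrix (Fin n) (Fin n) ℂ}

omit [IsManifold 𝓘(ℂ, E) 1 M] in
theorem IsHolFrame.mdifferentiableAt (hg : IsHolFrame E f x g) (i j : Fin n) :
    MDifferentiableAt 𝓘(ℂ, E) 𝓘(ℂ, ℂ) (fun y => g y i j) x :=
  hg.2.1.self_of_nhds i j

theorem IsHolFrame.exists_curve (hg : IsHolFrame E f x g) (hg' : IsHolFrame E f x g')
    (v : TangentSpace 𝓘(ℂ, E) x) :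
    ∃ c : ℝ → M, c 0 = x ∧ ContinuousAt c 0 ∧
      HasMatDerivAt (fun t => g (c t)) (matrixDeriv E g x v) 0 ∧
      HasMatDerivAt (fun t => g' (c t)) (matrixDeriv E g' x v) 0 := by
  obtain ⟨c, h0, hc, h1, -⟩ := _root_.exists_curve (n := 0) x v
  exact ⟨c, h0, hc, fun i j => h1 _ (hg.mdifferentiableAt i j),
    fun i j => h1 _ (hg'.mdifferentiableAt i j)⟩

theorem HasMatDerivAt.eventually_isUnit_det {c : ℝ → Matrix (Fin n) (Fin n) ℂ}
    {c' : Matrix (Fin n) (Fin n) ℂ} {t : ℝ} (hc : HasMatDerivAt c c' t) (ht : IsUnit (c t).det) :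
    ∀ᶠ s in 𝓝 t, IsUnit (c s).det := by
  have hcont : ContinuousAt (fun s => (c s).det) t := by
    simp only [Matrix.det_apply']
    exact tendsto_finsetSum _ fun σ _ => tendsto_const_nhds.mul
      (tendsto_finsetProd _ fun k _ => (hc _ _).continuousAt)
  filter_upwards [hcont.eventually_ne ht.ne_zero] with s hs using hs.isUnit

/-- The derivative of a curve of matrices preserving the filtration preserves it. -/
theorem mem_endF_of_hasMatDerivAt {F : Fil n} {c : ℝ → Matrix (Fin n) (Fin n) ℂ}
    {c' : Matrix (Fin n) (Fin n) ℂ} {t : ℝ} (hc : HasMatDerivAt c c' t)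
    (hF : ∀ᶠ s in 𝓝 t, ∀ p, ∀ v ∈ F p, c s *ᵥ v ∈ F p) : c' ∈ endF F 0 := by
  intro p v hv
  have h1 := hc.mulVec (hasDerivAt_const t v)
  rw [Matrix.mulVec_zero, add_zero] at h1
  rw [add_zero]
  exact mem_of_hasDerivAt h1 (hF.mono fun s hs => hs p v hv)

/-- The derivatives of two frames of the same family agree modulo `F^0`. -/
theorem IsHolFrame.matrixDeriv_sub_mem (hg : IsHolFrame E f x g) (hg' : IsHolFrame E f x g')
    (v : TangentSpace 𝓘(ℂ, E) x) :
    matrixDeriv E g x v - matrixDeriv E g' x v ∈ endF (f x) 0 := by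
  obtain ⟨c, h0, hc, h1, h2⟩ := hg.exists_curve hg' v
  have hu : IsUnit (g' (c 0)).det := by rw [h0, hg'.1]; simp
  have h3 := (h2.inv hu).mul h1
  have e : -((g' (c 0))⁻¹ * matrixDeriv E g' x v * (g' (c 0))⁻¹) * g (c 0) +
      (g' (c 0))⁻¹ * matrixDeriv E g x v = matrixDeriv E g x v - matrixDeriv E g' x v := by
    rw [h0, hg.1, hg'.1]
    simp
    abel
  rw [e] at h3
  refine mem_endF_of_hasMatDerivAt h3 ?_
  have hcx : Filter.Tendsto c (𝓝 0) (𝓝 x) := h0 ▸ hc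
  filter_upwards [hcx.eventually hg.2.2, hcx.eventually hg'.2.2, h2.eventually_isUnit_det hu]
    with t ht ht' hut p v hv
  have h4 : g (c t) *ᵥ v ∈ f (c t) p := by
    rw [ht]
    exact ⟨v, hv, rfl⟩
  rw [ht'] at h4
  obtain ⟨w, hw, hwv⟩ := h4
  rw [Matrix.mulVecLin_apply] at hwv
  rw [← Matrix.mulVec_mulVec, ← hwv, inv_mulVec_mulVec hut]
  exact hw

/-- The differential of a family of filtrations can be computed in any holomorphic frame. -/
theorem filDeriv_eq (hg : IsHolFrame E f x g) :
    filDeriv E f x = (endF (f x) 0).mkQ ∘ₗ matrixDeriv E g x := by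
  have h : HolAt E f x := ⟨g, hg⟩
  rw [filDeriv, dif_pos h]
  ext v
  exact (Submodule.Quotient.eq _).2 (h.choose_spec.matrixDeriv_sub_mem hg v)

theorem filDeriv_eq_zero_iff (hg : IsHolFrame E f x g) (v : TangentSpace 𝓘(ℂ, E) x) :
    filDeriv E f x v = 0 ↔ matrixDeriv E g x v ∈ endF (f x) 0 := by
  rw [filDeriv_eq hg]
  exact Submodule.Quotient.mk_eq_zero _

theorem act_mul (A B : Matrix (Fin n) (Fin n) ℂ) (F : Fil n) :
    Fil.act (A * B) F = Fil.act A (Fil.act B F) := by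
  funext p
  rw [Fil.act, Fil.act, Fil.act, ← Submodule.map_comp, Matrix.mulVecLin_mul]

theorem act_one (F : Fil n) : Fil.act 1 F = F := by
  funext p
  rw [Fil.act, Matrix.mulVecLin_one, Submodule.map_id]

theorem mulVec_mem_act_iff {A : Matrix (Fin n) (Fin n) ℂ} (hA : IsUnit A.det) {F : Fil n} {p : ℤ}
    {v : Fin n → ℂ} : A *ᵥ v ∈ Fil.act A F p ↔ v ∈ F p := by
  constructor
  · rintro ⟨w, hw, hwv⟩
    have := congrArg (fun u => A⁻¹ *ᵥ u) hwv
    rw [Matrix.mulVecLin_apply, inv_mulVec_mulVec hA, inv_mulVec_mulVec hA] at this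
    rwa [← this]
  · exact fun hv => ⟨v, hv, rfl⟩

theorem conj_mem_endF_act_iff {A B : Matrix (Fin n) (Fin n) ℂ} (hA : IsUnit A.det) {F : Fil n}
    {k : ℤ} : A * B * A⁻¹ ∈ endF (Fil.act A F) k ↔ B ∈ endF F k := by
  constructor
  · intro h p v hv
    have h1 := h p (A *ᵥ v) ((mulVec_mem_act_iff hA).2 hv)
    rw [← Matrix.mulVec_mulVec, ← Matrix.mulVec_mulVec, inv_mulVec_mulVec hA,
      mulVec_mem_act_iff hA] at h1
    exact h1
  · rintro h p _ ⟨w, hw, rfl⟩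
    rw [Matrix.mulVecLin_apply, ← Matrix.mulVec_mulVec, ← Matrix.mulVec_mulVec,
      inv_mulVec_mulVec hA, mulVec_mem_act_iff hA]
    exact h p w hw

theorem matrixDeriv_mul_mul (A B : Matrix (Fin n) (Fin n) ℂ)
    (hg : ∀ i j, MDifferentiableAt 𝓘(ℂ, E) 𝓘(ℂ, ℂ) (fun y => g y i j) x) :
    (∀ i j, MDifferentiableAt 𝓘(ℂ, E) 𝓘(ℂ, ℂ) (fun y => (A * g y * B) i j) x) ∧
    ∀ v, matrixDeriv E (fun y => A * g y * B) x v = A * matrixDeriv E g x v * B := by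
  have hd : ∀ i j, MDifferentiableAt 𝓘(ℂ, E) 𝓘(ℂ, ℂ) (fun y => (A * g y * B) i j) x := by
    intro i j
    rw [mdifferentiableAt_iff_chart (mem_chart_source E x)]
    change DifferentiableAt ℂ (fun y => (A * g ((chartAt E x).symm y) * B) i j) _
    simp only [Matrix.mul_apply]
    refine DifferentiableAt.fun_sum fun k _ => DifferentiableAt.fun_mul
      (DifferentiableAt.fun_sum fun l _ => DifferentiableAt.fun_mul (differentiableAt_const _) ?_)
      (differentiableAt_const _)
    exact (mdifferentiableAt_iff_chart (mem_chart_source E x)).1 (hg l k)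
  refine ⟨hd, fun v => ?_⟩
  obtain ⟨c, h0, hc, h1, -⟩ := _root_.exists_curve (n := 0) x v
  have h2 : HasMatDerivAt (fun t => g (c t)) (matrixDeriv E g x v) 0 := fun i j => h1 _ (hg i j)
  have h3 : HasMatDerivAt (fun t => A * g (c t) * B)
      (matrixDeriv E (fun y => A * g y * B) x v) 0 := fun i j => h1 _ (hd i j)
  have h4 := ((hasMatDerivAt_const A 0).mul h2).mul (hasMatDerivAt_const B 0)
  have := h3.unique h4
  simpa using this

/-- The translate of a holomorphic family by a fixed invertible matrix. -/
theorem IsHolFrame.act (hg : IsHolFrame E f x g) {A : Matrix (Fin n) (Fin n) ℂ}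
    (hA : IsUnit A.det) :
    IsHolFrame E (fun y => Fil.act A (f y)) x (fun y => A * g y * A⁻¹) := by
  refine ⟨by change A * g x * A⁻¹ = 1; rw [hg.1, Matrix.mul_one, Matrix.mul_nonsing_inv _ hA],
    ?_, ?_⟩
  · filter_upwards [hg.2.1] with y hy using (matrixDeriv_mul_mul A A⁻¹ hy).1
  · filter_upwards [hg.2.2] with y hy
    rw [hy, ← act_mul, ← act_mul, Matrix.mul_assoc, Matrix.nonsing_inv_mul _ hA, Matrix.mul_one]

/-- The differentials of a family and of its translate by a fixed matrix have the same kernel. -/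
theorem filDeriv_act_eq_zero_iff (hf : HolAt E f x) {A : Matrix (Fin n) (Fin n) ℂ}
    (hA : IsUnit A.det) (v : TangentSpace 𝓘(ℂ, E) x) :
    filDeriv E (fun y => Fil.act A (f y)) x v = 0 ↔ filDeriv E f x v = 0 := by
  obtain ⟨g, hg⟩ := hf
  rw [filDeriv_eq_zero_iff hg, filDeriv_eq_zero_iff (hg.act hA),
    (matrixDeriv_mul_mul A A⁻¹ fun i j => hg.mdifferentiableAt i j).2, conj_mem_endF_act_iff hA]

/-- Transfer of a frame to a chart. -/
theorem IsHolFrame.chart {x₀ : M} (hx : x ∈ (chartAt E x₀).source) (hg : IsHolFrame E f x g) :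
    IsHolFrame E (f ∘ (chartAt E x₀).symm) (chartAt E x₀ x) (g ∘ (chartAt E x₀).symm) ∧
    ∀ v, matrixDeriv E g x v = matrixDeriv E (g ∘ (chartAt E x₀).symm) (chartAt E x₀ x)
      ((mdifferentiable_chart (I := 𝓘(ℂ, E)) (H := E) x₀).mfderiv hx v) := by
  have hl : (chartAt E x₀).symm (chartAt E x₀ x) = x := (chartAt E x₀).left_inv hx
  have hcont : Filter.Tendsto (chartAt E x₀).symm (𝓝 (chartAt E x₀ x)) (𝓝 x) := by
    have := (chartAt E x₀).continuousAt_symm ((chartAt E x₀).map_source hx)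
    rwa [ContinuousAt, hl] at this
  refine ⟨⟨by rw [Function.comp_apply, hl, hg.1], ?_, ?_⟩, fun v => ?_⟩
  · filter_upwards [hcont.eventually hg.2.1, hcont ((chartAt E x₀).open_source.mem_nhds hx),
      (chartAt E x₀).open_target.mem_nhds ((chartAt E x₀).map_source hx)] with y hy hys hyt i j
    have := (mdifferentiableAt_iff_chart hys).1 (hy i j)
    rw [(chartAt E x₀).right_inv hyt] at this
    exact mdifferentiableAt_iff_differentiableAt.2 this
  · filter_upwards [hcont.eventually hg.2.2] with y hy
    rw [Function.comp_apply, Function.comp_apply, Function.comp_apply, hl, hy]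
  · ext i j
    have h1 := mfderiv_eq_chart hx (hg.mdifferentiableAt i j) v
    refine h1.trans ?_
    have h2 : (matrixDeriv E (g ∘ (chartAt E x₀).symm) (chartAt E x₀ x)
      ((mdifferentiable_chart (I := 𝓘(ℂ, E)) (H := E) x₀).mfderiv hx v) i j : ℂ) =
        mfderiv 𝓘(ℂ, E) 𝓘(ℂ, ℂ) (fun y => (g ∘ (chartAt E x₀).symm) y i j) (chartAt E x₀ x)
          ((mdifferentiable_chart (I := 𝓘(ℂ, E)) (H := E) x₀).mfderiv hx v) := rfl
    rw [h2, mfderiv_eq_fderiv]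
    rfl

theorem HolAt.chart {x₀ : M} (hx : x ∈ (chartAt E x₀).source) (h : HolAt E f x) :
    HolAt E (f ∘ (chartAt E x₀).symm) (chartAt E x₀ x) := by
  obtain ⟨g, hg⟩ := h
  exact ⟨_, (hg.chart hx).1⟩

theorem filDeriv_chart_eq_zero_iff {x₀ : M} (hx : x ∈ (chartAt E x₀).source) (h : HolAt E f x)
    (v : TangentSpace 𝓘(ℂ, E) x) :
    filDeriv E (f ∘ (chartAt E x₀).symm) (chartAt E x₀ x)
      ((mdifferentiable_chart (I := 𝓘(ℂ, E)) (H := E) x₀).mfderiv hx v) = 0 ↔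
    filDeriv E f x v = 0 := by
  obtain ⟨g, hg⟩ := h
  rw [filDeriv_eq_zero_iff hg, filDeriv_eq_zero_iff (hg.chart hx).1, (hg.chart hx).2,
    Function.comp_apply, (chartAt E x₀).left_inv hx]

/-- The rank of the differential can be computed in a chart. -/
theorem finrank_range_filDeriv_chart [FiniteDimensional ℂ E] {x₀ : M}
    (hx : x ∈ (chartAt E x₀).source) (h : HolAt E f x) :
    Module.finrank ℂ (LinearMap.range (filDeriv E (f ∘ (chartAt E x₀).symm) (chartAt E x₀ x))) =
      Module.finrank ℂ (LinearMap.range (filDeriv E f x)) := by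
  let A := (mdifferentiable_chart (I := 𝓘(ℂ, E)) (H := E) x₀).mfderiv hx
  have : FiniteDimensional ℂ (TangentSpace 𝓘(ℂ, E) x) := inferInstanceAs (FiniteDimensional ℂ E)
  have : FiniteDimensional ℂ (TangentSpace 𝓘(ℂ, E) (chartAt E x₀ x)) :=
    inferInstanceAs (FiniteDimensional ℂ E)
  have h1 := LinearMap.finrank_range_add_finrank_ker
    (filDeriv E (f ∘ (chartAt E x₀).symm) (chartAt E x₀ x))
  have h2 := LinearMap.finrank_range_add_finrank_ker (filDeriv E f x)
  have h3 : Module.finrank ℂ (LinearMap.ker (filDeriv E f x)) =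
      Module.finrank ℂ (LinearMap.ker
        (filDeriv E (f ∘ (chartAt E x₀).symm) (chartAt E x₀ x))) := by
    refine LinearEquiv.finrank_eq (A.toLinearEquiv.ofSubmodules _ _ ?_)
    ext w
    constructor
    · rintro ⟨v, hv, rfl⟩
      exact (filDeriv_chart_eq_zero_iff hx h v).2 hv
    · intro hw
      refine ⟨A.symm w, ?_, A.apply_symm_apply w⟩
      refine (filDeriv_chart_eq_zero_iff hx h (A.symm w)).1 ?_
      change filDeriv E _ _ (A (A.symm w)) = 0
      rw [A.apply_symm_apply]
      exact hw
  have h4 : Module.finrank ℂ (TangentSpace 𝓘(ℂ, E) x) =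
      Module.finrank ℂ (TangentSpace 𝓘(ℂ, E) (chartAt E x₀ x)) := rfl
  omega

end Manifolds

/-! ### The Kodaira–Spencer map and the horizontal tangent space -/

section KodairaSpencer

variable {n : ℕ}

/-- The dimension of the image of `S` in the quotient by `U`. -/
theorem finrank_map_mkQ_add {V : Type*} [AddCommGroup V] [Module ℂ V] [FiniteDimensional ℂ V]
    (S U : Submodule ℂ V) :
    Module.finrank ℂ (S.map U.mkQ) + Module.finrank ℂ ↥(S ⊓ U) = Module.finrank ℂ S := by
  have h := LinearMap.finrank_range_add_finrank_ker (U.mkQ.domRestrict S)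
  rw [LinearMap.range_domRestrict] at h
  rw [← h]
  congr 1
  have e : (LinearMap.ker (U.mkQ.domRestrict S)).map S.subtype = S ⊓ U := by
    rw [LinearMap.ker_domRestrict, Submodule.ker_mkQ, Submodule.map_comap_subtype]
  rw [← e]
  exact ((LinearMap.ker (U.mkQ.domRestrict S)).equivMapOfInjective S.subtype
    S.injective_subtype).finrank_eq.symm

theorem endF_anti {F : Fil n} (hF : Antitone F) {k l : ℤ} (h : k ≤ l) : endF F l ≤ endF F k :=
  fun _ hA p v hv => hF (by omega) (hA p v hv)

/-- The inclusion of `Gr_F^{-1} L` in `End(V_ℂ) / F^0`. -/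
def grIncl (F : Fil n) (L : Submodule ℂ (Matrix (Fin n) (Fin n) ℂ)) :
    GrNegOne F L →ₗ[ℂ] (Matrix (Fin n) (Fin n) ℂ ⧸ endF F 0) :=
  Submodule.mapQ _ _ (L ⊓ endF F (-1)).subtype (fun _ hA => hA.2)

theorem grIncl_mk (F : Fil n) (L : Submodule ℂ (Matrix (Fin n) (Fin n) ℂ))
    (A : ↥(L ⊓ endF F (-1))) :
    grIncl F L (Submodule.Quotient.mk A) = (endF F 0).mkQ A.1 := rfl

theorem grIncl_injective (F : Fil n) (L : Submodule ℂ (Matrix (Fin n) (Fin n) ℂ)) :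
    Function.Injective (grIncl F L) := by
  rw [injective_iff_map_eq_zero]
  intro ξ hξ
  obtain ⟨A, rfl⟩ := Submodule.Quotient.mk_surjective _ ξ
  rw [grIncl_mk, Submodule.mkQ_apply, Submodule.Quotient.mk_eq_zero] at hξ
  exact (Submodule.Quotient.mk_eq_zero _).2 ⟨A.2.1, hξ⟩

theorem range_grIncl (F : Fil n) (L : Submodule ℂ (Matrix (Fin n) (Fin n) ℂ)) :
    LinearMap.range (grIncl F L) = (L ⊓ endF F (-1)).map (endF F 0).mkQ := by
  ext ξ
  constructor
  · rintro ⟨η, rfl⟩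
    obtain ⟨A, rfl⟩ := Submodule.Quotient.mk_surjective _ η
    exact ⟨A.1, A.2, rfl⟩
  · rintro ⟨A, hA, rfl⟩
    exact ⟨Submodule.Quotient.mk ⟨A, hA⟩, rfl⟩

theorem finrank_grNegOne_lieAlgC (P : Subgroup (GL (Fin n) ℂ)) (F : Fil n) :
    Module.finrank ℂ (GrNegOne F (lieAlgC P)) = Module.finrank ℂ (horizontalTangent P F) := by
  rw [horizontalTangent, ← range_grIncl]
  exact (LinearMap.finrank_range_of_inj (grIncl_injective F _)).symm

variable {P : Subgroup (GL (Fin n) ℂ)}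

/-- The adjoint action of `g ∈ P` maps `F^k 𝔭` onto `(gF)^k 𝔭`. -/
theorem IsRatAlgebraic.finrank_lieAlgC_inf_endF_act (hP : IsRatAlgebraic P) {g : GL (Fin n) ℂ}
    (hg : g ∈ P) (F : Fil n) (k : ℤ) :
    Module.finrank ℂ ↥(lieAlgC P ⊓ endF (Fil.act g.1 F) k) =
      Module.finrank ℂ ↥(lieAlgC P ⊓ endF F k) := by
  have hdet : IsUnit g.1.det := (Matrix.isUnit_iff_isUnit_det _).1 g.isUnit
  have hinv : g⁻¹.1 = g.1⁻¹ := Matrix.coe_units_inv g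
  let c : Matrix (Fin n) (Fin n) ℂ →ₗ[ℂ] Matrix (Fin n) (Fin n) ℂ :=
    (LinearMap.mulRight ℂ g⁻¹.1).comp (LinearMap.mulLeft ℂ g.1)
  have hc : ∀ A, c A = g.1 * A * g⁻¹.1 := fun A => rfl
  have hinj : Function.Injective c := by
    intro A B h
    have := congrArg (fun C => g⁻¹.1 * C * g.1) h
    simpa [hc, hinv, Matrix.mul_assoc, Matrix.nonsing_inv_mul _ hdet,
      Matrix.nonsing_inv_mul_cancel_left _ _ hdet] using this
  have e : (lieAlgC P ⊓ endF F k).map c = lieAlgC P ⊓ endF (Fil.act g.1 F) k := by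
    ext B
    constructor
    · rintro ⟨A, ⟨hA, hA'⟩, rfl⟩
      refine ⟨hP.conj_mem_lieAlgC hg hA, ?_⟩
      rw [hc, hinv]
      exact (conj_mem_endF_act_iff hdet).2 hA'
    · rintro ⟨hB, hB'⟩
      have e1 : g.1 * (g⁻¹.1 * B * g.1) * g⁻¹.1 = B := by
        rw [hinv]
        simp [Matrix.mul_assoc, Matrix.mul_nonsing_inv _ hdet,
          Matrix.mul_nonsing_inv_cancel_left _ _ hdet]
      refine ⟨g⁻¹.1 * B * g.1, ⟨?_, ?_⟩, e1⟩
      · have := hP.conj_mem_lieAlgC (P.inv_mem hg) hB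
        rwa [inv_inv] at this
      · rw [SetLike.mem_coe, ← conj_mem_endF_act_iff hdet, ← hinv, e1]
        exact hB'
  rw [← e]
  exact ((lieAlgC P ⊓ endF F k).equivMapOfInjective c hinj).finrank_eq.symm

theorem endF_act_anti {F : Fil n} (hF : Antitone F) (A : Matrix (Fin n) (Fin n) ℂ) :
    Antitone (Fil.act A F) := fun _ _ h => Submodule.map_mono (hF h)

/-- The rank of the horizontal tangent bundle is constant on the domain. -/
theorem IsRatAlgebraic.finrank_horizontalTangent_act (hP : IsRatAlgebraic P) {g : GL (Fin n) ℂ}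
    (hg : g ∈ P) {F : Fil n} (hF : Antitone F) :
    Module.finrank ℂ (horizontalTangent P (Fil.act g.1 F)) =
      Module.finrank ℂ (horizontalTangent P F) := by
  have e : ∀ {F : Fil n}, Antitone F →
      lieAlgC P ⊓ endF F (-1) ⊓ endF F 0 = lieAlgC P ⊓ endF F 0 := by
    intro F hF
    rw [inf_assoc, inf_eq_right.2 (endF_anti hF (by norm_num : (-1 : ℤ) ≤ 0))]
  have h1 := finrank_map_mkQ_add (lieAlgC P ⊓ endF F (-1)) (endF F 0)
  have h2 := finrank_map_mkQ_add (lieAlgC P ⊓ endF (Fil.act g.1 F) (-1)) (endF (Fil.act g.1 F) 0)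
  rw [e hF, ← horizontalTangent] at h1
  rw [e (endF_act_anti hF _), ← horizontalTangent, hP.finrank_lieAlgC_inf_endF_act hg,
    hP.finrank_lieAlgC_inf_endF_act hg] at h2
  omega

variable {E : Type*} [NormedAddCommGroup E] [NormedSpace ℂ E]
  {X S : Type*} [TopologicalSpace X] [ChartedSpace E X] [IsManifold 𝓘(ℂ, E) 1 X] {π : X → S}

/-- A frame extends an element of `F^p` to a holomorphic section of `F^p`, with the expected
covariant derivative. -/
theorem isHolSection_frame {f : X → Fil n} {x : X} {g : X → Matrix (Fin n) (Fin n) ℂ}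
    (hg : IsHolFrame E f x g) {p : ℤ} {u : Fin n → ℂ} (hu : u ∈ f x p) :
    IsHolSection E f x p (fun y => g y *ᵥ u) ∧
      ∀ v, nabla E (fun y => g y *ᵥ u) x v = matrixDeriv E g x v *ᵥ u := by
  have hd : ∀ y, (∀ i j, MDifferentiableAt 𝓘(ℂ, E) 𝓘(ℂ, ℂ) (fun y' => g y' i j) y) →
      MDifferentiableAt 𝓘(ℂ, E) 𝓘(ℂ, Fin n → ℂ) (fun y => g y *ᵥ u) y := by
    intro y hy
    rw [mdifferentiableAt_iff_chart (mem_chart_source E y), differentiableAt_pi]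
    intro i
    change DifferentiableAt ℂ (fun y => (g _ *ᵥ u) i) _
    simp only [Matrix.mulVec, dotProduct]
    refine DifferentiableAt.fun_sum fun k _ => DifferentiableAt.fun_mul ?_
      (differentiableAt_const _)
    exact (mdifferentiableAt_iff_chart (mem_chart_source E y)).1 (hy i k)
  constructor
  · filter_upwards [hg.2.1, hg.2.2] with y h1 h2
    refine ⟨hd y h1, ?_⟩
    rw [h2]
    exact ⟨u, hu, rfl⟩
  · intro v
    obtain ⟨c, h0, -, h1, h2⟩ := exists_curve (n := n) x v
    have h3 : HasMatDerivAt (fun t => g (c t)) (matrixDeriv E g x v) 0 :=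
      fun i j => h1 _ (hg.mdifferentiableAt i j)
    have h4 := h3.mulVec (hasDerivAt_const 0 u)
    rw [Matrix.mulVec_zero, add_zero] at h4
    exact (h2 _ (hd x hg.2.1.self_of_nhds)).unique h4

namespace ZVMHS

variable (V : ZVMHS E π n) {x : X} {g : X → Matrix (Fin n) (Fin n) ℂ}

/-- Griffiths transversality for the derivative of a frame. -/
theorem matrixDeriv_mem (hg : IsHolFrame E V.F x g) (v : TangentSpace 𝓘(ℂ, E) x) :
    matrixDeriv E g x v ∈ endF (V.F x) (-1) := by
  intro p u hu
  obtain ⟨h1, h2⟩ := isHolSection_frame hg hu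
  rw [← h2]
  exact V.griffiths x p _ h1 v

/-- An endomorphism represents the Kodaira–Spencer map if and only if it agrees with the derivative
of a frame modulo `F^0`. -/
theorem representsKS_iff (hg : IsHolFrame E V.F x g) (v : TangentSpace 𝓘(ℂ, E) x)
    (A : Matrix (Fin n) (Fin n) ℂ) :
    V.RepresentsKS x v A ↔ matrixDeriv E g x v - A ∈ endF (V.F x) 0 := by
  constructor
  · intro h p u hu
    obtain ⟨h1, h2⟩ := isHolSection_frame hg hu
    have h3 := h p _ h1
    rw [h2, hg.1, Matrix.one_mulVec] at h3
    rwa [Matrix.sub_mulVec, add_zero]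
  · intro h p σ hσ
    obtain ⟨c, h0, hc, h1, h2⟩ := exists_curve (n := n) x v
    have hgc : HasMatDerivAt (fun t => g (c t)) (matrixDeriv E g x v) 0 :=
      fun i j => h1 _ (hg.mdifferentiableAt i j)
    have hσc := h2 σ hσ.self_of_nhds.1
    have hu : IsUnit (g (c 0)).det := by rw [h0, hg.1]; simp
    -- in the frame `g`, the section takes its values in the fixed subspace `F^p` at `x`
    have h3 := (hgc.inv hu).mulVec hσc
    have hcx : Filter.Tendsto c (𝓝 0) (𝓝 x) := h0 ▸ hc
    have h4 : -((g (c 0))⁻¹ * matrixDeriv E g x v * (g (c 0))⁻¹) *ᵥ σ (c 0) +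
        (g (c 0))⁻¹ *ᵥ (nabla E σ x v) ∈ V.F x p := by
      refine mem_of_hasDerivAt h3 ?_
      filter_upwards [hcx.eventually hg.2.2, hgc.eventually_isUnit_det hu, hcx.eventually hσ]
        with t ht hut hσt
      have h5 := hσt.2
      rw [ht] at h5
      obtain ⟨w, hw, hwv⟩ := h5
      rw [← hwv, Matrix.mulVecLin_apply, inv_mulVec_mulVec hut]
      exact hw
    rw [h0, hg.1] at h4
    simp only [inv_one, one_mul, mul_one, Matrix.one_mulVec, Matrix.neg_mulVec] at h4
    have h6 := h p (σ x) hσ.self_of_nhds.2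
    rw [add_zero, Matrix.sub_mulVec] at h6
    have e : nabla E σ x v - A *ᵥ σ x = (-(matrixDeriv E g x v *ᵥ σ x) + nabla E σ x v) +
        (matrixDeriv E g x v *ᵥ σ x - A *ᵥ σ x) := by abel
    rw [e]
    exact add_mem h4 h6

/-- The rank of the Kodaira–Spencer map at a point is the rank of the differential of the period
map, provided that this differential can be represented by endomorphisms preserving `W`. -/
theorem finrank_ksImage (h : LinearMap.range (filDeriv E V.F x) ≤
      (endW V.W ⊓ endF (V.F x) (-1)).map (endF (V.F x) 0).mkQ) :
    Module.finrank ℂ (V.ksImage x) = Module.finrank ℂ (LinearMap.range (filDeriv E V.F x)) := by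
  obtain ⟨g, hg⟩ := V.holomorphic x
  -- inside `End(V_ℂ) / F^0`, the image of the Kodaira–Spencer map is the image of the differential
  have e : (V.ksImage x).map (grIncl (V.F x) (endW V.W)) =
      LinearMap.range (filDeriv E V.F x) := by
    apply le_antisymm
    · rw [ksImage, Submodule.map_span_le]
      rintro _ ⟨v, A, hA, rfl⟩
      refine ⟨v, ?_⟩
      rw [filDeriv_eq hg, grIncl_mk]
      exact (Submodule.Quotient.eq _).2 ((V.representsKS_iff hg v A.1).1 hA)
    · rintro _ ⟨v, rfl⟩
      obtain ⟨A, hA, hAv⟩ := h ⟨v, rfl⟩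
      refine ⟨Submodule.Quotient.mk ⟨A, hA⟩, Submodule.subset_span ⟨v, ⟨A, hA⟩, ?_, rfl⟩, ?_⟩
      · rw [V.representsKS_iff hg]
        rw [filDeriv_eq hg] at hAv
        exact (Submodule.Quotient.eq _).1 hAv.symm
      · rw [grIncl_mk]
        exact hAv
  rw [← e]
  exact ((V.ksImage x).equivMapOfInjective _ (grIncl_injective _ _)).finrank_eq

end ZVMHS

end KodairaSpencer

/-! ### Charts of the flag variety -/

section FlagCharts

variable {n : ℕ}

/-- `N` is the projection onto `U` with the same kernel as the idempotent matrix `π`. -/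
structure IsFlagProj (π : Matrix (Fin n) (Fin n) ℂ) (U : Submodule ℂ (Fin n → ℂ))
    (N : Matrix (Fin n) (Fin n) ℂ) : Prop where
  left : π * N = π
  right : N * π = N
  mem : ∀ v, N *ᵥ v ∈ U
  eq_self : ∀ v ∈ U, N *ᵥ v = v

namespace IsFlagProj

variable {π N N' : Matrix (Fin n) (Fin n) ℂ} {U U' : Submodule ℂ (Fin n → ℂ)}

theorem mul_eq_of_mem (hN : IsFlagProj π U N) {A : Matrix (Fin n) (Fin n) ℂ}
    (hA : ∀ v, A *ᵥ v ∈ U) : N * A = A :=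
  Matrix.mulVec_injective (funext fun v => by
    rw [← Matrix.mulVec_mulVec]; exact hN.eq_self _ (hA v))

/-- `N' = N N' = N π N' = N π = N`: the image of `N'` lies in `U`, and the two projections have the
same kernel. -/
theorem unique (hN : IsFlagProj π U N) (hN' : IsFlagProj π U N') : N = N' := by
  rw [← hN.mul_eq_of_mem hN'.mem, ← hN.right, Matrix.mul_assoc, hN'.left]

theorem mul_self (hN : IsFlagProj π U N) : N * N = N := hN.mul_eq_of_mem hN.mem

/-- The projection onto a translate of `U`. -/
theorem act (hN : IsFlagProj π U N) {h : Matrix (Fin n) (Fin n) ℂ}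
    (hK : IsUnit (N * h * N + (1 - N)).det) :
    IsFlagProj π (U.map h.mulVecLin) (h * N * (N * h * N + (1 - N))⁻¹ * N) := by
  have hNN := hN.mul_self
  -- `K` is the compression `N h N` of `h` to `U`, extended by the identity to a complement
  set K := N * h * N + (1 - N) with hKdef
  have h1 : K * N = N * h * N := by
    rw [hKdef, add_mul, sub_mul, one_mul, hNN, sub_self, add_zero, Matrix.mul_assoc _ N N, hNN]
  have h2 : N * K = N * h * N := by
    rw [hKdef, mul_add, mul_sub, mul_one, hNN, sub_self, add_zero, ← Matrix.mul_assoc,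
      ← Matrix.mul_assoc, hNN]
  have h3 : N * K⁻¹ = K⁻¹ * N := by
    calc N * K⁻¹ = K⁻¹ * (K * N) * K⁻¹ := by
          rw [← Matrix.mul_assoc, Matrix.nonsing_inv_mul _ hK, Matrix.one_mul]
      _ = K⁻¹ * (N * K) * K⁻¹ := by rw [h1, h2]
      _ = K⁻¹ * N := by
          rw [← Matrix.mul_assoc, Matrix.mul_assoc _ K, Matrix.mul_nonsing_inv _ hK, Matrix.mul_one]
  set T := h * N * K⁻¹ * N with hT
  have h4 : N * T = N := by
    calc N * T = (N * h * N) * (K⁻¹ * N) := by rw [hT]; simp only [Matrix.mul_assoc]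
      _ = K * (N * K⁻¹) * N := by rw [← h1]; simp only [Matrix.mul_assoc]
      _ = K * K⁻¹ * (N * N) := by rw [h3]; simp only [Matrix.mul_assoc]
      _ = N := by rw [Matrix.mul_nonsing_inv _ hK, Matrix.one_mul, hNN]
  have h5 : T * N = T := by rw [hT, Matrix.mul_assoc _ N N, hNN]
  refine ⟨?_, ?_, ?_, ?_⟩
  · rw [← hN.left, Matrix.mul_assoc, h4]
  · rw [← h5, Matrix.mul_assoc, hN.right]
  · intro v
    refine ⟨N *ᵥ ((K⁻¹ * N) *ᵥ v), hN.mem _, ?_⟩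
    rw [Matrix.mulVecLin_apply, Matrix.mulVec_mulVec, Matrix.mulVec_mulVec, hT]
    simp only [Matrix.mul_assoc]
  · rintro _ ⟨w, hw, rfl⟩
    have hw' := hN.eq_self w hw
    have : T * h * N = h * N := by
      calc T * h * N = h * N * K⁻¹ * (N * h * N) := by rw [hT]; simp only [Matrix.mul_assoc]
        _ = h * N * (K⁻¹ * K) * N := by rw [← h1]; simp only [Matrix.mul_assoc]
        _ = h * N := by
          rw [Matrix.nonsing_inv_mul _ hK, Matrix.mul_one, Matrix.mul_assoc, hNN]
    have h6 := congrArg (fun A => A *ᵥ w) this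
    simp only [← Matrix.mulVec_mulVec, hw'] at h6
    exact h6

end IsFlagProj

/-- Every subspace lies in the domain of some chart, for instance the one given by a projection onto
it. -/
theorem exists_isFlagProj (U : Submodule ℂ (Fin n → ℂ)) : ∃ N, IsFlagProj N U N := by
  obtain ⟨f, hf⟩ := U.subtype.exists_leftInverse_of_injective (by simp)
  let N := LinearMap.toMatrix' (U.subtype.comp f)
  have hN : ∀ v, N *ᵥ v = (f v).1 := fun v => LinearMap.toMatrix'_mulVec _ v
  have h1 : ∀ v ∈ U, N *ᵥ v = v := by
    intro v hv
    rw [hN]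
    exact congrArg Subtype.val (LinearMap.congr_fun hf ⟨v, hv⟩)
  have h2 : N * N = N := Matrix.mulVec_injective (funext fun v => by
    rw [← Matrix.mulVec_mulVec]
    exact h1 _ (by rw [hN]; exact (f v).2))
  exact ⟨N, h2, h2, fun v => by rw [hN]; exact (f v).2, h1⟩

open Classical in
/-- The coordinate matrix of `U` in the chart of the Grassmannian given by the idempotent `π`: the
projection onto `U` along `ker π` (and `0` outside of the domain of the chart). -/
def flagCoord (π : Matrix (Fin n) (Fin n) ℂ) (U : Submodule ℂ (Fin n → ℂ)) :
    Matrix (Fin n) (Fin n) ℂ :=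
  if h : ∃ N, IsFlagProj π U N then h.choose else 0

theorem IsFlagProj.flagCoord_eq {π N : Matrix (Fin n) (Fin n) ℂ} {U : Submodule ℂ (Fin n → ℂ)}
    (h : IsFlagProj π U N) : flagCoord π U = N := by
  have h' : ∃ N, IsFlagProj π U N := ⟨N, h⟩
  rw [flagCoord, dif_pos h']
  exact h'.choose_spec.unique h

/-- The filtration `F` is trivial outside of the interval `(a, b)`. -/
def FilBdd (a b : ℤ) (F : Fil n) : Prop := (∀ p ≤ a, F p = ⊤) ∧ ∀ p ≥ b, F p = ⊥

theorem IsMHS.exists_filBdd {W : ℤ → Submodule ℚ (Fin n → ℚ)} {F : Fil n} (h : IsMHS W F) :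
    ∃ a b, FilBdd a b F := by
  obtain ⟨a, ha⟩ := h.F_top
  obtain ⟨b, hb⟩ := h.F_bot
  exact ⟨a, b, fun p hp => top_le_iff.1 (ha ▸ h.F_anti hp),
    fun p hp => le_bot_iff.1 (hb ▸ h.F_anti hp)⟩

theorem FilBdd.act {a b : ℤ} {F : Fil n} (h : FilBdd a b F) {g : Matrix (Fin n) (Fin n) ℂ}
    (hg : IsUnit g.det) : FilBdd a b (Fil.act g F) := by
  refine ⟨fun p hp => ?_, fun p hp => ?_⟩
  · rw [Fil.act, h.1 p hp, Submodule.map_top, LinearMap.range_eq_top]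
    exact fun v => ⟨g⁻¹ *ᵥ v, mulVec_inv_mulVec hg v⟩
  · rw [Fil.act, h.2 p hp, Submodule.map_bot]

/-- The domain of the chart of the flag variety given by a family of idempotents. -/
def FlagDom (a b : ℤ) (π : ℤ → Matrix (Fin n) (Fin n) ℂ) (F : Fil n) : Prop :=
  FilBdd a b F ∧ ∀ p ∈ Finset.Icc a b, ∃ N, IsFlagProj (π p) (F p) N

/-- The coordinates of a filtration in the chart of the flag variety given by a family of
idempotents. -/
def flagMap (a b : ℤ) (π : ℤ → Matrix (Fin n) (Fin n) ℂ) (F : Fil n)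
    (k : Finset.Icc a b × Fin n × Fin n) : ℂ :=
  flagCoord (π k.1) (F k.1) k.2.1 k.2.2

theorem FilBdd.exists_flagDom {a b : ℤ} {F : Fil n} (h : FilBdd a b F) :
    ∃ π, FlagDom a b π F := by
  choose N hN using fun p => exists_isFlagProj (F p)
  exact ⟨N, h, fun p _ => ⟨N p, hN p⟩⟩

variable {E : Type*} [NormedAddCommGroup E] [NormedSpace ℂ E] {f : E → Fil n} {x : E}
  {a b : ℤ} {π : ℤ → Matrix (Fin n) (Fin n) ℂ}

/-- The complex derivative in the direction `v` as the derivative along a real line. -/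
theorem hasDerivAt_line {G : Type*} [NormedAddCommGroup G] [NormedSpace ℂ G] {s : E → G} {x : E}
    (hs : DifferentiableAt ℂ s x) (v : E) :
    HasDerivAt (fun t : ℝ => s (x + (t : ℂ) • v)) (fderiv ℂ s x v) 0 := by
  let ℓ : ℝ → E := fun t => x + (t : ℂ) • v
  have hℓ0 : ℓ 0 = x := by simp [ℓ]
  have hℓ : HasDerivAt ℓ v 0 := by
    have h1 : HasDerivAt (fun t : ℝ => (t : ℂ)) 1 0 := Complex.ofRealCLM.hasDerivAt
    have h2 := (h1.smul_const v).const_add x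
    rwa [one_smul] at h2
  have h1 := hs.hasFDerivAt.restrictScalars ℝ
  rw [← hℓ0] at h1
  have h2 := h1.comp_hasDerivAt 0 hℓ
  rw [hℓ0] at h2
  exact h2

theorem IsHolFrame.hasMatDerivAt_line {g : E → Matrix (Fin n) (Fin n) ℂ}
    (hg : IsHolFrame E f x g) (v : E) :
    HasMatDerivAt (fun t : ℝ => g (x + (t : ℂ) • v)) (matrixDeriv E g x v) 0 := by
  intro i j
  have h1 := hasDerivAt_line
    (mdifferentiableAt_iff_differentiableAt.1 (hg.mdifferentiableAt i j)) v
  have h2 : matrixDeriv E g x v i j = fderiv ℂ (fun y => g y i j) x v := by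
    rw [← mfderiv_eq_fderiv]
    rfl
  rw [h2]
  exact h1

/-- The coordinates of a holomorphic family of filtrations are holomorphic, and their derivative
has the same kernel as the differential of the family. -/
theorem FlagDom.holAt (hD : FlagDom a b π (f x)) (hf : HolAt E f x) :
    (∀ᶠ y in 𝓝 x, FlagDom a b π (f y)) ∧
    DifferentiableAt ℂ (fun y => flagMap a b π (f y)) x ∧
    ∀ v, fderiv ℂ (fun y => flagMap a b π (f y)) x v = 0 ↔ filDeriv E f x v = 0 := by
  obtain ⟨g, hg⟩ := hf
  have hgd : ∀ i j, DifferentiableAt ℂ (fun y => g y i j) x := fun i j =>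
    mdifferentiableAt_iff_differentiableAt.1 (hg.mdifferentiableAt i j)
  have hdet : ∀ᶠ y in 𝓝 x, IsUnit (g y).det := by
    have := (differentiableAt_matrix_det hgd).continuousAt.eventually_ne
      (show (g x).det ≠ 0 by rw [hg.1]; simp)
    filter_upwards [this] with y hy using hy.isUnit
  choose! N hN using hD.2
  -- the projections onto `f y p = g y (f x p)` provided by `IsFlagProj.act`
  let K : ℤ → E → Matrix (Fin n) (Fin n) ℂ := fun p y => N p * g y * N p + (1 - N p)
  let T : ℤ → E → Matrix (Fin n) (Fin n) ℂ := fun p y => g y * N p * (K p y)⁻¹ * N p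
  have hc : ∀ (A : Matrix (Fin n) (Fin n) ℂ) i j, DifferentiableAt ℂ (fun _ : E => A i j) x :=
    fun A i j => differentiableAt_const _
  have hKd : ∀ p i j, DifferentiableAt ℂ (fun y => K p y i j) x := fun p i j =>
    (differentiableAt_matrix_mul (differentiableAt_matrix_mul (hc (N p)) hgd) (hc (N p)) i j).fun_add
      (hc (1 - N p) i j)
  have hKx : ∀ p ∈ Finset.Icc a b, K p x = 1 := by
    intro p hp
    simp only [K]
    rw [hg.1, Matrix.mul_one, (hN p hp).mul_self, add_sub_cancel]
  have hKu : ∀ p ∈ Finset.Icc a b, IsUnit (K p x).det := fun p hp => by rw [hKx p hp]; simp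
  have hTd : ∀ p ∈ Finset.Icc a b, ∀ i j, DifferentiableAt ℂ (fun y => T p y i j) x :=
    fun p hp => differentiableAt_matrix_mul (differentiableAt_matrix_mul
      (differentiableAt_matrix_mul hgd (hc (N p))) (differentiableAt_matrix_inv (hKd p) (hKu p hp)))
        (hc (N p))
  have hproj : ∀ᶠ y in 𝓝 x, ∀ p ∈ Finset.Icc a b, IsFlagProj (π p) (f y p) (T p y) := by
    rw [Filter.eventually_all_finset]
    intro p hp
    filter_upwards [hg.2.2, (differentiableAt_matrix_det (hKd p)).continuousAt.eventually_ne
      (hKu p hp).ne_zero] with y hy hyu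
    rw [hy]
    exact (hN p hp).act hyu.isUnit
  have heq : (fun y => flagMap a b π (f y)) =ᶠ[𝓝 x] fun y k => T k.1 y k.2.1 k.2.2 := by
    filter_upwards [hproj] with y hy
    funext k
    rw [flagMap, (hy k.1 k.1.2).flagCoord_eq]
  have hTd' : DifferentiableAt ℂ (fun y (k : Finset.Icc a b × Fin n × Fin n) =>
      T k.1 y k.2.1 k.2.2) x := differentiableAt_pi.2 fun k => hTd k.1 k.1.2 k.2.1 k.2.2
  refine ⟨?_, hTd'.congr_of_eventuallyEq heq, fun v => ?_⟩
  · filter_upwards [hproj, hg.2.2, hdet] with y h1 h2 h3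
    refine ⟨?_, fun p hp => ⟨_, h1 p hp⟩⟩
    rw [h2]
    exact hD.1.act h3
  obtain ⟨D, hgl, hiff⟩ : ∃ D : Matrix (Fin n) (Fin n) ℂ,
      HasMatDerivAt (fun t : ℝ => g (x + (t : ℂ) • v)) D 0 ∧
      (filDeriv E f x v = 0 ↔ D ∈ endF (f x) 0) :=
    ⟨matrixDeriv E g x v, hg.hasMatDerivAt_line v, filDeriv_eq_zero_iff hg v⟩
  -- the derivative of the coordinates in the direction `v`
  have hder : ∀ k : Finset.Icc a b × Fin n × Fin n,
      fderiv ℂ (fun y => flagMap a b π (f y)) x v k =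
        ((1 - N k.1) * D * N k.1) k.2.1 k.2.2 := by
    intro k
    rw [heq.fderiv_eq]
    have h1 := hasDerivAt_pi.1 (hasDerivAt_line hTd' v) k
    have hcN : ∀ A : Matrix (Fin n) (Fin n) ℂ, HasMatDerivAt (fun _ => A) 0 0 :=
      fun A => hasMatDerivAt_const A 0
    have hKl : HasMatDerivAt (fun t : ℝ => K k.1 (x + (t : ℂ) • v))
        (N k.1 * D * N k.1) 0 := by
      intro i j
      have h2 := (((hcN (N k.1)).mul hgl).mul (hcN (N k.1)) i j).add_const ((1 - N k.1) i j)
      simp only [zero_mul, zero_add, mul_zero, add_zero] at h2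
      exact h2
    have hK0 : K k.1 (x + ((0 : ℝ) : ℂ) • v) = 1 := by simp [hKx k.1 k.1.2]
    have h2 := ((hgl.mul (hcN (N k.1))).mul (hKl.inv (by rw [hK0]; simp))).mul (hcN (N k.1))
    have h3 := h1.unique (h2 k.2.1 k.2.2)
    rw [h3]
    have hNN := (hN k.1 k.1.2).mul_self
    have hx0 : x + ((0 : ℝ) : ℂ) • v = x := by simp
    simp only [hx0, hKx k.1 k.1.2, hg.1, inv_one, one_mul, mul_one, mul_zero, add_zero]
    have e : N k.1 * (N k.1 * D * N k.1) * N k.1 =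
        N k.1 * D * N k.1 := by
      rw [← Matrix.mul_assoc, ← Matrix.mul_assoc, hNN, Matrix.mul_assoc _ (N k.1) (N k.1), hNN]
    rw [mul_neg, add_mul, neg_mul, e, Matrix.mul_assoc _ (N k.1) (N k.1), hNN, sub_mul, sub_mul,
      one_mul]
    abel
  rw [hiff]
  constructor
  · intro h p u hu
    rw [add_zero]
    by_cases hp : p ∈ Finset.Icc a b
    · have h1 : (1 - N p) * D * N p = 0 := by
        ext i j
        have := hder (⟨p, hp⟩, i, j)
        rw [h] at this
        exact this.symm
      have h2 := congrArg (fun A => A *ᵥ u) h1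
      simp only [← Matrix.mulVec_mulVec, (hN p hp).eq_self u hu, Matrix.zero_mulVec,
        Matrix.sub_mulVec, Matrix.one_mulVec, sub_eq_zero] at h2
      rw [h2]
      exact (hN p hp).mem _
    · rw [Finset.mem_Icc, not_and_or, not_le, not_le] at hp
      rcases hp with hp | hp
      · rw [hD.1.1 p hp.le]
        exact Submodule.mem_top
      · rw [hD.1.2 p hp.le] at hu ⊢
        rw [(Submodule.mem_bot ℂ).1 hu, Matrix.mulVec_zero]
        exact zero_mem _
  · intro h
    funext k
    rw [hder]
    have h1 : (1 - N k.1) * D * N k.1 = 0 := by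
      refine Matrix.mulVec_injective (funext fun u => ?_)
      have h2 := h k.1 _ ((hN k.1 k.1.2).mem u)
      rw [add_zero] at h2
      rw [← Matrix.mulVec_mulVec, ← Matrix.mulVec_mulVec, Matrix.sub_mulVec, Matrix.one_mulVec,
        (hN k.1 k.1.2).eq_self _ h2, sub_self, Matrix.zero_mulVec]
    rw [h1]
    rfl

/-- The differential of a family of filtrations has the same rank as its differential in
coordinates. -/
theorem finrank_range_fderiv_flagMap [FiniteDimensional ℂ E] (hD : FlagDom a b π (f x))
    (hf : HolAt E f x) :
    Module.finrank ℂ (LinearMap.range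
      (fderiv ℂ (fun y => flagMap a b π (f y)) x).toLinearMap) =
    Module.finrank ℂ (LinearMap.range (filDeriv E f x)) := by
  have h1 := LinearMap.finrank_range_add_finrank_ker
    (fderiv ℂ (fun y => flagMap a b π (f y)) x).toLinearMap
  have : FiniteDimensional ℂ (TangentSpace 𝓘(ℂ, E) x) := inferInstanceAs (FiniteDimensional ℂ E)
  have h2 := LinearMap.finrank_range_add_finrank_ker (filDeriv E f x)
  have h3 : (LinearMap.ker (fderiv ℂ (fun y => flagMap a b π (f y)) x).toLinearMap :
      Submodule ℂ E) = LinearMap.ker (filDeriv E f x) := by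
    ext v
    exact (hD.holAt hf).2.2 v
  rw [h3] at h1
  exact Nat.add_right_cancel (h1.trans h2.symm)

end FlagCharts

/-! ### Real analytic loci -/

section AnalyticLoci

variable {E : Type*} [NormedAddCommGroup E] [NormedSpace ℂ E]
  {X : Type*} [TopologicalSpace X] [ChartedSpace E X]

/-- A subset of a connected manifold that is locally the zero locus of a family of real analytic
functions is closed, and is the whole manifold or has empty interior. -/
theorem isClosed_and_eq_univ_or_interior_eq_empty [PreconnectedSpace X] {Z : Set X}
    (h : ∀ x : X, ∃ r > 0, ∃ Φ : Set (E → ℂ),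
      Metric.ball (chartAt E x x) r ⊆ (chartAt E x).target ∧
      (∀ φ ∈ Φ, AnalyticOnNhd ℝ φ (Metric.ball (chartAt E x x) r)) ∧
      ∀ y ∈ Metric.ball (chartAt E x x) r, (chartAt E x).symm y ∈ Z ↔ ∀ φ ∈ Φ, φ y = 0) :
    IsClosed Z ∧ (Z = Set.univ ∨ interior Z = ∅) := by
  have hU : ∀ (x : X) (r : ℝ), 0 < r →
      (chartAt E x).source ∩ chartAt E x ⁻¹' Metric.ball (chartAt E x x) r ∈ 𝓝 x := by
    intro x r hr
    refine Filter.inter_mem ((chartAt E x).open_source.mem_nhds (mem_chart_source E x)) ?_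
    exact ((chartAt E x).continuousAt (mem_chart_source E x)) (Metric.ball_mem_nhds _ hr)
  constructor
  · refine isClosed_of_closure_subset fun x hx => ?_
    obtain ⟨r, hr, Φ, hB, hΦ, hZ⟩ := h x
    have hxB : chartAt E x x ∈ Metric.ball (chartAt E x x) r := Metric.mem_ball_self hr
    have key := (hZ _ hxB).2 fun φ hφ => by
      by_contra hne
      have h1 : ∀ᶠ y in 𝓝 x, φ (chartAt E x y) ≠ 0 :=
        ((hΦ φ hφ _ hxB).continuousAt.comp
          ((chartAt E x).continuousAt (mem_chart_source E x))).eventually_ne hne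
      obtain ⟨y, ⟨hy1, hy2⟩, hyZ⟩ := mem_closure_iff_nhds.1 hx _ (Filter.inter_mem h1 (hU x r hr))
      refine hy1 ((hZ _ hy2.2).1 ?_ φ hφ)
      rwa [(chartAt E x).left_inv hy2.1]
    rwa [(chartAt E x).left_inv (mem_chart_source E x)] at key
  · by_cases hne : interior Z = ∅
    · exact Or.inr hne
    left
    -- by the identity theorem on chart balls, the interior is closed as well
    have hclopen : IsClopen (interior Z) := by
      refine ⟨isClosed_of_closure_subset fun x hx => ?_, isOpen_interior⟩
      obtain ⟨r, hr, Φ, hB, hΦ, hZ⟩ := h x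
      obtain ⟨z, ⟨hzs, hzB⟩, hzZ⟩ := mem_closure_iff_nhds.1 hx _ (hU x r hr)
      rw [mem_interior_iff_mem_nhds]
      filter_upwards [hU x r hr] with y hy
      rw [← (chartAt E x).left_inv hy.1, hZ _ hy.2]
      intro φ hφ
      refine (hΦ φ hφ).eqOn_zero_of_preconnected_of_eventuallyEq_zero
        (convex_ball _ _).isPreconnected hzB ?_ hy.2
      have hcont : Filter.Tendsto (chartAt E x).symm (𝓝 (chartAt E x z)) (𝓝 z) := by
        have := (chartAt E x).continuousAt_symm ((chartAt E x).map_source hzs)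
        rwa [ContinuousAt, (chartAt E x).left_inv hzs] at this
      filter_upwards [hcont (mem_interior_iff_mem_nhds.1 hzZ), Metric.isOpen_ball.mem_nhds hzB]
        with w hw hwB
      exact (hZ w hwB).1 hw φ hφ
    have := hclopen.eq_univ (Set.nonempty_iff_ne_empty.2 hne)
    exact Set.eq_univ_of_univ_subset (this ▸ interior_subset)

omit [NormedSpace ℂ E] in
/-- A property that holds near a point in a chart holds on a ball in the target of the chart. -/
theorem exists_ball_of_eventually {Q : E → Prop} {x : X}
    (h : ∀ᶠ y in 𝓝 (chartAt E x x), Q y) :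
    ∃ r > 0, Metric.ball (chartAt E x x) r ⊆ (chartAt E x).target ∧
      ∀ y ∈ Metric.ball (chartAt E x x) r, Q y := by
  have h1 := (chartAt E x).open_target.mem_nhds ((chartAt E x).map_source (mem_chart_source E x))
  obtain ⟨r, hr, hB⟩ := Metric.mem_nhds_iff.1 (Filter.inter_mem h h1)
  exact ⟨r, hr, fun y hy => (hB hy).2, fun y hy => (hB hy).1⟩

end AnalyticLoci

/-! ### Density of the Hodge generic points -/

section Genericity

variable {E : Type*} [NormedAddCommGroup E] [NormedSpace ℂ E] [FiniteDimensional ℂ E]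
  {X S : Type*} [TopologicalSpace X] [ChartedSpace E X] [IsManifold 𝓘(ℂ, E) 1 X] {π : X → S}
  {n : ℕ}

omit [FiniteDimensional ℂ E] in
theorem MatAnalyticAt.eventually {M : E → Matrix (Fin n) (Fin n) ℂ} {x : E}
    (hM : MatAnalyticAt M x) : ∀ᶠ y in 𝓝 x, MatAnalyticAt M y :=
  Filter.eventually_all.2 fun i => Filter.eventually_all.2 fun j => (hM i j).eventually_analyticAt

theorem MatAnalyticAt.aeval {G : Type*} [NormedAddCommGroup G] [NormedSpace ℝ G]
    {M : G → Matrix (Fin n) (Fin n) ℂ} {x : G} (hM : MatAnalyticAt M x)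
    (f : MvPolynomial (Fin n × Fin n) ℚ) :
    AnalyticAt ℝ (fun y => MvPolynomial.aeval (fun ij => M y ij.1 ij.2) f) x := by
  induction f using MvPolynomial.induction_on with
  | C a => simpa using analyticAt_const
  | add p q hp hq =>
    simp only [map_add]
    exact hp.fun_add hq
  | mul_X p i hp =>
    simp only [map_mul, MvPolynomial.aeval_X]
    exact hp.fun_mul (hM i.1 i.2)

namespace ZVMHS

variable (V : ZVMHS E π n)

/-- A chart ball on which there is a real analytic frame adapted to the Deligne splittings. -/
theorem exists_ball_isAdapted (x : X) : ∃ r > 0,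
    Metric.ball (chartAt E x x) r ⊆ (chartAt E x).target ∧
    ∃ (β : E → Matrix (Fin n) (Fin n) ℂ) (p q : Fin n → ℤ),
      ∀ y ∈ Metric.ball (chartAt E x x) r,
        MatAnalyticAt β y ∧ IsAdapted V.W (V.F ((chartAt E x).symm y)) (β y) p q := by
  have hx := mem_chart_source E x
  obtain ⟨β, p, q, hβ, hA⟩ := ((V.holomorphic x).chart hx).exists_analytic_isAdapted (W := V.W)
    (Filter.Eventually.of_forall fun y => V.isMHS _)
  obtain ⟨r, hr, hB, h⟩ := exists_ball_of_eventually (hβ.eventually.and hA)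
  exact ⟨r, hr, hB, β, p, q, h⟩

/-- The set of points whose torus elements satisfy a given polynomial equation. -/
def torusLocus (f : MvPolynomial (Fin n × Fin n) ℚ) : Set X :=
  {x | ∀ z w g, IsTorusElement V.W (V.F x) z w g →
    MvPolynomial.aeval (fun ij => g.1 ij.1 ij.2) f = 0}

/-- In an adapted frame the torus elements are real analytic functions of the point, so a polynomial
equation holds for all of them everywhere or on a closed set with empty interior. -/
theorem torusLocus_dichotomy [PreconnectedSpace X] (f : MvPolynomial (Fin n × Fin n) ℚ) :
    IsClosed (V.torusLocus f) ∧
      (V.torusLocus f = Set.univ ∨ interior (V.torusLocus f) = ∅) := by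
  refine isClosed_and_eq_univ_or_interior_eq_empty (E := E) fun x => ?_
  obtain ⟨r, hr, hB, β, p, q, h⟩ := V.exists_ball_isAdapted x
  let D : ℂˣ → ℂˣ → Matrix (Fin n) (Fin n) ℂ := fun z w =>
    Matrix.diagonal (fun i => (z : ℂ) ^ (-p i) * (w : ℂ) ^ (-q i))
  refine ⟨r, hr, {φ | ∃ z w, φ = fun y => MvPolynomial.aeval
    (fun ij => (β y * D z w * (β y)⁻¹) ij.1 ij.2) f}, hB, ?_, ?_⟩
  · rintro _ ⟨z, w, rfl⟩ y hy
    exact (((h y hy).1.mul (matAnalyticAt_const _ _)).mul ((h y hy).1.inv (h y hy).2.det)).aeval f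
  · intro y hy
    constructor
    · rintro hZ _ ⟨z, w, rfl⟩
      obtain ⟨g, hg⟩ := (h y hy).2.exists_isTorusElement z w
      have h1 := hZ z w g hg
      rw [(h y hy).2.isTorusElement_iff.1 hg] at h1
      exact h1
    · intro hφ z w g hg
      rw [(h y hy).2.isTorusElement_iff.1 hg]
      exact hφ _ ⟨z, w, rfl⟩

/-- Hodge generic points are dense: outside of countably many nowhere dense loci, the polynomial
equations satisfied by the torus elements are those satisfied everywhere. -/
theorem dense_isHodgeGeneric [PreconnectedSpace X] [T2Space X] :
    Dense {x | V.IsHodgeGeneric x} := by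
  have : ProperSpace E := FiniteDimensional.proper ℂ E
  have : LocallyCompactSpace X := ChartedSpace.locallyCompactSpace E X
  have : Countable (MvPolynomial (Fin n × Fin n) ℚ) :=
    Cardinal.mk_le_aleph0_iff.1 (MvPolynomial.cardinalMk_le_max.trans
      (max_le (max_le Cardinal.mk_le_aleph0 Cardinal.mk_le_aleph0) le_rfl))
  let B := {f : MvPolynomial (Fin n × Fin n) ℚ // V.torusLocus f ≠ Set.univ}
  have hdense : Dense (⋂ f : B, (V.torusLocus f.1)ᶜ) := by
    refine dense_iInter_of_isOpen (fun f => (V.torusLocus_dichotomy f.1).1.isOpen_compl)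
      fun f => ?_
    rw [← interior_eq_empty_iff_dense_compl]
    exact (V.torusLocus_dichotomy f.1).2.resolve_left f.2
  refine hdense.mono fun x hx x' => ?_
  have hP := mumfordTate_isRatAlgebraic V.W (V.F x)
  refine mumfordTate_le hP fun z w g hg => ?_
  obtain ⟨I, hI⟩ := hP
  refine (hI g).2 fun f hf => ?_
  have hfx : x ∈ V.torusLocus f := fun z w g hg => (hI g).1 hg.mem_mumfordTate f hf
  -- an equation of the Mumford–Tate group at `x` holds everywhere, as `x` avoids the exceptional
  -- loci
  have huniv : V.torusLocus f = Set.univ := by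
    by_contra hne
    exact Set.mem_iInter.1 hx ⟨f, hne⟩ hfx
  have : x' ∈ V.torusLocus f := huniv ▸ Set.mem_univ x'
  exact this z w g hg

end ZVMHS

end Genericity

/-! ### Points of maximal rank -/

section MaximalRank

variable {E : Type*} [NormedAddCommGroup E] [NormedSpace ℂ E] [FiniteDimensional ℂ E]

/-- A linear map has rank at least `r` if and only if some minor of size `r` does not vanish. -/
theorem le_finrank_range_iff {A B : Type*} [AddCommGroup A] [Module ℂ A] [AddCommGroup B]
    [Module ℂ B] [FiniteDimensional ℂ B] (L : A →ₗ[ℂ] B) (r : ℕ) :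
    r ≤ Module.finrank ℂ (LinearMap.range L) ↔
      ∃ (v : Fin r → A) (ℓ : Fin r → (B →ₗ[ℂ] ℂ)),
        (Matrix.of fun i j => ℓ i (L (v j))).det ≠ 0 := by
  constructor
  · intro h
    obtain ⟨e, he⟩ : ∃ e : Fin r → LinearMap.range L, LinearIndependent ℂ e := by
      let b := Module.finBasis ℂ (LinearMap.range L)
      exact ⟨b ∘ Fin.castLE h, b.linearIndependent.comp _ (Fin.castLE_injective h)⟩
    choose v hv using fun i => (e i).2
    have hlin : LinearIndependent ℂ (fun i => L (v i)) := by
      have h1 := he.map' (LinearMap.range L).subtype (by simp)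
      have : (fun i => L (v i)) = (LinearMap.range L).subtype ∘ e := funext hv
      rw [this]
      exact h1
    -- linear forms dual to the images of the vectors `v i`
    obtain ⟨f, hf⟩ := (Fintype.linearCombination ℂ fun i => L (v i)).exists_leftInverse_of_injective
      (LinearMap.ker_eq_bot.2 (linearIndependent_iff_injective_fintypeLinearCombination.1 hlin))
    refine ⟨v, fun i => (LinearMap.proj i).comp f, ?_⟩
    have : (Matrix.of fun i j => ((LinearMap.proj i).comp f) (L (v j))) =
        (1 : Matrix (Fin r) (Fin r) ℂ) := by
      ext i j
      have h2 := LinearMap.congr_fun hf (Pi.single j 1)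
      rw [LinearMap.comp_apply, Fintype.linearCombination_apply_single, one_smul] at h2
      simp [h2, Matrix.one_apply, Pi.single_apply]
    rw [this]
    simp
  · rintro ⟨v, ℓ, hdet⟩
    have hlin : LinearIndependent ℂ (fun j => (⟨L (v j), v j, rfl⟩ : LinearMap.range L)) := by
      let Ψ : LinearMap.range L →ₗ[ℂ] (Fin r → ℂ) :=
        LinearMap.pi fun i => (ℓ i).comp (LinearMap.range L).subtype
      refine LinearIndependent.of_comp Ψ ?_
      have h1 := Matrix.linearIndependent_cols_of_det_ne_zero hdet
      exact h1
    simpa using hlin.fintype_card_le_finrank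

/-- The partial derivatives of a holomorphic map are analytic. -/
theorem analyticOnNhd_fderiv_apply {G : Type*} [NormedAddCommGroup G]
    [NormedSpace ℂ G] [FiniteDimensional ℂ G] {Θ : E → G} {U : Set E} (hU : IsOpen U)
    (hΘ : DifferentiableOn ℂ Θ U) (v : E) (ℓ : G →ₗ[ℂ] ℂ) :
    AnalyticOnNhd ℝ (fun y => ℓ (fderiv ℂ Θ y v)) U := by
  intro y hy
  have h1 : ∀ᶠ z in 𝓝 y, DifferentiableAt ℂ (fun y => ℓ (fderiv ℂ Θ y v)) z := by
    filter_upwards [hU.mem_nhds hy] with z hz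
    have h2 := (differentiableOn_fderiv hU hΘ).differentiableAt (hU.mem_nhds hz)
    exact (LinearMap.toContinuousLinearMap ℓ).differentiableAt.comp z
      (h2.clm_apply (differentiableAt_const v))
  exact (analyticAt_of_eventually_differentiableAt h1).restrictScalars

variable {X S : Type*} [TopologicalSpace X] [ChartedSpace E X] [IsManifold 𝓘(ℂ, E) 1 X] {π : X → S}
  {n : ℕ}

omit [FiniteDimensional ℂ E] in
theorem HolAt.comp_chart_symm {f : X → Fil n} (hf : ∀ x, HolAt E f x) {x₀ : X} {y : E}
    (hy : y ∈ (chartAt E x₀).target) : HolAt E (f ∘ (chartAt E x₀).symm) y := by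
  have := (hf ((chartAt E x₀).symm y)).chart ((chartAt E x₀).map_target hy)
  rwa [(chartAt E x₀).right_inv hy] at this

theorem finrank_range_filDeriv_comp_chart_symm {f : X → Fil n} (hf : ∀ x, HolAt E f x) {x₀ : X}
    {y : E} (hy : y ∈ (chartAt E x₀).target) :
    Module.finrank ℂ (LinearMap.range (filDeriv E (f ∘ (chartAt E x₀).symm) y)) =
      Module.finrank ℂ (LinearMap.range (filDeriv E f ((chartAt E x₀).symm y))) := by
  have := finrank_range_filDeriv_chart ((chartAt E x₀).map_target hy)
    (hf ((chartAt E x₀).symm y))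
  rwa [(chartAt E x₀).right_inv hy] at this

omit [FiniteDimensional ℂ E] in
/-- A chart ball that a holomorphic family maps into a chart of the flag variety. -/
theorem exists_ball_flagDom {f : X → Fil n} (hf : ∀ x, HolAt E f x) {x : X} {a b : ℤ}
    (hb : FilBdd a b (f x)) : ∃ r > 0,
      Metric.ball (chartAt E x x) r ⊆ (chartAt E x).target ∧
      ∃ π, ∀ y ∈ Metric.ball (chartAt E x x) r, FlagDom a b π (f ((chartAt E x).symm y)) := by
  have hx := mem_chart_source E x
  obtain ⟨π, hπ⟩ := hb.exists_flagDom
  have h1 := ((chartAt E x).left_inv hx).symm ▸ hπ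
  obtain ⟨r, hr, hB, h⟩ := exists_ball_of_eventually
    (FlagDom.holAt (f := f ∘ (chartAt E x).symm) h1 ((hf x).chart hx)).1
  exact ⟨r, hr, hB, π, h⟩

/-- The set of points at which the differential of a holomorphic family of filtrations has rank
less than `r` is locally the zero locus of the minors of size `r` in a chart. -/
theorem isClosed_finrank_range_filDeriv_lt [PreconnectedSpace X] {f : X → Fil n}
    (hf : ∀ x, HolAt E f x) (hb : ∀ x, ∃ a b, FilBdd a b (f x)) (r : ℕ) :
    IsClosed {x | Module.finrank ℂ (LinearMap.range (filDeriv E f x)) < r} ∧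
      ({x | Module.finrank ℂ (LinearMap.range (filDeriv E f x)) < r} = Set.univ ∨
        interior {x | Module.finrank ℂ (LinearMap.range (filDeriv E f x)) < r} = ∅) := by
  refine isClosed_and_eq_univ_or_interior_eq_empty (E := E) fun x => ?_
  obtain ⟨a, b, hab⟩ := hb x
  obtain ⟨ρ, hρ, hB, π, hD⟩ := exists_ball_flagDom hf hab
  let Θ : E → Finset.Icc a b × Fin n × Fin n → ℂ :=
    fun y => flagMap a b π (f ((chartAt E x).symm y))
  have hΘ : DifferentiableOn ℂ Θ (Metric.ball (chartAt E x x) ρ) := fun y hy =>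
    (FlagDom.holAt (f := f ∘ (chartAt E x).symm) (hD y hy)
      (HolAt.comp_chart_symm hf (hB hy))).2.1.differentiableWithinAt
  refine ⟨ρ, hρ, {φ | ∃ (v : Fin r → E) (ℓ : Fin r → (_ →ₗ[ℂ] ℂ)), φ = fun y =>
    (Matrix.of fun i j => ℓ i (fderiv ℂ Θ y (v j))).det}, hB, ?_, ?_⟩
  · rintro _ ⟨v, ℓ, rfl⟩ y hy
    exact MatAnalyticAt.det fun i j =>
      analyticOnNhd_fderiv_apply Metric.isOpen_ball hΘ (v j) (ℓ i) y hy
  · intro y hy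
    have h1 : Module.finrank ℂ (LinearMap.range (filDeriv E f ((chartAt E x).symm y))) =
        Module.finrank ℂ (LinearMap.range (fderiv ℂ Θ y).toLinearMap) :=
      (finrank_range_filDeriv_comp_chart_symm hf (hB hy)).symm.trans
        (finrank_range_fderiv_flagMap (f := f ∘ (chartAt E x).symm) (hD y hy)
          (HolAt.comp_chart_symm hf (hB hy))).symm
    rw [Set.mem_ofPred_eq, h1, ← not_le, le_finrank_range_iff]
    push Not
    constructor
    · rintro h _ ⟨v, ℓ, rfl⟩
      exact h v ℓ
    · intro h v ℓ
      exact h _ ⟨v, ℓ, rfl⟩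

namespace ZVMHS

variable (V : ZVMHS E π n)

/-- The points at which the period map has maximal rank form a dense open set. -/
theorem isOpen_dense_maximal_rank [ConnectedSpace X] :
    IsOpen {x | ∀ x', Module.finrank ℂ (LinearMap.range (filDeriv E V.F x')) ≤
      Module.finrank ℂ (LinearMap.range (filDeriv E V.F x))} ∧
    Dense {x | ∀ x', Module.finrank ℂ (LinearMap.range (filDeriv E V.F x')) ≤
      Module.finrank ℂ (LinearMap.range (filDeriv E V.F x))} := by
  let rk : X → ℕ := fun x => Module.finrank ℂ (LinearMap.range (filDeriv E V.F x))
  have hbdd : BddAbove (Set.range rk) := by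
    refine ⟨Module.finrank ℂ E, ?_⟩
    rintro _ ⟨x, rfl⟩
    have : FiniteDimensional ℂ (TangentSpace 𝓘(ℂ, E) x) := inferInstanceAs (FiniteDimensional ℂ E)
    exact LinearMap.finrank_range_le (filDeriv E V.F x)
  obtain ⟨x₀, hx₀⟩ : ∃ x₀, rk x₀ = sSup (Set.range rk) :=
    Nat.sSup_mem (Set.range_nonempty rk) hbdd
  have heq : {x | ∀ x', rk x' ≤ rk x} = {x | rk x < rk x₀}ᶜ := by
    ext x
    simp only [Set.mem_ofPred_eq, Set.mem_compl_iff, not_lt]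
    exact ⟨fun h => h x₀, fun h x' => (le_csSup hbdd ⟨x', rfl⟩).trans (hx₀ ▸ h)⟩
  have key := isClosed_finrank_range_filDeriv_lt V.holomorphic
    (fun x => (V.isMHS x).exists_filBdd) (rk x₀)
  refine ⟨?_, ?_⟩
  · exact heq ▸ key.1.isOpen_compl
  · have h1 : interior {x | rk x < rk x₀} = ∅ := by
      refine key.2.resolve_left fun h => ?_
      have : x₀ ∈ {x | rk x < rk x₀} := h ▸ Set.mem_univ x₀
      exact lt_irrefl (rk x₀) this
    have h2 := interior_eq_empty_iff_dense_compl.1 h1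
    exact heq ▸ h2

/-- A dense set meets a dense open one. -/
theorem exists_isHodgeGeneric_maximal_rank [ConnectedSpace X] [T2Space X] :
    ∃ x, V.IsHodgeGeneric x ∧
      ∀ x', Module.finrank ℂ (LinearMap.range (filDeriv E V.F x')) ≤
        Module.finrank ℂ (LinearMap.range (filDeriv E V.F x)) := by
  have h := V.isOpen_dense_maximal_rank
  obtain ⟨x, hx1, hx2⟩ := V.dense_isHodgeGeneric.inter_open_nonempty _ h.1 h.2.nonempty
  exact ⟨x, hx2, hx1⟩

end ZVMHS

end MaximalRank

/-! ### Linear differential equations for matrices -/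

section LinearODE

variable {ι : Type*} [Fintype ι]

/-- Two solutions of a linear differential equation for matrices with the same initial value
agree. -/
theorem eq_of_matrix_ode {M g g' : ℝ → Matrix ι ι ℂ} {T : ℝ}
    (hM : ContinuousOn M (Set.Icc 0 T))
    (hg : ∀ t ∈ Set.Icc 0 T, HasMatDerivAt g (M t * g t) t)
    (hg' : ∀ t ∈ Set.Icc 0 T, HasMatDerivAt g' (M t * g' t) t) (h0 : g 0 = g' 0) :
    ∀ t ∈ Set.Icc 0 T, g t = g' t := by
  intro t ht
  ext i j
  have key := eq_zero_of_linear_ode (u := fun s k => g s k j - g' s k j) hM ?_ ?_ t ht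
  · exact sub_eq_zero.1 (congrFun key i)
  · intro s hs k
    refine ((hg s hs k j).fun_sub (hg' s hs k j)).congr_deriv ?_
    simp [Matrix.mul_apply, Matrix.mulVec, dotProduct, mul_sub]
  · funext k
    simp [h0]

/-- The solution of a linear differential equation for matrices with initial value `1` is
invertible. -/
theorem isUnit_det_of_matrix_ode [DecidableEq ι] {M g : ℝ → Matrix ι ι ℂ} {T : ℝ}
    (hM : ContinuousOn M (Set.Icc 0 T))
    (hg : ∀ t ∈ Set.Icc 0 T, HasMatDerivAt g (M t * g t) t) (h0 : g 0 = 1) :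
    ∀ t ∈ Set.Icc 0 T, IsUnit (g t).det := by
  intro t ht
  by_contra hdet
  rw [isUnit_iff_ne_zero, not_not] at hdet
  obtain ⟨w, hw, hgw⟩ := Matrix.exists_mulVec_eq_zero_iff.2 hdet
  -- a solution that vanishes at time `t` vanishes at time `0`
  have hmaps : Set.MapsTo (fun s => t - s) (Set.Icc 0 t) (Set.Icc 0 T) := fun s hs =>
    ⟨by linarith [hs.2], by linarith [hs.1, ht.2]⟩
  have key := eq_zero_of_linear_ode (u := fun s => g (t - s) *ᵥ w) (M := fun s => -M (t - s))
    (T := t) ((hM.comp (by fun_prop) hmaps).neg) ?_ (by simpa using hgw) t ⟨ht.1, le_rfl⟩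
  · simp only [sub_self, h0, Matrix.one_mulVec] at key
    exact hw key
  · intro s hs i
    have h1 := (hg _ (hmaps hs)).mulVec (hasDerivAt_const (t - s) w)
    rw [Matrix.mulVec_zero, add_zero] at h1
    have h2 := (hasDerivAt_pi.1 h1 i).scomp s ((hasDerivAt_id s).const_sub t)
    refine h2.congr_deriv ?_
    simp [Matrix.neg_mulVec, Matrix.mulVec_mulVec]

/-- A curve that starts in a linear subspace and whose derivative stays in it remains in it. -/
theorem mem_of_forall_hasDerivAt_mem {ι : Type*} [Fintype ι] {U : Submodule ℂ (ι → ℂ)}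
    {γ γ' : ℝ → ι → ℂ} {T : ℝ} (hγ : ∀ t ∈ Set.Icc 0 T, HasDerivAt γ (γ' t) t)
    (hU : ∀ t ∈ Set.Icc 0 T, γ' t ∈ U) (h0 : γ 0 ∈ U) : ∀ t ∈ Set.Icc 0 T, γ t ∈ U := by
  intro t ht
  by_contra h
  obtain ⟨ℓ, hℓ, hℓU⟩ := Submodule.exists_le_ker_of_notMem h
  have hℓc : ∀ s ∈ Set.Icc 0 T, HasDerivAt (fun s => ℓ (γ s)) 0 s := by
    intro s hs
    have h1 := ((LinearMap.toContinuousLinearMap ℓ).restrictScalars ℝ).hasFDerivAt.comp_hasDerivAt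
      s (hγ s hs)
    refine h1.congr_deriv ?_
    exact hℓU (hU s hs)
  have h2 := constant_of_has_deriv_right_zero (f := fun s => ℓ (γ s)) (a := 0) (b := T)
    (fun s hs => (hℓc s hs).continuousAt.continuousWithinAt)
    (fun s hs => (hℓc s ⟨hs.1, hs.2.le⟩).hasDerivWithinAt) t ht
  exact hℓ (h2.trans (hℓU h0))

/-- Solutions of `g' = C(x + t v, v) g`, `g(0) = 1`, along the segments `x + t v`, `0 ≤ t ≤ 1`, that
start at `x`, for a family of matrices `C(y, v)` that is homogeneous in `v`. Their values at the end
points depend continuously on the end point. -/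
theorem exists_transport {G : Type*} [NormedAddCommGroup G] [NormedSpace ℝ G]
    [FiniteDimensional ℝ G] [DecidableEq ι] {C : G → G → Matrix ι ι ℂ} {x : G}
    (hC : ∀ i j, ContDiffAt ℝ 1 (fun z : G × G => C z.1 z.2 i j) (x, 0))
    (hs : ∀ y (s : ℝ) v, C y (s • v) = (s : ℂ) • C y v) :
    ∃ δ > 0, ∃ g : G → ℝ → Matrix ι ι ℂ,
      (∀ y ∈ Metric.ball x δ, g y 0 = 1 ∧ ∀ t ∈ Set.Icc (0 : ℝ) 1,
        HasMatDerivAt (g y) (C (x + t • (y - x)) (y - x) * g y t) t) ∧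
      ∀ i j, ContinuousOn (fun y => g y 1 i j) (Metric.ball x δ) := by
  let I₁ : ι → ι → ℂ := fun i j => (1 : Matrix ι ι ℂ) i j
  have : CompleteSpace G := FiniteDimensional.complete ℝ G
  -- the autonomous vector field `(g, y, v) ↦ (C(y, v) g, v, 0)`; its flow is defined on a uniform
  -- time interval near `(1, x, 0)`, and by homogeneity in `v` a rescaling of time reaches the end
  -- points of all short segments
  let Ψ : (ι → ι → ℂ) × G × G → (ι → ι → ℂ) × G × G := fun z =>
    (fun i j => ∑ k, C z.2.1 z.2.2 i k * z.1 k j, z.2.2, 0)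
  have hΨ : ContDiffAt ℝ 1 Ψ (I₁, x, 0) := by
    refine ContDiffAt.prodMk (contDiffAt_pi.2 fun i => contDiffAt_pi.2 fun j => ?_)
      (ContDiffAt.prodMk (by fun_prop) (by fun_prop))
    refine ContDiffAt.sum fun k _ => ContDiffAt.mul ?_ (by fun_prop)
    exact (hC i k).comp (I₁, x, 0)
      (contDiffAt_snd (𝕜 := ℝ) (n := 1) (E := ι → ι → ℂ) (F := G × G))
  obtain ⟨ε, hε, a, r, L, K, hr, hPL⟩ := IsPicardLindelof.of_contDiffAt_one hΨ
  obtain ⟨α, hα, hαc⟩ :=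
    (hPL 0).exists_forall_mem_closedBall_eq_hasDerivWithinAt_continuousOn
  set e := ε / 2 with he
  have he0 : 0 < e := by positivity
  -- the initial value for which the flow reaches `y` at time `e`
  let ζ : G → (ι → ι → ℂ) × G × G := fun y => (I₁, x, (1 / e) • (y - x))
  have hζc : Continuous ζ := by fun_prop
  have hζ : ∀ y ∈ Metric.ball x (e * r), ζ y ∈ Metric.closedBall (I₁, x, 0) r := by
    intro y hy
    rw [Metric.mem_ball, dist_eq_norm] at hy
    have h1 : ‖(1 / e) • (y - x)‖ ≤ r := by
      rw [norm_smul, Real.norm_of_nonneg (by positivity), one_div, inv_mul_le_iff₀ he0]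
      exact hy.le
    rw [Metric.mem_closedBall, Prod.dist_eq, Prod.dist_eq]
    refine max_le (by simp [ζ]) (max_le (by simp [ζ]) ?_)
    rw [dist_zero_right]
    exact h1
  have hmem : ∀ t ∈ Set.Icc (0 : ℝ) 1, 0 - ε < e * t ∧ e * t < 0 + ε := fun t ht =>
    ⟨by nlinarith [ht.1], by nlinarith [ht.2]⟩
  have hder : ∀ y ∈ Metric.ball x (e * r), ∀ s, 0 - ε < s → s < 0 + ε →
      HasDerivAt (fun s => α (ζ y, s)) (Ψ (α (ζ y, s))) s := fun y hy s h1 h2 =>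
    ((hα _ (hζ y hy)).2 s ⟨h1.le, h2.le⟩).hasDerivAt (Icc_mem_nhds h1 h2)
  have h0mem : ∀ s ∈ Set.Icc (0 : ℝ) e, 0 - ε < s ∧ s < 0 + ε := fun s hs =>
    ⟨by linarith [hs.1], by linarith [hs.2]⟩
  -- the second and third component of the flow are explicit
  have hv : ∀ y ∈ Metric.ball x (e * r), ∀ s ∈ Set.Icc (0 : ℝ) e,
      (α (ζ y, s)).2.2 = (1 / e) • (y - x) := by
    intro y hy s hs
    have hd : ∀ s ∈ Set.Icc (0 : ℝ) e, HasDerivAt (fun s => (α (ζ y, s)).2.2) 0 s := by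
      intro s hs
      have h1 := (ContinuousLinearMap.snd ℝ G G ∘L
        ContinuousLinearMap.snd ℝ (ι → ι → ℂ) (G × G)).hasFDerivAt.comp_hasDerivAt s
          (hder y hy s (h0mem s hs).1 (h0mem s hs).2)
      exact h1
    have h2 := constant_of_has_deriv_right_zero (f := fun s => (α (ζ y, s)).2.2) (a := 0) (b := e)
      (fun s hs => (hd s hs).continuousAt.continuousWithinAt)
      (fun s hs => (hd s ⟨hs.1, hs.2.le⟩).hasDerivWithinAt) s hs
    refine h2.trans ?_
    rw [(hα _ (hζ y hy)).1]
  have hy' : ∀ y ∈ Metric.ball x (e * r), ∀ s ∈ Set.Icc (0 : ℝ) e,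
      (α (ζ y, s)).2.1 = x + (s / e) • (y - x) := by
    intro y hy s hs
    have hd : ∀ s ∈ Set.Icc (0 : ℝ) e,
        HasDerivAt (fun s => (α (ζ y, s)).2.1 - (s / e) • (y - x)) 0 s := by
      intro s hs
      have h1 := (ContinuousLinearMap.fst ℝ G G ∘L
        ContinuousLinearMap.snd ℝ (ι → ι → ℂ) (G × G)).hasFDerivAt.comp_hasDerivAt s
          (hder y hy s (h0mem s hs).1 (h0mem s hs).2)
      have h2 : HasDerivAt (fun s => (α (ζ y, s)).2.1) ((α (ζ y, s)).2.2) s := h1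
      have h3 := h2.fun_sub (((hasDerivAt_id s).div_const e).smul_const (y - x))
      refine h3.congr_deriv ?_
      rw [hv y hy s hs, sub_self]
    have h2 := constant_of_has_deriv_right_zero
      (f := fun s => (α (ζ y, s)).2.1 - (s / e) • (y - x)) (a := 0) (b := e)
      (fun s hs => (hd s hs).continuousAt.continuousWithinAt)
      (fun s hs => (hd s ⟨hs.1, hs.2.le⟩).hasDerivWithinAt) s hs
    have h3 : (α (ζ y, 0)).2.1 = x := by rw [(hα _ (hζ y hy)).1]
    simp only [h3, zero_div, zero_smul, sub_zero] at h2
    exact sub_eq_iff_eq_add.1 h2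
  refine ⟨e * r, by positivity, fun y t => Matrix.of (α (ζ y, e * t)).1, fun y hy => ⟨?_, ?_⟩, ?_⟩
  · simp only [mul_zero, (hα _ (hζ y hy)).1]
    rfl
  · intro t ht i j
    have hts : e * t ∈ Set.Icc (0 : ℝ) e := ⟨by nlinarith [ht.1], by nlinarith [ht.2]⟩
    have h1 := (ContinuousLinearMap.fst ℝ (ι → ι → ℂ) (G × G)).hasFDerivAt.comp_hasDerivAt (e * t)
      (hder y hy (e * t) (hmem t ht).1 (hmem t ht).2)
    have h2 : HasDerivAt (fun s => (α (ζ y, s)).1) (Ψ (α (ζ y, e * t))).1 (e * t) := h1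
    have h3 := hasDerivAt_pi.1 (hasDerivAt_pi.1 h2 i) j
    have h4 := h3.scomp t ((hasDerivAt_id t).const_mul e)
    refine h4.congr_deriv ?_
    have e1 : (e * t) / e = t := by field_simp
    simp only [Ψ, hv y hy _ hts, hy' y hy _ hts, e1, hs, Matrix.mul_apply, Matrix.of_apply,
      Matrix.smul_apply, smul_eq_mul, mul_one, Finset.smul_sum, Complex.real_smul]
    refine Finset.sum_congr rfl fun k _ => ?_
    have : (e : ℂ) ≠ 0 := by exact_mod_cast he0.ne'
    push_cast
    field_simp
  · intro i j
    have h1 : ContinuousOn (fun y => α (ζ y, e * 1)) (Metric.ball x (e * r)) :=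
      hαc.comp (by fun_prop) fun y hy => ⟨hζ y hy, (hmem 1 ⟨zero_le_one, le_rfl⟩).1.le,
        (hmem 1 ⟨zero_le_one, le_rfl⟩).2.le⟩
    exact continuousOn_pi.1 (continuousOn_pi.1 (continuous_fst.comp_continuousOn h1) i) j

end LinearODE

/-! ### Hodge components of logarithmic derivatives -/

section Components

variable {n : ℕ}

theorem coord_conj {β : Matrix (Fin n) (Fin n) ℂ} (hβ : IsUnit β.det)
    (M : Matrix (Fin n) (Fin n) ℂ) : β⁻¹ * (β * M * β⁻¹) * β = M := by
  rw [Matrix.mul_assoc, Matrix.mul_assoc, Matrix.nonsing_inv_mul _ hβ, Matrix.mul_one,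
    ← Matrix.mul_assoc, Matrix.nonsing_inv_mul _ hβ, Matrix.one_mul]

theorem conj_coord {β : Matrix (Fin n) (Fin n) ℂ} (hβ : IsUnit β.det)
    (M : Matrix (Fin n) (Fin n) ℂ) : β * (β⁻¹ * M * β) * β⁻¹ = M := by
  rw [Matrix.mul_assoc, Matrix.mul_assoc, Matrix.mul_nonsing_inv _ hβ, Matrix.mul_one,
    ← Matrix.mul_assoc, Matrix.mul_nonsing_inv _ hβ, Matrix.one_mul]

/-- A space of matrices that is stable under conjugation by a diagonalizable matrix is stable under
the polynomials in this conjugation. -/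
theorem polynomial_conj_mem {L : Submodule ℂ (Matrix (Fin n) (Fin n) ℂ)}
    {β : Matrix (Fin n) (Fin n) ℂ} (hβ : IsUnit β.det) {d : Fin n → ℂ}
    (hL : ∀ B ∈ L, β * Matrix.of (fun i j => d i / d j * (β⁻¹ * B * β) i j) * β⁻¹ ∈ L)
    (Q : Polynomial ℂ) {B : Matrix (Fin n) (Fin n) ℂ} (hB : B ∈ L) :
    β * Matrix.of (fun i j => Q.eval (d i / d j) * (β⁻¹ * B * β) i j) * β⁻¹ ∈ L := by
  induction Q using Polynomial.induction_on with
  | C a =>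
    have : Matrix.of (fun i j => (Polynomial.C a).eval (d i / d j) * (β⁻¹ * B * β) i j) =
        a • (β⁻¹ * B * β) := by
      ext i j
      simp
    rw [this, Matrix.mul_smul, Matrix.smul_mul, conj_coord hβ]
    exact L.smul_mem a hB
  | add Q Q' hQ hQ' =>
    have : Matrix.of (fun i j => (Q + Q').eval (d i / d j) * (β⁻¹ * B * β) i j) =
        Matrix.of (fun i j => Q.eval (d i / d j) * (β⁻¹ * B * β) i j) +
          Matrix.of (fun i j => Q'.eval (d i / d j) * (β⁻¹ * B * β) i j) := by
      ext i j
      simp [add_mul]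
    rw [this, Matrix.mul_add, Matrix.add_mul]
    exact L.add_mem hQ hQ'
  | monomial k a h =>
    have h1 := hL _ h
    rw [coord_conj hβ] at h1
    convert h1 using 3
    ext i j
    simp only [Matrix.of_apply, Polynomial.eval_mul, Polynomial.eval_C, Polynomial.eval_pow,
      Polynomial.eval_X]
    ring

/-- A space of matrices that is stable under conjugation by a diagonalizable matrix is graded by the
eigenspaces of this conjugation. -/
theorem mask_mem {L : Submodule ℂ (Matrix (Fin n) (Fin n) ℂ)}
    {β : Matrix (Fin n) (Fin n) ℂ} (hβ : IsUnit β.det) {d : Fin n → ℂ}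
    (hL : ∀ B ∈ L, β * Matrix.of (fun i j => d i / d j * (β⁻¹ * B * β) i j) * β⁻¹ ∈ L)
    {τ : Fin n → Fin n → ℂ} (hτ : ∀ i j k l, d i / d j = d k / d l → τ i j = τ k l)
    {B : Matrix (Fin n) (Fin n) ℂ} (hB : B ∈ L) :
    β * Matrix.of (fun i j => τ i j * (β⁻¹ * B * β) i j) * β⁻¹ ∈ L := by
  classical
  let s : Finset ℂ := Finset.univ.image fun ij : Fin n × Fin n => d ij.1 / d ij.2
  let r : ℂ → ℂ := fun l => if h : ∃ ij : Fin n × Fin n, d ij.1 / d ij.2 = l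
    then τ h.choose.1 h.choose.2 else 0
  have hr : ∀ i j, r (d i / d j) = τ i j := by
    intro i j
    have h : ∃ ij : Fin n × Fin n, d ij.1 / d ij.2 = d i / d j := ⟨(i, j), rfl⟩
    simp only [r]
    rw [dif_pos h]
    exact hτ _ _ _ _ h.choose_spec
  -- the Lagrange interpolation polynomial with `Q(d_i / d_j) = τ_ij`
  have hQ : ∀ i j, (Lagrange.interpolate s id r).eval (d i / d j) = τ i j := by
    intro i j
    have hmem : d i / d j ∈ s := Finset.mem_image.2 ⟨(i, j), Finset.mem_univ _, rfl⟩
    have := Lagrange.eval_interpolate_at_node (s := s) (v := id) r Function.injective_id.injOn hmem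
    rw [id_eq] at this
    rw [this, hr]
  have := polynomial_conj_mem hβ hL (Lagrange.interpolate s id r) hB
  simpa only [hQ] using this

/-- Unique factorization: compare the 2-adic and the 3-adic valuations. -/
theorem two_zpow_mul_three_zpow_injective {a b c d : ℤ}
    (h : (2 : ℂ) ^ a * (3 : ℂ) ^ b = (2 : ℂ) ^ c * (3 : ℂ) ^ d) : a = c ∧ b = d := by
  have hq : (2 : ℚ) ^ a * (3 : ℚ) ^ b = (2 : ℚ) ^ c * (3 : ℚ) ^ d := by
    apply (algebraMap ℚ ℂ).injective
    simpa using h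
  have h2 : Fact (Nat.Prime 2) := ⟨Nat.prime_two⟩
  have h3 : Fact (Nat.Prime 3) := ⟨Nat.prime_three⟩
  have e : ∀ (r : ℕ) [Fact r.Prime] (a b : ℤ), padicValRat r ((2 : ℚ) ^ a * (3 : ℚ) ^ b) =
      a * padicValRat r 2 + b * padicValRat r 3 := by
    intro r _ a b
    rw [padicValRat.mul (by positivity) (by positivity)]
    simp
  have e22 : padicValRat 2 2 = 1 := by exact_mod_cast padicValRat.self (p := 2) (by norm_num)
  have e33 : padicValRat 3 3 = 1 := by exact_mod_cast padicValRat.self (p := 3) (by norm_num)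
  have e23 : padicValRat 2 3 = 0 := by
    have : padicValRat 2 ((3 : ℕ) : ℚ) = 0 := by
      rw [padicValRat.of_nat, padicValNat.eq_zero_of_not_dvd (by norm_num)]
      rfl
    exact_mod_cast this
  have e32 : padicValRat 3 2 = 0 := by
    have : padicValRat 3 ((2 : ℕ) : ℚ) = 0 := by
      rw [padicValRat.of_nat, padicValNat.eq_zero_of_not_dvd (by norm_num)]
      rfl
    exact_mod_cast this
  have k2 := congrArg (padicValRat 2) hq
  have k3 := congrArg (padicValRat 3) hq
  rw [e, e, e22, e23] at k2
  rw [e, e, e32, e33] at k3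
  exact ⟨by linarith, by linarith⟩

variable {W : ℤ → Submodule ℚ (Fin n → ℚ)} {F : Fil n} {β : Matrix (Fin n) (Fin n) ℂ}
  {p q : Fin n → ℤ} {P : Subgroup (GL (Fin n) ℂ)}

/-- The eigenvalues of the element `φ_ℂ(2, 3)` of the Deligne torus; they separate the types. -/
def torusWeight (p q : Fin n → ℤ) (i : Fin n) : ℂ := (2 : ℂ) ^ (-p i) * (3 : ℂ) ^ (-q i)

theorem torusWeight_div (p q : Fin n → ℤ) (i j : Fin n) :
    torusWeight p q i / torusWeight p q j =
      (2 : ℂ) ^ (-(p i - p j)) * (3 : ℂ) ^ (-(q i - q j)) := by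
  simp only [torusWeight]
  rw [show -(p i - p j) = -p i - -p j by ring, show -(q i - q j) = -q i - -q j by ring,
    zpow_sub₀ (by norm_num), zpow_sub₀ (by norm_num), mul_div_mul_comm]

theorem torusWeight_ne_zero (p q : Fin n → ℤ) (i : Fin n) : torusWeight p q i ≠ 0 :=
  mul_ne_zero (zpow_ne_zero _ (by norm_num)) (zpow_ne_zero _ (by norm_num))

theorem IsAdapted.exists_torusWeight (h : IsAdapted W F β p q) : ∃ (z w : ℂˣ) (g : GL (Fin n) ℂ),
    IsTorusElement W F z w g ∧ g.1 = β * Matrix.diagonal (torusWeight p q) * β⁻¹ := by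
  obtain ⟨z, hz⟩ : ∃ z : ℂˣ, (z : ℂ) = 2 := ⟨Units.mk0 2 (by norm_num), rfl⟩
  obtain ⟨w, hw⟩ : ∃ w : ℂˣ, (w : ℂ) = 3 := ⟨Units.mk0 3 (by norm_num), rfl⟩
  obtain ⟨g, hg⟩ := h.exists_isTorusElement z w
  refine ⟨z, w, g, hg, ?_⟩
  rw [h.isTorusElement_iff.1 hg, hz, hw]
  rfl

/-- For the Lie algebra of an algebraic group that contains the Deligne torus, the components with
respect to the Deligne splitting of an element of the Lie algebra lie in it. -/
theorem IsAdapted.mask_mem_lieAlgC (h : IsAdapted W F β p q) (hP : IsRatAlgebraic P)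
    (hT : ∀ z w g, IsTorusElement W F z w g → g ∈ P) (τ : ℤ → ℤ → ℂ)
    {B : Matrix (Fin n) (Fin n) ℂ} (hB : B ∈ lieAlgC P) :
    β * Matrix.of (fun i j => τ (p i - p j) (q i - q j) * (β⁻¹ * B * β) i j) * β⁻¹ ∈
      lieAlgC P := by
  refine mask_mem h.det (d := torusWeight p q) ?_ ?_ hB
  · intro B hB
    obtain ⟨z, w, g, hg, hgD⟩ := h.exists_torusWeight
    have h1 := hP.conj_mem_lieAlgC (hT z w g hg) hB
    have hne := torusWeight_ne_zero p q
    have hgi : g⁻¹.1 = β * Matrix.diagonal (fun i => (torusWeight p q i)⁻¹) * β⁻¹ := by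
      rw [Matrix.coe_units_inv, hgD]
      refine Matrix.inv_eq_right_inv ?_
      calc β * Matrix.diagonal (torusWeight p q) * β⁻¹ *
            (β * Matrix.diagonal (fun i => (torusWeight p q i)⁻¹) * β⁻¹)
          = β * (Matrix.diagonal (torusWeight p q) * (β⁻¹ * β) *
            Matrix.diagonal (fun i => (torusWeight p q i)⁻¹)) * β⁻¹ := by
              simp only [Matrix.mul_assoc]
        _ = 1 := by
          have hone : (fun i => torusWeight p q i * (torusWeight p q i)⁻¹) = 1 :=
            funext fun i => mul_inv_cancel₀ (hne i)
          rw [Matrix.nonsing_inv_mul _ h.det, Matrix.mul_one, Matrix.diagonal_mul_diagonal, hone]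
          simp [Matrix.mul_nonsing_inv _ h.det]
    rw [hgi, hgD] at h1
    convert h1 using 1
    have : Matrix.of (fun i j => torusWeight p q i / torusWeight p q j * (β⁻¹ * B * β) i j) =
        Matrix.diagonal (torusWeight p q) * (β⁻¹ * B * β) *
          Matrix.diagonal (fun i => (torusWeight p q i)⁻¹) := by
      ext i j
      rw [Matrix.mul_diagonal, Matrix.diagonal_mul, Matrix.of_apply]
      ring
    rw [this]
    simp only [Matrix.mul_assoc]
  · intro i j k l hd
    rw [torusWeight_div, torusWeight_div] at hd
    obtain ⟨h1, h2⟩ := two_zpow_mul_three_zpow_injective hd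
    rw [neg_inj.1 h1, neg_inj.1 h2]

/-- The component of Hodge type `p < 0` of the logarithmic derivative `b β⁻¹` of an adapted
frame. -/
def negComponent (β b : Matrix (Fin n) (Fin n) ℂ) (p : Fin n → ℤ) : Matrix (Fin n) (Fin n) ℂ :=
  β * Matrix.of (fun i j => if p i < p j then (β⁻¹ * b) i j else 0) * β⁻¹

/-- The real matrix `A + conj A`, for `A` as in `negComponent`. -/
def realComponent (β b : Matrix (Fin n) (Fin n) ℂ) (p : Fin n → ℤ) : Matrix (Fin n) (Fin n) ℂ :=
  negComponent β b p + (negComponent β b p).map (starRingEnd ℂ)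

/-- Minus the component of negative weight of `conj A`, for `A` as in `negComponent`. -/
def nilComponent (β b : Matrix (Fin n) (Fin n) ℂ) (p q : Fin n → ℤ) : Matrix (Fin n) (Fin n) ℂ :=
  -(β * Matrix.of (fun i j => if p i + q i < p j + q j then
    (β⁻¹ * (negComponent β b p).map (starRingEnd ℂ) * β) i j else 0) * β⁻¹)

theorem realComponent_conj (β b : Matrix (Fin n) (Fin n) ℂ) (p : Fin n → ℤ) :
    (realComponent β b p).map (starRingEnd ℂ) = realComponent β b p := by
  ext i j
  simp [realComponent, add_comm]

/-- Differentiating the torus elements `β D β⁻¹ ∈ P` shows that the components of nonzero type of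
the logarithmic derivative of `β` lie in the Lie algebra of `P`. -/
theorem negComponent_mem_lieAlgC (hP : IsRatAlgebraic P) {c : ℝ → Matrix (Fin n) (Fin n) ℂ}
    {b : Matrix (Fin n) (Fin n) ℂ} {t : ℝ} {f : ℝ → Fil n} (hc : HasMatDerivAt c b t)
    (hA : ∀ᶠ s in 𝓝 t, IsAdapted W (f s) (c s) p q)
    (hT : ∀ᶠ s in 𝓝 t, ∀ z w g, IsTorusElement W (f s) z w g → g ∈ P) :
    negComponent (c t) b p ∈ lieAlgC P := by
  set β := c t with hβ
  have h := hA.self_of_nhds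
  set D := Matrix.diagonal (torusWeight p q) with hD
  have hne := torusWeight_ne_zero p q
  have hDu : IsUnit D.det := by
    rw [hD, Matrix.det_diagonal, isUnit_iff_ne_zero, Finset.prod_ne_zero_iff]
    exact fun i _ => hne i
  have h1 : HasMatDerivAt (fun s => c s * D * (c s)⁻¹)
      (b * D * β⁻¹ + β * D * (-(β⁻¹ * b * β⁻¹))) t := by
    have := (hc.mul (hasMatDerivAt_const D t)).mul (hc.inv h.det)
    rwa [mul_zero, add_zero] at this
  have h2 := hP.deriv_mul_inv_mem_lieAlgC h1 (by
    filter_upwards [hA, hT] with s hs hTs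
    obtain ⟨z, w, g, hg, hgD⟩ := hs.exists_torusWeight
    exact ⟨g, hTs z w g hg, hgD⟩)
  have hinv : (β * D * β⁻¹)⁻¹ = β * D⁻¹ * β⁻¹ := by
    rw [Matrix.mul_inv_rev, Matrix.mul_inv_rev, Matrix.nonsing_inv_nonsing_inv _ h.det,
      Matrix.mul_assoc]
  -- in the adapted basis, the logarithmic derivative of `β D β⁻¹` is `B - D B D⁻¹`, where `B = β⁻¹
  -- b`
  have hco : β⁻¹ * ((b * D * β⁻¹ + β * D * (-(β⁻¹ * b * β⁻¹))) * (β * D * β⁻¹)⁻¹) * β =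
      β⁻¹ * b - D * (β⁻¹ * b) * D⁻¹ := by
    have e1 : β⁻¹ * β = 1 := Matrix.nonsing_inv_mul _ h.det
    have e2 : D * D⁻¹ = 1 := Matrix.mul_nonsing_inv _ hDu
    rw [hinv]
    calc β⁻¹ * ((b * D * β⁻¹ + β * D * (-(β⁻¹ * b * β⁻¹))) * (β * D⁻¹ * β⁻¹)) * β
        = β⁻¹ * b * (D * (β⁻¹ * β) * D⁻¹) * (β⁻¹ * β) -
          (β⁻¹ * β) * D * β⁻¹ * b * (β⁻¹ * β) * D⁻¹ * (β⁻¹ * β) := by noncomm_ring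
      _ = β⁻¹ * b - D * (β⁻¹ * b) * D⁻¹ := by
        rw [e1, Matrix.mul_one D, e2]
        noncomm_ring
  have hDinv : D⁻¹ = Matrix.diagonal fun i => (torusWeight p q i)⁻¹ := by
    refine Matrix.inv_eq_right_inv ?_
    have hone : (fun i => torusWeight p q i * (torusWeight p q i)⁻¹) = 1 :=
      funext fun i => mul_inv_cancel₀ (hne i)
    rw [hD, Matrix.diagonal_mul_diagonal, hone]
    simp
  -- divide the component of type `(m, l)` by `1 - 2⁻ᵐ 3⁻ˡ`, which is nonzero for `m < 0`
  have h3 := h.mask_mem_lieAlgC hP hT.self_of_nhds (fun m l => if m < 0 then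
    (1 - (2 : ℂ) ^ (-m) * (3 : ℂ) ^ (-l))⁻¹ else 0) h2
  rw [hco] at h3
  rw [negComponent]
  convert h3 using 3
  ext i j
  rw [Matrix.of_apply, Matrix.of_apply, Matrix.sub_apply, hDinv, Matrix.mul_diagonal,
    Matrix.diagonal_mul]
  by_cases hij : p i < p j
  · have hij' : p i - p j < 0 := by omega
    rw [if_pos hij, if_pos hij', ← torusWeight_div]
    have hne1 : 1 - torusWeight p q i / torusWeight p q j ≠ 0 := by
      rw [sub_ne_zero, torusWeight_div]
      intro e
      have : (2 : ℂ) ^ (0 : ℤ) * (3 : ℂ) ^ (0 : ℤ) =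
          (2 : ℂ) ^ (-(p i - p j)) * (3 : ℂ) ^ (-(q i - q j)) := by simpa using e
      have := (two_zpow_mul_three_zpow_injective this).1
      omega
    have : (β⁻¹ * b) i j - torusWeight p q i * (β⁻¹ * b) i j * (torusWeight p q j)⁻¹ =
        (1 - torusWeight p q i / torusWeight p q j) * (β⁻¹ * b) i j := by ring
    rw [this, inv_mul_cancel_left₀ hne1]
  · have hij' : ¬ p i - p j < 0 := by omega
    rw [if_neg hij, if_neg hij', zero_mul]

section

variable {b : Matrix (Fin n) (Fin n) ℂ}

theorem realComponent_mem_lieAlgC (hb : negComponent β b p ∈ lieAlgC P) :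
    realComponent β b p ∈ lieAlgC P :=
  add_mem hb (map_star_mem_lieAlgC hb)

/-- The nilpotent part is, up to sign, a sum of Hodge components of the conjugate of an element of
the Lie algebra. -/
theorem IsAdapted.nilComponent_mem_lieAlgC (h : IsAdapted W F β p q) (hP : IsRatAlgebraic P)
    (hT : ∀ z w g, IsTorusElement W F z w g → g ∈ P) (hb : negComponent β b p ∈ lieAlgC P) :
    nilComponent β b p q ∈ lieAlgC P := by
  refine neg_mem ?_
  have := h.mask_mem_lieAlgC hP hT (fun m l => if m + l < 0 then 1 else 0)
    (map_star_mem_lieAlgC hb)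
  convert this using 3
  ext i j
  have e : (p i - p j + (q i - q j) < 0) ↔ p i + q i < p j + q j := by omega
  simp [e]

/-- The nilpotent part lowers the weight by at least one. -/
theorem IsAdapted.nilComponent_mulVec_mem (h : IsAdapted W F β p q) {k : ℤ} {v : Fin n → ℂ}
    (hv : v ∈ complexify (W k)) : nilComponent β b p q *ᵥ v ∈ complexify (W (k - 1)) := by
  have := (h.forall_mulVec_mem_iff (k := -1) (A := nilComponent β b p q)).2 (fun i j hij => by
    rw [nilComponent, Matrix.mul_neg, Matrix.neg_mul, coord_conj h.det, Matrix.neg_apply,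
      Matrix.of_apply, if_neg (by omega), neg_zero])
  exact this k v hv

/-- Modulo `F^0`, the logarithmic derivative of an adapted frame is the sum of its real part and of
its nilpotent part. -/
theorem IsAdapted.coord_realComponent_add_nilComponent (h : IsAdapted W F β p q) (hP : IsRatAlgebraic P)
    (hPW : P ≤ weightStab W) (hb : negComponent β b p ∈ lieAlgC P) {i j : Fin n} (hij : p i < p j) :
    (β⁻¹ * (realComponent β b p + nilComponent β b p q) * β) i j = (β⁻¹ * b) i j := by
  have hW : ∀ B ∈ lieAlgC P, ∀ i j, p j + q j < p i + q i → (β⁻¹ * B * β) i j = 0 := by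
    intro B hB i j hij
    refine (h.forall_mulVec_mem_iff (k := 0)).1 (fun l v hv => ?_) i j (by omega)
    rw [add_zero]
    exact hP.lieAlgC_le_endW hPW hB l v hv
  have hco : β⁻¹ * negComponent β b p * β =
      Matrix.of (fun i j => if p i < p j then (β⁻¹ * b) i j else 0) := coord_conj h.det _
  have hconj : p i + q i = p j + q j →
      (β⁻¹ * (negComponent β b p).map (starRingEnd ℂ) * β) i j = 0 := fun hw => by
    refine h.coord_conj_eq_zero (fun k l hkl => ?_) hw hij.le
    have h1 : p k < p l := by
      by_contra h1
      rw [hco, Matrix.of_apply, if_neg h1] at hkl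
      exact hkl rfl
    exact ⟨h1, not_lt.1 fun h2 => hkl (hW _ hb _ _ h2)⟩
  have e : β⁻¹ * (realComponent β b p + nilComponent β b p q) * β = β⁻¹ * negComponent β b p * β +
      β⁻¹ * (negComponent β b p).map (starRingEnd ℂ) * β + β⁻¹ * nilComponent β b p q * β := by
    rw [realComponent]
    noncomm_ring
  rw [e, Matrix.add_apply, Matrix.add_apply, hco, Matrix.of_apply, if_pos hij, nilComponent,
    Matrix.mul_neg, Matrix.neg_mul, coord_conj h.det, Matrix.neg_apply, Matrix.of_apply]
  -- the conjugate part contributes nothing: in negative weight it is cancelled by the nilpotent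
  -- part, in weight zero it vanishes by Hodge symmetry, and in positive weight it vanishes because
  -- `P` preserves the weight filtration
  split_ifs with hw
  · ring
  · rcases (not_lt.1 hw).eq_or_lt with hw | hw
    · rw [hconj hw.symm]
      ring
    · rw [hW _ (map_star_mem_lieAlgC hb) _ _ hw]
      ring

end

end Components

/-! ### Parallel transport in `P(ℝ) 𝐖(ℂ)` -/

section Transport

variable {n : ℕ} {W : ℤ → Submodule ℚ (Fin n → ℚ)} {F F' : Fil n}
  {β β' : Matrix (Fin n) (Fin n) ℂ} {p q : Fin n → ℤ} {P : Subgroup (GL (Fin n) ℂ)}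

theorem finrank_coordSub_le (hβ : IsUnit β.det) (hβ' : IsUnit β'.det) (T : Set (Fin n)) :
    Module.finrank ℂ (coordSub β' T) ≤ Module.finrank ℂ (coordSub β T) := by
  have hle : coordSub β' T ≤ (coordSub β T).map (β' * β⁻¹).mulVecLin := by
    intro v hv
    refine ⟨β *ᵥ (β'⁻¹ *ᵥ v), fun i hi => ?_, ?_⟩
    · rw [inv_mulVec_mulVec hβ]
      exact hv i hi
    · rw [Matrix.mulVecLin_apply, ← Matrix.mulVec_mulVec, inv_mulVec_mulVec hβ,
        mulVec_inv_mulVec hβ']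
  exact (Submodule.finrank_mono (R := ℂ) hle).trans (Submodule.finrank_map_le _ _)

/-- A matrix that is block triangular with respect to two adapted frames of the same types maps one
Hodge filtration to the other. -/
theorem IsAdapted.eq_act_of_coord (h : IsAdapted W F β p q) (h' : IsAdapted W F' β' p q)
    {g : Matrix (Fin n) (Fin n) ℂ} (hg : IsUnit g.det)
    (hco : ∀ i j, p i < p j → (β'⁻¹ * g * β) i j = 0) : F' = Fil.act g F := by
  funext a
  symm
  refine Submodule.eq_of_le_of_finrank_le ?_ ?_
  · rintro _ ⟨v, hv, rfl⟩
    rw [Matrix.mulVecLin_apply, h'.F_eq_coordSub]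
    rw [SetLike.mem_coe, h.F_eq_coordSub] at hv
    intro i hi
    have e : β'⁻¹ *ᵥ (g *ᵥ v) = (β'⁻¹ * g * β) *ᵥ (β⁻¹ *ᵥ v) := by
      rw [← Matrix.mulVec_mulVec, mulVec_inv_mulVec h.det, Matrix.mulVec_mulVec]
    rw [e]
    change ∑ j, (β'⁻¹ * g * β) i j * (β⁻¹ *ᵥ v) j = 0
    refine Finset.sum_eq_zero fun j _ => ?_
    by_cases hj : a ≤ p j
    · rw [hco i j ((not_le.1 hi).trans_le hj), zero_mul]
    · rw [hv j hj, mul_zero]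
  · have h1 : F a ≤ (Fil.act g F a).map g⁻¹.mulVecLin := fun v hv =>
      ⟨g *ᵥ v, ⟨v, hv, rfl⟩, inv_mulVec_mulVec hg v⟩
    have h2 : Module.finrank ℂ (F' a) ≤ Module.finrank ℂ (F a) := by
      rw [h.F_eq_coordSub, h'.F_eq_coordSub]
      exact finrank_coordSub_le h.det h'.det _
    exact h2.trans ((Submodule.finrank_mono h1).trans (Submodule.finrank_map_le _ _))

theorem HasMatDerivAt.continuousAt {c : ℝ → Matrix (Fin n) (Fin n) ℂ}
    {c' : Matrix (Fin n) (Fin n) ℂ} {t : ℝ} (hc : HasMatDerivAt c c' t) : ContinuousAt c t :=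
  continuousAt_pi.2 fun i => continuousAt_pi.2 fun j => (hc i j).continuousAt

theorem HasMatDerivAt.conj {c : ℝ → Matrix (Fin n) (Fin n) ℂ}
    {c' : Matrix (Fin n) (Fin n) ℂ} {t : ℝ} (hc : HasMatDerivAt c c' t) :
    HasMatDerivAt (fun s => (c s).map (starRingEnd ℂ)) (c'.map (starRingEnd ℂ)) t := by
  intro i j
  have := (Complex.conjCLE.toContinuousLinearMap.hasFDerivAt (x := c t i j)).comp_hasDerivAt t
    (hc i j)
  exact this

/-- Parallel transport along a curve of mixed Hodge structures whose Deligne tori lie in `P`: the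
solution `g` of `g' = (R + N) g`, where `R` and `N` are the real and the nilpotent part of the
logarithmic derivative of an adapted frame, takes values in `P(ℝ) 𝐖(ℂ)` and maps the initial to the
final filtration. Indeed the solution `h` of `h' = R h` is real, and `h⁻¹ g` acts trivially on the
graded pieces of the weight filtration. -/
theorem transport_mem_realUnipotent (hP : IsRatAlgebraic P) (hPW : P ≤ weightStab W)
    {c b h g : ℝ → Matrix (Fin n) (Fin n) ℂ} {f : ℝ → Fil n}
    (hc : ∀ t ∈ Set.Icc (0 : ℝ) 1, HasMatDerivAt c (b t) t)
    (hA : ∀ t ∈ Set.Icc (0 : ℝ) 1, IsAdapted W (f t) (c t) p q)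
    (hT : ∀ t ∈ Set.Icc (0 : ℝ) 1, ∀ z w g, IsTorusElement W (f t) z w g → g ∈ P)
    (hneg : ∀ t ∈ Set.Icc (0 : ℝ) 1, negComponent (c t) (b t) p ∈ lieAlgC P)
    (hb : ContinuousOn b (Set.Icc 0 1))
    (hR : ContinuousOn (fun t => realComponent (c t) (b t) p) (Set.Icc 0 1))
    (hN : ContinuousOn (fun t => nilComponent (c t) (b t) p q) (Set.Icc 0 1))
    (hh : ∀ t ∈ Set.Icc (0 : ℝ) 1, HasMatDerivAt h (realComponent (c t) (b t) p * h t) t)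
    (hg : ∀ t ∈ Set.Icc (0 : ℝ) 1, HasMatDerivAt g
      ((realComponent (c t) (b t) p + nilComponent (c t) (b t) p q) * g t) t)
    (hh0 : h 0 = 1) (hg0 : g 0 = 1) :
    ∃ γ ∈ realUnipotent P, γ.1 = g 1 ∧ f 1 = Fil.act (g 1) (f 0) := by
  have h0mem : (0 : ℝ) ∈ Set.Icc (0 : ℝ) 1 := ⟨le_rfl, zero_le_one⟩
  have h1mem : (1 : ℝ) ∈ Set.Icc (0 : ℝ) 1 := ⟨zero_le_one, le_rfl⟩
  have hRP : ∀ t ∈ Set.Icc (0 : ℝ) 1, realComponent (c t) (b t) p ∈ lieAlgC P := fun t ht =>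
    realComponent_mem_lieAlgC (hneg t ht)
  have hNP : ∀ t ∈ Set.Icc (0 : ℝ) 1, nilComponent (c t) (b t) p q ∈ lieAlgC P := fun t ht =>
    (hA t ht).nilComponent_mem_lieAlgC hP (hT t ht) (hneg t ht)
  have hhu := isUnit_det_of_matrix_ode hR hh hh0
  have hgu := isUnit_det_of_matrix_ode (hR.add hN) hg hg0
  let η : ∀ t ∈ Set.Icc (0 : ℝ) 1, GL (Fin n) ℂ := fun t ht =>
    Matrix.GeneralLinearGroup.mk'' (h t) (hhu t ht)
  have hηP : ∀ t (ht : t ∈ Set.Icc (0 : ℝ) 1), η t ht ∈ P := fun t ht =>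
    hP.mem_of_ode hRP hR hh hh0 ht rfl
  have hηinv : ∀ t (ht : t ∈ Set.Icc (0 : ℝ) 1), (η t ht)⁻¹.1 = (h t)⁻¹ := fun t ht =>
    Matrix.coe_units_inv _
  -- `h` is real
  have hreal : ∀ t ∈ Set.Icc (0 : ℝ) 1, (h t).map (starRingEnd ℂ) = h t := by
    refine eq_of_matrix_ode hR (fun t ht => ?_) hh ?_
    · have h1 := (hh t ht).conj
      rwa [Matrix.map_mul, realComponent_conj] at h1
    · rw [hh0, Matrix.map_one _ (map_zero _) (map_one _)]
  -- the differential equation for `k = h⁻¹ g`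
  let N' : ℝ → Matrix (Fin n) (Fin n) ℂ := fun t => (h t)⁻¹ * nilComponent (c t) (b t) p q * h t
  have hk : ∀ t ∈ Set.Icc (0 : ℝ) 1,
      HasMatDerivAt (fun s => (h s)⁻¹ * g s) (N' t * ((h t)⁻¹ * g t)) t := by
    intro t ht
    have h1 := ((hh t ht).inv (hhu t ht)).mul (hg t ht)
    have e1 : h t * (h t)⁻¹ = 1 := Matrix.mul_nonsing_inv _ (hhu t ht)
    have e : N' t * ((h t)⁻¹ * g t) =
        -((h t)⁻¹ * (realComponent (c t) (b t) p * h t) * (h t)⁻¹) * g t +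
          (h t)⁻¹ * ((realComponent (c t) (b t) p + nilComponent (c t) (b t) p q) * g t) := by
      calc N' t * ((h t)⁻¹ * g t)
          = (h t)⁻¹ * nilComponent (c t) (b t) p q * (h t * (h t)⁻¹) * g t := by
            simp only [N', Matrix.mul_assoc]
        _ = -((h t)⁻¹ * realComponent (c t) (b t) p * 1) * g t +
          (h t)⁻¹ * ((realComponent (c t) (b t) p + nilComponent (c t) (b t) p q) * g t) := by
            rw [e1]
            noncomm_ring
        _ = _ := by
            rw [← e1]
            simp only [Matrix.mul_assoc]
    rw [e]
    exact h1
  have hN'P : ∀ t ∈ Set.Icc (0 : ℝ) 1, N' t ∈ lieAlgC P := by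
    intro t ht
    have h1 := hP.conj_mem_lieAlgC (P.inv_mem (hηP t ht)) (hNP t ht)
    rw [inv_inv, hηinv t ht] at h1
    exact h1
  have hhc : ContinuousOn h (Set.Icc 0 1) := fun t ht =>
    (hh t ht).continuousAt.continuousWithinAt
  have hhic : ContinuousOn (fun t => (h t)⁻¹) (Set.Icc 0 1) := fun t ht =>
    ((hh t ht).inv (hhu t ht)).continuousAt.continuousWithinAt
  have hN'c : ContinuousOn N' (Set.Icc 0 1) := (hhic.mul hN).mul hhc
  have hk0 : (h 0)⁻¹ * g 0 = 1 := by rw [hh0, hg0, inv_one, Matrix.mul_one]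
  have hku : ∀ t ∈ Set.Icc (0 : ℝ) 1, IsUnit ((h t)⁻¹ * g t).det := fun t ht => by
    rw [Matrix.det_mul]
    exact (Matrix.isUnit_nonsing_inv_det _ (hhu t ht)).mul (hgu t ht)
  let κ : ∀ t ∈ Set.Icc (0 : ℝ) 1, GL (Fin n) ℂ := fun t ht =>
    Matrix.GeneralLinearGroup.mk'' ((h t)⁻¹ * g t) (hku t ht)
  have hκP : ∀ t (ht : t ∈ Set.Icc (0 : ℝ) 1), κ t ht ∈ P := fun t ht =>
    hP.mem_of_ode hN'P hN'c hk hk0 ht rfl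
  -- `k` acts trivially on the graded pieces of the weight filtration
  have hκW : κ 1 h1mem ∈ weightUnipotent W := by
    refine ⟨hPW (hκP 1 h1mem), fun l v hv => ?_⟩
    refine mem_of_forall_hasDerivAt_mem (T := 1)
      (γ := fun t => ((h t)⁻¹ * g t - 1) *ᵥ v)
      (γ' := fun t => (N' t * ((h t)⁻¹ * g t)) *ᵥ v) (fun t ht => ?_) (fun t ht => ?_) ?_ 1 h1mem
    · have h1 := (hk t ht).mulVec (hasDerivAt_const t v)
      rw [Matrix.mulVec_zero, add_zero] at h1
      simp only [Matrix.sub_mulVec, Matrix.one_mulVec]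
      exact h1.sub_const v
    · have h1 : ((h t)⁻¹ * g t) *ᵥ v ∈ complexify (W l) := hPW (hκP t ht) l v hv
      have h2 : h t *ᵥ (((h t)⁻¹ * g t) *ᵥ v) ∈ complexify (W l) := hPW (hηP t ht) l _ h1
      have h3 := (hA t ht).nilComponent_mulVec_mem (b := b t) h2
      have h4 := hPW (P.inv_mem (hηP t ht)) (l - 1) _ h3
      rw [hηinv t ht] at h4
      simpa only [N', Matrix.mulVec_mulVec, Matrix.mul_assoc] using h4
    · simp only [hk0, sub_self, Matrix.zero_mulVec]
      exact zero_mem _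
  have hκU : κ 1 h1mem ∈ unipotentRadical P :=
    hP.inf_weightUnipotent_le hPW (hA 0 h0mem).isMHS ⟨hκP 1 h1mem, hκW⟩
  have hηR : η 1 h1mem ∈ realPoints P := by
    refine ⟨hηP 1 h1mem, ?_⟩
    refine Units.ext ?_
    exact (hreal 1 h1mem).symm
  have hprod : (η 1 h1mem * κ 1 h1mem).1 = g 1 := by
    change h 1 * ((h 1)⁻¹ * g 1) = g 1
    rw [← Matrix.mul_assoc, Matrix.mul_nonsing_inv _ (hhu 1 h1mem), Matrix.one_mul]
  refine ⟨η 1 h1mem * κ 1 h1mem, mul_mem (le_sup_left (a := realPoints P) hηR)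
    (le_sup_right (a := realPoints P) hκU), hprod, ?_⟩
  -- `g` maps the Hodge filtration to the Hodge filtration
  refine (hA 0 h0mem).eq_act_of_coord (hA 1 h1mem) (hgu 1 h1mem) fun i j hij => ?_
  -- `c⁻¹ g c(0)` solves `m' = M m`, where `M` is block triangular with respect to the Hodge
  -- filtration
  let C : ℝ → Matrix (Fin n) (Fin n) ℂ := fun t =>
    realComponent (c t) (b t) p + nilComponent (c t) (b t) p q
  let M : ℝ → Matrix (Fin n) (Fin n) ℂ := fun t => (c t)⁻¹ * C t * c t - (c t)⁻¹ * b t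
  have hM : ∀ t ∈ Set.Icc (0 : ℝ) 1, ∀ i j, p i < p j → M t i j = 0 := by
    intro t ht i j hij
    refine (Matrix.sub_apply _ _ i j).trans ?_
    rw [(hA t ht).coord_realComponent_add_nilComponent hP hPW (hneg t ht) hij,
      sub_self]
  have hcc : ContinuousOn c (Set.Icc 0 1) := fun t ht => (hc t ht).continuousAt.continuousWithinAt
  have hcic : ContinuousOn (fun t => (c t)⁻¹) (Set.Icc 0 1) := fun t ht =>
    ((hc t ht).inv (hA t ht).det).continuousAt.continuousWithinAt
  have hMc : ContinuousOn M (Set.Icc 0 1) :=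
    ((hcic.mul (hR.add hN)).mul hcc).sub (hcic.mul hb)
  have hm : ∀ t ∈ Set.Icc (0 : ℝ) 1, HasMatDerivAt (fun s => (c s)⁻¹ * g s * c 0)
      (M t * ((c t)⁻¹ * g t * c 0)) t := by
    intro t ht
    have h1 := (((hc t ht).inv (hA t ht).det).mul (hg t ht)).mul (hasMatDerivAt_const (c 0) t)
    have e1 : c t * (c t)⁻¹ = 1 := Matrix.mul_nonsing_inv _ (hA t ht).det
    convert h1 using 1
    calc M t * ((c t)⁻¹ * g t * c 0)
        = (c t)⁻¹ * C t * (c t * (c t)⁻¹) * g t * c 0 - (c t)⁻¹ * b t * (c t)⁻¹ * g t * c 0 := by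
          simp only [M]
          noncomm_ring
      _ = _ := by
          rw [e1]
          simp only [C]
          noncomm_ring
  -- the entries `(i, j)` with `p i < p j`, for fixed `j`, solve a linear system
  have key := eq_zero_of_linear_ode (T := 1)
    (u := fun t i => if p i < p j then ((c t)⁻¹ * g t * c 0) i j else 0)
    (M := fun t => Matrix.of fun i k => if p i < p j then M t i k else 0) ?_ ?_ ?_ 1 h1mem
  · have := congrFun key i
    simp only [if_pos hij] at this
    exact this
  · refine continuousOn_pi.2 fun i => continuousOn_pi.2 fun k => ?_
    by_cases hi : p i < p j
    · simp only [Matrix.of_apply, if_pos hi]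
      exact continuousOn_pi.1 (continuousOn_pi.1 hMc i) k
    · simp only [Matrix.of_apply, if_neg hi]
      exact continuousOn_const
  · intro t ht i
    by_cases hi : p i < p j
    · simp only [if_pos hi]
      refine (hm t ht i j).congr_deriv ?_
      simp only [Matrix.mulVec, dotProduct, Matrix.of_apply, if_pos hi]
      rw [Matrix.mul_apply]
      refine Finset.sum_congr rfl fun k _ => ?_
      by_cases hk : p k < p j
      · rw [if_pos hk]
      · rw [hM t ht i k (hi.trans_le (not_lt.1 hk)), zero_mul, zero_mul]
    · simp only [if_neg hi]
      refine (hasDerivAt_const t (0 : ℂ)).congr_deriv ?_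
      simp [Matrix.mulVec, dotProduct, hi]
  · funext i
    have : (c 0)⁻¹ * g 0 * c 0 = 1 := by
      rw [hg0, Matrix.mul_one, Matrix.nonsing_inv_mul _ (hA 0 h0mem).det]
    simp only [this]
    by_cases hi : p i < p j
    · rw [if_pos hi, Matrix.one_apply_ne (fun e => by rw [e] at hi; exact lt_irrefl _ hi)]
      rfl
    · rw [if_neg hi]
      rfl

end Transport

/-! ### Local lifts of the period map -/

section LocalLift

variable {E : Type*} [NormedAddCommGroup E] [NormedSpace ℝ E] {n : ℕ}

/-- The entrywise real directional derivative of a family of matrices. -/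
def dirDeriv (β : E → Matrix (Fin n) (Fin n) ℂ) (y v : E) : Matrix (Fin n) (Fin n) ℂ :=
  Matrix.of fun i j => fderiv ℝ (fun z => β z i j) y v

theorem dirDeriv_smul (β : E → Matrix (Fin n) (Fin n) ℂ) (y : E) (s : ℝ) (v : E) :
    dirDeriv β y (s • v) = (s : ℂ) • dirDeriv β y v := by
  ext i j
  simp [dirDeriv]

theorem MatAnalyticAt.hasMatDerivAt_line {β : E → Matrix (Fin n) (Fin n) ℂ} {x v : E} {t : ℝ}
    (hβ : MatAnalyticAt β (x + t • v)) :
    HasMatDerivAt (fun s : ℝ => β (x + s • v)) (dirDeriv β (x + t • v) v) t := by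
  intro i j
  have h1 : HasDerivAt (fun s : ℝ => x + s • v) v t := by
    have := ((hasDerivAt_id t).smul_const v).const_add x
    rwa [one_smul] at this
  exact (hβ i j).differentiableAt.hasFDerivAt.comp_hasDerivAt t h1

theorem MatAnalyticAt.dirDeriv {β : E → Matrix (Fin n) (Fin n) ℂ} {z : E × E}
    (hβ : MatAnalyticAt β z.1) : MatAnalyticAt (fun z : E × E => dirDeriv β z.1 z.2) z := by
  intro i j
  have h1 : AnalyticAt ℝ (fun z : E × E => fderiv ℝ (fun y => β y i j) z.1) z :=
    (hβ i j).fderiv.comp analyticAt_fst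
  exact ((ContinuousLinearMap.id ℝ (E →L[ℝ] ℂ)).analyticAt_bilinear _).comp
    (h1.prod analyticAt_snd)

theorem MatAnalyticAt.comp_fst {β : E → Matrix (Fin n) (Fin n) ℂ} {z : E × E}
    (hβ : MatAnalyticAt β z.1) : MatAnalyticAt (fun z : E × E => β z.1) z := fun i j =>
  AnalyticAt.comp (g := fun y => β y i j) (hβ i j) analyticAt_fst

theorem MatAnalyticAt.mask {M : E → Matrix (Fin n) (Fin n) ℂ} {x : E} (hM : MatAnalyticAt M x)
    (τ : Fin n → Fin n → Prop) [∀ i j, Decidable (τ i j)] :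
    MatAnalyticAt (fun y => Matrix.of fun i j => if τ i j then M y i j else 0) x := by
  intro i j
  by_cases h : τ i j
  · simpa [h] using hM i j
  · simpa [h] using analyticAt_const

section

variable {β b : E → Matrix (Fin n) (Fin n) ℂ} {x : E} (hβ : MatAnalyticAt β x)
  (hb : MatAnalyticAt b x) (hu : IsUnit (β x).det) (p q : Fin n → ℤ)
include hβ hb hu

theorem MatAnalyticAt.negComponent : MatAnalyticAt (fun y => negComponent (β y) (b y) p) x :=
  (hβ.mul (((hβ.inv hu).mul hb).mask fun i j => p i < p j)).mul (hβ.inv hu)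

theorem MatAnalyticAt.realComponent : MatAnalyticAt (fun y => realComponent (β y) (b y) p) x :=
  (hβ.negComponent hb hu p).add (hβ.negComponent hb hu p).conj

theorem MatAnalyticAt.nilComponent : MatAnalyticAt (fun y => nilComponent (β y) (b y) p q) x :=
  fun i j => (((hβ.mul ((((hβ.inv hu).mul (hβ.negComponent hb hu p).conj).mul hβ).mask
    fun i j => p i + q i < p j + q j)).mul (hβ.inv hu)) i j).fun_neg

end

theorem negComponent_smul (β b : Matrix (Fin n) (Fin n) ℂ) (p : Fin n → ℤ) (s : ℝ) :
    negComponent β ((s : ℂ) • b) p = (s : ℂ) • negComponent β b p := by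
  have : (Matrix.of fun i j => if p i < p j then (β⁻¹ * ((s : ℂ) • b)) i j else 0) =
      (s : ℂ) • Matrix.of fun i j => if p i < p j then (β⁻¹ * b) i j else 0 := by
    ext i j
    simp
  rw [negComponent, this, Matrix.mul_smul, Matrix.smul_mul, negComponent]

theorem map_conj_smul (M : Matrix (Fin n) (Fin n) ℂ) (s : ℝ) :
    ((s : ℂ) • M).map (starRingEnd ℂ) = (s : ℂ) • M.map (starRingEnd ℂ) := by
  ext i j
  simp

theorem realComponent_smul (β b : Matrix (Fin n) (Fin n) ℂ) (p : Fin n → ℤ) (s : ℝ) :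
    realComponent β ((s : ℂ) • b) p = (s : ℂ) • realComponent β b p := by
  rw [realComponent, negComponent_smul, map_conj_smul, ← smul_add, realComponent]

theorem nilComponent_smul (β b : Matrix (Fin n) (Fin n) ℂ) (p q : Fin n → ℤ) (s : ℝ) :
    nilComponent β ((s : ℂ) • b) p q = (s : ℂ) • nilComponent β b p q := by
  have : (Matrix.of fun i j => if p i + q i < p j + q j then
      (β⁻¹ * (negComponent β ((s : ℂ) • b) p).map (starRingEnd ℂ) * β) i j else 0) =
      (s : ℂ) • Matrix.of fun i j => if p i + q i < p j + q j then
        (β⁻¹ * (negComponent β b p).map (starRingEnd ℂ) * β) i j else 0 := by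
    rw [negComponent_smul, map_conj_smul]
    ext i j
    simp
  rw [nilComponent, this, Matrix.mul_smul, Matrix.smul_mul, nilComponent, smul_neg]

/-- Continuity into `GL_n(ℂ)` can be tested on the matrix entries, since the inverse is given by
Cramer's rule. -/
theorem continuousAt_generalLinearGroup {α : Type*} [TopologicalSpace α] {g : α → GL (Fin n) ℂ}
    {a : α} (hg : ∀ i j, ContinuousAt (fun y => (g y).1 i j) a) : ContinuousAt g a := by
  have h1 : ContinuousAt (fun y => (g y).1) a := continuousAt_pi.2 fun i => continuousAt_pi.2 (hg i)
  have h2 : ContinuousAt (fun y => (g y)⁻¹.1) a := by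
    have e : (fun y => (g y)⁻¹.1) = fun y => ((g y).1.det)⁻¹ • (g y).1.adjugate := by
      funext y
      rw [Matrix.coe_units_inv, Matrix.inv_def, Ring.inverse_eq_inv']
    rw [e]
    have h3 : ContinuousAt (fun y => (g y).1.det) a :=
      (Continuous.matrix_det continuous_id).continuousAt.comp h1
    have h4 : ContinuousAt (fun y => (g y).1.adjugate) a :=
      (Continuous.matrix_adjugate continuous_id).continuousAt.comp h1
    exact (h3.inv₀ ((Matrix.isUnit_iff_isUnit_det _).1 (g a).isUnit).ne_zero).smul h4
  refine Units.isInducing_embedProduct.continuousAt_iff.2 ?_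
  exact h1.prodMk (MulOpposite.continuous_op.continuousAt.comp h2)

/-- A family of mixed Hodge structures with a real analytic adapted frame, and with Deligne tori in
`P`, lifts continuously to `P(ℝ) 𝐖(ℂ)` near every point. -/
theorem exists_local_lift [FiniteDimensional ℝ E] {W : ℤ → Submodule ℚ (Fin n → ℚ)}
    {F : E → Fil n} {β : E → Matrix (Fin n) (Fin n) ℂ} {p q : Fin n → ℤ}
    {P : Subgroup (GL (Fin n) ℂ)} (hP : IsRatAlgebraic P) (hPW : P ≤ weightStab W) {x : E} {r : ℝ}
    (hr : 0 < r) (hβ : ∀ y ∈ Metric.ball x r, MatAnalyticAt β y)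
    (hA : ∀ y ∈ Metric.ball x r, IsAdapted W (F y) (β y) p q)
    (hT : ∀ y ∈ Metric.ball x r, ∀ z w g, IsTorusElement W (F y) z w g → g ∈ P) :
    ∃ g : E → GL (Fin n) ℂ, g x = 1 ∧ ContinuousAt g x ∧
      ∀ᶠ y in 𝓝 x, g y ∈ realUnipotent P ∧ F y = Fil.act (g y).1 (F x) := by
  classical
  let R : E → E → Matrix (Fin n) (Fin n) ℂ := fun y v => realComponent (β y) (dirDeriv β y v) p
  let N : E → E → Matrix (Fin n) (Fin n) ℂ := fun y v => nilComponent (β y) (dirDeriv β y v) p q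
  have hRa : ∀ y ∈ Metric.ball x r, ∀ v, MatAnalyticAt (fun z : E × E => R z.1 z.2) (y, v) :=
    fun y hy v => MatAnalyticAt.realComponent (MatAnalyticAt.comp_fst (z := (y, v)) (hβ y hy))
      (MatAnalyticAt.dirDeriv (z := (y, v)) (hβ y hy)) (hA y hy).det p
  have hNa : ∀ y ∈ Metric.ball x r, ∀ v, MatAnalyticAt (fun z : E × E => N z.1 z.2) (y, v) :=
    fun y hy v => MatAnalyticAt.nilComponent (MatAnalyticAt.comp_fst (z := (y, v)) (hβ y hy))
      (MatAnalyticAt.dirDeriv (z := (y, v)) (hβ y hy)) (hA y hy).det p q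
  have hx : x ∈ Metric.ball x r := Metric.mem_ball_self hr
  -- transport along radial segments by the real part, which stays in `P(ℝ)`
  obtain ⟨δ₁, hδ₁, h, hh, -⟩ := exists_transport (C := R) (x := x)
    (fun i j => (hRa x hx 0 i j).contDiffAt)
    (fun y s v => by simp only [R]; rw [dirDeriv_smul, realComponent_smul])
  -- transport by the full connection form; it differs from the former by an element of `𝐖(ℂ)`
  obtain ⟨δ₂, hδ₂, g, hg, hgc⟩ := exists_transport (C := fun y v => R y v + N y v) (x := x)
    (fun i j => (((hRa x hx 0).add (hNa x hx 0)) i j).contDiffAt)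
    (fun y s v => by
      simp only [R, N]
      rw [dirDeriv_smul, realComponent_smul, nilComponent_smul, smul_add])
  have key : ∀ y ∈ Metric.ball x (min r (min δ₁ δ₂)),
      ∃ γ ∈ realUnipotent P, γ.1 = g y 1 ∧ F y = Fil.act (g y 1) (F x) := by
    intro y hy
    have hyr : y ∈ Metric.ball x r := Metric.ball_subset_ball (min_le_left _ _) hy
    have hy1 : y ∈ Metric.ball x δ₁ :=
      Metric.ball_subset_ball ((min_le_right _ _).trans (min_le_left _ _)) hy
    have hy2 : y ∈ Metric.ball x δ₂ :=
      Metric.ball_subset_ball ((min_le_right _ _).trans (min_le_right _ _)) hy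
    obtain ⟨ℓ, hℓe⟩ : ∃ ℓ : ℝ → E, ℓ = fun t => x + t • (y - x) := ⟨_, rfl⟩
    have hℓc : Continuous ℓ := by
      rw [hℓe]
      fun_prop
    have hℓ : ∀ t ∈ Set.Icc (0 : ℝ) 1, ℓ t ∈ Metric.ball x r := by
      intro t ht
      rw [Metric.mem_ball, dist_eq_norm] at hyr ⊢
      have : ‖ℓ t - x‖ = t * ‖y - x‖ := by
        simp only [hℓe]
        rw [add_sub_cancel_left, norm_smul, Real.norm_of_nonneg ht.1]
      rw [this]
      nlinarith [norm_nonneg (y - x), ht.2]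
    have hℓ1 : ℓ 1 = y := by simp [hℓe]
    have hℓ0 : ℓ 0 = x := by simp [hℓe]
    have hcont : ∀ {M : E → E → Matrix (Fin n) (Fin n) ℂ},
        (∀ y ∈ Metric.ball x r, ∀ v, MatAnalyticAt (fun z : E × E => M z.1 z.2) (y, v)) →
        ContinuousOn (fun t => M (ℓ t) (y - x)) (Set.Icc 0 1) := by
      intro M hM t ht
      refine ContinuousAt.continuousWithinAt (continuousAt_pi.2 fun i => continuousAt_pi.2 fun j => ?_)
      have h1 : ContinuousAt (fun t => (ℓ t, y - x)) t := by fun_prop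
      exact ContinuousAt.comp (f := fun t => (ℓ t, y - x)) (g := fun z : E × E => M z.1 z.2 i j)
        (hM (ℓ t) (hℓ t ht) (y - x) i j).continuousAt h1
    have hline : ∀ t ∈ Set.Icc (0 : ℝ) 1,
        HasMatDerivAt (fun s => β (ℓ s)) (dirDeriv β (ℓ t) (y - x)) t := by
      intro t ht
      have h1 := hβ _ (hℓ t ht)
      rw [hℓe] at h1 ⊢
      exact h1.hasMatDerivAt_line
    have hnhds : ∀ t ∈ Set.Icc (0 : ℝ) 1, ∀ᶠ s in 𝓝 t, ℓ s ∈ Metric.ball x r := fun t ht =>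
      hℓc.continuousAt.eventually (Metric.isOpen_ball.mem_nhds (hℓ t ht))
    have hneg : ∀ t ∈ Set.Icc (0 : ℝ) 1,
        negComponent (β (ℓ t)) (dirDeriv β (ℓ t) (y - x)) p ∈ lieAlgC P := fun t ht =>
      negComponent_mem_lieAlgC (c := fun t => β (ℓ t)) (f := fun t => F (ℓ t)) (q := q)
        hP (hline t ht) ((hnhds t ht).mono fun s hs => hA _ hs) ((hnhds t ht).mono fun s hs => hT _ hs)
    have hb : ContinuousOn (fun t => dirDeriv β (ℓ t) (y - x)) (Set.Icc 0 1) :=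
      hcont fun y hy v => MatAnalyticAt.dirDeriv (z := (y, v)) (hβ y hy)
    have hR : ContinuousOn (fun t => realComponent (β (ℓ t)) (dirDeriv β (ℓ t) (y - x)) p)
        (Set.Icc 0 1) := hcont hRa
    have hN : ContinuousOn (fun t => nilComponent (β (ℓ t)) (dirDeriv β (ℓ t) (y - x)) p q)
        (Set.Icc 0 1) := hcont hNa
    have hhy : ∀ t ∈ Set.Icc (0 : ℝ) 1, HasMatDerivAt (h y) (R (ℓ t) (y - x) * h y t) t := by
      rw [hℓe]
      exact (hh y hy1).2
    have hgy : ∀ t ∈ Set.Icc (0 : ℝ) 1,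
        HasMatDerivAt (g y) ((R (ℓ t) (y - x) + N (ℓ t) (y - x)) * g y t) t := by
      rw [hℓe]
      exact (hg y hy2).2
    have := transport_mem_realUnipotent (f := fun t => F (ℓ t)) (c := fun t => β (ℓ t))
      (b := fun t => dirDeriv β (ℓ t) (y - x)) (h := h y) (g := g y) hP hPW hline
      (fun t ht => hA _ (hℓ t ht)) (fun t ht => hT _ (hℓ t ht)) hneg hb hR hN
      hhy hgy (hh y hy1).1 (hg y hy2).1
    simp only [hℓ0, hℓ1] at this
    exact this
  have hpos : 0 < min r (min δ₁ δ₂) := lt_min hr (lt_min hδ₁ hδ₂)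
  let γ : E → GL (Fin n) ℂ := fun y => if hu : IsUnit (g y 1).det then
    Matrix.GeneralLinearGroup.mk'' (g y 1) hu else 1
  have hγ : ∀ y ∈ Metric.ball x (min r (min δ₁ δ₂)),
      (γ y).1 = g y 1 ∧ γ y ∈ realUnipotent P ∧ F y = Fil.act (γ y).1 (F x) := by
    intro y hy
    obtain ⟨γ', hγ', h1, h2⟩ := key y hy
    have hu : IsUnit (g y 1).det := h1 ▸ (Matrix.isUnit_iff_isUnit_det _).1 γ'.isUnit
    have h3 : γ y = Matrix.GeneralLinearGroup.mk'' (g y 1) hu := dif_pos hu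
    have h4 : γ y = γ' := Units.ext (by rw [h3, h1]; rfl)
    exact ⟨h4 ▸ h1, h4 ▸ hγ', by rw [h4, h1]; exact h2⟩
  have hball := Metric.ball_mem_nhds x hpos
  have hx' : x ∈ Metric.ball x (min r (min δ₁ δ₂)) := Metric.mem_ball_self hpos
  refine ⟨γ, ?_, ?_, ?_⟩
  · -- the transport along the constant segment is trivial
    refine Units.ext ((hγ x hx').1.trans ?_)
    have hx2 : x ∈ Metric.ball x δ₂ := Metric.mem_ball_self hδ₂
    have h1 := eq_of_matrix_ode (T := 1) (M := fun _ => 0) (g := g x) (g' := fun _ => 1)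
      continuousOn_const (fun t ht => ?_) (fun t ht => ?_) (hg x hx2).1 1 ⟨zero_le_one, le_rfl⟩
    · exact h1
    · have h2 := (hg x hx2).2 t ht
      have h3 : ∀ y, R y 0 + N y 0 = 0 := by
        intro y
        have e : dirDeriv β y 0 = ((0 : ℝ) : ℂ) • dirDeriv β y 0 := by
          ext i j
          simp [dirDeriv]
        simp only [R, N]
        rw [e, realComponent_smul, nilComponent_smul]
        simp
      simp only [sub_self] at h2
      rwa [h3] at h2
    · rw [zero_mul]
      exact hasMatDerivAt_const 1 t
  · refine continuousAt_generalLinearGroup fun i j => ?_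
    have h1 : ContinuousAt (fun y => g y 1 i j) x :=
      (hgc i j).continuousAt (Metric.ball_mem_nhds x hδ₂)
    refine h1.congr ?_
    filter_upwards [hball] with y hy
    rw [(hγ y hy).1]
  · filter_upwards [hball] with y hy
    exact (hγ y hy).2

end LocalLift

/-! ### Horizontality of the period map -/

section Horizontal

variable {E : Type*} [NormedAddCommGroup E] [NormedSpace ℂ E] {n : ℕ}

/-- The derivative of a holomorphic family of mixed Hodge structures with Deligne tori in `P` comes
from the Lie algebra of `P`. -/
theorem IsHolFrame.exists_lieAlgC_sub_mem {W : ℤ → Submodule ℚ (Fin n → ℚ)} {F : E → Fil n}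
    {β : E → Matrix (Fin n) (Fin n) ℂ} {p q : Fin n → ℤ} {P : Subgroup (GL (Fin n) ℂ)}
    (hP : IsRatAlgebraic P) (hPW : P ≤ weightStab W) {x : E} {g : E → Matrix (Fin n) (Fin n) ℂ}
    (hg : IsHolFrame E F x g) (hβ : MatAnalyticAt β x)
    (hA : ∀ᶠ y in 𝓝 x, IsAdapted W (F y) (β y) p q)
    (hT : ∀ᶠ y in 𝓝 x, ∀ z w g, IsTorusElement W (F y) z w g → g ∈ P) (v : E) :
    ∃ A ∈ lieAlgC P, matrixDeriv E g x v - A ∈ endF (F x) 0 := by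
  obtain ⟨D, hD, hgl⟩ : ∃ D : Matrix (Fin n) (Fin n) ℂ, matrixDeriv E g x v = D ∧
      HasMatDerivAt (fun t : ℝ => g (x + (t : ℂ) • v)) D 0 := ⟨_, rfl, hg.hasMatDerivAt_line v⟩
  rw [hD]
  obtain ⟨ℓ, hℓe⟩ : ∃ ℓ : ℝ → E, ℓ = fun t => x + t • v := ⟨_, rfl⟩
  have hℓ0 : ℓ 0 = x := by simp [hℓe]
  have hℓ : Filter.Tendsto ℓ (𝓝 0) (𝓝 x) := by
    have : Continuous ℓ := by
      rw [hℓe]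
      fun_prop
    exact hℓ0 ▸ this.tendsto 0
  have hgℓ : HasMatDerivAt (fun t => g (ℓ t)) D 0 := by
    rw [hℓe]
    simpa only [Complex.coe_smul] using hgl
  set b := dirDeriv β x v with hb
  have hβℓ : HasMatDerivAt (fun t => β (ℓ t)) b 0 := by
    have h1 : MatAnalyticAt β (x + (0 : ℝ) • v) := by simpa using hβ
    have h2 := h1.hasMatDerivAt_line
    rw [zero_smul, add_zero] at h2
    rw [hℓe]
    exact h2
  have h := hA.self_of_nhds
  have hneg : negComponent (β x) b p ∈ lieAlgC P := by
    have := negComponent_mem_lieAlgC (c := fun t => β (ℓ t)) (f := fun t => F (ℓ t)) (q := q) hP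
      hβℓ (hℓ.eventually hA) (hℓ.eventually hT)
    simpa only [hℓ0] using this
  refine ⟨realComponent (β x) b p + nilComponent (β x) b p q, add_mem
    (realComponent_mem_lieAlgC hneg) (h.nilComponent_mem_lieAlgC hP hT.self_of_nhds hneg), ?_⟩
  -- modulo `F^0`, the element of the Lie algebra is the logarithmic derivative of `β`
  have h1 : realComponent (β x) b p + nilComponent (β x) b p q - b * (β x)⁻¹ ∈ endF (F x) 0 := by
    refine h.mem_endF_iff.2 fun i j hij => ?_
    have e : (β x)⁻¹ * (realComponent (β x) b p + nilComponent (β x) b p q - b * (β x)⁻¹) * β x =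
        (β x)⁻¹ * (realComponent (β x) b p + nilComponent (β x) b p q) * β x -
          (β x)⁻¹ * b * ((β x)⁻¹ * β x) := by noncomm_ring
    rw [e, Matrix.nonsing_inv_mul _ h.det, Matrix.mul_one, Matrix.sub_apply,
      h.coord_realComponent_add_nilComponent hP hPW hneg (by omega), sub_self]
  -- `g` and `β β(x)⁻¹` both carry `F_x` to the nearby filtrations, so their derivatives agree
  -- modulo `F^0`
  have h2 : D - b * (β x)⁻¹ ∈ endF (F x) 0 := by
    have hu : IsUnit (β (ℓ 0)).det := hℓ0 ▸ h.det
    have h3 := ((hasMatDerivAt_const (β x) 0).mul (hβℓ.inv hu)).mul hgℓ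
    have e : (0 * (β (ℓ 0))⁻¹ + β x * -((β (ℓ 0))⁻¹ * b * (β (ℓ 0))⁻¹)) * g (ℓ 0) +
        β x * (β (ℓ 0))⁻¹ * D = D - b * (β x)⁻¹ := by
      rw [hℓ0, hg.1, Matrix.mul_nonsing_inv _ h.det, zero_mul, zero_add, Matrix.mul_one, mul_neg,
        ← Matrix.mul_assoc, ← Matrix.mul_assoc, Matrix.mul_nonsing_inv _ h.det]
      simp only [Matrix.one_mul]
      abel
    rw [e] at h3
    refine mem_endF_of_hasMatDerivAt h3 ?_
    filter_upwards [hℓ.eventually hA, hℓ.eventually hg.2.2] with t ht htg a u hu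
    rw [← Matrix.mulVec_mulVec, ← Matrix.mulVec_mulVec]
    have h4 : g (ℓ t) *ᵥ u ∈ F (ℓ t) a := by
      rw [htg]
      exact ⟨u, hu, rfl⟩
    rw [ht.F_eq_coordSub] at h4
    rw [h.F_eq_coordSub]
    intro i hi
    rw [inv_mulVec_mulVec h.det]
    exact h4 i hi
  have e : D - (realComponent (β x) b p + nilComponent (β x) b p q) = (D - b * (β x)⁻¹) -
      (realComponent (β x) b p + nilComponent (β x) b p q - b * (β x)⁻¹) := by abel
  rw [e]
  exact sub_mem h2 h1

end Horizontal

namespace ZVMHS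

variable {E : Type*} [NormedAddCommGroup E] [NormedSpace ℂ E] [FiniteDimensional ℂ E]
  {X S : Type*} [TopologicalSpace X] [ChartedSpace E X] [IsManifold 𝓘(ℂ, E) 1 X] {π : X → S}
  {n : ℕ} (V : ZVMHS E π n) {x₀ : X}

omit [FiniteDimensional ℂ E] [IsManifold 𝓘(ℂ, E) 1 X] in
theorem isRatAlgebraic_mtGroup (x : X) : IsRatAlgebraic (V.mtGroup x) :=
  mumfordTate_isRatAlgebraic _ _

omit [FiniteDimensional ℂ E] [IsManifold 𝓘(ℂ, E) 1 X] in
theorem mtGroup_le_weightStab (x : X) : V.mtGroup x ≤ weightStab V.W :=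
  mumfordTate_le_weightStab (V.isMHS x)

variable {V}

omit [FiniteDimensional ℂ E] [IsManifold 𝓘(ℂ, E) 1 X] in
/-- The Deligne tori of all fibres lie in the generic Mumford–Tate group. -/
theorem IsHodgeGeneric.torus_mem (hgen : V.IsHodgeGeneric x₀) (x : X) (z w : ℂˣ)
    (g : GL (Fin n) ℂ) (hg : IsTorusElement V.W (V.F x) z w g) : g ∈ V.mtGroup x₀ :=
  hgen x hg.mem_mumfordTate

/-- The period map lifts locally to `P_S(ℝ) 𝐖_S(ℂ)`: apply `exists_local_lift` in a chart. -/
theorem IsHodgeGeneric.exists_local_lift (hgen : V.IsHodgeGeneric x₀) (x : X) :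
    ∃ g : X → GL (Fin n) ℂ, g x = 1 ∧ ContinuousAt g x ∧
      ∀ᶠ y in 𝓝 x, g y ∈ realUnipotent (V.mtGroup x₀) ∧ V.F y = Fil.act (g y).1 (V.F x) := by
  obtain ⟨r, hr, hB, β, p, q, h⟩ := V.exists_ball_isAdapted x
  have hx := mem_chart_source E x
  have : FiniteDimensional ℝ E := FiniteDimensional.complexToReal E
  obtain ⟨g, hg1, hgc, hg⟩ := _root_.exists_local_lift (W := V.W)
    (F := fun y => V.F ((chartAt E x).symm y)) (V.isRatAlgebraic_mtGroup x₀)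
    (V.mtGroup_le_weightStab x₀) hr (fun y hy => (h y hy).1) (fun y hy => (h y hy).2)
    (fun y _ => hgen.torus_mem _)
  have hc : ContinuousAt (chartAt E x) x := (chartAt E x).continuousAt hx
  refine ⟨fun y => g (chartAt E x y), hg1, hgc.comp hc, ?_⟩
  filter_upwards [hc.eventually hg, (chartAt E x).open_source.mem_nhds hx] with y hy hys
  simp only [(chartAt E x).left_inv hys, (chartAt E x).left_inv hx] at hy
  exact hy

/-- All Hodge filtrations of the variation lie in one orbit, by local lifts and connectedness of the
base. -/
theorem IsHodgeGeneric.exists_eq_act [PreconnectedSpace X] (hgen : V.IsHodgeGeneric x₀) (x : X) :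
    ∃ g ∈ realUnipotent (V.mtGroup x₀), V.F x = Fil.act g.1 (V.F x₀) := by
  let Z : Set X := {x | ∃ g ∈ realUnipotent (V.mtGroup x₀), V.F x = Fil.act g.1 (V.F x₀)}
  have hnear : ∀ x, ∀ᶠ y in 𝓝 x, y ∈ Z ↔ x ∈ Z := by
    intro x
    obtain ⟨g, -, -, hg⟩ := hgen.exists_local_lift x
    filter_upwards [hg] with y hy
    constructor
    · rintro ⟨γ, hγ, h⟩
      refine ⟨(g y)⁻¹ * γ, mul_mem (inv_mem hy.1) hγ, ?_⟩
      rw [Units.val_mul, act_mul, ← h, hy.2, ← act_mul]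
      rw [show (g y)⁻¹.1 * (g y).1 = 1 from (g y).inv_mul, act_one]
    · rintro ⟨γ, hγ, h⟩
      exact ⟨g y * γ, mul_mem hy.1 hγ, by rw [hy.2, h, Units.val_mul, act_mul]⟩
  have hclopen : IsClopen Z := by
    constructor
    · rw [← isOpen_compl_iff, isOpen_iff_mem_nhds]
      intro x hx
      filter_upwards [hnear x] with y hy hyZ
      exact hx (hy.1 hyZ)
    · rw [isOpen_iff_mem_nhds]
      intro x hx
      filter_upwards [hnear x] with y hy
      exact hy.2 hx
  have h0 : x₀ ∈ Z := ⟨1, one_mem _, (act_one _).symm⟩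
  have : x ∈ Z := hclopen.eq_univ ⟨x₀, h0⟩ ▸ Set.mem_univ x
  exact this

/-- The Hodge filtration defines a continuous map to `D_S⁺`. -/
theorem IsHodgeGeneric.exists_continuous_lift [PreconnectedSpace X] (hgen : V.IsHodgeGeneric x₀) :
    ∃ φ : X → V.domain x₀, Continuous φ ∧ ∀ x, (φ x).1.1 = V.F x := by
  let P := V.mtGroup x₀
  let ψ : X → MTDomain P (V.F x₀) := fun x => ⟨V.F x, by
    obtain ⟨g, hg, h⟩ := hgen.exists_eq_act x
    exact ⟨⟨g, hg⟩, h⟩⟩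
  have hψ : Continuous ψ := by
    rw [continuous_iff_continuousAt]
    intro x
    obtain ⟨g, hg1, hgc, hg⟩ := hgen.exists_local_lift x
    obtain ⟨γ, hγ, hx⟩ := hgen.exists_eq_act x
    classical
    -- the local lift, translated by `γ`, is continuous, and the domain carries the quotient
    -- topology of the group
    let κ : X → realUnipotent P := fun y =>
      if h : g y ∈ realUnipotent P then ⟨g y * γ, mul_mem h hγ⟩ else 1
    have hκ : ∀ᶠ y in 𝓝 x, (κ y).1 = g y * γ := by
      filter_upwards [hg] with y hy
      simp only [κ]
      rw [dif_pos hy.1]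
    have hκc : ContinuousAt κ x := by
      refine Topology.IsInducing.subtypeVal.continuousAt_iff.2 ?_
      exact (hgc.mul continuousAt_const).congr (hκ.mono fun y hy => hy.symm)
    have ho : Continuous (orbitMap P (V.F x₀)) := continuous_coinduced_rng
    refine (ho.continuousAt.comp hκc).congr ?_
    filter_upwards [hκ, hg] with y hy hyg
    refine Subtype.ext ?_
    change Fil.act (κ y).1.1 (V.F x₀) = V.F y
    rw [hy, hyg.2, hx, Units.val_mul, act_mul]
  have h0 : ψ x₀ = orbitMap P (V.F x₀) 1 := Subtype.ext (act_one _).symm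
  have hsub : Set.range ψ ⊆ DPlus P (V.F x₀) :=
    (isPreconnected_range hψ).subset_connectedComponent ⟨x₀, h0⟩
  exact ⟨fun x => ⟨ψ x, hsub ⟨x, rfl⟩⟩, hψ.subtype_mk _, fun x => rfl⟩

/-- The image of the differential of the period map is horizontal. -/
theorem IsHodgeGeneric.range_filDeriv_le (hgen : V.IsHodgeGeneric x₀) (x : X) :
    LinearMap.range (filDeriv E V.F x) ≤ horizontalTangent (V.mtGroup x₀) (V.F x) := by
  obtain ⟨g, hg⟩ := V.holomorphic x
  have hx := mem_chart_source E x
  obtain ⟨β, p, q, hβ, hA⟩ := ((V.holomorphic x).chart hx).exists_analytic_isAdapted (W := V.W)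
    (Filter.Eventually.of_forall fun y => V.isMHS _)
  rw [filDeriv_eq hg]
  rintro _ ⟨v, rfl⟩
  obtain ⟨A, hAP, hA0⟩ : ∃ A ∈ lieAlgC (V.mtGroup x₀),
      matrixDeriv E g x v - A ∈ endF (V.F x) 0 := by
    have h1 := (hg.chart hx).1.exists_lieAlgC_sub_mem (V.isRatAlgebraic_mtGroup x₀)
      (V.mtGroup_le_weightStab x₀) hβ hA
      (Filter.Eventually.of_forall fun y => hgen.torus_mem ((chartAt E x).symm y))
      ((mdifferentiable_chart (I := 𝓘(ℂ, E)) (H := E) x).mfderiv hx v)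
    rw [(hg.chart hx).2 v]
    rwa [Function.comp_apply, (chartAt E x).left_inv hx] at h1
  have hD := V.matrixDeriv_mem hg v
  refine ⟨A, ⟨hAP, ?_⟩, ?_⟩
  · have h2 := endF_anti (V.isMHS x).F_anti (show (-1 : ℤ) ≤ 0 by norm_num) hA0
    have := sub_mem hD h2
    rwa [sub_sub_cancel] at this
  · exact ((Submodule.Quotient.eq _).2 hA0).symm

/-- The Kodaira–Spencer map and the period map have the same rank at every point. -/
theorem IsHodgeGeneric.finrank_ksImage (hgen : V.IsHodgeGeneric x₀) (x : X) :
    Module.finrank ℂ (V.ksImage x) = Module.finrank ℂ (LinearMap.range (filDeriv E V.F x)) := by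
  refine V.finrank_ksImage ((hgen.range_filDeriv_le x).trans (Submodule.map_mono ?_))
  exact inf_le_inf_right _
    ((V.isRatAlgebraic_mtGroup x₀).lieAlgC_le_endW (V.mtGroup_le_weightStab x₀))

end ZVMHS

/-! ### The rank of the Kodaira–Spencer map -/

namespace ZVMHS

variable {E : Type*} [NormedAddCommGroup E] [NormedSpace ℂ E] [FiniteDimensional ℂ E]
  {X S : Type*} [TopologicalSpace X] [ChartedSpace E X] [IsManifold 𝓘(ℂ, E) 1 X] {π : X → S}
  {n : ℕ} {V : ZVMHS E π n} {x₀ : X}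

/-- The generic rank of the Kodaira–Spencer map is the rank of the period map at a point where the
latter is maximal. -/
theorem IsHodgeGeneric.ksRank_eq (hgen : V.IsHodgeGeneric x₀) {x : X}
    (hx : ∀ x', Module.finrank ℂ (LinearMap.range (filDeriv E V.F x')) ≤
      Module.finrank ℂ (LinearMap.range (filDeriv E V.F x))) :
    V.ksRank = Module.finrank ℂ (LinearMap.range (filDeriv E V.F x)) := by
  have : Nonempty X := ⟨x⟩
  simp only [ksRank, hgen.finrank_ksImage]
  refine le_antisymm (ciSup_le hx) ?_
  exact le_ciSup (f := fun x => Module.finrank ℂ (LinearMap.range (filDeriv E V.F x)))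
    ⟨_, by rintro _ ⟨x', rfl⟩; exact hx x'⟩ x

theorem IsHodgeGeneric.finrank_range_filDeriv_le_ksRank [ConnectedSpace X]
    (hgen : V.IsHodgeGeneric x₀) (x : X) :
    Module.finrank ℂ (LinearMap.range (filDeriv E V.F x)) ≤ V.ksRank := by
  obtain ⟨x₁, hx₁⟩ := V.isOpen_dense_maximal_rank.2.nonempty
  rw [hgen.ksRank_eq hx₁]
  exact hx₁ x

omit [FiniteDimensional ℂ E] [IsManifold 𝓘(ℂ, E) 1 X] in
/-- The rank of the horizontal tangent bundle is constant on the orbit, so the Hodge codimension may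
be computed at any filtration in it. -/
theorem hodgeCodim_eq (V : ZVMHS E π n) (x₀ : X) {g : GL (Fin n) ℂ} (hg : g ∈ V.mtGroup x₀)
    {F : Fil n} (hF : F = Fil.act g.1 (V.F x₀)) :
    V.hodgeCodim x₀ =
      (Module.finrank ℂ (horizontalTangent (V.mtGroup x₀) F) : ℤ) - (V.ksRank : ℤ) := by
  rw [hodgeCodim, finrank_grNegOne_lieAlgC, hF,
    (V.isRatAlgebraic_mtGroup x₀).finrank_horizontalTangent_act hg (V.isMHS x₀).F_anti]

omit [FiniteDimensional ℂ E] [IsManifold 𝓘(ℂ, E) 1 X] in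
theorem hodgeCodim_eq_of_mem_domain (V : ZVMHS E π n) (x₀ : X) (y : V.domain x₀) :
    V.hodgeCodim x₀ =
      (Module.finrank ℂ (horizontalTangent (V.mtGroup x₀) y.1.1) : ℤ) - (V.ksRank : ℤ) := by
  obtain ⟨g, hg⟩ := y.1.2
  exact V.hodgeCodim_eq x₀ (realUnipotent_le _ g.2) hg

end ZVMHS

/-! ### The quotient by the arithmetic group -/

section ArithmeticQuotient

variable {n : ℕ} {P : Subgroup (GL (Fin n) ℂ)} {F₀ : Fil n}

/-- The matrix in `GL_n(ℂ)` of an element of `GL_n(ℤ)`. -/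
abbrev intToComplex (γ : GL (Fin n) ℤ) : GL (Fin n) ℂ :=
  Matrix.GeneralLinearGroup.map (Int.castRingHom ℂ) γ

theorem act_intToComplex_mul (γ γ' : GL (Fin n) ℤ) (F : Fil n) :
    Fil.act (intToComplex γ).1 (Fil.act (intToComplex γ').1 F) =
      Fil.act (intToComplex (γ * γ')).1 F := by
  rw [← act_mul]
  refine congrArg (fun A => Fil.act A F) ?_
  exact (congrArg Units.val
    (map_mul (Matrix.GeneralLinearGroup.map (Int.castRingHom ℂ)) γ γ')).symm

theorem act_intToComplex_one (F : Fil n) : Fil.act (intToComplex 1).1 F = F := by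
  rw [intToComplex, map_one, Units.val_one, act_one]

/-- The relation generating the quotient is already an equivalence relation. -/
theorem HodgeVariety.mk_eq_mk_iff {y y' : DPlus P F₀} :
    (HodgeVariety.mk y = HodgeVariety.mk y') ↔
      ∃ γ ∈ arithGroup P, y'.1.1 = Fil.act (intToComplex γ).1 y.1.1 := by
  refine ⟨fun h => ?_, fun h => Quot.sound h⟩
  have h' := Quot.eqvGen_exact h
  clear h
  induction h' with
  | rel y y' h => exact h
  | refl y => exact ⟨1, one_mem _, (act_intToComplex_one _).symm⟩
  | symm y y' h ih =>
    obtain ⟨γ, hγ, e⟩ := ih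
    refine ⟨γ⁻¹, inv_mem hγ, ?_⟩
    refine ((congrArg _ e).trans ((act_intToComplex_mul _ _ _).trans ?_)).symm
    rw [inv_mul_cancel]
    exact act_intToComplex_one _
  | trans y y' y'' h h' ih ih' =>
    obtain ⟨γ, hγ, e⟩ := ih
    obtain ⟨γ', hγ', e'⟩ := ih'
    exact ⟨γ' * γ, mul_mem hγ' hγ, e'.trans ((congrArg _ e).trans (act_intToComplex_mul _ _ _))⟩

end ArithmeticQuotient

/-! ### Deck transformations and descent of the period map -/

section Covering

/-- The image of a covering map is open and closed. -/
theorem IsCoveringMap.surjective {X S : Type*} [TopologicalSpace X] [TopologicalSpace S]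
    {π : X → S} (hπ : IsCoveringMap π) [Nonempty X] [PreconnectedSpace S] :
    Function.Surjective π := by
  have hclopen : IsClopen (Set.range π) := by
    refine ⟨?_, hπ.isOpenMap.isOpen_range⟩
    rw [← isOpen_compl_iff, isOpen_iff_mem_nhds]
    intro s hs
    obtain ⟨-, U, hsU, hU, -, H, -⟩ := hπ s
    refine Filter.mem_of_superset (hU.mem_nhds hsU) fun s' hs' => ?_
    rintro ⟨x, rfl⟩
    exact hs ⟨((H ⟨x, hs'⟩).2).1, ((H ⟨x, hs'⟩).2).2⟩
  exact Set.range_eq_univ.1 (hclopen.eq_univ (Set.range_nonempty π))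

/-- The group of deck transformations of a simply connected covering acts transitively on the
fibres. -/
theorem IsCoveringMap.exists_deck {X S : Type*} [TopologicalSpace X] [TopologicalSpace S]
    {π : X → S} (hπ : IsCoveringMap π) [SimplyConnectedSpace X] [LocallyPathConnectedSpace X]
    {x x' : X} (h : π x = π x') : ∃ γ : Deck π, γ.1 x = x' := by
  let f : C(X, S) := ⟨π, hπ.continuous⟩
  obtain ⟨G, ⟨hG, hGπ⟩, -⟩ := hπ.existsUnique_continuousMap_lifts f x x' h.symm
  obtain ⟨G', ⟨hG', hGπ'⟩, -⟩ := hπ.existsUnique_continuousMap_lifts f x' x h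
  have hid : ∀ {K K' : C(X, X)} {z z' : X}, π ∘ K = π → π ∘ K' = π → K z = z' → K' z' = z →
      ∀ y, K' (K y) = y := by
    intro K K' z z' hK hK' hz hz' y
    have h1 : (fun y => K' (K y)) = id := by
      refine hπ.eq_of_comp_eq (K'.continuous.comp K.continuous) continuous_id ?_ z ?_
      · funext y
        exact (congrFun hK' (K y)).trans (congrFun hK y)
      · change K' (K z) = z
        rw [hz, hz']
    exact congrFun h1 y
  exact ⟨⟨⟨⟨G, G', hid hGπ hGπ' hG hG', hid hGπ' hGπ hG' hG⟩, G.continuous, G'.continuous⟩,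
    fun y => congrFun hGπ y⟩, hG⟩

end Covering

namespace ZVMHS

variable {E : Type*} [NormedAddCommGroup E] [NormedSpace ℂ E]
  {X S : Type*} [TopologicalSpace X] [ChartedSpace E X] {π : X → S}
  {n : ℕ} {V : ZVMHS E π n} {x₀ : X}

/-- The preimage in `D_S⁺` of the image of the period map. -/
theorem IsPeriodMap.mem_preimage_range_iff {Φ : S → V.Hod x₀} (hΦ : V.IsPeriodMap x₀ Φ)
    (hπ : Function.Surjective π) {y : V.domain x₀} :
    y ∈ HodgeVariety.mk ⁻¹' Set.range Φ ↔ ∃ x, ∃ γ ∈ arithGroup (V.mtGroup x₀),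
      y.1.1 = Fil.act (intToComplex γ).1 (V.F x) := by
  constructor
  · rintro ⟨s, hs⟩
    obtain ⟨x, rfl⟩ := hπ s
    obtain ⟨y', hy', hΦx⟩ := hΦ x
    obtain ⟨γ, hγ, h⟩ := HodgeVariety.mk_eq_mk_iff.1 (hΦx.symm.trans hs)
    exact ⟨x, γ, hγ, hy' ▸ h⟩
  · rintro ⟨x, γ, hγ, h⟩
    obtain ⟨y', hy', hΦx⟩ := hΦ x
    refine ⟨π x, hΦx.trans (HodgeVariety.mk_eq_mk_iff.2 ⟨γ, hγ, ?_⟩)⟩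
    rw [h, hy']

/-- If the monodromy lies in the generic Mumford–Tate group, the Hodge filtration descends to a
period map. -/
theorem exists_isPeriodMap [TopologicalSpace S] (hπ : IsCoveringMap π)
    (hsurj : Function.Surjective π) [SimplyConnectedSpace X] [LocallyPathConnectedSpace X]
    {φ : X → V.domain x₀} (hφ : ∀ x, (φ x).1.1 = V.F x)
    (hmon : ∀ γ, V.ρ γ ∈ arithGroup (V.mtGroup x₀)) : ∃ Φ, V.IsPeriodMap x₀ Φ := by
  choose σ hσ using hsurj
  refine ⟨fun s => HodgeVariety.mk (φ (σ s)), fun x => ⟨φ x, hφ x, ?_⟩⟩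
  obtain ⟨γ, hγ⟩ := hπ.exists_deck (hσ (π x))
  refine HodgeVariety.mk_eq_mk_iff.2 ⟨V.ρ γ, hmon γ, ?_⟩
  rw [hφ, hφ, ← V.F_equivariant, hγ]

end ZVMHS

/-! ### Immersions into the flag variety -/

section ChainRule

variable {E E' : Type*} [NormedAddCommGroup E] [NormedSpace ℂ E] [NormedAddCommGroup E']
  [NormedSpace ℂ E'] {n : ℕ} {f : E → Fil n}

/-- The pullback of a holomorphic family of filtrations along a holomorphic map is holomorphic. -/
theorem HolAt.comp {s : E' → E} {u : E'} (hf : HolAt E f (s u))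
    (hs : ∀ᶠ u' in 𝓝 u, DifferentiableAt ℂ s u') : HolAt E' (fun u' => f (s u')) u := by
  obtain ⟨g, hg⟩ := hf
  have hc : Filter.Tendsto s (𝓝 u) (𝓝 (s u)) := hs.self_of_nhds.continuousAt
  refine ⟨fun u' => g (s u'), hg.1, ?_, hc.eventually hg.2.2⟩
  filter_upwards [hs, hc.eventually hg.2.1] with u' hu' hgu i j
  exact mdifferentiableAt_iff_differentiableAt.2
    ((mdifferentiableAt_iff_differentiableAt.1 (hgu i j)).comp u' hu')

theorem matrixDeriv_apply_eq_fderiv {g : E → Matrix (Fin n) (Fin n) ℂ} {x v : E} (i j : Fin n) :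
    matrixDeriv E g x v i j = fderiv ℂ (fun y => g y i j) x v := by
  rw [← mfderiv_eq_fderiv]
  rfl

end ChainRule

section Immersions

variable {n : ℕ} {G : Type*} [NormedAddCommGroup G] [NormedSpace ℂ G] [FiniteDimensional ℂ G]

/-- A holomorphic immersion to a flag variety has a holomorphic left inverse `ψ ∘ L ∘ θ`, where `θ`
is a chart of the flag variety and `L` is linear, for which `L ∘ θ ∘ f` is inverse to `ψ`. -/
theorem exists_flag_inverse {f : G → Fil n} {u₀ : G} {a b : ℤ} (hb : FilBdd a b (f u₀))
    (hf : ∀ᶠ u in 𝓝 u₀, HolAt G f u) (hinj : Function.Injective (filDeriv G f u₀)) :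
    ∃ (θ : ℤ → Matrix (Fin n) (Fin n) ℂ)
      (L : (Finset.Icc a b × Fin n × Fin n → ℂ) →L[ℂ] G) (ψ : G → G),
      FlagDom a b θ (f u₀) ∧ ψ (L (flagMap a b θ (f u₀))) = u₀ ∧
      (∀ᶠ p in 𝓝 (L (flagMap a b θ (f u₀))), DifferentiableAt ℂ ψ p) ∧
      (∀ᶠ p in 𝓝 (L (flagMap a b θ (f u₀))), L (flagMap a b θ (f (ψ p))) = p) ∧
      ∀ᶠ u in 𝓝 u₀, ψ (L (flagMap a b θ (f u))) = u := by
  obtain ⟨θ, hθ⟩ := hb.exists_flagDom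
  obtain ⟨hD, hd, hiff⟩ := hθ.holAt hf.self_of_nhds
  let Θ : G → Finset.Icc a b × Fin n × Fin n → ℂ := fun u => flagMap a b θ (f u)
  have hΘ : ∀ᶠ u in 𝓝 u₀, DifferentiableAt ℂ Θ u := by
    filter_upwards [hD, hf] with u h1 h2 using (h1.holAt h2).2.1
  have hΘinj : LinearMap.ker (fderiv ℂ Θ u₀).toLinearMap = ⊥ := by
    rw [LinearMap.ker_eq_bot']
    intro v hv
    exact hinj (((hiff v).1 hv).trans (map_zero (filDeriv G f u₀)).symm)
  obtain ⟨L, hL⟩ := (fderiv ℂ Θ u₀).toLinearMap.exists_leftInverse_of_injective hΘinj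
  let L' := LinearMap.toContinuousLinearMap L
  have hLΘ : ∀ᶠ u in 𝓝 u₀, DifferentiableAt ℂ (fun u => L' (Θ u)) u :=
    hΘ.mono fun u hu => L'.differentiableAt.comp u hu
  have hder : ∀ v, fderiv ℂ (fun u => L' (Θ u)) u₀ v = v := by
    intro v
    have h1 := (L'.hasFDerivAt (x := Θ u₀)).comp u₀ hΘ.self_of_nhds.hasFDerivAt
    have h2 : fderiv ℂ (fun u => L' (Θ u)) u₀ = L' ∘L fderiv ℂ Θ u₀ := h1.fderiv
    rw [h2]
    exact LinearMap.congr_fun hL v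
  obtain ⟨ψ, h1, h2, h3, h4⟩ := exists_holomorphic_local_inverse hLΘ
    (by rw [show ⇑(fderiv ℂ (fun u => L' (Θ u)) u₀) = id from funext hder]
        exact Function.bijective_id)
  exact ⟨θ, L', ψ, hθ, h1, h2, h3, h4⟩

end Immersions

/-! ### The dimension of the image -/

section Dimension

variable {E : Type*} [NormedAddCommGroup E] [NormedSpace ℂ E] [FiniteDimensional ℂ E]
  {X : Type*} [TopologicalSpace X] [ChartedSpace E X] [IsManifold 𝓘(ℂ, E) 1 X]
  {n : ℕ} {F : X → Fil n}

omit [FiniteDimensional ℂ E] in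
theorem HolAt.act {x : X} (hF : HolAt E F x) {A : Matrix (Fin n) (Fin n) ℂ} (hA : IsUnit A.det) :
    HolAt E (fun y => Fil.act A (F y)) x := by
  obtain ⟨g, hg⟩ := hF
  exact ⟨_, hg.act hA⟩

omit [FiniteDimensional ℂ E] [IsManifold 𝓘(ℂ, E) 1 X] in
theorem immersion_congr {F' : X → Fil n} (h : F = F') {x : X}
    (hF : HolAt E F x ∧ Function.Injective (filDeriv E F x)) :
    HolAt E F' x ∧ Function.Injective (filDeriv E F' x) := by
  subst h
  exact hF

/-- The rank of the differential does not change under translation by a fixed matrix. -/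
theorem finrank_range_filDeriv_act {x : X} (hF : HolAt E F x) {A : Matrix (Fin n) (Fin n) ℂ}
    (hA : IsUnit A.det) :
    Module.finrank ℂ (LinearMap.range (filDeriv E (fun y => Fil.act A (F y)) x)) =
      Module.finrank ℂ (LinearMap.range (filDeriv E F x)) := by
  have : FiniteDimensional ℂ (TangentSpace 𝓘(ℂ, E) x) := inferInstanceAs (FiniteDimensional ℂ E)
  have h1 := LinearMap.finrank_range_add_finrank_ker (filDeriv E (fun y => Fil.act A (F y)) x)
  have h2 := LinearMap.finrank_range_add_finrank_ker (filDeriv E F x)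
  have h3 : LinearMap.ker (filDeriv E (fun y => Fil.act A (F y)) x) =
      LinearMap.ker (filDeriv E F x) := by
    ext v
    exact filDeriv_act_eq_zero_iff hF hA v
  rw [h3] at h1
  exact Nat.add_right_cancel (h1.trans h2.symm)

open MeasureTheory in
/-- If a holomorphic family of filtrations has rank less than `d` everywhere, its image under a
linear projection of a chart of the flag variety to `ℂᵈ` is a null set. -/
theorem volume_image_flagMap_eq_zero [SecondCountableTopology X] (hF : ∀ x, HolAt E F x) {d : ℕ}
    (hrk : ∀ x, Module.finrank ℂ (LinearMap.range (filDeriv E F x)) < d) {a b : ℤ}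
    (θ : ℤ → Matrix (Fin n) (Fin n) ℂ)
    (L : (Finset.Icc a b × Fin n × Fin n → ℂ) →L[ℂ] (Fin d → ℂ)) :
    volume ((fun x => L (flagMap a b θ (F x))) '' {x | FlagDom a b θ (F x)}) = 0 := by
  have hloc : ∀ x₁ ∈ {x | FlagDom a b θ (F x)}, ∃ U ∈ 𝓝 x₁,
      volume ((fun x => L (flagMap a b θ (F x))) '' U) = 0 := by
    intro x₁ hx₁
    have hx := mem_chart_source E x₁
    have h1 : FlagDom a b θ ((F ∘ (chartAt E x₁).symm) (chartAt E x₁ x₁)) := by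
      rw [Function.comp_apply, (chartAt E x₁).left_inv hx]
      exact hx₁
    obtain ⟨r, hr, hB, hD⟩ := exists_ball_of_eventually (h1.holAt ((hF x₁).chart hx)).1
    let h : E → Fin d → ℂ := fun y => L (flagMap a b θ (F ((chartAt E x₁).symm y)))
    have hh : ∀ y ∈ Metric.ball (chartAt E x₁ x₁) r, DifferentiableAt ℂ h y ∧
        ¬ Function.Surjective (fderiv ℂ h y) := by
      intro y hy
      have hFy := HolAt.comp_chart_symm hF (hB hy)
      have h2 := ((hD y hy).holAt hFy).2.1
      refine ⟨L.differentiableAt.comp y h2, fun hs => ?_⟩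
      have h3 := (L.hasFDerivAt (x := flagMap a b θ ((F ∘ (chartAt E x₁).symm) y))).comp y
        h2.hasFDerivAt
      have h4 : fderiv ℂ h y = L ∘L fderiv ℂ
        (fun y => flagMap a b θ ((F ∘ (chartAt E x₁).symm) y)) y := h3.fderiv
      rw [h4] at hs
      have h5 := finrank_range_fderiv_flagMap (hD y hy) hFy
      rw [finrank_range_filDeriv_comp_chart_symm hF (hB hy)] at h5
      have h6 := hrk ((chartAt E x₁).symm y)
      rw [← h5] at h6
      have h7 : LinearMap.range (L.toLinearMap ∘ₗ (fderiv ℂ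
          (fun y => flagMap a b θ ((F ∘ (chartAt E x₁).symm) y)) y).toLinearMap) = ⊤ :=
        LinearMap.range_eq_top.2 hs
      have h8 := Submodule.finrank_map_le L.toLinearMap (LinearMap.range (fderiv ℂ
          (fun y => flagMap a b θ ((F ∘ (chartAt E x₁).symm) y)) y).toLinearMap)
      rw [← LinearMap.range_comp, h7, finrank_top, Module.finrank_fin_fun] at h8
      omega
    -- identify `E` with a coordinate space, so that Sard's theorem applies
    let e : E ≃L[ℂ] (Fin (Module.finrank ℂ E) → ℂ) :=
      ContinuousLinearEquiv.ofFinrankEq (by simp)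
    have hnull := volume_image_eq_zero_of_fderiv_not_surjective (Module.finrank ℂ E) d
      (fun z => h (e.symm z)) (e.symm ⁻¹' Metric.ball (chartAt E x₁ x₁) r)
      (Metric.isOpen_ball.preimage e.symm.continuous)
      (fun z hz => (hh _ hz).1.comp z e.symm.differentiableAt) (fun z hz hs => ?_)
    · refine ⟨(chartAt E x₁).source ∩ chartAt E x₁ ⁻¹' Metric.ball (chartAt E x₁ x₁) r,
        Filter.inter_mem ((chartAt E x₁).open_source.mem_nhds hx)
          (((chartAt E x₁).continuousAt hx) (Metric.ball_mem_nhds _ hr)),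
        measure_mono_null ?_ hnull⟩
      rintro _ ⟨x, ⟨hxs, hxB⟩, rfl⟩
      refine ⟨e (chartAt E x₁ x), by simpa using hxB, ?_⟩
      simp only [h, e.symm_apply_apply, (chartAt E x₁).left_inv hxs]
    · have h1 := (hh _ hz).1.hasFDerivAt.comp z e.symm.hasFDerivAt
      have h2 : fderiv ℂ (fun z => h (e.symm z)) z =
        fderiv ℂ h (e.symm z) ∘L (e.symm : _ →L[ℂ] E) := h1.fderiv
      rw [h2] at hs
      exact (hh _ hz).2 (Function.Surjective.of_comp hs)
  choose! U hU hUnull using hloc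
  obtain ⟨t, hts, htc, ht⟩ := TopologicalSpace.countable_cover_nhdsWithin (f := U)
    fun x hx => mem_nhdsWithin_of_mem_nhds (hU x hx)
  refine measure_mono_null (t := ⋃ x ∈ t, (fun x => L (flagMap a b θ (F x))) '' U x) ?_
    ((measure_biUnion_null_iff htc).2 fun x hx => hUnull x (hts hx))
  rintro _ ⟨x, hx, rfl⟩
  obtain ⟨x₁, hx₁, hxU⟩ := Set.mem_iUnion₂.1 (ht hx)
  exact Set.mem_iUnion₂.2 ⟨x₁, hx₁, x, hxU, rfl⟩

open MeasureTheory in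
/-- The dimension of an immersed complex submanifold contained in countably many translates of the
image of a holomorphic family of filtrations is at most the maximal rank of the family. This is
where Sard's theorem enters. -/
theorem exists_le_finrank_of_immersion [SecondCountableTopology X] (hF : ∀ x, HolAt E F x)
    {κ : Type*} [Countable κ] (γ : κ → GL (Fin n) ℂ) {d : ℕ} {f : (Fin d → ℂ) → Fil n} {a b : ℤ}
    (hb : FilBdd a b (f 0)) (hf : ∀ᶠ u in 𝓝 0, HolAt (Fin d → ℂ) f u)
    (hinj : Function.Injective (filDeriv (Fin d → ℂ) f 0))
    (hfF : ∀ᶠ u in 𝓝 0, ∃ k x, f u = Fil.act (γ k).1 (F x)) :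
    ∃ x, d ≤ Module.finrank ℂ (LinearMap.range (filDeriv E F x)) := by
  by_contra! hrk
  obtain ⟨θ, L, ψ, hθ, hψ0, hψ, hψr, -⟩ := exists_flag_inverse hb hf hinj
  have hu : ∀ k, IsUnit (γ k).1.det := fun k => (Matrix.isUnit_iff_isUnit_det _).1 (γ k).isUnit
  let B : κ → Set (Fin d → ℂ) := fun k =>
    (fun x => L (flagMap a b θ (Fil.act (γ k).1 (F x)))) ''
      {x | FlagDom a b θ (Fil.act (γ k).1 (F x))}
  have hB : volume (⋃ k, B k) = 0 := measure_iUnion_null fun k =>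
    volume_image_flagMap_eq_zero (F := fun x => Fil.act (γ k).1 (F x))
      (fun x => (hF x).act (hu k))
      (fun x => by rw [finrank_range_filDeriv_act (hF x) (hu k)]; exact hrk x) θ L
  have hψc : Filter.Tendsto ψ (𝓝 (L (flagMap a b θ (f 0)))) (𝓝 0) := by
    have := hψ.self_of_nhds.continuousAt
    rwa [ContinuousAt, hψ0] at this
  -- `ψ` is a local inverse of the immersion followed by `L` and the flag coordinates, so the
  -- countable union, which is a null set, would contain a neighbourhood
  have hnhds : (⋃ k, B k) ∈ 𝓝 (L (flagMap a b θ (f 0))) := by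
    filter_upwards [hψr, hψc.eventually hfF,
      hψc.eventually (hθ.holAt hf.self_of_nhds).1] with p hp hpF hpD
    obtain ⟨k, x, hx⟩ := hpF
    refine Set.mem_iUnion.2 ⟨k, x, ?_, ?_⟩
    · change FlagDom a b θ (Fil.act (γ k).1 (F x))
      rw [← hx]
      exact hpD
    · exact (congrArg (fun G => L (flagMap a b θ G)) hx).symm.trans hp
  exact (Measure.measure_pos_of_mem_nhds volume hnhds).ne' hB

/-- At a point at which a holomorphic family of filtrations has rank `r`, it restricts to an
immersion on an `r`-dimensional slice. -/
theorem exists_slice (hF : ∀ x, HolAt E F x) {x : X} {a b : ℤ} (hb : FilBdd a b (F x)) {r : ℕ}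
    (hr : r = Module.finrank ℂ (LinearMap.range (filDeriv E F x))) :
    ∃ s : (Fin r → ℂ) → X, s 0 = x ∧
      ∀ᶠ u in 𝓝 0, HolAt (Fin r → ℂ) (fun u' => F (s u')) u ∧
        Function.Injective (filDeriv (Fin r → ℂ) (fun u' => F (s u')) u) := by
  obtain ⟨ρ, hρ, hB, θ, hD⟩ := exists_ball_flagDom hF hb
  set y₀ := chartAt E x x with hy₀
  have hy₀B : y₀ ∈ Metric.ball y₀ ρ := Metric.mem_ball_self hρ
  have hx : (chartAt E x).symm y₀ = x := (chartAt E x).left_inv (mem_chart_source E x)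
  replace hD : ∀ y ∈ Metric.ball y₀ ρ, FlagDom a b θ ((F ∘ (chartAt E x).symm) y) := hD
  let Θ : E → Finset.Icc a b × Fin n × Fin n → ℂ :=
    fun y => flagMap a b θ ((F ∘ (chartAt E x).symm) y)
  have hHol : ∀ y ∈ Metric.ball y₀ ρ, HolAt E (F ∘ (chartAt E x).symm) y := fun y hy =>
    HolAt.comp_chart_symm hF (hB hy)
  have hΘ : DifferentiableOn ℂ Θ (Metric.ball y₀ ρ) := fun y hy =>
    ((hD y hy).holAt (hHol y hy)).2.1.differentiableWithinAt
  have hr' : Module.finrank ℂ (LinearMap.range (fderiv ℂ Θ y₀).toLinearMap) = r := by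
    have h1 := finrank_range_fderiv_flagMap (hD y₀ hy₀B) (hHol y₀ hy₀B)
    rw [finrank_range_filDeriv_comp_chart_symm hF (hB hy₀B), hx] at h1
    rw [hr]
    exact h1
  -- a complement of the kernel of the differential
  obtain ⟨J, hJ⟩ : ∃ J : (Fin r → ℂ) →L[ℂ] E, Function.Injective (fderiv ℂ Θ y₀ ∘L J) := by
    let R := LinearMap.range (fderiv ℂ Θ y₀).toLinearMap
    let e : (Fin r → ℂ) ≃ₗ[ℂ] R := LinearEquiv.ofFinrankEq _ _ (by simp [R, hr'])
    obtain ⟨σ, hσ⟩ := (fderiv ℂ Θ y₀).toLinearMap.rangeRestrict.exists_rightInverse_of_surjective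
      (LinearMap.range_rangeRestrict _)
    refine ⟨LinearMap.toContinuousLinearMap (σ ∘ₗ e.toLinearMap), fun u u' h => e.injective ?_⟩
    have h1 : ∀ u, fderiv ℂ Θ y₀ (σ (e u)) = (e u).1 := fun u =>
      congrArg Subtype.val (LinearMap.congr_fun hσ (e u))
    exact Subtype.ext ((h1 u).symm.trans (Eq.trans h (h1 u')))
  let s : (Fin r → ℂ) → E := fun u => y₀ + J u
  have hs : ∀ u, HasFDerivAt s J u := fun u => J.hasFDerivAt.const_add y₀
  have hs0 : s 0 = y₀ := by simp [s]
  have hsc : Filter.Tendsto s (𝓝 0) (𝓝 y₀) := hs0 ▸ (hs 0).continuousAt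
  -- injectivity of the differential is an open condition
  have hopen : ∀ᶠ u in 𝓝 (0 : Fin r → ℂ), Function.Injective (fderiv ℂ Θ (s u) ∘L J) := by
    have hcont : ContinuousAt (fun u => fderiv ℂ Θ (s u) ∘L J) 0 := by
      have h1 : ContinuousAt (fderiv ℂ Θ) y₀ :=
        ((differentiableOn_fderiv Metric.isOpen_ball hΘ).continuousOn).continuousAt
          (Metric.ball_mem_nhds _ hρ)
      have h2 : ContinuousAt (fun u => fderiv ℂ Θ (s u)) 0 := by
        refine ContinuousAt.comp (g := fderiv ℂ Θ) ?_ (hs 0).continuousAt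
        rwa [hs0]
      exact h2.clm_comp continuousAt_const
    refine hcont.eventually (ContinuousLinearMap.isOpen_injective.mem_nhds ?_)
    change Function.Injective (fderiv ℂ Θ (s 0) ∘L J)
    rw [hs0]
    exact hJ
  refine ⟨fun u => (chartAt E x).symm (s u), (congrArg _ hs0).trans hx, ?_⟩
  filter_upwards [hopen, hsc.eventually (Metric.isOpen_ball.mem_nhds hy₀B)] with u hu huB
  have hHolu : HolAt (Fin r → ℂ) (fun u' => F ((chartAt E x).symm (s u'))) u :=
    (hHol _ huB).comp (Filter.Eventually.of_forall fun u' => (hs u').differentiableAt)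
  refine ⟨hHolu, ?_⟩
  rw [← LinearMap.ker_eq_bot, LinearMap.ker_eq_bot']
  intro v hv
  have h1 := (FlagDom.holAt (f := fun u' => F ((chartAt E x).symm (s u'))) (hD _ huB) hHolu).2.2 v
  have h2 := h1.2 hv
  have h3 : fderiv ℂ (fun u' => Θ (s u')) u = fderiv ℂ Θ (s u) ∘L J :=
    ((hΘ.differentiableAt (Metric.isOpen_ball.mem_nhds huB)).hasFDerivAt.comp u (hs u)).fderiv
  have h4 : fderiv ℂ (fun u' => Θ (s u')) u v = 0 := h2
  rw [h3] at h4
  exact hu (h4.trans (map_zero (fderiv ℂ Θ (s u) ∘L J)).symm)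

end Dimension

namespace ZVMHS

variable {E : Type*} [NormedAddCommGroup E] [NormedSpace ℂ E] [FiniteDimensional ℂ E]
  {X S : Type*} [TopologicalSpace X] [ChartedSpace E X] [IsManifold 𝓘(ℂ, E) 1 X] {π : X → S}
  {n : ℕ} {V : ZVMHS E π n} {x₀ : X}

theorem countable_generalLinearGroup_int : Countable (GL (Fin n) ℤ) := by
  have : Countable (Matrix (Fin n) (Fin n) ℤ) :=
    inferInstanceAs (Countable (Fin n → Fin n → ℤ))
  exact Units.val_injective.countable

/-- An immersed complex submanifold of the preimage of the image of the period map has dimension at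
most the rank of the Kodaira–Spencer map. -/
theorem IsHodgeGeneric.le_ksRank_of_immersion [ConnectedSpace X] [SecondCountableTopology X]
    (hgen : V.IsHodgeGeneric x₀) {d : ℕ} {f : (Fin d → ℂ) → Fil n}
    (hf : ∀ᶠ u in 𝓝 0, HolAt (Fin d → ℂ) f u)
    (hinj : Function.Injective (filDeriv (Fin d → ℂ) f 0))
    (hfF : ∀ᶠ u in 𝓝 0, ∃ x, ∃ γ ∈ arithGroup (V.mtGroup x₀),
      f u = Fil.act (intToComplex γ).1 (V.F x)) : d ≤ V.ksRank := by
  have := countable_generalLinearGroup_int (n := n)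
  obtain ⟨x₁, γ₁, -, h₁⟩ := hfF.self_of_nhds
  obtain ⟨a, b, hab⟩ := (V.isMHS x₁).exists_filBdd
  have hb : FilBdd a b (f 0) := by
    rw [h₁]
    exact hab.act ((Matrix.isUnit_iff_isUnit_det _).1 (intToComplex γ₁).isUnit)
  obtain ⟨x, hx⟩ := exists_le_finrank_of_immersion V.holomorphic
    (fun γ : GL (Fin n) ℤ => intToComplex γ) hb hf hinj
    (hfF.mono fun u ⟨x, γ, _, h⟩ => ⟨γ, x, h⟩)
  exact hx.trans (hgen.finrank_range_filDeriv_le_ksRank x)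

/-- The dimension of the image of the period map is the rank of the Kodaira–Spencer map. -/
theorem IsHodgeGeneric.complexDim_range [ConnectedSpace X] [SecondCountableTopology X]
    (hgen : V.IsHodgeGeneric x₀) (hπ : Function.Surjective π) {Φ : S → V.Hod x₀}
    (hΦ : V.IsPeriodMap x₀ Φ) : HodgeVariety.complexDim (Set.range Φ) = V.ksRank := by
  refine le_antisymm (csSup_le' ?_) (le_csSup ⟨V.ksRank, ?_⟩ ?_)
  -- a slice through a point of maximal rank is an immersed submanifold of the required dimension
  pick_goal 3
  · obtain ⟨φ, -, hφ⟩ := hgen.exists_continuous_lift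
    obtain ⟨x, hx⟩ := V.isOpen_dense_maximal_rank.2.nonempty
    obtain ⟨a, b, hab⟩ := (V.isMHS x).exists_filBdd
    obtain ⟨s, -, hs⟩ := exists_slice V.holomorphic hab (hgen.ksRank_eq hx)
    refine ⟨fun u => φ (s u), ?_⟩
    have hφs : (fun u => (φ (s u)).1.1) = fun u => V.F (s u) := funext fun u => hφ (s u)
    filter_upwards [hs] with u hu
    refine ⟨(hΦ.mem_preimage_range_iff hπ).2 ⟨s u, 1, one_mem _,
      (hφ (s u)).trans (act_intToComplex_one _).symm⟩, ?_⟩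
    exact immersion_congr hφs.symm hu
  all_goals
    rintro d ⟨f, hf⟩
    exact hgen.le_ksRank_of_immersion (hf.mono fun u h => h.2.1) hf.self_of_nhds.2.2
      (hf.mono fun u h => (hΦ.mem_preimage_range_iff hπ).1 h.1)

end ZVMHS

/-! ### Pullback of holomorphic frames -/

section Frames

variable {G : Type*} [NormedAddCommGroup G] [NormedSpace ℂ G] {n : ℕ} {f : G → Fil n} {u₀ : G}
  {g : G → Matrix (Fin n) (Fin n) ℂ}
  {E : Type*} [NormedAddCommGroup E] [NormedSpace ℂ E] {M : Type*} [TopologicalSpace M]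
  [ChartedSpace E M]

/-- The pullback of a frame is a frame, and its derivative is given by the chain rule. -/
theorem IsHolFrame.comp_mdifferentiable {κ : M → G} {x : M} (hg : IsHolFrame G f (κ x) g)
    (hκ : ∀ᶠ y in 𝓝 x, MDifferentiableAt 𝓘(ℂ, E) 𝓘(ℂ, G) κ y) :
    IsHolFrame E (fun y => f (κ y)) x (fun y => g (κ y)) ∧
      ∀ v, matrixDeriv E (fun y => g (κ y)) x v =
        matrixDeriv G g (κ x) (mfderiv 𝓘(ℂ, E) 𝓘(ℂ, G) κ x v) := by
  have hc : Filter.Tendsto κ (𝓝 x) (𝓝 (κ x)) := hκ.self_of_nhds.continuousAt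
  refine ⟨⟨hg.1, ?_, hc.eventually hg.2.2⟩, fun v => ?_⟩
  · filter_upwards [hκ, hc.eventually hg.2.1] with y hy hgy i j
    exact (hgy i j).comp y hy
  · ext i j
    exact congrArg (fun L : TangentSpace 𝓘(ℂ, E) x →L[ℂ] ℂ => L v)
      (mfderiv_comp x (hg.mdifferentiableAt i j) hκ.self_of_nhds)

/-- A frame `g` at `u₀` yields the frames `u' ↦ g(u') g(u)⁻¹` at the nearby points `u`. -/
theorem IsHolFrame.eventually_translate (hg : IsHolFrame G f u₀ g) :
    ∀ᶠ u in 𝓝 u₀, IsUnit (g u).det ∧ IsHolFrame G f u (fun u' => g u' * (g u)⁻¹) ∧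
      ∀ w, matrixDeriv G (fun u' => g u' * (g u)⁻¹) u w = matrixDeriv G g u w * (g u)⁻¹ := by
  have hdet : ∀ᶠ u in 𝓝 u₀, IsUnit (g u).det := by
    have h1 := (differentiableAt_matrix_det fun i j => mdifferentiableAt_iff_differentiableAt.1
      (hg.mdifferentiableAt i j)).continuousAt
    filter_upwards [h1.eventually_ne (y := 0) (by rw [hg.1]; simp)] with u hu using Ne.isUnit hu
  filter_upwards [hdet, hg.2.1.eventually_nhds, hg.2.2.eventually_nhds] with u hu hd hf
  have e : ∀ u', g u' * (g u)⁻¹ = 1 * g u' * (g u)⁻¹ := fun u' => by rw [Matrix.one_mul]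
  simp only [e]
  refine ⟨hu, ⟨?_, ?_, ?_⟩, fun w => ?_⟩
  · exact (e u).symm.trans (Matrix.mul_nonsing_inv _ hu)
  · filter_upwards [hd] with u' hu' using (matrixDeriv_mul_mul 1 (g u)⁻¹ hu').1
  · filter_upwards [hf] with u' hu'
    rw [hu', hf.self_of_nhds, ← act_mul, Matrix.mul_assoc, Matrix.nonsing_inv_mul _ hu,
      Matrix.mul_one, Matrix.one_mul]
  · rw [(matrixDeriv_mul_mul 1 (g u)⁻¹ hd.self_of_nhds).2, Matrix.one_mul]

theorem IsHolFrame.congr {F F' : M → Fil n} {x : M} {h : M → Matrix (Fin n) (Fin n) ℂ}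
    (hh : IsHolFrame E F x h) (hF : F' =ᶠ[𝓝 x] F) : IsHolFrame E F' x h := by
  refine ⟨hh.1, hh.2.1, ?_⟩
  filter_upwards [hh.2.2, hF] with y h1 h2
  rw [h2, h1, hF.self_of_nhds]

/-- The chain rule for the differential of a family of filtrations, in terms of a frame. -/
theorem IsHolFrame.filDeriv_comp [IsManifold 𝓘(ℂ, E) 1 M] {F : M → Fil n} {κ : M → G} {x : M}
    (hg : IsHolFrame G f (κ x) g)
    (hκ : ∀ᶠ y in 𝓝 x, MDifferentiableAt 𝓘(ℂ, E) 𝓘(ℂ, G) κ y)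
    (hF : ∀ᶠ y in 𝓝 x, F y = f (κ y)) :
    ∀ᶠ y in 𝓝 x, ∀ v, filDeriv E F y v = (endF (F y) 0).mkQ
      (matrixDeriv G g (κ y) (mfderiv 𝓘(ℂ, E) 𝓘(ℂ, G) κ y v) * (g (κ y))⁻¹) := by
  have hc : Filter.Tendsto κ (𝓝 x) (𝓝 (κ x)) := hκ.self_of_nhds.continuousAt
  filter_upwards [hκ.eventually_nhds, hF.eventually_nhds, hc.eventually hg.eventually_translate]
    with y h1 h2 h3 v
  have h4 := h3.2.1.comp_mdifferentiable h1
  rw [filDeriv_eq (h4.1.congr h2)]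
  exact congrArg _ ((h4.2 v).trans (h3.2.2 _))

/-- The logarithmic derivative of a frame is continuous. -/
theorem IsHolFrame.continuousAt_matrixDeriv [FiniteDimensional ℂ G] (hg : IsHolFrame G f u₀ g)
    (w : G) : ContinuousAt (fun u => matrixDeriv G g u w * (g u)⁻¹) u₀ := by
  obtain ⟨r, hr, hB, hD⟩ : ∃ r > 0, Metric.ball u₀ r ⊆ Set.univ ∧ ∀ u ∈ Metric.ball u₀ r,
      ∀ i j, DifferentiableAt ℂ (fun u' => g u' i j) u := by
    obtain ⟨r, hr, h⟩ := Metric.eventually_nhds_iff_ball.1 hg.2.1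
    exact ⟨r, hr, Set.subset_univ _, fun u hu i j =>
      mdifferentiableAt_iff_differentiableAt.1 (h u hu i j)⟩
  have h1 : ∀ i j, ContinuousAt (fun u => matrixDeriv G g u w i j) u₀ := by
    intro i j
    simp only [matrixDeriv_apply_eq_fderiv]
    exact ((differentiableOn_fderiv_apply Metric.isOpen_ball
      (fun u hu => (hD u hu i j).differentiableWithinAt) w).continuousOn).continuousAt
        (Metric.ball_mem_nhds _ hr)
  have h2 : ∀ i j, ContinuousAt (fun u => (g u)⁻¹ i j) u₀ := fun i j =>
    (differentiableAt_matrix_inv (fun i j => hD u₀ (Metric.mem_ball_self hr) i j)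
      (by rw [hg.1]; simp) i j).continuousAt
  refine continuousAt_pi.2 fun i => continuousAt_pi.2 fun j => ?_
  simp only [Matrix.mul_apply]
  exact tendsto_finsetSum _ fun k _ => (h1 i k).mul (h2 k j)

end Frames

/-! ### Smooth points of the image -/

section Retraction

variable {E : Type*} [NormedAddCommGroup E] [NormedSpace ℂ E] [FiniteDimensional ℂ E]
  {X : Type*} [TopologicalSpace X] [ChartedSpace E X] [IsManifold 𝓘(ℂ, E) 1 X]
  {n : ℕ} {F : X → Fil n} {G : Type*} [NormedAddCommGroup G] [NormedSpace ℂ G]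
  [FiniteDimensional ℂ G]

omit [FiniteDimensional ℂ E] in
/-- A holomorphic family of filtrations with values in a submanifold factors holomorphically
through a parametrization of it. -/
theorem exists_holomorphic_factor (hF : ∀ x, HolAt E F x) {x : X} {f : G → Fil n} {u₀ : G} {a b : ℤ}
    (hb : FilBdd a b (F x)) (hf : ∀ᶠ u in 𝓝 u₀, HolAt G f u)
    (hinj : Function.Injective (filDeriv G f u₀)) (hx : F x = f u₀)
    (hlift : ∀ U ∈ 𝓝 u₀, ∀ᶠ y in 𝓝 x, ∃ u ∈ U, F y = f u) :
    ∃ κ : X → G, κ x = u₀ ∧ (∀ᶠ y in 𝓝 x, MDifferentiableAt 𝓘(ℂ, E) 𝓘(ℂ, G) κ y) ∧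
      ∀ᶠ y in 𝓝 x, F y = f (κ y) := by
  rw [hx] at hb
  obtain ⟨θ, L, ψ, hθ, hψ0, hψ, -, hl⟩ := exists_flag_inverse hb hf hinj
  rw [← hx] at hθ hψ0 hψ
  refine ⟨fun y => ψ (L (flagMap a b θ (F y))), hψ0, ?_, ?_⟩
  · have hxs := mem_chart_source E x
    have hθ' : FlagDom a b θ ((F ∘ (chartAt E x).symm) (chartAt E x x)) := by
      rw [Function.comp_apply, (chartAt E x).left_inv hxs]
      exact hθ
    have hψ' : ∀ᶠ p in 𝓝 (L (flagMap a b θ ((F ∘ (chartAt E x).symm) (chartAt E x x)))),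
        DifferentiableAt ℂ ψ p := by
      rw [Function.comp_apply, (chartAt E x).left_inv hxs]
      exact hψ
    have h1 := hθ'.holAt ((hF x).chart hxs)
    have h2 : ContinuousAt (fun z => L (flagMap a b θ ((F ∘ (chartAt E x).symm) z)))
        (chartAt E x x) := (L.differentiableAt.comp _ h1.2.1).continuousAt
    have hc := (chartAt E x).continuousAt hxs
    filter_upwards [(chartAt E x).open_source.mem_nhds hxs, hc.eventually h1.1,
      hc.eventually (h2.eventually hψ')] with y hy hyθ hyψ
    rw [mdifferentiableAt_iff_chart hy]
    refine DifferentiableAt.comp (chartAt E x y)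
      (f := fun z => L (flagMap a b θ ((F ∘ (chartAt E x).symm) z))) hyψ
      (L.differentiableAt.comp _ (hyθ.holAt ((hF y).chart hy)).2.1)
  · filter_upwards [hlift _ hl] with y hy
    obtain ⟨u, hu, hyu⟩ := hy
    have h1 : ψ (L (flagMap a b θ (F y))) = u := by
      rw [hyu]
      exact hu
    rw [h1, hyu]

end Retraction

namespace ZVMHS

variable {E : Type*} [NormedAddCommGroup E] [NormedSpace ℂ E] [FiniteDimensional ℂ E]
  {X S : Type*} [TopologicalSpace X] [ChartedSpace E X] [IsManifold 𝓘(ℂ, E) 1 X] {π : X → S}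
  {n : ℕ} {V : ZVMHS E π n} {x₀ : X}

/-- Suppose that the period map factors near `x` through an immersed submanifold of dimension at
most the rank of the Kodaira–Spencer map. Then the dimension is equal to that rank, and the tangent
space of the submanifold at `F_x` is horizontal: this holds at the points of maximal rank near `x`,
where the factorization is a submersion, and passes to the limit. -/
theorem IsHodgeGeneric.parametrization_horizontal [ConnectedSpace X]
    (hgen : V.IsHodgeGeneric x₀) {x : X} {d : ℕ} {f : (Fin d → ℂ) → Fil n}
    {g : (Fin d → ℂ) → Matrix (Fin n) (Fin n) ℂ} (hg : IsHolFrame (Fin d → ℂ) f 0 g)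
    {κ : X → Fin d → ℂ} (hκx : κ x = 0)
    (hκ : ∀ᶠ y in 𝓝 x, MDifferentiableAt 𝓘(ℂ, E) 𝓘(ℂ, Fin d → ℂ) κ y)
    (hF : ∀ᶠ y in 𝓝 x, V.F y = f (κ y)) (hd : d ≤ V.ksRank) :
    d = V.ksRank ∧ ∀ w, matrixDeriv (Fin d → ℂ) g 0 w ∈
      (horizontalTangent (V.mtGroup x₀) (V.F x)).comap (endF (V.F x) 0).mkQ := by
  let M : Set X := {x | ∀ x', Module.finrank ℂ (LinearMap.range (filDeriv E V.F x')) ≤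
      Module.finrank ℂ (LinearMap.range (filDeriv E V.F x))}
  have hM : Dense M := V.isOpen_dense_maximal_rank.2
  have hNeBot : (𝓝[M] x).NeBot := mem_closure_iff_nhdsWithin_neBot.1 (hM x)
  have hg' := hg
  rw [← hκx] at hg'
  -- at a point of maximal rank, `κ` is a submersion
  have hsub : ∀ᶠ y in 𝓝[M] x, d = V.ksRank ∧ ∀ w, matrixDeriv (Fin d → ℂ) g (κ y) w * (g (κ y))⁻¹ ∈
      (horizontalTangent (V.mtGroup x₀) (V.F y)).comap (endF (V.F y) 0).mkQ := by
    filter_upwards [(hg'.filDeriv_comp hκ hF).filter_mono nhdsWithin_le_nhds,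
      self_mem_nhdsWithin] with y hy hyM
    let D : TangentSpace 𝓘(ℂ, E) y →ₗ[ℂ] (Fin d → ℂ) :=
      (mfderiv 𝓘(ℂ, E) 𝓘(ℂ, Fin d → ℂ) κ y).toLinearMap
    let B : (Fin d → ℂ) →ₗ[ℂ] (Matrix (Fin n) (Fin n) ℂ ⧸ endF (V.F y) 0) :=
      (endF (V.F y) 0).mkQ ∘ₗ LinearMap.mulRight ℂ (g (κ y))⁻¹ ∘ₗ matrixDeriv (Fin d → ℂ) g (κ y)
    have hBD : filDeriv E V.F y = B ∘ₗ D := LinearMap.ext hy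
    have h1 := hgen.ksRank_eq hyM
    rw [hBD, LinearMap.range_comp] at h1
    have h2 := Submodule.finrank_map_le B (LinearMap.range D)
    have h3 := Submodule.finrank_le (LinearMap.range D)
    rw [Module.finrank_fin_fun] at h3
    have h4 : LinearMap.range D = ⊤ := by
      refine Submodule.eq_top_of_finrank_eq ?_
      rw [Module.finrank_fin_fun]
      omega
    refine ⟨by omega, fun w => ?_⟩
    obtain ⟨v, rfl⟩ := LinearMap.range_eq_top.1 h4 w
    rw [Submodule.mem_comap]
    exact hgen.range_filDeriv_le y ⟨v, hy v⟩
  refine ⟨hsub.exists.choose_spec.1, fun w => ?_⟩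
  -- translate back to `x` and pass to the limit
  obtain ⟨h, hh1, hhc, hh⟩ := hgen.exists_local_lift x
  have hP := V.isRatAlgebraic_mtGroup x₀
  have hmem : ∀ᶠ y in 𝓝[M] x, (h y)⁻¹.1 * (matrixDeriv (Fin d → ℂ) g (κ y) w * (g (κ y))⁻¹) *
      (h y).1 ∈ (horizontalTangent (V.mtGroup x₀) (V.F x)).comap (endF (V.F x) 0).mkQ := by
    filter_upwards [hsub, hh.filter_mono nhdsWithin_le_nhds] with y hy hhy
    obtain ⟨A, ⟨hAP, hA⟩, hAe⟩ := hy.2 w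
    have hA0 := (Submodule.Quotient.eq _).1 hAe
    have hinv : (h y)⁻¹ ∈ V.mtGroup x₀ := inv_mem (realUnipotent_le _ hhy.1)
    have hdet : IsUnit (h y)⁻¹.1.det := (Matrix.isUnit_iff_isUnit_det _).1 (h y)⁻¹.isUnit
    have hFx : V.F x = Fil.act (h y)⁻¹.1 (V.F y) := by
      rw [hhy.2, ← act_mul, show (h y)⁻¹.1 * (h y).1 = 1 from (h y).inv_mul, act_one]
    have hi : ((h y)⁻¹.1)⁻¹ = (h y).1 := by
      rw [← Matrix.coe_units_inv, inv_inv]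
    have key : ∀ {C : Matrix (Fin n) (Fin n) ℂ} {k : ℤ}, C ∈ endF (V.F y) k →
        (h y)⁻¹.1 * C * (h y).1 ∈ endF (V.F x) k := by
      intro C k hC
      rw [hFx, ← hi]
      exact (conj_mem_endF_act_iff hdet).2 hC
    refine ⟨(h y)⁻¹.1 * A * (h y).1, ⟨?_, key hA⟩, ?_⟩
    · have := hP.conj_mem_lieAlgC hinv hAP
      rwa [inv_inv] at this
    · refine (Submodule.Quotient.eq _).2 ?_
      rw [← sub_mul, ← mul_sub]
      exact key hA0
  have hlim : Filter.Tendsto (fun y => (h y)⁻¹.1 *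
      (matrixDeriv (Fin d → ℂ) g (κ y) w * (g (κ y))⁻¹) * (h y).1) (𝓝[M] x)
      (𝓝 (matrixDeriv (Fin d → ℂ) g 0 w)) := by
    have h1 : ContinuousAt (fun y => (h y).1) x := Units.continuous_val.continuousAt.comp hhc
    have h2 : ContinuousAt (fun y => (h y)⁻¹.1) x := Units.continuous_val.continuousAt.comp hhc.inv
    have h3 : ContinuousAt
        (fun y => matrixDeriv (Fin d → ℂ) g (κ y) w * (g (κ y))⁻¹) x :=
      (hg'.continuousAt_matrixDeriv w).comp hκ.self_of_nhds.continuousAt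
    have h4 : ContinuousAt (fun y => (h y)⁻¹.1 *
      (matrixDeriv (Fin d → ℂ) g (κ y) w * (g (κ y))⁻¹) * (h y).1) x := (h2.mul h3).mul h1
    have h5 := h4.tendsto.mono_left (nhdsWithin_le_nhds (s := M))
    rw [hκx, hh1, hg.1, inv_one, inv_one, Units.val_one, one_mul, mul_one, mul_one] at h5
    exact h5
  exact (Submodule.closed_of_finiteDimensional _).mem_of_tendsto hlim hmem

/-- At a smooth point of the image of the period map, the tangent space is horizontal, of dimension
the rank of the Kodaira–Spencer map. -/
theorem IsHodgeGeneric.isSmoothPoint_tangent [ConnectedSpace X] [SecondCountableTopology X]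
    (hgen : V.IsHodgeGeneric x₀) (hπ : Function.Surjective π) {Φ : S → V.Hod x₀}
    (hΦ : V.IsPeriodMap x₀ Φ) {y : V.domain x₀} {x : X} (hyx : y.1.1 = V.F x)
    {T : Submodule ℂ (Matrix (Fin n) (Fin n) ℂ ⧸ endF y.1.1 0)}
    (hT : IsSmoothPoint (HodgeVariety.mk ⁻¹' Set.range Φ) y T) :
    T ≤ horizontalTangent (V.mtGroup x₀) y.1.1 ∧ Module.finrank ℂ T = V.ksRank := by
  obtain ⟨d, f, rfl, hf, hinj, hmap, hTeq⟩ := hT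
  obtain ⟨φ, hφc, hφ⟩ := hgen.exists_continuous_lift
  have hφA : ∀ y, φ y ∈ HodgeVariety.mk ⁻¹' Set.range Φ := fun y =>
    (hΦ.mem_preimage_range_iff hπ).2
      ⟨y, 1, one_mem _, (hφ y).trans (act_intToComplex_one _).symm⟩
  have hφx : φ x = f 0 := Subtype.ext (Subtype.ext ((hφ x).trans hyx.symm))
  have hTr : T = LinearMap.range (filDeriv (Fin d → ℂ) (fun u' => (f u').1.1) 0) :=
    (Submodule.comap_injective_of_surjective (Submodule.mkQ_surjective _) hTeq).symm
  have hd : d ≤ V.ksRank := by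
    refine hgen.le_ksRank_of_immersion hf hinj ?_
    have h1 : ∀ᶠ y in Filter.map f (𝓝 0), y ∈ HodgeVariety.mk ⁻¹' Set.range Φ := by
      rw [hmap]
      exact self_mem_nhdsWithin
    filter_upwards [Filter.eventually_map.1 h1] with u hu
    exact (hΦ.mem_preimage_range_iff hπ).1 hu
  obtain ⟨a, b, hab⟩ := (V.isMHS x).exists_filBdd
  -- by continuity, the period map takes values in the submanifold near `x`
  obtain ⟨κ, hκx, hκ, hκF⟩ := exists_holomorphic_factor V.holomorphic
    (f := fun u => (f u).1.1) hab hf hinj hyx.symm (fun U hU => by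
      have h1 : Filter.Tendsto φ (𝓝 x) (𝓝[HodgeVariety.mk ⁻¹' Set.range Φ] (f 0)) :=
        tendsto_nhdsWithin_iff.2 ⟨hφx ▸ hφc.continuousAt, Filter.Eventually.of_forall hφA⟩
      rw [← hmap] at h1
      filter_upwards [h1.eventually (Filter.image_mem_map hU)] with y hy
      obtain ⟨u, hu, huy⟩ := hy
      exact ⟨u, hu, by rw [← hφ, huy]⟩)
  obtain ⟨g, hg⟩ := hf.self_of_nhds
  obtain ⟨hdk, hhor⟩ := hgen.parametrization_horizontal hg hκx hκ hκF hd
  rw [← hyx] at hhor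
  rw [hTr]
  constructor
  · rw [filDeriv_eq hg]
    rintro _ ⟨w, rfl⟩
    exact hhor w
  · rw [← hdk]
    exact (LinearMap.finrank_range_of_inj hinj).trans (Module.finrank_fin_fun ℂ)

end ZVMHS

end

/-! ### The Hodge codimension and the image of the period map -/

theorem mainTheorem4
    {E : Type*} [NormedAddCommGroup E] [NormedSpace ℂ E] [FiniteDimensional ℂ E]
    {S : Type*} [TopologicalSpace S] [ChartedSpace E S] [IsManifold 𝓘(ℂ, E) ω S]
    [T2Space S] [SecondCountableTopology S] [ConnectedSpace S]
    {X : Type*} [TopologicalSpace X] [ChartedSpace E X] [IsManifold 𝓘(ℂ, E) ω X]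
    [T2Space X] [SecondCountableTopology X] [SimplyConnectedSpace X]
    {π : X → S} (hcov : IsCoveringMap π)
    (hloc : IsLocalDiffeomorph 𝓘(ℂ, E) 𝓘(ℂ, E) ω π)
    {n : ℕ} (V : ZVMHS E π n) (hpol : V.GradedPolarizable) :
    (∃ x, V.IsHodgeGeneric x) ∧
    ∀ x₀, V.IsHodgeGeneric x₀ →
      -- the Hodge filtration takes its values in `D_S⁺`, and the period map exists as soon as
      -- the monodromy is contained in `P_S`
      (∀ x, ∃ y : V.domain x₀, y.1.1 = V.F x) ∧
      ((∀ γ, V.ρ γ ∈ arithGroup (V.mtGroup x₀)) → ∃ Φ, V.IsPeriodMap x₀ Φ) ∧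
      -- `H-cd(S, 𝕍) = rk T_h Hod⁰(S, 𝕍) - dim Φ_S(S)`
      (∀ Φ, V.IsPeriodMap x₀ Φ → ∀ y : V.domain x₀,
        V.hodgeCodim x₀ =
          (Module.finrank ℂ (horizontalTangent (V.mtGroup x₀) y.1.1) : ℤ) -
            (HodgeVariety.complexDim (Set.range Φ) : ℤ)) ∧
      -- codimension of the tangent space at a Hodge generic smooth point of `Φ_S(S)`
      (∀ Φ, V.IsPeriodMap x₀ Φ → ∀ (y : V.domain x₀) (x : X), y.1.1 = V.F x →
        V.IsHodgeGeneric x →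
        ∀ T, IsSmoothPoint (HodgeVariety.mk ⁻¹' Set.range Φ) y T →
          T ≤ horizontalTangent (V.mtGroup x₀) y.1.1 ∧
          V.hodgeCodim x₀ =
            (Module.finrank ℂ (horizontalTangent (V.mtGroup x₀) y.1.1) : ℤ) -
              (Module.finrank ℂ T : ℤ)) ∧
      -- codimension of the image of the differential of the period map at a Hodge generic point
      -- where its rank is maximal, and existence of such points
      (∃ x, V.IsHodgeGeneric x ∧
        ∀ x', Module.finrank ℂ (LinearMap.range (filDeriv E V.F x')) ≤
          Module.finrank ℂ (LinearMap.range (filDeriv E V.F x))) ∧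
      (∀ x, V.IsHodgeGeneric x →
        (∀ x', Module.finrank ℂ (LinearMap.range (filDeriv E V.F x')) ≤
          Module.finrank ℂ (LinearMap.range (filDeriv E V.F x))) →
        LinearMap.range (filDeriv E V.F x) ≤ horizontalTangent (V.mtGroup x₀) (V.F x) ∧
        V.hodgeCodim x₀ =
          (Module.finrank ℂ (horizontalTangent (V.mtGroup x₀) (V.F x)) : ℤ) -
            (Module.finrank ℂ (LinearMap.range (filDeriv E V.F x)) : ℤ)) := by
  have hX : IsManifold 𝓘(ℂ, E) 1 X := IsManifold.of_le (n := ω) le_top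
  have hE : LocallyPathConnectedSpace E := inferInstance
  have hlc : LocallyPathConnectedSpace X := ChartedSpace.locallyPathConnectedSpace E X
  have hconn : ConnectedSpace X := inferInstance
  have hsurj : Function.Surjective π := hcov.surjective
  have hmax := V.exists_isHodgeGeneric_maximal_rank
  refine ⟨hmax.imp fun x hx => hx.1, fun x₀ hgen => ?_⟩
  obtain ⟨φ, -, hφ⟩ := hgen.exists_continuous_lift
  refine ⟨fun x => ⟨φ x, hφ x⟩, ZVMHS.exists_isPeriodMap hcov hsurj hφ, fun Φ hΦ y => ?_,
    fun Φ hΦ y x hyx _ T hT => ?_, hmax, fun x _ hx => ⟨hgen.range_filDeriv_le x, ?_⟩⟩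
  · rw [hgen.complexDim_range hsurj hΦ]
    exact V.hodgeCodim_eq_of_mem_domain x₀ y
  · have h := hgen.isSmoothPoint_tangent hsurj hΦ hyx hT
    rw [h.2]
    exact ⟨h.1, V.hodgeCodim_eq_of_mem_domain x₀ y⟩
  · obtain ⟨g, hg, hgF⟩ := hgen.exists_eq_act x
    rw [← hgen.ksRank_eq hx]
    exact V.hodgeCodim_eq x₀ (realUnipotent_le _ hg) hgF
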